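/- **Setting.** Instances are pairs $(u,x)\in\mathcal I=\{0,1\}^\infty\times\mathbb R^\infty$ (finite bit strings and finite real sequences); $\mathrm{length}(u,x)$ is the total number of bits and reals. A *decision problem* is a pair $(S,\mu)$ with $S\subseteq\mathcal I$ and a condition number $\mu:\mathcal I\to[1,\infty]$; its size is $\mathrm{size}(u,x)=\mathrm{length}(u,x)+\lceil\log_2\mu(u,x)\rceil$. In a $\mathsf u$-computation ($0<\mathsf u<1$) of a BSS machine, every real input value, built-in constant and result of an arithmetic operation $z$ is replaced by some $z(1+\delta)$, $|\delta|<\mathsf u$; discrete data, copying and tests are error-free, and a division by $0$ returns $0$. Put $\mathsf k=\lceil\log_2(1/\mathsf u)\rceil$. $\mathrm P_{\mathrm{dir}}$ is the class of problems $(S,\mu)$ for which there are a BSS machine $M$, not reading $\mathsf u$ or $\mathsf k$, and polynomials $t,q$ such that, for every $(u,x)\in\mathcal I$ and every $\mathsf u\in(0,1)$, all $\mathsf u$-computations of $M$ on $(u,x)$ halt within $t(\mathrm{length}(u,x))$ steps, all of them correctly decide whether $(u,x)\in S$ when $\mathsf k\ge q(\mathrm{size}(u,x))$, and the exact computation is correct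 for every $(u,x)$, including those with $\mu(u,x)=\infty$. A problem $(W,\mu_W)$ is in $\mathrm{NP}^{\mathsf U}_{\mathrm{dir}}$ if there are $(B,\mu_B)\in\mathrm P_{\mathrm{dir}}$ and polynomials $p,Q$ such that for all $(u,x)$, with $m=p(\mathrm{length}(u,x))$: (i) if $(u,x)\in W$, there is $y^*\in\mathbb R^m$ with $(u,x,y^*)\in B$ and $\log_2\mu_B(u,x,y^*)\le Q(\log_2\mu_W(u,x))$; (ii) if $(u,x)\notin W$, then for all $y\in\mathbb R^m$, $(u,x,y)\notin B$ and $\log_2\mu_B(u,x,y)\le Q(\log_2\mu_W(u,x))$. (Bounds in terms of $\mu_W(u,x)$ are void when $\mu_W(u,x)=\infty$.) The class $\mathrm{NP}^{\mathsf B}_{\mathrm{dir}}$ is defined in the same way, with the additional requirement in (i) that $\mathrm{mgt}(y^*)\le q(\mathrm{size}_W(u,x))$ for a polynomial $q$ (void when $\mathrm{size}_W(u,x)=\infty$). Here the magnitude $\mathrm{mgt}(y)$ of a real $y$ is the least $k\ge1$ such that $y=0$ or $2^{-2^k}\le|y|\le2^{2^{k+1}-1}(1-2^{-k-1})$, and that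 of a vector is the maximum over its components. A *P-reduction* from $(W,\mu_W)$ to $(S,\mu_S)$ is a BSS machine that performs a discrete computation (no arithmetic on reals, no tests of reals; input reals and built-in constants are only copied, without error), maps every $(u,x)\in\mathcal I$ to some $(v,z)\in\mathcal I$ in a number of steps polynomially bounded in $\mathrm{length}(u,x)$, and satisfies $(u,x)\in W\iff(v,z)\in S$ and $\mathrm{size}_S(v,z)\le r(\mathrm{size}_W(u,x))$ for a polynomial $r$ (the size bound is void when $\mathrm{size}_W(u,x)=\infty$). A problem $S$ is *complete* for a class with respect to P-reductions if it belongs to the class and every problem of the class has a P-reduction to $S$. An *algebraic circuit* $\mathcal C$ is a connected directed acyclic graph with input nodes (variables $Y_1,\dots,Y_m$), real constant nodes, arithmetic nodes ($+,-,\times,/$) and selection nodes (returning the second parent if the first is $<0$ and the third otherwise), with one singled-out node of out-degree $0$, its output $f_{\mathcal C}$. Circuits are encoded as elements of $\mathcal I$, with their constants as the real part. In an $\varepsilon$-evaluation the values of the input, constant and arithmetic nodes are multiplied by factors $1+\delta$, $|\delta|<\varepsilon$. Let $S_{\mathcal C}=\{y\in\mathbb R^m: f_{\mathcal C}(y)\ge0\}$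 and call $\mathcal C$ feasible if $S_{\mathcal C}\ne\emptyset$. Let $\varrho_{\mathrm{eval}}(\mathcal C,y)$ be the supremum of the $\varepsilon\in(0,1)$ such that all $\varepsilon$-evaluations at $y$ correctly decide whether $y\in S_{\mathcal C}$ ($0$ if there are none). $\mathsf{CircFeas}$ and $\mathsf{CircBFeas}$ are both the problem of deciding whether $\mathcal C$ is feasible, with the condition numbers $\max\{1,1/\varrho_{\mathrm{feas}}(\mathcal C)\}$ and $\max\{1,1/\varrho_{\mathrm{Bfeas}}(\mathcal C)\}$, respectively. If $\mathcal C$ is feasible, $\varrho_{\mathrm{feas}}(\mathcal C)=\sup_{y\in S_{\mathcal C}}\varrho_{\mathrm{eval}}(\mathcal C,y)$ and $\varrho_{\mathrm{Bfeas}}(\mathcal C)=\sup_{y\in S_{\mathcal C}}\varrho_{\mathrm{eval}}(\mathcal C,y)\,2^{-\mathrm{mgt}(y)}$; otherwise both equal $\inf_{y\in\mathbb R^m}\varrho_{\mathrm{eval}}(\mathcal C,y)$. Instances that do not encode a circuit are No-instances of condition number $1$. **Theorem.** With respect to P-reductions, $\mathsf{CircFeas}$ is $\mathrm{NP}^{\mathsf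 U}_{\mathrm{dir}}$-complete and $\mathsf{CircBFeas}$ is $\mathrm{NP}^{\mathsf B}_{\mathrm{dir}}$-complete. -/

import Mathlib

open scoped ENNReal

namespace FiniteBSS

/-! ### Instances and decision problems -/

/-- The space `{0,1}^∞ × ℝ^∞` of instances: a finite sequence of bits and a finite sequence
of reals. -/
abbrev Instance : Type := List Bool × List ℝ

/-- The length of `(u, x) ∈ {0,1}^s × ℝ^n` is `s + n`. -/
def Instance.len (w : Instance) : ℕ := w.1.length + w.2.length

/-- The instance `(u, x, y)` obtained from `(u, x)` by appending the reals `y`. -/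
def Instance.append (w : Instance) {m : ℕ} (y : Fin m → ℝ) : Instance :=
  (w.1, w.2 ++ List.ofFn y)

/-- A decision problem: a set of instances together with a condition number with values in
`[1, ∞]`. -/
structure DecisionProblem where
  carrier : Set Instance
  cond : Instance → ℝ≥0∞
  one_le_cond : ∀ w, 1 ≤ cond w

/-- The base two logarithm of a finite condition number. -/
noncomputable def DecisionProblem.logCond (P : DecisionProblem) (w : Instance) : ℝ :=
  Real.logb 2 (P.cond w).toReal

open Classical in
/-- `size w = length w + ⌈log₂ (cond w)⌉`, which is `∞` exactly for the ill-posed `w`. -/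
noncomputable def DecisionProblem.size (P : DecisionProblem) (w : Instance) : ℕ∞ :=
  if P.cond w = ⊤ then ⊤ else ((w.len + ⌈P.logCond w⌉₊ : ℕ) : ℕ∞)

/-! ### Finite-precision arithmetic -/

/-- The four arithmetic operations. -/
inductive ArithOp : Type
  | add | sub | mul | div

/-- The result of an arithmetic operation. A division is understood to be preceded by a test of
its denominator, and returns `0` when that denominator is `0`. -/
noncomputable def ArithOp.apply : ArithOp → ℝ → ℝ → ℝ
  | add, a, b => a + b
  | sub, a, b => a - b
  | mul, a, b => a * b
  | div, a, b => a / b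

/-- `Rounds ε z v`: the real `v` is a possible value of `fl(z)` for the unit roundoff `ε`, that
is, `v = z (1 + δ)` for some `|δ| < ε`. Exact arithmetic corresponds to the relation `Eq`. -/
def Rounds (ε z v : ℝ) : Prop := ∃ δ : ℝ, |δ| < ε ∧ v = z * (1 + δ)

/-- The precision `⌈log₂ (1/ε)⌉` belonging to the unit roundoff `ε`. -/
noncomputable def precision (ε : ℝ) : ℕ := ⌈Real.logb 2 (1 / ε)⌉₊

/-! ### Finite-precision BSS machines

The memory of a machine consists of finitely many two-way infinite tapes of real numbers (all but
finitely many of whose cells hold `0`), and of finitely many tapes over `{0, 1, blank}` for its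
discrete data. Computation nodes act on the cells under the heads, and shift nodes move a tape.
The registers that hold the unit roundoff and the precision are left out, because the machines
considered here never read them. -/

/-- The nodes of a machine with labels in `L`, `d + 2` discrete tapes and `r + 1` real tapes. -/
inductive Node (L : Type) (d r : ℕ) : Type
  /-- Branch on the symbol under the head of a discrete tape. -/
  | readBit (i : Fin (d + 2)) (next : Option Bool → L)
  /-- Write a symbol on a discrete tape. -/
  | writeBit (i : Fin (d + 2)) (a : Option Bool) (next : L)
  /-- Move the head of a discrete tape. -/
  | moveBit (i : Fin (d + 2)) (dir : Turing.Dir) (next : L)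
  /-- Move the head of a real tape. -/
  | moveReal (i : Fin (r + 1)) (dir : Turing.Dir) (next : L)
  /-- Copy the current cell of the real tape `j` to the current cell of the real tape `i`. -/
  | copy (i j : Fin (r + 1)) (next : L)
  /-- Load a built-in constant into the current cell of the real tape `i`. -/
  | const (i : Fin (r + 1)) (a : ℝ) (next : L)
  /-- Store the result of an operation on the current cells of the real tapes `j` and `k` in the
  current cell of the real tape `i`. -/
  | arith (op : ArithOp) (i j k : Fin (r + 1)) (next : L)
  /-- Branch on the sign (`< 0` or `≥ 0`) of the current cell of a real tape. -/
  | branch (i : Fin (r + 1)) (ifNeg ifNonneg : L)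
  /-- Halt, with answer `Yes` (`true`) or `No` (`false`). -/
  | halt (answer : Bool)

/-- The nodes that neither perform real arithmetic nor test a real number. -/
def Node.IsDiscrete {L : Type} {d r : ℕ} : Node L d r → Prop
  | arith _ _ _ _ _ => False
  | branch _ _ _ => False
  | _ => True

/-- A BSS machine: a finite flowchart of nodes. -/
structure Machine where
  Label : Type
  finite_label : Finite Label
  bitTapes : ℕ
  realTapes : ℕ
  start : Label
  node : Label → Node Label bitTapes realTapes

namespace Machine

/-- All data processing of the machine is discrete; real numbers are only moved around. -/
def IsDiscrete (M : Machine) : Prop := ∀ l, (M.node l).IsDiscrete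

/-- The configurations of a machine. -/
structure Config (M : Machine) where
  label : M.Label
  bits : Fin (M.bitTapes + 2) → Turing.Tape (Option Bool)
  reals : Fin (M.realTapes + 1) → Turing.Tape ℝ

/-- One step of a computation, where `R z v` says that the machine may work with `v` in the place
of the constant or the result `z`. -/
def Step (M : Machine) (R : ℝ → ℝ → Prop) (c c' : M.Config) : Prop :=
  match M.node c.label with
  | .readBit i next => c' = { c with label := next (c.bits i).head }
  | .writeBit i a next =>
      c' = { c with label := next, bits := Function.update c.bits i ((c.bits i).write a) }
  | .moveBit i dir next =>
      c' = { c with label := next, bits := Function.update c.bits i ((c.bits i).move dir) }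
  | .moveReal i dir next =>
      c' = { c with label := next, reals := Function.update c.reals i ((c.reals i).move dir) }
  | .copy i j next =>
      c' = { c with
        label := next, reals := Function.update c.reals i ((c.reals i).write (c.reals j).head) }
  | .const i a next => ∃ v, R a v ∧
      c' = { c with label := next, reals := Function.update c.reals i ((c.reals i).write v) }
  | .arith op i j k next => ∃ v, R (op.apply (c.reals j).head (c.reals k).head) v ∧
      c' = { c with label := next, reals := Function.update c.reals i ((c.reals i).write v) }
  | .branch i ifNeg ifNonneg =>
      c' = { c with label := if (c.reals i).head < 0 then ifNeg else ifNonneg }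
  | .halt _ => False

/-- `M.Steps R n c c'`: some computation leads in exactly `n` steps from `c` to `c'`. -/
def Steps (M : Machine) (R : ℝ → ℝ → Prop) : ℕ → M.Config → M.Config → Prop
  | 0, c, c' => c = c'
  | n + 1, c, c' => ∃ e, M.Step R c e ∧ Steps M R n e c'

/-- `c` is an initial configuration on input `(u, x)`: the bits `u` stand on the discrete tape `0`,
the number of reals stands in unary on the discrete tape `1`, and the (rounded) reals stand on the
real tape `0`; all other tapes are empty. -/
def IsInitial (M : Machine) (R : ℝ → ℝ → Prop) (w : Instance) (c : M.Config) : Prop :=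
  c.label = M.start ∧
  c.bits 0 = Turing.Tape.mk₁ (w.1.map some) ∧
  c.bits 1 = Turing.Tape.mk₁ (List.replicate w.2.length (some true)) ∧
  (∀ i, i ≠ 0 → i ≠ 1 → c.bits i = default) ∧
  (∃ x' : List ℝ, List.Forall₂ R w.2 x' ∧ c.reals 0 = Turing.Tape.mk₁ x') ∧
  (∀ i, i ≠ 0 → c.reals i = default)

/-- `M.Run R w n c`: some computation on input `w` is in configuration `c` after `n` steps. -/
def Run (M : Machine) (R : ℝ → ℝ → Prop) (w : Instance) (n : ℕ) (c : M.Config) : Prop :=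
  ∃ c₀, M.IsInitial R w c₀ ∧ M.Steps R n c₀ c

/-- All computations on input `w` halt within `T` steps (a computation can always be continued
until it reaches a halting node). -/
def HaltsWithin (M : Machine) (R : ℝ → ℝ → Prop) (w : Instance) (T : ℕ) : Prop :=
  ∀ n c, M.Run R w n c → n ≤ T

/-- Whenever a computation on input `w` halts, its answer to the question `w ∈ S` is correct. -/
def AnswersCorrectly (M : Machine) (R : ℝ → ℝ → Prop) (w : Instance) (S : Set Instance) : Prop :=
  ∀ n c b, M.Run R w n c → M.node c.label = .halt b → (b = true ↔ w ∈ S)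

/-- The instance `(v, z)` that is displayed by a configuration: to the right of the heads, up to
the first blank, the discrete tape `0` holds `v` and the discrete tape `1` holds the number of
reals in `z`, and the first that many cells of the real tape `0` hold `z`. -/
def Config.Displays {M : Machine} (c : M.Config) (w : Instance) : Prop :=
  (∀ i : Fin w.1.length, (c.bits 0).nth (i : ℕ) = some (w.1.get i)) ∧
  (c.bits 0).nth (w.1.length : ℤ) = none ∧
  (∀ i : Fin w.2.length, (c.bits 1).nth (i : ℕ) = some true) ∧
  (c.bits 1).nth (w.2.length : ℤ) = none ∧
  (∀ i : Fin w.2.length, (c.reals 0).nth (i : ℕ) = w.2.get i)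

/-- The error-free computation on input `w` halts within `T` steps and returns `w'`. -/
def Returns (M : Machine) (w w' : Instance) (T : ℕ) : Prop :=
  ∃ n c b, n ≤ T ∧ M.Run Eq w n c ∧ M.node c.label = .halt b ∧ c.Displays w'

end Machine

/-! ### Complexity classes and reductions -/

/-- Direct polynomial cost: the number of steps is polynomially bounded in the length, and the
answers are correct as soon as the precision exceeds a polynomial in the size. Infinite precision
is sufficient for every instance, ill-posed or not. -/
def PDir (P : DecisionProblem) : Prop :=
  ∃ (M : Machine) (t q : Polynomial ℕ), ∀ w : Instance,
    (∀ ε : ℝ, 0 < ε → ε < 1 → M.HaltsWithin (Rounds ε) w (t.eval w.len)) ∧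
    (∀ ε : ℝ, 0 < ε → ε < 1 → ∀ s : ℕ, P.size w = s → q.eval s ≤ precision ε →
      M.AnswersCorrectly (Rounds ε) w P.carrier) ∧
    M.AnswersCorrectly Eq w P.carrier

/-- `log μ_B(w') ≤ Q(log μ_W(w))`; nothing is required when `μ_W(w) = ∞`. -/
def CondBounded (Q : Polynomial ℝ) (W B : DecisionProblem) (w w' : Instance) : Prop :=
  W.cond w ≠ ⊤ → B.cond w' ≠ ⊤ ∧ B.logCond w' ≤ Q.eval (W.logCond w)

/-- The range of the floating-point system with base `2`, mantissas of `k + 1` digits, and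
exponents between `-2^k + 1` and `2^(k+1) - 1`. -/
def floatRange (k : ℕ) : Set ℝ :=
  {x | x = 0 ∨ ((2 : ℝ) ^ 2 ^ k)⁻¹ ≤ |x| ∧
    |x| ≤ (2 : ℝ) ^ (2 ^ (k + 1) - 1) * (1 - ((2 : ℝ) ^ (k + 1))⁻¹)}

/-- The magnitude of a real number. -/
noncomputable def mgt (x : ℝ) : ℕ := sInf {k | 1 ≤ k ∧ x ∈ floatRange k}

/-- The magnitude of a vector: the maximum of the magnitudes of its components. -/
noncomputable def mgtVec {m : ℕ} (y : Fin m → ℝ) : ℕ := Finset.univ.sup fun i => mgt (y i)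

/-- Nondeterministic direct polynomial cost, with unrestricted certificates. -/
def NPUDir (W : DecisionProblem) : Prop :=
  ∃ B : DecisionProblem, PDir B ∧ ∃ (p : Polynomial ℕ) (Q : Polynomial ℝ), ∀ w : Instance,
    (w ∈ W.carrier → ∃ y : Fin (p.eval w.len) → ℝ,
      w.append y ∈ B.carrier ∧ CondBounded Q W B w (w.append y)) ∧
    (w ∉ W.carrier → ∀ y : Fin (p.eval w.len) → ℝ,
      w.append y ∉ B.carrier ∧ CondBounded Q W B w (w.append y))

/-- Nondeterministic direct polynomial cost, with certificates of bounded magnitude. -/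
def NPBDir (W : DecisionProblem) : Prop :=
  ∃ B : DecisionProblem, PDir B ∧ ∃ (p q : Polynomial ℕ) (Q : Polynomial ℝ), ∀ w : Instance,
    (w ∈ W.carrier → ∃ y : Fin (p.eval w.len) → ℝ,
      w.append y ∈ B.carrier ∧ CondBounded Q W B w (w.append y) ∧
      ∀ s : ℕ, W.size w = s → mgtVec y ≤ q.eval s) ∧
    (w ∉ W.carrier → ∀ y : Fin (p.eval w.len) → ℝ,
      w.append y ∉ B.carrier ∧ CondBounded Q W B w (w.append y))

/-- P-reductions: a discrete (hence error-free) computation, of cost polynomially bounded in the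
length, turns `w` into `f w` such that `w ∈ W ↔ f w ∈ S`, and the size of `f w` is polynomially
bounded in the size of `w` (which says nothing when the latter is `∞`). -/
def PReduces (W S : DecisionProblem) : Prop :=
  ∃ (M : Machine) (f : Instance → Instance) (t r : Polynomial ℕ), M.IsDiscrete ∧
    ∀ w : Instance,
      M.Returns w (f w) (t.eval w.len) ∧
      (w ∈ W.carrier ↔ f w ∈ S.carrier) ∧
      ∀ s : ℕ, W.size w = s → S.size (f w) ≤ (r.eval s : ℕ)

/-- `S` is hard for the class `K` with respect to P-reductions. -/
def Hard (K : DecisionProblem → Prop) (S : DecisionProblem) : Prop :=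
  ∀ W, K W → PReduces W S

/-- `S` is complete for the class `K` with respect to P-reductions. -/
def Complete (K : DecisionProblem → Prop) (S : DecisionProblem) : Prop :=
  K S ∧ Hard K S

/-! ### Algebraic circuits -/

/-- The nodes of positive in-degree of a circuit, together with the numbers of their parents. -/
inductive Gate : Type
  /-- An arithmetic node, of in-degree 2. -/
  | arith (op : ArithOp) (a b : ℕ)
  /-- A selection node, of in-degree 3: the value of `b` if that of `a` is negative, and the value
  of `c` otherwise. -/
  | select (a b c : ℕ)

/-- The parents of a gate. -/
def Gate.parents : Gate → List ℕ
  | arith _ a b => [a, b]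
  | select a b c => [a, b, c]

/-- An algebraic circuit, with its nodes numbered in a topological order: first the constant
nodes, then the input nodes, then the arithmetic and selection nodes. The last node has out-degree
0; it is the output node that is singled out. -/
structure Circuit where
  consts : List ℝ
  numInputs : ℕ
  gates : List Gate

namespace Circuit

/-- The number of nodes of in-degree 0. -/
def numLeaves (C : Circuit) : ℕ := C.consts.length + C.numInputs

/-- The number of nodes. -/
def numNodes (C : Circuit) : ℕ := C.numLeaves + C.gates.length

/-- There is an edge from the node `i` to the node `j`. -/
def Edge (C : Circuit) (i j : ℕ) : Prop :=
  ∃ t : Fin C.gates.length, j = C.numLeaves + t ∧ i ∈ (C.gates.get t).parents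

/-- The graph of the circuit is acyclic, as every edge leads to a node of larger number, and it is
connected (in particular, not empty). -/
def Valid (C : Circuit) : Prop :=
  (∀ i j, C.Edge i j → i < j) ∧
  (SimpleGraph.fromRel fun i j : Fin C.numNodes => C.Edge i j).Connected

/-- `v` assigns values to the nodes of the circuit in an evaluation at the point `y`, where `R z z'`
says that `z'` may be used in the place of `z`: with `R = Rounds ε` these are the
`ε`-evaluations, and with `R = Eq` the exact one. -/
def IsEvaluation (C : Circuit) (R : ℝ → ℝ → Prop) (y : Fin C.numInputs → ℝ) (v : ℕ → ℝ) : Prop :=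
  (∀ i : Fin C.consts.length, R (C.consts.get i) (v i)) ∧
  (∀ i : Fin C.numInputs, R (y i) (v (C.consts.length + i))) ∧
  ∀ t : Fin C.gates.length,
    match C.gates.get t with
    | .arith op a b => R (op.apply (v a) (v b)) (v (C.numLeaves + t))
    | .select a b c => v (C.numLeaves + t) = if v a < 0 then v b else v c

/-- Some evaluation of the circuit at `y` has the result `z`. -/
def Yields (C : Circuit) (R : ℝ → ℝ → Prop) (y : Fin C.numInputs → ℝ) (z : ℝ) : Prop :=
  ∃ v : ℕ → ℝ, C.IsEvaluation R y v ∧ z = v (C.numNodes - 1)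

/-- The set `{y | f_C(y) ≥ 0}`, where `f_C(y)` is the result of the exact evaluation. -/
def solutions (C : Circuit) : Set (Fin C.numInputs → ℝ) := {y | ∃ z, C.Yields Eq y z ∧ 0 ≤ z}

/-- The circuit is feasible. -/
def Feasible (C : Circuit) : Prop := C.solutions.Nonempty

/-- The supremum of the `ε < 1` such that all `ε`-evaluations at `y` correctly decide whether `y`
is a solution. -/
noncomputable def rhoEval (C : Circuit) (y : Fin C.numInputs → ℝ) : ℝ≥0∞ :=
  ⨆ ε ∈ {ε : ℝ | 0 < ε ∧ ε < 1 ∧ ∀ z, C.Yields (Rounds ε) y z → (0 ≤ z ↔ y ∈ C.solutions)},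
    ENNReal.ofReal ε

open Classical in
/-- The best value of `rhoEval` at a solution, or the worst one at any point if there is no
solution. -/
noncomputable def rhoFeas (C : Circuit) : ℝ≥0∞ :=
  if C.Feasible then ⨆ y ∈ C.solutions, C.rhoEval y else ⨅ y, C.rhoEval y

open Classical in
/-- The variant of `rhoFeas` that takes the magnitude of the solutions into account. -/
noncomputable def rhoBFeas (C : Circuit) : ℝ≥0∞ :=
  if C.Feasible then ⨆ y ∈ C.solutions, C.rhoEval y * (2 ^ mgtVec y)⁻¹ else ⨅ y, C.rhoEval y

end Circuit

/-- The unary code `1ⁿ0` of a natural number. -/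
def natCode (n : ℕ) : List Bool := List.replicate n true ++ [false]

/-- The code of an arithmetic operation. -/
def ArithOp.code : ArithOp → List Bool
  | add => natCode 0
  | sub => natCode 1
  | mul => natCode 2
  | div => natCode 3

/-- The code of a gate: its kind, followed by its parents. -/
def Gate.code : Gate → List Bool
  | arith op a b => op.code ++ natCode a ++ natCode b
  | select a b c => natCode 4 ++ natCode a ++ natCode b ++ natCode c

/-- The encoding of circuits as instances: the bits describe the number of inputs and the gates,
and the reals are the constants. -/
def Circuit.code (C : Circuit) : Instance :=
  (natCode C.numInputs ++ C.gates.flatMap Gate.code, C.consts)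

theorem natCode_append_inj {a b : ℕ} {l m : List Bool} (h : natCode a ++ l = natCode b ++ m) :
    a = b ∧ l = m := by
  induction a generalizing b with
  | zero =>
    cases b with
    | zero => simpa [natCode] using h
    | succ b => simp [natCode, List.replicate_succ] at h
  | succ a ih =>
    cases b with
    | zero => simp [natCode, List.replicate_succ] at h
    | succ b =>
      have h2 : natCode a ++ l = natCode b ++ m := by
        simpa [natCode, List.replicate_succ] using h
      simpa using ih h2

theorem Gate.code_append_inj {g g' : Gate} {l m : List Bool} (h : g.code ++ l = g'.code ++ m) :
    g = g' ∧ l = m := by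
  have key : ∀ {a b : ℕ} {l m : List Bool}, natCode a ++ l = natCode b ++ m → a = b ∧ l = m :=
    natCode_append_inj
  cases g with
  | arith op a b =>
    cases g' with
    | arith op' a' b' =>
      cases op <;> cases op' <;> simp only [Gate.code, ArithOp.code, List.append_assoc] at h <;>
        have h0 := key h <;> first
          | exact absurd h0.1 (by decide)
          | (have h1 := key h0.2
             have h2 := key h1.2
             rw [h1.1, h2.1]
             exact ⟨rfl, h2.2⟩)
    | select a' b' c' =>
      cases op <;> simp only [Gate.code, ArithOp.code, List.append_assoc] at h <;>
        exact absurd (key h).1 (by decide)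
  | select a b c =>
    cases g' with
    | arith op' a' b' =>
      cases op' <;> simp only [Gate.code, ArithOp.code, List.append_assoc] at h <;>
        exact absurd (key h).1 (by decide)
    | select a' b' c' =>
      simp only [Gate.code, List.append_assoc] at h
      have h1 := key (key h).2
      have h2 := key h1.2
      have h3 := key h2.2
      rw [h1.1, h2.1, h3.1]
      exact ⟨rfl, h3.2⟩

theorem Gate.code_ne_nil (g : Gate) : g.code ≠ [] := by
  cases g with
  | arith op a b => simp [Gate.code, natCode]
  | select a b c => simp [Gate.code, natCode]

/-- Different circuits have different codes. -/
theorem Circuit.code_injective : Function.Injective Circuit.code := by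
  have gates : ∀ gs gs' : List Gate,
      gs.flatMap Gate.code = gs'.flatMap Gate.code → gs = gs' := by
    intro gs
    induction gs with
    | nil =>
      intro gs' h
      cases gs' with
      | nil => rfl
      | cons g' gs' => simp [Gate.code_ne_nil] at h
    | cons g gs ih =>
      intro gs' h
      cases gs' with
      | nil => simp [Gate.code_ne_nil] at h
      | cons g' gs' =>
        simp only [List.flatMap_cons] at h
        have h1 := Gate.code_append_inj h
        rw [h1.1, ih gs' h1.2]
  rintro ⟨c, m, gs⟩ ⟨c', m', gs'⟩ h
  simp only [Circuit.code, Prod.mk.injEq] at h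
  have h1 := natCode_append_inj h.1
  rw [h.2, h1.1, gates _ _ h1.2]

open Classical in
/-- The problem of deciding whether a circuit is feasible, with condition number
`max {1, 1 / rho C}`. An instance that does not encode a circuit is a `No`-instance of condition
number `1`. -/
noncomputable def circuitProblem (rho : Circuit → ℝ≥0∞) : DecisionProblem where
  carrier := {w | ∃ C : Circuit, C.Valid ∧ C.code = w ∧ C.Feasible}
  cond w := if h : ∃ C : Circuit, C.Valid ∧ C.code = w then max 1 (rho h.choose)⁻¹ else 1
  one_le_cond w := by
    split_ifs
    · exact le_max_left _ _
    · exact le_rfl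

/-- The circuit feasibility problem with condition number `μ_feas`. -/
noncomputable def circFeas : DecisionProblem := circuitProblem Circuit.rhoFeas

/-- The circuit feasibility problem with condition number `μ_Bfeas`. -/
noncomputable def circBFeas : DecisionProblem := circuitProblem Circuit.rhoBFeas

end FiniteBSS

namespace FiniteBSS

/-! ### A structured language for machines -/

/-! Both completeness statements are one statement with a parameter. Let `e` be a weight on
certificates. `NPWeighted e` is the class whose certificates have `e y` polynomially bounded, and
`rhoWeighted e` counts a solution `y` with the factor `2 ^ (-e y)`. The weight `0` gives the
unrestricted class with `circFeas`, the weight `mgtVec` gives the class with bounded magnitude and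
`circBFeas`. Membership (`npWeighted_circuitProblem`) and hardness (`hard_circuitProblem`) are
proved once for such weights.

Hardness: a verifier `M` that halts within polynomially many steps is unrolled into a circuit. Each
step becomes a layer of gates that holds the label and the tape cells near the heads. Discrete data
are stored as signs, and all control flow is done by selection gates. Selections are free of errors,
a relative error below `1` changes no sign, and `0` is not perturbed at all. So an evaluation of the
circuit at `y`, exact or with errors below `ε`, follows a computation of `M` on `(u, x, y)` with
errors of the same kind: the value chosen at an arithmetic gate is the value chosen by the machine,
and whatever is computed for inactive labels is discarded (`step_exists`, `layer_step`, `sim_run`).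
Therefore the solutions of the circuit are the accepted certificates, and `rhoEval` at `y` is at
least `2 ^ (-J)` as soon as the precision `J` suffices for `M` on `(u, x, y)` (`sim_correct`). A
good certificate then bounds the supremum for a Yes-instance from below, and all points together
bound the infimum for a No-instance. The gates are so regular that a discrete program can print them
in polynomial time, with the built-in constants of `M` and the reals `x` merely copied into the list
of constants (`exists_reduction`).

Membership: the verifier evaluates the circuit at `y`, one gate after the other, with the same
rounding errors as an evaluation of the circuit. Evaluating is thus in the class of direct
polynomial cost when its condition number is `1 / rhoEval` (`evalProblem`, `pDir_evalProblem`).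
Three points need care. The machine has to reject bit strings that encode no circuit; connectedness
is tested by spreading marks from the node `0` in repeated passes over the gates
(`connected_iff_marked`). The number of certificate components may depend only on the length of the
instance; the point is therefore padded to as many components as that length, and the total number
of reals then reveals the number of constants. Finally, the supremum over the solutions need not be
attained, but some solution reaches half of it whenever it is positive, which costs one bit
(`exists_half_lt`).

Neither machine is written down directly. A small structured language is compiled into flowcharts,
and `Spec` provides compositional total correctness with time bounds for every serial relation `R`.
The reduction uses `R = Eq`; the evaluator uses `Eq` and `Rounds ε`. -/

/-- The states of structured programs: `k` counters, three arrays of symbols with a head on each,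
an array of reals with a head, and three real registers. -/
@[ext]
structure St (k : ℕ) where
  cnt : Fin k → ℕ
  arr : Fin 3 → ℤ → Option Bool
  pos : Fin 3 → ℤ
  main : ℤ → ℝ
  mpos : ℤ
  reg : Fin 3 → ℝ

/-- The elementary actions. -/
inductive Act (k : ℕ) : Type
  | skip
  | inc (i : Fin k)
  | dec (i : Fin k)
  | move (a : Fin 3) (d : Turing.Dir)
  | write (a : Fin 3) (s : Option Bool)
  | moveMain (d : Turing.Dir)
  | load (i : Fin 3)
  | store (i : Fin 3)
  | const (x : ℝ)
  | arith (op : ArithOp)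

/-- The elementary tests. -/
inductive Test (k : ℕ) : Type
  | zero (i : Fin k)
  | pos (i : Fin k)
  | bit (a : Fin 3) (s : Option Bool)
  | nbit (a : Fin 3) (s : Option Bool)
  | neg (i : Fin 3)

/-- Structured programs. -/
inductive Cmd (k : ℕ) : Type
  | act (a : Act k)
  | seq (p q : Cmd k)
  | ite (b : Test k) (p q : Cmd k)
  | whil (b : Test k) (p : Cmd k)

infixr:60 " ;; " => Cmd.seq

/-- The arrays occupy the discrete tapes `0`, `1`, `2`, so that arrays `0` and `1` already carry the
input and later display the output; the counters follow. Among the real tapes, `0` is the main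
array, and the cells under the heads of `1`, `2`, `3` are the registers. -/
def arrTape {k : ℕ} (a : Fin 3) : Fin (k + 1 + 2) := ⟨a, by omega⟩
def cntTape {k : ℕ} (i : Fin k) : Fin (k + 1 + 2) := ⟨i + 3, by omega⟩

theorem arrTape_inj {k : ℕ} {a b : Fin 3} : (arrTape a : Fin (k + 1 + 2)) = arrTape b ↔ a = b := by
  simp [arrTape, Fin.ext_iff]

theorem cntTape_inj {k : ℕ} {a b : Fin k} : cntTape a = cntTape b ↔ a = b := by
  simp [cntTape, Fin.ext_iff]

theorem arrTape_ne_cntTape {k : ℕ} (a : Fin 3) (i : Fin k) : arrTape a ≠ cntTape i := by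
  simp only [arrTape, cntTape, ne_eq, Fin.ext_iff]; omega

/-- The first node (`false`) and the second node (`true`) of an action. -/
def Act.node {k : ℕ} {L : Type} (nxt mid : L) : Act k → Bool → Node L (k + 1) 3
  -- A counter is a block of strokes whose last one is under the head; the value `0` is a blank
  -- there. Testing for `0` thus takes one look, and counting changes one cell and moves once.
  | inc i, false => .moveBit (cntTape i) .right mid
  | inc i, true => .writeBit (cntTape i) (some true) nxt
  | dec i, false => .writeBit (cntTape i) none mid
  | dec i, true => .moveBit (cntTape i) .left nxt
  | skip, false => .readBit 0 fun _ => mid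
  | move a d, false => .moveBit (arrTape a) d mid
  | write a s, false => .writeBit (arrTape a) s mid
  | moveMain d, false => .moveReal 0 d mid
  | load i, false => .copy i.succ 0 mid
  | store i, false => .copy 0 i.succ mid
  | const x, false => .const 0 x mid
  | arith op, false => .arith op 3 1 2 mid
  -- Idle node: it makes every action last exactly two steps.
  | _, true => .readBit 0 fun _ => nxt

def Test.node {k : ℕ} {L : Type} (yes no : L) : Test k → Node L (k + 1) 3
  | zero i => .readBit (cntTape i) fun x => if x = none then yes else no
  | pos i => .readBit (cntTape i) fun x => if x = none then no else yes
  | bit a s => .readBit (arrTape a) fun x => if x = s then yes else no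
  | nbit a s => .readBit (arrTape a) fun x => if x = s then no else yes
  | neg i => .branch i.succ yes no

def Test.Holds {k : ℕ} (σ : St k) : Test k → Prop
  | zero i => σ.cnt i = 0
  | pos i => σ.cnt i ≠ 0
  | bit a s => σ.arr a (σ.pos a) = s
  | nbit a s => σ.arr a (σ.pos a) ≠ s
  | neg i => σ.reg i < 0

namespace Cmd

/-- Two labels for an action and one for a test. The exit of a program is not one of its labels; the
surrounding program supplies it. -/
def Label {k : ℕ} : Cmd k → Type
  | act _ => Bool
  | seq p q => p.Label ⊕ q.Label
  | ite _ p q => Option (p.Label ⊕ q.Label)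
  | whil _ p => Option p.Label

theorem finite_label {k : ℕ} : ∀ p : Cmd k, Finite p.Label
  | act _ => inferInstanceAs (Finite Bool)
  | seq p q => by
    have := p.finite_label; have := q.finite_label
    exact inferInstanceAs (Finite (p.Label ⊕ q.Label))
  | ite _ p q => by
    have := p.finite_label; have := q.finite_label
    exact inferInstanceAs (Finite (Option (p.Label ⊕ q.Label)))
  | whil _ p => by
    have := p.finite_label
    exact inferInstanceAs (Finite (Option p.Label))

def entry {k : ℕ} : (p : Cmd k) → p.Label
  | act _ => false
  | seq p _ => Sum.inl p.entry
  | ite _ _ _ => none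
  | whil _ _ => none

/-- The flowchart of a program whose labels are embedded by `emb` and which is left to `exit`. -/
def node {k : ℕ} {L : Type} : (p : Cmd k) → (p.Label → L) → L → p.Label → Node L (k + 1) 3
  | act a, emb, exit, b => a.node exit (emb true) b
  | seq p q, emb, _, .inl l => p.node (fun x => emb (.inl x)) (emb (.inr q.entry)) l
  | seq _ q, emb, exit, .inr l => q.node (fun x => emb (.inr x)) exit l
  | ite b p q, emb, _, none => b.node (emb (some (.inl p.entry))) (emb (some (.inr q.entry)))
  | ite _ p _, emb, exit, some (.inl l) => p.node (fun x => emb (some (.inl x))) exit l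
  | ite _ _ q, emb, exit, some (.inr l) => q.node (fun x => emb (some (.inr x))) exit l
  | whil b p, emb, exit, none => b.node (emb (some p.entry)) exit
  | whil _ p, emb, _, some l => p.node (fun x => emb (some x)) (emb none) l

end Cmd

/-- The tapes `bits` and `reals` represent the state `σ`. -/
structure Rep {k : ℕ} (σ : St k) (bits : Fin (k + 1 + 2) → Turing.Tape (Option Bool))
    (reals : Fin (3 + 1) → Turing.Tape ℝ) : Prop where
  arr : ∀ a j, (bits (arrTape a)).nth j = σ.arr a (σ.pos a + j)
  cnt : ∀ i j, (bits (cntTape i)).nth j = if -(σ.cnt i : ℤ) < j ∧ j ≤ 0 then some true else none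
  main : ∀ j, (reals 0).nth j = σ.main (σ.mpos + j)
  reg : ∀ i : Fin 3, (reals i.succ).head = σ.reg i

/-- `R`-paths from `c` lead within `t` steps to a configuration with the property `P`. -/
def Machine.Ensures (M : Machine) (R : ℝ → ℝ → Prop) : ℕ → M.Config → (M.Config → Prop) → Prop
  | 0, c, P => P c
  -- Demanding a successor excludes computations that get stuck before `P` is reached.
  | t + 1, c, P => P c ∨ ((∃ c', M.Step R c c') ∧ ∀ c', M.Step R c c' → M.Ensures R t c' P)

theorem Machine.Ensures.mono {M : Machine} {R : ℝ → ℝ → Prop} {P Q : M.Config → Prop}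
    (hPQ : ∀ c, P c → Q c) : ∀ {t t' : ℕ} {c : M.Config}, t ≤ t' → M.Ensures R t c P →
      M.Ensures R t' c Q
  | 0, 0, _, _, h => hPQ _ h
  | 0, _ + 1, _, _, h => Or.inl (hPQ _ h)
  | _ + 1, _ + 1, _, ht, h => h.imp (hPQ _) fun h =>
      ⟨h.1, fun c' hc => (h.2 c' hc).mono hPQ (Nat.le_of_succ_le_succ ht)⟩

theorem Machine.Ensures.trans {M : Machine} {R : ℝ → ℝ → Prop} {P Q : M.Config → Prop} {t' : ℕ}
    (hPQ : ∀ c, P c → M.Ensures R t' c Q) : ∀ {t : ℕ} {c : M.Config}, M.Ensures R t c P →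
      M.Ensures R (t + t') c Q
  | 0, _, h => by simpa using hPQ _ h
  | t + 1, c, h => by
    rcases h with h | h
    · exact (hPQ c h).mono (fun _ => id) (by omega)
    · rw [show t + 1 + t' = t + t' + 1 by omega]
      exact Or.inr ⟨h.1, fun c' hc => (h.2 c' hc).trans hPQ⟩

/-- All executions of `p` from the state `σ` end after at most `t` steps in a state with the
property `Q`. -/
def Spec {k : ℕ} (R : ℝ → ℝ → Prop) (p : Cmd k) (σ : St k) (t : ℕ) (Q : St k → Prop) : Prop :=
  -- The machine that contains the flowchart is arbitrary. This is what makes specifications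
  -- composable: a part of a program is used inside the machine of the whole program.
  ∀ (L : Type) (fin : Finite L) (s : L) (node : L → Node L (k + 1) 3) (emb : p.Label → L)
    (exit : L), (∀ l, node (emb l) = p.node emb exit l) → ∀ bits reals, Rep σ bits reals →
      (Machine.mk L fin (k + 1) 3 s node).Ensures R t ⟨emb p.entry, bits, reals⟩
        fun c => c.label = exit ∧ ∃ σ', Rep σ' c.bits c.reals ∧ Q σ'

theorem Spec.mono {k : ℕ} {R : ℝ → ℝ → Prop} {p : Cmd k} {σ : St k} {t t' : ℕ} {Q Q' : St k → Prop}
    (h : Spec R p σ t Q) (ht : t ≤ t') (hQ : ∀ σ', Q σ' → Q' σ') : Spec R p σ t' Q' :=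
  fun L fin s node emb exit hn bits reals hr =>
    (h L fin s node emb exit hn bits reals hr).mono
      (fun _ hc => ⟨hc.1, hc.2.imp fun _ h => ⟨h.1, hQ _ h.2⟩⟩) ht

theorem Spec.seq {k : ℕ} {R : ℝ → ℝ → Prop} {p q : Cmd k} {σ : St k} {t t' : ℕ}
    {Q : St k → Prop} (h : Spec R p σ t fun σ' => Spec R q σ' t' Q) :
    Spec R (p ;; q) σ (t + t') Q := by
  intro L fin s node emb exit hn bits reals hr
  refine Machine.Ensures.trans ?_ (h L fin s node (fun x => emb (.inl x)) (emb (.inr q.entry))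
    (fun l => hn (.inl l)) bits reals hr)
  rintro ⟨l, b, r⟩ ⟨rfl, σ', hr', hq⟩
  exact hq L fin s node (fun x => emb (.inr x)) exit (fun l => hn (.inr l)) b r hr'

theorem Test.ensures {k : ℕ} {R : ℝ → ℝ → Prop} {L : Type} {fin : Finite L} {s : L}
    {node : L → Node L (k + 1) 3} {l yes no : L} {b : Test k} (hn : node l = b.node yes no)
    {bits reals} {σ : St k} (hr : Rep σ bits reals) {t : ℕ}
    {P : (Machine.mk L fin (k + 1) 3 s node).Config → Prop}
    (hy : b.Holds σ → (Machine.mk L fin (k + 1) 3 s node).Ensures R t ⟨yes, bits, reals⟩ P)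
    (hno : ¬ b.Holds σ → (Machine.mk L fin (k + 1) 3 s node).Ensures R t ⟨no, bits, reals⟩ P) :
    (Machine.mk L fin (k + 1) 3 s node).Ensures R (t + 1) ⟨l, bits, reals⟩ P := by
  classical
  have key : ∀ c', (Machine.mk L fin (k + 1) 3 s node).Step R ⟨l, bits, reals⟩ c' ↔
      c' = ⟨if b.Holds σ then yes else no, bits, reals⟩ := by
    intro c'
    cases b with
    | zero i =>
      have h0 := hr.cnt i 0
      rw [Turing.Tape.nth_zero] at h0
      simp only [Machine.Step, hn, Test.node, Test.Holds, h0]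
      by_cases h : σ.cnt i = 0
      · simp [h]
      · simp [h, Nat.pos_of_ne_zero h]
    | pos i =>
      have h0 := hr.cnt i 0
      rw [Turing.Tape.nth_zero] at h0
      simp only [Machine.Step, hn, Test.node, Test.Holds, h0]
      by_cases h : σ.cnt i = 0
      · simp [h]
      · simp [h, Nat.pos_of_ne_zero h]
    | nbit a x =>
      have h0 := hr.arr a 0
      rw [Turing.Tape.nth_zero, add_zero] at h0
      simp only [Machine.Step, hn, Test.node, Test.Holds, h0]
      by_cases h : σ.arr a (σ.pos a) = x <;> simp [h]
    | bit a x =>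
      have h0 := hr.arr a 0
      rw [Turing.Tape.nth_zero, add_zero] at h0
      simp only [Machine.Step, hn, Test.node, Test.Holds, h0]
      exact iff_of_eq (by congr)
    | neg i =>
      have h0 := hr.reg i
      simp only [Machine.Step, hn, Test.node, Test.Holds, h0]
      exact iff_of_eq (by congr)
  refine Or.inr ⟨⟨_, (key _).2 rfl⟩, fun c' hc => ?_⟩
  rw [key] at hc
  subst hc
  by_cases h : b.Holds σ
  · simpa [h] using hy h
  · simpa [h] using hno h

theorem Spec.ite {k : ℕ} {R : ℝ → ℝ → Prop} {b : Test k} {p q : Cmd k} {σ : St k} {t : ℕ}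
    {Q : St k → Prop} (hp : b.Holds σ → Spec R p σ t Q) (hq : ¬ b.Holds σ → Spec R q σ t Q) :
    Spec R (.ite b p q) σ (t + 1) Q := by
  intro L fin s node emb exit hn bits reals hr
  refine Test.ensures (hn none) hr (fun h => ?_) fun h => ?_
  · exact hp h L fin s node (fun x => emb (some (.inl x))) exit (fun l => hn (some (.inl l))) _ _ hr
  · exact hq h L fin s node (fun x => emb (some (.inr x))) exit (fun l => hn (some (.inr l))) _ _ hr

theorem Spec.whil_false {k : ℕ} {R : ℝ → ℝ → Prop} {b : Test k} {p : Cmd k} {σ : St k}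
    {Q : St k → Prop} (hb : ¬ b.Holds σ) (h : Q σ) : Spec R (.whil b p) σ 1 Q := by
  intro L fin s node emb exit hn bits reals hr
  exact Test.ensures (t := 0) (hn none) hr (fun h => absurd h hb) fun _ => ⟨rfl, σ, hr, h⟩

theorem Spec.whil_true {k : ℕ} {R : ℝ → ℝ → Prop} {b : Test k} {p : Cmd k} {σ : St k} {t t' : ℕ}
    {Q : St k → Prop} (hb : b.Holds σ)
    (h : Spec R p σ t fun σ' => Spec R (.whil b p) σ' t' Q) :
    Spec R (.whil b p) σ (t + t' + 1) Q := by
  intro L fin s node emb exit hn bits reals hr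
  refine Test.ensures (hn none) hr (fun _ => ?_) (fun h => absurd hb h)
  refine Machine.Ensures.trans ?_ (h L fin s node (fun x => emb (some x)) (emb none)
    (fun l => hn (some l)) bits reals hr)
  rintro ⟨l, b, r⟩ ⟨rfl, σ', hr', hq⟩
  exact hq L fin s node emb exit hn b r hr'

/-- Every real number may be replaced by something. -/
class IsSerial (R : ℝ → ℝ → Prop) : Prop where
  ex : ∀ z, ∃ v, R z v

instance : IsSerial Eq := ⟨fun z => ⟨z, rfl⟩⟩

theorem isSerial_rounds {ε : ℝ} (h : 0 < ε) : IsSerial (Rounds ε) :=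
  ⟨fun z => ⟨z, 0, by simpa using h, by simp⟩⟩

def dirStep : Turing.Dir → ℤ
  | .left => -1
  | .right => 1

def St.setc {k : ℕ} (σ : St k) (i : Fin k) (n : ℕ) : St k :=
  { σ with cnt := Function.update σ.cnt i n }

/-- `Q` holds after the action. -/
def Act.Post {k : ℕ} (R : ℝ → ℝ → Prop) (σ : St k) (Q : St k → Prop) : Act k → Prop
  | skip => Q σ
  | inc i => Q (σ.setc i (σ.cnt i + 1))
  | dec i => 0 < σ.cnt i ∧ Q (σ.setc i (σ.cnt i - 1))
  | move a d => Q { σ with pos := Function.update σ.pos a (σ.pos a + dirStep d) }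
  | write a s =>
      Q { σ with arr := Function.update σ.arr a (Function.update (σ.arr a) (σ.pos a) s) }
  | moveMain d => Q { σ with mpos := σ.mpos + dirStep d }
  | load i => Q { σ with reg := Function.update σ.reg i (σ.main σ.mpos) }
  | store i => Q { σ with main := Function.update σ.main σ.mpos (σ.reg i) }
  | const x => ∀ v, R x v → Q { σ with main := Function.update σ.main σ.mpos v }
  | arith op => ∀ v, R (op.apply (σ.reg 0) (σ.reg 1)) v →
      Q { σ with reg := Function.update σ.reg 2 v }

theorem nth_move {Γ : Type*} [Inhabited Γ] (T : Turing.Tape Γ) (d : Turing.Dir) (j : ℤ) :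
    (T.move d).nth j = T.nth (j + dirStep d) := by
  cases d
  · rw [Turing.Tape.move_left_nth]; rfl
  · rw [Turing.Tape.move_right_nth]; rfl

section
variable {k : ℕ} {σ : St k} {bits : Fin (k + 1 + 2) → Turing.Tape (Option Bool)}
  {reals : Fin (3 + 1) → Turing.Tape ℝ}

theorem Rep.move (hr : Rep σ bits reals) (a : Fin 3) (d : Turing.Dir) :
    Rep { σ with pos := Function.update σ.pos a (σ.pos a + dirStep d) }
      (Function.update bits (arrTape a) ((bits (arrTape a)).move d)) reals where
  arr b j := by
    by_cases h : b = a
    · subst h; simp [nth_move, hr.arr, add_comm j, add_assoc]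
    · simp [h, arrTape_inj, Function.update_of_ne, hr.arr]
  cnt i j := by
    simp [Function.update_of_ne (arrTape_ne_cntTape a i).symm, hr.cnt]
  main := hr.main
  reg := hr.reg

theorem Rep.write (hr : Rep σ bits reals) (a : Fin 3) (s : Option Bool) :
    Rep { σ with arr := Function.update σ.arr a (Function.update (σ.arr a) (σ.pos a) s) }
      (Function.update bits (arrTape a) ((bits (arrTape a)).write s)) reals where
  arr b j := by
    by_cases h : b = a
    · subst h
      rw [Function.update_self, Turing.Tape.write_nth, hr.arr]
      by_cases hj : j = 0 <;> simp [hj]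
    · simp [h, arrTape_inj, Function.update_of_ne, hr.arr]
  cnt i j := by
    simp [Function.update_of_ne (arrTape_ne_cntTape a i).symm, hr.cnt]
  main := hr.main
  reg := hr.reg

theorem Rep.setc (hr : Rep σ bits reals) (i : Fin k) (n : ℕ) {T : Turing.Tape (Option Bool)}
    (hT : ∀ j, T.nth j = if -(n : ℤ) < j ∧ j ≤ 0 then some true else none) :
    Rep (σ.setc i n) (Function.update bits (cntTape i) T) reals where
  arr b j := by
    simp [Function.update_of_ne (arrTape_ne_cntTape b i), hr.arr, St.setc]
  cnt i' j := by
    by_cases h : i' = i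
    · subst h; simp [hT, St.setc]
    · simp [h, cntTape_inj, Function.update_of_ne, hr.cnt, St.setc]
  main := hr.main
  reg := hr.reg

theorem Rep.setMain (hr : Rep σ bits reals) (v : ℝ) :
    Rep { σ with main := Function.update σ.main σ.mpos v } bits
      (Function.update reals 0 ((reals 0).write v)) where
  arr := hr.arr
  cnt := hr.cnt
  main j := by
    rw [Function.update_self, Turing.Tape.write_nth, hr.main]
    by_cases hj : j = 0 <;> simp [hj]
  reg i := by simp [hr.reg]

theorem Rep.setReg (hr : Rep σ bits reals) (i : Fin 3) (v : ℝ) :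
    Rep { σ with reg := Function.update σ.reg i v } bits
      (Function.update reals i.succ ((reals i.succ).write v)) where
  arr := hr.arr
  cnt := hr.cnt
  main j := by simp [Function.update_of_ne (Fin.succ_ne_zero i).symm, hr.main]
  reg i' := by
    by_cases h : i' = i
    · subst h; simp [← Turing.Tape.nth_zero, Turing.Tape.write_nth]
    · simp [h, Function.update_of_ne, hr.reg]

theorem Rep.moveMain (hr : Rep σ bits reals) (d : Turing.Dir) :
    Rep { σ with mpos := σ.mpos + dirStep d } bits
      (Function.update reals 0 ((reals 0).move d)) where
  arr := hr.arr
  cnt := hr.cnt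
  main j := by simp [nth_move, hr.main, add_comm j, add_assoc]
  reg i := by simp [hr.reg]

end

/-- Seriality of `R` matters only for constants and arithmetic, where the machine must have a
successor; the postcondition then has to hold for every admissible value. -/
theorem Spec.act {k : ℕ} {R : ℝ → ℝ → Prop} [hS : IsSerial R] {a : Act k} {σ : St k}
    {Q : St k → Prop} (h : a.Post R σ Q) : Spec R (.act a) σ 2 Q := by
  intro L fin s node emb exit hn bits reals hr
  have h1 : node (emb false) = _ := hn false
  have h2 : node (emb true) = _ := hn true
  have skip2 : ∀ {b r σ'}, Rep σ' b r → Q σ' → node (emb true) = .readBit 0 (fun _ => exit) →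
      (Machine.mk L fin (k + 1) 3 s node).Ensures R 1 ⟨emb true, b, r⟩
        fun c => c.label = exit ∧ ∃ σ', Rep σ' c.bits c.reals ∧ Q σ' := by
    intro b r σ' hr' hq hn'
    refine Or.inr ⟨⟨_, by simp only [Machine.Step, hn']; rfl⟩, ?_⟩
    simp only [Machine.Step, hn', forall_eq]
    exact ⟨rfl, σ', hr', hq⟩
  cases a with
  | skip =>
    simp only [Cmd.node, Act.node] at h1 h2
    refine Or.inr ⟨⟨_, by simp only [Machine.Step, Cmd.entry, h1]; rfl⟩, ?_⟩
    simp only [Machine.Step, Cmd.entry, h1, forall_eq]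
    exact skip2 hr h h2
  | move a d =>
    simp only [Cmd.node, Act.node] at h1 h2
    refine Or.inr ⟨⟨_, by simp only [Machine.Step, Cmd.entry, h1]; rfl⟩, ?_⟩
    simp only [Machine.Step, Cmd.entry, h1, forall_eq]
    exact skip2 (hr.move a d) h h2
  | write a x =>
    simp only [Cmd.node, Act.node] at h1 h2
    refine Or.inr ⟨⟨_, by simp only [Machine.Step, Cmd.entry, h1]; rfl⟩, ?_⟩
    simp only [Machine.Step, Cmd.entry, h1, forall_eq]
    exact skip2 (hr.write a x) h h2
  | moveMain d =>
    simp only [Cmd.node, Act.node] at h1 h2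
    refine Or.inr ⟨⟨_, by simp only [Machine.Step, Cmd.entry, h1]; rfl⟩, ?_⟩
    simp only [Machine.Step, Cmd.entry, h1, forall_eq]
    exact skip2 (hr.moveMain d) h h2
  | load i =>
    simp only [Cmd.node, Act.node] at h1 h2
    refine Or.inr ⟨⟨_, by simp only [Machine.Step, Cmd.entry, h1]; rfl⟩, ?_⟩
    simp only [Machine.Step, Cmd.entry, h1, forall_eq]
    have h0 := hr.main 0
    rw [Turing.Tape.nth_zero, add_zero] at h0
    rw [h0]
    exact skip2 (hr.setReg i _) h h2
  | store i =>
    simp only [Cmd.node, Act.node] at h1 h2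
    refine Or.inr ⟨⟨_, by simp only [Machine.Step, Cmd.entry, h1]; rfl⟩, ?_⟩
    simp only [Machine.Step, Cmd.entry, h1, forall_eq]
    rw [hr.reg i]
    exact skip2 (hr.setMain _) h h2
  | const x =>
    simp only [Cmd.node, Act.node] at h1 h2
    obtain ⟨v, hv⟩ := hS.ex x
    refine Or.inr ⟨⟨_, by simp only [Machine.Step, Cmd.entry, h1]; exact ⟨v, hv, rfl⟩⟩, ?_⟩
    simp only [Machine.Step, Cmd.entry, h1]
    rintro _ ⟨v, hv, rfl⟩
    exact skip2 (hr.setMain _) (h v hv) h2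
  | arith op =>
    simp only [Cmd.node, Act.node] at h1 h2
    obtain ⟨v, hv⟩ := hS.ex (op.apply (reals 1).head (reals 2).head)
    refine Or.inr ⟨⟨_, by simp only [Machine.Step, Cmd.entry, h1]; exact ⟨v, hv, rfl⟩⟩, ?_⟩
    simp only [Machine.Step, Cmd.entry, h1]
    rintro _ ⟨v, hv, rfl⟩
    have e0 : (reals 1).head = σ.reg 0 := hr.reg 0
    have e1 : (reals 2).head = σ.reg 1 := hr.reg 1
    rw [e0, e1] at hv
    exact skip2 (hr.setReg 2 v) (h v hv) h2
  | inc i =>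
    simp only [Cmd.node, Act.node] at h1 h2
    refine Or.inr ⟨⟨_, by simp only [Machine.Step, Cmd.entry, h1]; rfl⟩, ?_⟩
    simp only [Machine.Step, Cmd.entry, h1, forall_eq]
    refine Or.inr ⟨⟨_, by simp only [Machine.Step, h2]; rfl⟩, ?_⟩
    simp only [Machine.Step, h2, forall_eq]
    refine ⟨rfl, _, ?_, h⟩
    simp only [Function.update_idem, Function.update_self]
    refine hr.setc i _ fun j => ?_
    rw [Turing.Tape.write_nth, nth_move, hr.cnt]
    by_cases hj : j = 0
    · simp only [hj]; simp; omega
    · have : dirStep .right = 1 := rfl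
      rw [if_neg hj, this]
      congr 1
      push_cast
      apply propext
      omega
  | dec i =>
    simp only [Cmd.node, Act.node] at h1 h2
    refine Or.inr ⟨⟨_, by simp only [Machine.Step, Cmd.entry, h1]; rfl⟩, ?_⟩
    simp only [Machine.Step, Cmd.entry, h1, forall_eq]
    refine Or.inr ⟨⟨_, by simp only [Machine.Step, h2]; rfl⟩, ?_⟩
    simp only [Machine.Step, h2, forall_eq]
    obtain ⟨hp, h⟩ := h
    refine ⟨rfl, _, ?_, h⟩
    simp only [Function.update_idem, Function.update_self]
    refine hr.setc i _ fun j => ?_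
    rw [nth_move, Turing.Tape.write_nth, hr.cnt]
    have : dirStep .left = -1 := rfl
    rw [this]
    by_cases hj : j + -1 = 0
    · have : ¬ (j ≤ 0) := by omega
      simp [hj, this]
    · rw [if_neg hj]
      congr 1
      apply propext
      push_cast [Nat.cast_sub (show 1 ≤ σ.cnt i by omega)]
      omega

end FiniteBSS
namespace FiniteBSS

/-! ### From programs to machines -/

/-- A halting node has no successor. So no computation continues beyond a configuration with `P`,
and before `P` is reached there is always a successor, hence no halt. -/
theorem Machine.Ensures.run {M : Machine} {R : ℝ → ℝ → Prop} {P : M.Config → Prop}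
    (hP : ∀ c, P c → ∃ b, M.node c.label = .halt b) : ∀ {t : ℕ} {c : M.Config},
      M.Ensures R t c P → ∀ {n c'}, M.Steps R n c c' →
        n ≤ t ∧ ∀ b, M.node c'.label = .halt b → P c' := by
  have stuck : ∀ c b, M.node c.label = .halt b → ∀ c', ¬ M.Step R c c' := by
    intro c b hb c' hs
    simp [Machine.Step, hb] at hs
  have base : ∀ {c : M.Config}, P c → ∀ {t n c'}, M.Steps R n c c' →
      n ≤ t ∧ ∀ b, M.node c'.label = .halt b → P c' := by
    intro c hc t n c' hs
    obtain ⟨b, hb⟩ := hP c hc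
    cases n with
    | zero => cases hs; exact ⟨Nat.zero_le _, fun _ _ => hc⟩
    | succ n => obtain ⟨e, he, -⟩ := hs; exact absurd he (stuck c b hb e)
  intro t
  induction t with
  | zero => intro c h n c' hs; exact base h hs
  | succ t ih =>
    intro c h n c' hs
    rcases h with h | ⟨⟨e, he⟩, h⟩
    · exact base h hs
    · cases n with
      | zero => cases hs; exact ⟨Nat.zero_le _, fun b hb => absurd he (stuck c b hb e)⟩
      | succ n =>
        obtain ⟨e, he, hs⟩ := hs
        have := ih (h e he) hs
        exact ⟨Nat.succ_le_succ this.1, this.2⟩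

theorem Machine.Ensures.exists_run {M : Machine} {R : ℝ → ℝ → Prop} {P : M.Config → Prop} :
    ∀ {t : ℕ} {c : M.Config}, M.Ensures R t c P → ∃ n ≤ t, ∃ c', M.Steps R n c c' ∧ P c' := by
  intro t
  induction t with
  | zero => intro c h; exact ⟨0, le_rfl, c, rfl, h⟩
  | succ t ih =>
    intro c h
    rcases h with h | ⟨⟨e, he⟩, h⟩
    · exact ⟨0, Nat.zero_le _, c, rfl, h⟩
    · obtain ⟨n, hn, c', hs, hc⟩ := ih (h e he)
      exact ⟨n + 1, Nat.succ_le_succ hn, c', ⟨e, he, hs⟩, hc⟩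

/-- The machine that runs the program `p` and then answers whether `b` holds. -/
def Cmd.machine {k : ℕ} (p : Cmd k) (b : Test k) : Machine where
  Label := p.Label ⊕ Option Bool
  finite_label := by have := p.finite_label; infer_instance
  bitTapes := k + 1
  realTapes := 3
  start := .inl p.entry
  node
    | .inl l => p.node .inl (.inr none) l
    | .inr none => b.node (.inr (some true)) (.inr (some false))
    | .inr (some a) => .halt a

def Act.IsDiscrete {k : ℕ} : Act k → Prop
  | arith _ => False
  | _ => True

def Test.IsDiscrete {k : ℕ} : Test k → Prop
  | neg _ => False
  | _ => True

def Cmd.IsDiscrete {k : ℕ} : Cmd k → Prop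
  | act a => a.IsDiscrete
  | seq p q => p.IsDiscrete ∧ q.IsDiscrete
  | ite b p q => b.IsDiscrete ∧ p.IsDiscrete ∧ q.IsDiscrete
  | whil b p => b.IsDiscrete ∧ p.IsDiscrete

theorem Test.IsDiscrete.node {k : ℕ} {L : Type} {yes no : L} {b : Test k} (h : b.IsDiscrete) :
    (b.node yes no).IsDiscrete := by
  cases b <;> simp_all [Test.node, Test.IsDiscrete, Node.IsDiscrete]

theorem Cmd.IsDiscrete.node {k : ℕ} {L : Type} : ∀ {p : Cmd k} {emb : p.Label → L} {exit : L},
    p.IsDiscrete → ∀ l, (p.node emb exit l).IsDiscrete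
  | act a, emb, exit, h, b => by
    cases a <;> cases b <;>
      simp_all [Cmd.node, Cmd.IsDiscrete, Act.node, Act.IsDiscrete, Node.IsDiscrete]
  | seq p q, emb, exit, h, .inl l => h.1.node l
  | seq p q, emb, exit, h, .inr l => h.2.node l
  | ite b p q, emb, exit, h, none => h.1.node
  | ite b p q, emb, exit, h, some (.inl l) => h.2.1.node l
  | ite b p q, emb, exit, h, some (.inr l) => h.2.2.node l
  | whil b p, emb, exit, h, none => h.1.node
  | whil b p, emb, exit, h, some l => h.2.node l

theorem Cmd.machine_isDiscrete {k : ℕ} {p : Cmd k} {b : Test k} (hp : p.IsDiscrete)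
    (hb : b.IsDiscrete) : (p.machine b).IsDiscrete := by
  rintro (l | _ | a)
  · exact hp.node l
  · exact hb.node
  · trivial

/-- The array that holds a list of bits, surrounded by blanks. -/
def listArr (l : List Bool) (j : ℤ) : Option Bool := if 0 ≤ j then l[j.toNat]? else none

/-- The array that holds a list of reals, surrounded by zeros. -/
def listReal (l : List ℝ) (j : ℤ) : ℝ := if 0 ≤ j then l.getD j.toNat 0 else 0

theorem mk₁_nth {Γ : Type*} [Inhabited Γ] (l : List Γ) (j : ℤ) :
    (Turing.Tape.mk₁ l).nth j = if 0 ≤ j then l.getD j.toNat default else default := by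
  rw [Turing.Tape.mk₁, Turing.Tape.mk₂]
  rcases j with n | n
  · rw [Int.ofNat_eq_natCast, Turing.Tape.mk'_nth_nat, Turing.ListBlank.nth_mk]
    rw [← List.getD_default_eq_getI]
    simp
  · have : (Turing.Tape.mk' (Turing.ListBlank.mk []) (Turing.ListBlank.mk l)).nth (Int.negSucc n)
        = (Turing.ListBlank.mk ([] : List Γ)).nth n := rfl
    rw [this, Turing.ListBlank.nth_mk]
    have : ¬ (0 ≤ Int.negSucc n) := by omega
    simp [this]

/-- The state in which a program starts on the input `(u, x)` with rounded reals `x'`. -/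
def St.init (k : ℕ) (w : Instance) (x' : List ℝ) : St k where
  cnt _ := 0
  arr a := if a = 0 then listArr w.1 else if a = 1 then listArr (List.replicate w.2.length true)
    else fun _ => none
  pos _ := 0
  main := listReal x'
  mpos := 0
  reg _ := 0

theorem default_nth {Γ : Type*} [Inhabited Γ] (j : ℤ) :
    (default : Turing.Tape Γ).nth j = default := by
  have : (default : Turing.Tape Γ) = Turing.Tape.mk₁ [] := by
    rw [Turing.Tape.mk₁, Turing.Tape.mk₂, Turing.Tape.mk']
    rfl
  rw [this, mk₁_nth]
  simp

theorem mk₁_bits_nth (l : List Bool) (j : ℤ) :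
    (Turing.Tape.mk₁ (l.map some)).nth j = listArr l j := by
  rw [mk₁_nth, listArr]
  split_ifs
  · rw [List.getD_eq_getElem?_getD, List.getElem?_map]
    cases l[j.toNat]? <;> rfl
  · rfl

theorem Cmd.rep_init {k : ℕ} {p : Cmd k} {b : Test k} {R : ℝ → ℝ → Prop} {w : Instance}
    {c : (p.machine b).Config} (h : (p.machine b).IsInitial R w c) :
    ∃ x', List.Forall₂ R w.2 x' ∧ Rep (St.init k w x') c.bits c.reals := by
  obtain ⟨-, h0, h1, hb, ⟨x', hx, hr0⟩, hr⟩ := h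
  refine ⟨x', hx, ?_, ?_, ?_, ?_⟩
  · intro a j
    match a with
    | 0 =>
      have := mk₁_bits_nth w.1 j
      rw [← h0] at this
      exact this.trans (by simp [St.init])
    | 1 =>
      have := mk₁_bits_nth (List.replicate w.2.length true) j
      rw [List.map_replicate, ← h1] at this
      exact this.trans (by simp [St.init])
    | 2 =>
      have : c.bits (arrTape 2) = default :=
        hb _ (fun h => absurd (congrArg (fun x : Fin (k + 1 + 2) => (x : ℕ)) h) (by simp [arrTape]))
          (fun h => absurd (congrArg (fun x : Fin (k + 1 + 2) => (x : ℕ)) h) (by simp [arrTape]))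
      rw [this, default_nth]
      rfl
  · intro i j
    have : c.bits (cntTape i) = default :=
      hb _ (fun h => absurd (congrArg (fun x : Fin (k + 1 + 2) => (x : ℕ)) h) (by simp [cntTape]))
        (fun h => absurd (congrArg (fun x : Fin (k + 1 + 2) => (x : ℕ)) h) (by simp [cntTape]))
    rw [this, default_nth]
    have : ¬ (0 < j ∧ j ≤ 0) := by omega
    simp [St.init, this]
    rfl
  · intro j
    have := mk₁_nth x' j
    rw [← hr0] at this
    refine this.trans ?_
    simp only [St.init, listReal, zero_add]
    rfl
  · intro i
    have : c.reals i.succ = default := hr _ (Fin.succ_ne_zero i)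
    rw [this]
    rfl

theorem Cmd.machine_ensures {k : ℕ} {p : Cmd k} {b : Test k} {R : ℝ → ℝ → Prop} {σ : St k}
    {Q : St k → Prop} {t : ℕ} (h : Spec R p σ t Q) {c : (p.machine b).Config}
    (hc : c.label = (p.machine b).start) (hr : Rep σ c.bits c.reals) :
    (p.machine b).Ensures R (t + 1) c fun c' => ∃ σ' a, Rep σ' c'.bits c'.reals ∧ Q σ' ∧
      (p.machine b).node c'.label = .halt a ∧ (a = true ↔ b.Holds σ') := by
  obtain ⟨l, bits, reals⟩ := c
  subst hc
  refine Machine.Ensures.trans ?_ (h _ (p.machine b).finite_label (p.machine b).start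
    (p.machine b).node .inl (.inr none) (fun l => rfl) bits reals hr)
  rintro ⟨l, b', r'⟩ ⟨rfl, σ', hr', hq⟩
  refine Test.ensures (t := 0) (b := b) (yes := Sum.inr (some true)) (no := Sum.inr (some false)) rfl hr'
    (fun hb => ?_) fun hb => ?_
  · exact ⟨σ', true, hr', hq, rfl, by simpa using hb⟩
  · exact ⟨σ', false, hr', hq, rfl, by simpa using hb⟩

/-- Time bound and correctness are separated because halting is required at every precision,
correctness only at a sufficient one. -/
theorem Cmd.machine_decides {k : ℕ} {p : Cmd k} {b : Test k} {R : ℝ → ℝ → Prop} {w : Instance}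
    {Q : List ℝ → St k → Prop} {t : ℕ}
    (h : ∀ x', List.Forall₂ R w.2 x' → Spec R p (St.init k w x') t (Q x')) :
    (p.machine b).HaltsWithin R w (t + 1) ∧ ∀ S : Set Instance,
      (∀ x', List.Forall₂ R w.2 x' → ∀ σ', Q x' σ' → (b.Holds σ' ↔ w ∈ S)) →
        (p.machine b).AnswersCorrectly R w S := by
  have key : ∀ n c, (p.machine b).Run R w n c → n ≤ t + 1 ∧
      ∀ a, (p.machine b).node c.label = .halt a → ∃ x', List.Forall₂ R w.2 x' ∧ ∃ σ', Q x' σ' ∧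
        (a = true ↔ b.Holds σ') := by
    rintro n c ⟨c₀, hi, hs⟩
    obtain ⟨x', hx, hr⟩ := Cmd.rep_init hi
    have := (Cmd.machine_ensures (h x' hx) hi.1 hr).run
      (fun c ⟨_, a, _, _, ha, _⟩ => ⟨a, ha⟩) hs
    refine ⟨this.1, fun a ha => ?_⟩
    obtain ⟨σ', a', _, hq, ha', hh⟩ := this.2 a ha
    rw [ha] at ha'
    cases ha'
    exact ⟨x', hx, σ', hq, hh⟩
  refine ⟨fun n c hr => (key n c hr).1, fun S hS n c a hr ha => ?_⟩
  obtain ⟨x', hx, σ', hq, hh⟩ := (key n c hr).2 a ha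
  rw [hh]
  exact hS x' hx σ' hq

/-- The instance displayed by a state. -/
structure St.Displays {k : ℕ} (σ : St k) (w : Instance) : Prop where
  bits : ∀ i : ℕ, i ≤ w.1.length → σ.arr 0 (σ.pos 0 + i) = w.1[i]?
  ones : ∀ i : ℕ, i < w.2.length → σ.arr 1 (σ.pos 1 + i) = some true
  blank : σ.arr 1 (σ.pos 1 + w.2.length) = none
  reals : ∀ (i : ℕ) (h : i < w.2.length), σ.main (σ.mpos + i) = w.2[i]

theorem Cmd.machine_returns {k : ℕ} {p : Cmd k} {b : Test k} {w w' : Instance} {t : ℕ}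
    (h : Spec Eq p (St.init k w w.2) t fun σ => σ.Displays w') :
    (p.machine b).Returns w w' (t + 1) := by
  let c₀ : (p.machine b).Config :=
    { label := (p.machine b).start
      bits := fun i => if i = 0 then Turing.Tape.mk₁ (w.1.map some) else
        if i = 1 then Turing.Tape.mk₁ (List.replicate w.2.length (some true)) else default
      reals := fun i => if i = 0 then Turing.Tape.mk₁ w.2 else default }
  have hi : (p.machine b).IsInitial Eq w c₀ :=
    ⟨rfl, by simp [c₀], by simp [c₀], fun i h0 h1 => by simp [c₀, h0, h1],
      ⟨w.2, by simp, by simp [c₀]⟩, fun i h0 => by simp [c₀, h0]⟩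
  obtain ⟨x', hx, hr⟩ := Cmd.rep_init hi
  have hx : w.2 = x' := by simpa using hx
  subst hx
  obtain ⟨n, hn, c', hs, σ', a, hr', hq, ha, -⟩ :=
    (Cmd.machine_ensures (b := b) h hi.1 hr).exists_run
  refine ⟨n, c', a, hn, ⟨c₀, hi, hs⟩, ha, fun i => ?_, ?_, fun i => ?_, ?_, fun i => ?_⟩
  · have := hr'.arr 0 (i : ℕ)
    rw [hq.bits _ i.2.le] at this
    refine this.trans ?_
    simp
  · have := hr'.arr 0 (w'.1.length : ℕ)
    rw [hq.bits _ le_rfl] at this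
    refine this.trans ?_
    simp
  · exact (hr'.arr 1 (i : ℕ)).trans (hq.ones _ i.2)
  · exact (hr'.arr 1 (w'.2.length : ℕ)).trans hq.blank
  · exact (hr'.main (i : ℕ)).trans (hq.reals _ i.2)

/-! ### Loops and counters -/

/-- Repeat `p` as often as the counter `i` says; the counter ends with the value `0`. -/
def loop {k : ℕ} (i : Fin k) (p : Cmd k) : Cmd k := .whil (.pos i) (.act (.dec i) ;; p)

section
variable {k : ℕ} {R : ℝ → ℝ → Prop}

theorem Spec.seq_eq {p q : Cmd k} {σ σ' : St k} {t t' : ℕ} {Q : St k → Prop}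
    (hp : Spec R p σ t (· = σ')) (hq : Spec R q σ' t' Q) : Spec R (p ;; q) σ (t + t') Q :=
  Spec.seq (hp.mono le_rfl fun _ h => h ▸ hq)

/-- The index of the invariant bounds the number of remaining rounds from above. A round may lower
it by more than one, hence the strong induction. -/
theorem Spec.whil_inv {b : Test k} {p : Cmd k} {t : ℕ} (I : ℕ → St k → Prop)
    (hb : ∀ j σ, I j σ → (b.Holds σ ↔ j ≠ 0))
    (h : ∀ j σ, I (j + 1) σ → Spec R p σ t (fun σ' => ∃ j' ≤ j, I j' σ')) :
    ∀ (n : ℕ) (σ : St k), I n σ → Spec R (.whil b p) σ (n * (t + 1) + 1) (I 0) := by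
  intro n
  induction n using Nat.strong_induction_on with
  | _ n ih =>
    intro σ hσ
    cases n with
    | zero => exact (Spec.whil_false (by simp [hb 0 σ hσ]) hσ).mono (by omega) fun _ => id
    | succ n =>
      refine (Spec.whil_true (by simp [hb _ σ hσ])
        ((h n σ hσ).mono le_rfl fun σ' ⟨j', hj, hI⟩ =>
          (ih j' (by omega) σ' hI).mono (t' := n * (t + 1) + 1) ?_ fun _ => id)).mono ?_ fun _ => id
      · gcongr
      · rw [add_mul]; omega

variable [IsSerial R]

theorem Spec.loop {i : Fin k} {p : Cmd k} {t : ℕ} (I : ℕ → St k → Prop)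
    (hI : ∀ j σ, I j σ → σ.cnt i = j)
    (h : ∀ j σ, I (j + 1) σ → Spec R p (σ.setc i j) t (I j)) {n : ℕ} {σ : St k} (hσ : I n σ) :
    Spec R (loop i p) σ (n * (t + 3) + 1) (I 0) := by
  refine (Spec.whil_inv (R := R) (t := 2 + t) I (fun j σ hj => by simp [Test.Holds, hI j σ hj])
    (fun j σ hj => ?_) n σ hσ).mono (by rw [show 2 + t + 1 = t + 3 by omega]) fun _ => id
  refine Spec.seq (Spec.act ⟨by rw [hI _ _ hj]; omega, ?_⟩)
  rw [hI _ _ hj]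
  exact (h j σ hj).mono le_rfl fun σ' h => ⟨j, le_rfl, h⟩

/-- A loop whose states are given explicitly, indexed by the number of remaining rounds. -/
theorem Spec.loop_eq {i : Fin k} {p : Cmd k} {t : ℕ} (F : ℕ → St k) {n : ℕ}
    (hF : ∀ j, (F j).cnt i = j)
    (h : ∀ j < n, Spec R p ((F (j + 1)).setc i j) t (· = F j)) :
    Spec R (FiniteBSS.loop i p) (F n) (n * (t + 3) + 1) (· = F 0) := by
  refine (Spec.loop (fun j σ => σ = F j ∧ j ≤ n) (fun j σ hj => by rw [hj.1, hF])
    (fun j σ hj => ?_) ⟨rfl, le_rfl⟩).mono le_rfl fun σ h => h.1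
  rw [hj.1]
  exact (h j hj.2).mono le_rfl fun σ' h => ⟨h, by omega⟩

/-- A loop whose states are given explicitly, indexed by the numbers of the rounds that are done and
that remain. -/
theorem Spec.loop_up {i : Fin k} {p : Cmd k} {t n : ℕ} (F : ℕ → ℕ → St k)
    (hF : ∀ d j, (F d j).cnt i = j) (hset : ∀ d j, (F d (j + 1)).setc i j = F d j)
    (h : ∀ d j, d + (j + 1) = n → Spec R p (F d j) t (· = F (d + 1) j)) :
    Spec R (FiniteBSS.loop i p) (F 0 n) (n * (t + 3) + 1) (· = F n 0) := by
  refine (Spec.loop (fun j σ => ∃ d, d + j = n ∧ σ = F d j) (fun j σ ⟨d, _, hj⟩ => by rw [hj, hF])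
    (fun j σ ⟨d, hd, hj⟩ => ?_) ⟨0, by omega, rfl⟩).mono le_rfl fun σ ⟨d, hd, h⟩ => ?_
  · rw [hj, hset]
    exact (h d j hd).mono le_rfl fun σ' h => ⟨d + 1, by omega, h⟩
  · rw [h, show d = n by omega]

theorem Spec.act_eq {a : Act k} {σ σ' : St k} (h : a.Post R σ (· = σ')) :
    Spec R (.act a) σ 2 (· = σ') := Spec.act h

theorem Spec.inc (i : Fin k) (σ : St k) :
    Spec R (.act (.inc i)) σ 2 (· = σ.setc i (σ.cnt i + 1)) := Spec.act rfl

@[simp] theorem St.cnt_setc (σ : St k) (i j : Fin k) (n : ℕ) :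
    (σ.setc i n).cnt j = if j = i then n else σ.cnt j := by
  simp [St.setc, Function.update_apply]

@[simp] theorem St.setc_arr (σ : St k) (i : Fin k) (n : ℕ) : (σ.setc i n).arr = σ.arr := rfl
@[simp] theorem St.setc_pos (σ : St k) (i : Fin k) (n : ℕ) : (σ.setc i n).pos = σ.pos := rfl
@[simp] theorem St.setc_main (σ : St k) (i : Fin k) (n : ℕ) : (σ.setc i n).main = σ.main := rfl
@[simp] theorem St.setc_mpos (σ : St k) (i : Fin k) (n : ℕ) : (σ.setc i n).mpos = σ.mpos := rfl
@[simp] theorem St.setc_reg (σ : St k) (i : Fin k) (n : ℕ) : (σ.setc i n).reg = σ.reg := rfl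

theorem St.setc_self (σ : St k) (i : Fin k) : σ.setc i (σ.cnt i) = σ := by
  simp [St.setc]

theorem St.setc_self' {σ : St k} {i : Fin k} {n : ℕ} (h : σ.cnt i = n) : σ.setc i n = σ := by
  rw [← h, St.setc_self]

theorem St.setc_setc (σ : St k) (i : Fin k) (m n : ℕ) : (σ.setc i m).setc i n = σ.setc i n := by
  simp [St.setc]

theorem St.setc_comm (σ : St k) {i j : Fin k} (h : i ≠ j) (m n : ℕ) :
    (σ.setc i m).setc j n = (σ.setc j n).setc i m := by
  simp only [St.setc, Function.update_comm h]

theorem St.ext_cnt {σ τ : St k} (h : ∀ i, σ.cnt i = τ.cnt i) (h1 : σ.arr = τ.arr)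
    (h2 : σ.pos = τ.pos) (h3 : σ.main = τ.main) (h4 : σ.mpos = τ.mpos) (h5 : σ.reg = τ.reg) :
    σ = τ := St.ext (funext h) h1 h2 h3 h4 h5

def clear (i : Fin k) : Cmd k := loop i (.act .skip)

theorem Spec.clear (i : Fin k) (σ : St k) :
    Spec R (clear i) σ (5 * σ.cnt i + 1) (· = σ.setc i 0) := by
  have := Spec.loop_eq (R := R) (i := i) (p := .act .skip) (t := 2) (n := σ.cnt i)
    (fun j => σ.setc i j) (by simp) (fun j _ => Spec.act (by simp [Act.Post, St.setc_setc]))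
  rw [St.setc_self] at this
  exact this.mono (by omega) fun _ => id

/-- Add the counter `i` to the counter `j`, and set `i` to `0`. -/
def moveCnt (i j : Fin k) : Cmd k := loop i (.act (.inc j))

theorem Spec.moveCnt {i j : Fin k} (hij : i ≠ j) (σ : St k) :
    Spec R (moveCnt i j) σ (5 * σ.cnt i + 1)
      (· = (σ.setc i 0).setc j (σ.cnt j + σ.cnt i)) := by
  have := Spec.loop_eq (R := R) (i := i) (p := .act (.inc j)) (t := 2) (n := σ.cnt i)
    (fun m => (σ.setc i m).setc j (σ.cnt j + (σ.cnt i - m))) (by simp [hij])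
    (fun m hm => (Spec.inc _ _).mono le_rfl fun _ h => by
      subst h
      rw [St.setc_comm _ hij.symm, St.setc_setc, St.setc_setc]
      congr 1
      simp only [St.cnt_setc, if_true]
      omega)
  rw [St.setc_self, Nat.sub_self, add_zero, St.setc_self] at this
  exact this.mono (by omega) fun _ => id

/-- Add the counter `i` to the counter `j`, using the counter `s`. -/
def addCnt (i j s : Fin k) : Cmd k := loop i (.act (.inc j) ;; .act (.inc s)) ;; moveCnt s i

theorem Spec.addCnt {i j s : Fin k} (hij : i ≠ j) (his : i ≠ s) (hjs : j ≠ s) (σ : St k)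
    (hs : σ.cnt s = 0) :
    Spec R (addCnt i j s) σ (12 * σ.cnt i + 2) (· = σ.setc j (σ.cnt j + σ.cnt i)) := by
  have h1 := Spec.loop_eq (R := R) (i := i) (p := .act (.inc j) ;; .act (.inc s)) (t := 4)
    (n := σ.cnt i)
    (fun m => ((σ.setc i m).setc j (σ.cnt j + (σ.cnt i - m))).setc s (σ.cnt i - m))
    (by simp [hij, his])
    (fun m hm => Spec.seq_eq (Spec.inc _ _) ((Spec.inc _ _).mono le_rfl fun _ h => by
      subst h
      refine St.ext_cnt (fun x => ?_) rfl rfl rfl rfl rfl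
      by_cases hx1 : x = i
      · subst hx1; simp [hij, his]
      · by_cases hx2 : x = j
        · subst hx2; simp [hjs, hij.symm]; omega
        · by_cases hx3 : x = s
          · subst hx3; simp [hjs.symm, his.symm]; omega
          · simp [hx1, hx2, hx3]))
  have e : ((σ.setc i (σ.cnt i)).setc j (σ.cnt j + (σ.cnt i - σ.cnt i))).setc s
      (σ.cnt i - σ.cnt i) = σ := by
    rw [St.setc_self, Nat.sub_self, add_zero, St.setc_self]
    exact St.setc_self' hs
  rw [e] at h1
  refine (Spec.seq_eq h1 (Spec.moveCnt his.symm _)).mono ?_ fun _ h => ?_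
  · simp; omega
  · rw [h]
    refine St.ext_cnt (fun x => ?_) rfl rfl rfl rfl rfl
    by_cases hx1 : x = i
    · subst hx1; simp [hij, his]
    · by_cases hx3 : x = s
      · subst hx3; simp [hjs.symm, his.symm, hs]
      · simp [hx1, hx3]

/-- Set the counter `j` to the value of the counter `i`, using the counter `s`. -/
def copyCnt (i j s : Fin k) : Cmd k := clear j ;; addCnt i j s

theorem Spec.copyCnt {i j s : Fin k} (hij : i ≠ j) (his : i ≠ s) (hjs : j ≠ s) (σ : St k)
    (hs : σ.cnt s = 0) :
    Spec R (copyCnt i j s) σ (5 * σ.cnt j + 12 * σ.cnt i + 3) (· = σ.setc j (σ.cnt i)) := by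
  refine (Spec.seq_eq (Spec.clear j σ) (Spec.addCnt hij his hjs _ (by simp [hjs.symm, hs]))).mono
    ?_ fun _ h => ?_
  · simp [hij]; omega
  · simpa [hij, St.setc_setc] using h

/-- Add a constant to a counter. -/
def incBy (i : Fin k) : ℕ → Cmd k
  | 0 => .act .skip
  | n + 1 => .act (.inc i) ;; incBy i n

theorem Spec.incBy (i : Fin k) (n : ℕ) : ∀ σ : St k,
    Spec R (incBy i n) σ (2 * n + 2) (· = σ.setc i (σ.cnt i + n)) := by
  induction n with
  | zero => intro σ; exact Spec.act (by simp [Act.Post, St.setc_self])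
  | succ n ih =>
    intro σ
    refine (Spec.seq_eq (Spec.inc i σ) (ih _)).mono (by omega) fun _ h => ?_
    rw [h, St.setc_setc]
    simp [add_assoc, add_comm 1 n]

/-! ### Output -/

/-- Append bits to the output, on the array `0`. -/
def St.emit : List Bool → St k → St k
  | [], σ => σ
  | b :: l, σ => St.emit l
      { σ with
        arr := Function.update σ.arr 0 (Function.update (σ.arr 0) (σ.pos 0) (some b))
        pos := Function.update σ.pos 0 (σ.pos 0 + 1) }

theorem St.emit_append (l l' : List Bool) : ∀ σ : St k,
    St.emit (l ++ l') σ = St.emit l' (St.emit l σ) := by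
  induction l with
  | nil => intro σ; rfl
  | cons b l ih => intro σ; exact ih _

theorem St.emit_setc (l : List Bool) (i : Fin k) (n : ℕ) : ∀ σ : St k,
    St.emit l (σ.setc i n) = (St.emit l σ).setc i n := by
  induction l with
  | nil => intro σ; rfl
  | cons b l ih => intro σ; simp only [St.emit]; rw [← ih]; rfl

@[simp] theorem St.emit_cnt (l : List Bool) : ∀ σ : St k, (St.emit l σ).cnt = σ.cnt := by
  induction l with
  | nil => intro σ; rfl
  | cons b l ih => intro σ; exact ih _

def emitBit (b : Bool) : Cmd k := .act (.write 0 (some b)) ;; .act (.move 0 .right)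

theorem Spec.emitBit (b : Bool) (σ : St k) : Spec R (emitBit b) σ 4 (· = St.emit [b] σ) :=
  Spec.seq_eq (Spec.act (by exact rfl)) (Spec.act (by exact rfl))

def emitBits : List Bool → Cmd k
  | [] => .act .skip
  | b :: l => emitBit b ;; emitBits l

theorem Spec.emitBits (l : List Bool) : ∀ σ : St k,
    Spec R (emitBits l) σ (4 * l.length + 2) (· = St.emit l σ) := by
  induction l with
  | nil => intro σ; exact Spec.act rfl
  | cons b l ih =>
    intro σ
    exact (Spec.seq_eq (Spec.emitBit b σ) (ih _)).mono (by simp; omega) fun _ => id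

/-- Output the unary code of `n` plus the value of the counter `i`, using the counter `s`. -/
def emitNat (i s : Fin k) (n : ℕ) : Cmd k :=
  loop i (.act (.inc s) ;; emitBit true) ;; moveCnt s i ;; emitBits (natCode n)

theorem replicate_append_natCode (m n : ℕ) :
    List.replicate m true ++ natCode n = natCode (m + n) := by
  rw [natCode, natCode, ← List.append_assoc, ← List.replicate_add]

theorem Spec.emitNat {i s : Fin k} (his : i ≠ s) (n : ℕ) (σ : St k) (hs : σ.cnt s = 0) :
    Spec R (emitNat i s n) σ (14 * σ.cnt i + 4 * n + 8)
      (· = St.emit (natCode (σ.cnt i + n)) σ) := by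
  have h1 := Spec.loop_eq (R := R) (i := i) (p := .act (.inc s) ;; FiniteBSS.emitBit true) (t := 6)
    (n := σ.cnt i)
    (fun m => St.emit (List.replicate (σ.cnt i - m) true)
      ((σ.setc i m).setc s (σ.cnt i - m)))
    (by simp [his])
    (fun m hm => Spec.seq_eq (Spec.inc _ _) ((Spec.emitBit _ _).mono le_rfl fun _ h => by
      rw [h, ← St.emit_setc, ← St.emit_setc, ← St.emit_append, ← List.replicate_succ',
        show σ.cnt i - (m + 1) + 1 = σ.cnt i - m by omega]
      congr 1
      refine St.ext_cnt (fun x => ?_) rfl rfl rfl rfl rfl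
      by_cases hx1 : x = i
      · subst hx1; simp [his]
      · by_cases hx3 : x = s
        · subst hx3; simp [his.symm]; omega
        · simp [hx1, hx3]))
  have e : St.emit (List.replicate (σ.cnt i - σ.cnt i) true)
      ((σ.setc i (σ.cnt i)).setc s (σ.cnt i - σ.cnt i)) = σ := by
    rw [St.setc_self, Nat.sub_self]
    exact St.setc_self' hs
  rw [e] at h1
  refine (Spec.seq_eq h1 (Spec.seq_eq (Spec.moveCnt his.symm _)
    (Spec.emitBits (natCode n) _))).mono ?_ fun _ h => ?_
  · simp [natCode]; omega
  · rw [h, ← St.emit_setc, ← St.emit_setc, ← St.emit_append, Nat.sub_zero,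
      replicate_append_natCode]
    congr 1
    refine St.ext_cnt (fun x => ?_) rfl rfl rfl rfl rfl
    by_cases hx1 : x = i
    · subst hx1; simp [his]
    · by_cases hx3 : x = s
      · subst hx3; simp [his.symm, hs]
      · simp [hx1, hx3]

/-- There is a program that evaluates a polynomial. -/
theorem exists_evalPoly {i j s s' : Fin k} (hij : i ≠ j) (his : i ≠ s) (his' : i ≠ s')
    (hjs : j ≠ s) (hjs' : j ≠ s') (hss' : s ≠ s') (p : Polynomial ℕ) :
    ∃ (P : Cmd k) (t : Polynomial ℕ), P.IsDiscrete ∧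
      ∀ (R : ℝ → ℝ → Prop) [IsSerial R] (σ : St k), σ.cnt j = 0 → σ.cnt s = 0 → σ.cnt s' = 0 →
        Spec R P σ (t.eval (σ.cnt i)) (· = σ.setc j (p.eval (σ.cnt i))) := by
  classical
  induction p using Polynomial.recOnHorner with
  | M0 =>
    refine ⟨.act .skip, 2, trivial, fun R _ σ hj hs hs' => ?_⟩
    refine (Spec.act (R := R) (a := .skip) (σ := σ) (Q := (· = σ)) rfl).mono (by simp) fun _ h => ?_
    rw [h, Polynomial.eval_zero, St.setc_self' hj]
  | MC p a _ _ ih =>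
    obtain ⟨P, t, hd, hP⟩ := ih
    refine ⟨P ;; incBy j a, t + .C (2 * a + 2), ⟨hd, ?_⟩, fun R _ σ hj hs hs' => ?_⟩
    · generalize a = a
      clear * -
      induction a with
      | zero => trivial
      | succ a ih => exact ⟨trivial, ih⟩
    · refine (Spec.seq_eq (hP R σ hj hs hs') (Spec.incBy j a _)).mono (by simp) fun _ h => ?_
      rw [h, St.setc_setc]
      simp
  -- Horner step: the value `v` reached so far controls a loop that adds the counter `i` to `s`, so
  -- that `s` becomes `v * x`; it is then moved back to `j`.
  | MX p _ ih =>
    obtain ⟨P, t, hd, hP⟩ := ih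
    refine ⟨P ;; loop j (addCnt i s s') ;; moveCnt s j,
      t + p * (12 * .X + 5) + 5 * p * .X + 2, ⟨hd, ⟨trivial, trivial, ?_⟩, ?_⟩,
      fun R _ σ hj hs hs' => ?_⟩
    · exact ⟨⟨trivial, trivial, trivial, trivial⟩, ⟨trivial, trivial, trivial⟩⟩
    · exact ⟨trivial, trivial, trivial⟩
    · set x := σ.cnt i with hx
      set v := p.eval x with hv
      have h1 := Spec.loop_eq (R := R) (i := j) (p := addCnt i s s') (t := 12 * x + 2) (n := v)
        (fun m => (σ.setc j m).setc s ((v - m) * x)) (by simp [hjs]) (fun m hm => by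
          have := Spec.addCnt (R := R) his his' hss'
            ((((σ.setc j (m + 1)).setc s ((v - (m + 1)) * x))).setc j m)
            (by simp [hss'.symm, hjs'.symm, hs'])
          refine this.mono (by simp [hij, his]; omega) fun _ h => ?_
          rw [h, St.setc_comm _ hjs.symm, St.setc_setc, St.setc_setc]
          congr 1
          simp only [St.cnt_setc, if_true, if_neg hij, if_neg his, if_neg hjs.symm]
          rw [← hx]
          clear_value v x
          obtain ⟨e, rfl⟩ : ∃ e, v = m + 1 + e := ⟨v - (m + 1), by omega⟩
          rw [show m + 1 + e - (m + 1) = e by omega, show m + 1 + e - m = e + 1 by omega, add_mul]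
          omega)
      have e : (σ.setc j v).setc s ((v - v) * x) = σ.setc j v := by
        rw [Nat.sub_self, zero_mul]
        exact St.setc_self' (by simp [hjs.symm, hs])
      rw [e] at h1
      refine (Spec.seq_eq (hP R σ hj hs hs') (Spec.seq_eq h1 (Spec.moveCnt hjs.symm _))).mono
        ?_ fun _ h => ?_
      · simp only [St.cnt_setc, Polynomial.eval_add, Polynomial.eval_mul, Polynomial.eval_X,
          Polynomial.eval_ofNat, ← hv, ← hx, if_true, Nat.sub_zero]
        ring_nf
        omega
      · rw [h]
        refine St.ext_cnt (fun y => ?_) rfl rfl rfl rfl rfl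
        by_cases hx1 : y = j
        · subst hx1; simp [hjs, hv]
        · by_cases hx3 : y = s
          · subst hx3; simp [hjs.symm, hs]
          · simp [hx1, hx3]

end

end FiniteBSS
namespace FiniteBSS

/-! ### Evaluations of circuits -/

/-- `P` holds for every element of a list and its number, the first element having number `i`. -/
def Along {α : Type*} (P : ℕ → α → Prop) : ℕ → List α → Prop
  | _, [] => True
  | i, g :: gs => P i g ∧ Along P (i + 1) gs

section
variable {α β : Type*} {P : ℕ → α → Prop}

theorem along_append {l l' : List α} {i : ℕ} :
    Along P i (l ++ l') ↔ Along P i l ∧ Along P (i + l.length) l' := by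
  induction l generalizing i with
  | nil => simp [Along]
  | cons a l ih => simp [Along, ih, and_assoc, add_assoc, add_comm 1]

theorem along_iff {l : List α} {i : ℕ} :
    Along P i l ↔ ∀ t (h : t < l.length), P (i + t) l[t] := by
  induction l generalizing i with
  | nil => simp [Along]
  | cons a l ih =>
    rw [Along, ih]
    constructor
    · rintro ⟨h0, h⟩ (_ | t) ht
      · exact h0
      · have := h t (by simpa using ht)
        rwa [show i + 1 + t = i + (t + 1) by omega] at this
    · intro h
      refine ⟨h 0 (by simp), fun t ht => ?_⟩
      have := h (t + 1) (by simpa using ht)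
      rwa [show i + (t + 1) = i + 1 + t by omega] at this

theorem length_flatMap_const {l : List β} {f : β → List α} {c : ℕ}
    (hc : ∀ a ∈ l, (f a).length = c) : (l.flatMap f).length = l.length * c := by
  induction l with
  | nil => simp
  | cons b l ih =>
    rw [List.flatMap_cons, List.length_append, hc b (by simp), ih fun a ha => hc a (by simp [ha]),
      List.length_cons, add_mul, one_mul, add_comm]

/-- With blocks of constant length, the number of a gate is found by multiplication. This is why
templates below are padded to fixed sizes, even with idle gates. -/
theorem along_flatMap {l : List β} {f : β → List α} {c i : ℕ}
    (hc : ∀ a ∈ l, (f a).length = c) :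
    Along P i (l.flatMap f) ↔ ∀ t (h : t < l.length), Along P (i + t * c) (f l[t]) := by
  induction l generalizing i with
  | nil => simp [Along]
  | cons b l ih =>
    rw [List.flatMap_cons, along_append, hc b (by simp), ih fun a ha => hc a (by simp [ha])]
    constructor
    · rintro ⟨h0, h⟩ (_ | t) ht
      · simpa using h0
      · have := h t (by simpa using ht)
        rwa [show i + c + t * c = i + (t + 1) * c by ring] at this
    · intro h
      refine ⟨by have := h 0 (by simp); rwa [zero_mul, add_zero] at this, fun t ht => ?_⟩
      have := h (t + 1) (by simpa using ht)
      rwa [show i + (t + 1) * c = i + c + t * c by ring] at this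

theorem Along.imp {Q : ℕ → α → Prop} {l : List α} {i : ℕ} (h : Along P i l)
    (hPQ : ∀ t a, i ≤ t → t < i + l.length → a ∈ l → P t a → Q t a) : Along Q i l := by
  rw [along_iff] at h ⊢
  exact fun t ht => hPQ _ _ (by omega) (by omega) (List.getElem_mem ht) (h t ht)

end

/-- The value of node `i` agrees with the gate. -/
def Gate.Holds (R : ℝ → ℝ → Prop) (v : ℕ → ℝ) (i : ℕ) : Gate → Prop
  | arith op a b => R (op.apply (v a) (v b)) (v i)
  | select a b c => v i = if v a < 0 then v b else v c

/-- The parents of the gate are nodes of numbers less than `i`. -/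
def Gate.Below (i : ℕ) (g : Gate) : Prop := ∀ p ∈ g.parents, p < i

/-- A gate sees only its own node and earlier ones, so values assigned later do not matter. -/
theorem Gate.Holds.congr {R : ℝ → ℝ → Prop} {v v' : ℕ → ℝ} {i : ℕ} {g : Gate} (hg : g.Below i)
    (hv : ∀ j ≤ i, v j = v' j) (h : g.Holds R v i) : g.Holds R v' i := by
  cases g with
  | arith op a b =>
    simp only [Gate.Below, Gate.parents, List.mem_cons, forall_eq_or_imp] at hg
    simpa only [Gate.Holds, ← hv i le_rfl, ← hv a hg.1.le, ← hv b hg.2.1.le] using h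
  | select a b c =>
    simp only [Gate.Below, Gate.parents, List.mem_cons, forall_eq_or_imp] at hg
    simpa only [Gate.Holds, ← hv i le_rfl, ← hv a hg.1.le, ← hv b hg.2.1.le,
      ← hv c hg.2.2.1.le] using h

theorem exists_along_holds (gs : List Gate) : ∀ (i : ℕ) (v₀ : ℕ → ℝ),
    Along Gate.Below i gs → ∃ v, (∀ j < i, v j = v₀ j) ∧ Along (Gate.Holds Eq v) i gs := by
  induction gs with
  | nil => intro i v₀ _; exact ⟨v₀, fun _ _ => rfl, trivial⟩
  | cons g gs ih =>
    intro i v₀ ⟨hg, hgs⟩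
    obtain ⟨z, hz⟩ : ∃ z, g.Holds Eq (Function.update v₀ i z) i := by
      cases g with
      | arith op a b =>
        simp only [Gate.Below, Gate.parents, List.mem_cons, forall_eq_or_imp] at hg
        exact ⟨op.apply (v₀ a) (v₀ b), by
          simp [Gate.Holds, hg.1.ne, hg.2.1.ne]⟩
      | select a b c =>
        simp only [Gate.Below, Gate.parents, List.mem_cons, forall_eq_or_imp] at hg
        exact ⟨if v₀ a < 0 then v₀ b else v₀ c, by
          simp [Gate.Holds, hg.1.ne, hg.2.1.ne, hg.2.2.1.ne]⟩
    obtain ⟨v, hv, hh⟩ := ih (i + 1) (Function.update v₀ i z) hgs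
    refine ⟨v, fun j hj => ?_, hz.congr hg fun j hj => (hv j (by omega)).symm, hh⟩
    rw [hv j (by omega), Function.update_of_ne hj.ne]

/-- Exact values are determined one after the other along the topological order; this needs the
relation `Eq`. -/
theorem along_holds_unique {gs : List Gate} {v v' : ℕ → ℝ} : ∀ {i : ℕ},
    Along Gate.Below i gs → Along (Gate.Holds Eq v) i gs → Along (Gate.Holds Eq v') i gs →
      (∀ j < i, v j = v' j) → ∀ j < i + gs.length, v j = v' j := by
  induction gs with
  | nil => intro i _ _ _ h; simpa using h
  | cons g gs ih =>
    intro i hb h h' hv j hj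
    refine ih hb.2 h.2 h'.2 (fun j hj => ?_) j (by simp at hj; omega)
    rcases Nat.lt_succ_iff_lt_or_eq.1 hj with hj | rfl
    · exact hv j hj
    · have h1 := h.1
      have h2 := h'.1
      have hg := hb.1
      cases g with
      | arith op a b =>
        simp only [Gate.Below, Gate.parents, List.mem_cons, forall_eq_or_imp] at hg
        simp only [Gate.Holds, hv a hg.1, hv b hg.2.1] at h1 h2
        rw [← h1, ← h2]
      | select a b c =>
        simp only [Gate.Below, Gate.parents, List.mem_cons, forall_eq_or_imp] at hg
        simp only [Gate.Holds, hv a hg.1, hv b hg.2.1, hv c hg.2.2.1] at h1 h2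
        rw [h1, h2]

namespace Circuit

/-- The reals at the nodes of in-degree `0`. -/
def leaves (C : Circuit) (y : Fin C.numInputs → ℝ) : List ℝ := C.consts ++ List.ofFn y

theorem length_leaves (C : Circuit) (y : Fin C.numInputs → ℝ) :
    (C.leaves y).length = C.numLeaves := by simp [leaves, numLeaves]

theorem isEvaluation_iff {C : Circuit} {R : ℝ → ℝ → Prop} {y : Fin C.numInputs → ℝ}
    {v : ℕ → ℝ} : C.IsEvaluation R y v ↔
      Along (fun i x => R x (v i)) 0 (C.leaves y) ∧ Along (Gate.Holds R v) C.numLeaves C.gates := by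
  rw [leaves, along_append, along_iff, along_iff, along_iff, IsEvaluation, and_assoc]
  refine and_congr ?_ (and_congr ?_ ?_)
  · exact ⟨fun h t ht => by simpa using h ⟨t, ht⟩, fun h t => by simpa using h t t.2⟩
  · constructor
    · intro h t ht
      rw [List.length_ofFn] at ht
      simpa using h ⟨t, ht⟩
    · intro h t
      simpa using h t (by simp)
  · constructor
    · intro h t ht
      have := h ⟨t, ht⟩
      simp only [List.get_eq_getElem] at this
      cases hg : C.gates[t] <;> simpa only [hg, Gate.Holds] using this
    · intro h t
      have := h t t.2
      simp only [List.get_eq_getElem]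
      cases hg : C.gates[(t : ℕ)] <;> simpa only [hg, Gate.Holds] using this

theorem edge_lt_iff {C : Circuit} : (∀ i j, C.Edge i j → i < j) ↔
    Along Gate.Below C.numLeaves C.gates := by
  rw [along_iff]
  constructor
  · intro h t ht p hp
    exact h p _ ⟨⟨t, ht⟩, rfl, by simpa using hp⟩
  · rintro h i j ⟨t, rfl, hi⟩
    exact h t t.2 i (by simpa using hi)

theorem exists_isEvaluation {C : Circuit} (hC : Along Gate.Below C.numLeaves C.gates)
    (y : Fin C.numInputs → ℝ) : ∃ v, C.IsEvaluation Eq y v := by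
  obtain ⟨v, hv, h⟩ := exists_along_holds C.gates C.numLeaves (fun i => (C.leaves y).getD i 0) hC
  refine ⟨v, isEvaluation_iff.2 ⟨along_iff.2 fun t ht => ?_, h⟩⟩
  rw [zero_add, hv t (by rwa [length_leaves] at ht)]
  simp [ht]

theorem isEvaluation_unique {C : Circuit} (hC : Along Gate.Below C.numLeaves C.gates)
    {y : Fin C.numInputs → ℝ} {v v' : ℕ → ℝ} (h : C.IsEvaluation Eq y v)
    (h' : C.IsEvaluation Eq y v') : ∀ j < C.numNodes, v j = v' j := by
  rw [isEvaluation_iff] at h h'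
  refine along_holds_unique hC h.2 h'.2 fun j hj => ?_
  rw [← C.length_leaves y] at hj
  have h1 := along_iff.1 h.1 j hj
  have h2 := along_iff.1 h'.1 j hj
  rw [zero_add] at h1 h2
  rw [← h1, ← h2]

theorem mem_solutions_iff {C : Circuit} (hC : Along Gate.Below C.numLeaves C.gates)
    (hN : 0 < C.numNodes) {y : Fin C.numInputs → ℝ} {z : ℝ} (hz : C.Yields Eq y z) :
    y ∈ C.solutions ↔ 0 ≤ z := by
  obtain ⟨v, hv, rfl⟩ := hz
  constructor
  · rintro ⟨_, ⟨v', hv', rfl⟩, h⟩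
    rwa [isEvaluation_unique hC hv hv' _ (by omega)]
  · exact fun h => ⟨_, ⟨v, hv, rfl⟩, h⟩

end Circuit

/-- Gates that connect the node `0` to each of the first `n` nodes, and that copy their values. -/
def starGates (n : ℕ) : List Gate := (List.range n).map fun i => .select 0 i i

/-- The star gate `n + i` has the parents `0` and `i`. It links every earlier node to the node `0`,
and is itself adjacent to `0`. Thus connectedness is obtained without any knowledge about `gs`. -/
theorem valid_of_star {consts : List ℝ} {m n : ℕ} {gs : List Gate}
    (hn : n = consts.length + m + gs.length) (h0 : 0 < n)
    (hb : Along Gate.Below (consts.length + m) gs) :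
    (Circuit.mk consts m (gs ++ starGates n)).Valid := by
  set C := Circuit.mk consts m (gs ++ starGates n) with hC
  have hL : C.numLeaves = consts.length + m := rfl
  have hN : C.numNodes = n + n := by
    rw [Circuit.numNodes, hL]
    simp [hC, starGates, hn]
    omega
  refine ⟨Circuit.edge_lt_iff.2 ?_, ?_⟩
  · rw [hL, along_append, ← hn]
    refine ⟨hb, along_iff.2 fun t ht => ?_⟩
    simp only [starGates, List.length_map, List.length_range] at ht
    simp only [starGates, List.getElem_map, List.getElem_range, Gate.Below, Gate.parents,
      List.mem_cons, List.not_mem_nil, or_false]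
    rintro p (rfl | rfl | rfl) <;> omega
  · have edge : ∀ i < n, C.Edge i (n + i) ∧ C.Edge 0 (n + i) := by
      intro i hi
      have hlt : gs.length + i < C.gates.length := by simp [hC, starGates, hi]
      have : C.gates.get ⟨gs.length + i, hlt⟩ = .select 0 i i := by
        simp [hC, starGates]
      exact ⟨⟨⟨_, hlt⟩, by simp [hL, hn]; omega, by rw [this]; simp [Gate.parents]⟩,
        ⟨⟨_, hlt⟩, by simp [hL, hn]; omega, by rw [this]; simp [Gate.parents]⟩⟩
    have : NeZero C.numNodes := ⟨by omega⟩
    set G := SimpleGraph.fromRel fun i j : Fin C.numNodes => C.Edge i j with hG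
    have adj : ∀ i j : Fin C.numNodes, C.Edge i j → (i : ℕ) < j → G.Adj i j := fun i j h hij => by
      rw [hG, SimpleGraph.fromRel_adj]
      exact ⟨fun h => by rw [h] at hij; omega, Or.inl h⟩
    have r0 : ∀ i (hi : i < n), G.Reachable ⟨0, by omega⟩ ⟨n + i, by omega⟩ := fun i hi =>
      (adj ⟨0, by omega⟩ ⟨n + i, by omega⟩ (edge i hi).2 (by simp; omega)).reachable
    have r1 : ∀ i (hi : i < n), G.Reachable ⟨i, by omega⟩ ⟨n + i, by omega⟩ := fun i hi =>
      (adj ⟨i, by omega⟩ ⟨n + i, by omega⟩ (edge i hi).1 (by simp; omega)).reachable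
    refine SimpleGraph.connected_iff_exists_forall_reachable _ |>.2 ⟨⟨0, by omega⟩, fun j => ?_⟩
    by_cases hj : (j : ℕ) < n
    · exact (r0 j hj).trans (r1 j hj).symm
    · have := r0 (j - n) (by omega)
      convert this using 1
      ext
      simp only
      omega

/-- Both branches of a star gate coincide, so it copies without looking at the sign and without
error. The last one copies the output of the original gates. -/
theorem star_last {R : ℝ → ℝ → Prop} {v : ℕ → ℝ} {n : ℕ} (h0 : 0 < n)
    (h : Along (Gate.Holds R v) n (starGates n)) : v (n + n - 1) = v (n - 1) := by
  have := along_iff.1 h (n - 1) (by simp [starGates]; omega)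
  simp only [starGates, List.getElem_map, List.getElem_range, Gate.Holds, ite_self] at this
  rw [← this]
  congr 1
  omega

end FiniteBSS
namespace FiniteBSS

/-! ### Enumerations of finite types -/

noncomputable def enum (α : Type*) [Finite α] : List α := List.ofFn (Finite.equivFin α).symm

noncomputable def idx {α : Type*} [Finite α] (a : α) : ℕ := Finite.equivFin α a

section
variable {α β : Type*} [Finite α]

theorem length_enum : (enum α).length = Nat.card α := by simp [enum]

theorem idx_lt (a : α) : idx a < Nat.card α := (Finite.equivFin α a).2

theorem enum_idx (a : α) : (enum α)[idx a]'(length_enum (α := α) ▸ idx_lt a) = a := by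
  simp [enum, idx]

theorem idx_enum {t : ℕ} (h : t < (enum α).length) : idx (enum α)[t] = t := by
  simp [enum, idx]

theorem length_enum_flatMap {f : α → List β} {c : ℕ} (hc : ∀ a, (f a).length = c) :
    ((enum α).flatMap f).length = Nat.card α * c := by
  rw [length_flatMap_const (c := c) fun a _ => hc a, length_enum]

theorem along_enum {P : ℕ → β → Prop} {f : α → List β} {c i : ℕ} (hc : ∀ a, (f a).length = c) :
    Along P i ((enum α).flatMap f) ↔ ∀ a, Along P (i + idx a * c) (f a) := by
  rw [along_flatMap (c := c) fun a _ => hc a]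
  constructor
  · intro h a
    have := h (idx a) (length_enum (α := α) ▸ idx_lt a)
    rwa [enum_idx] at this
  · intro h t ht
    have := h (enum α)[t]
    rwa [idx_enum] at this

end

theorem along_map {α β : Type*} {P : ℕ → β → Prop} {f : α → β} {l : List α} {i : ℕ} :
    Along P i (l.map f) ↔ Along (fun i a => P i (f a)) i l := by
  induction l generalizing i with
  | nil => simp [Along]
  | cons a l ih => simp [Along, ih]

/-! ### Templates of gates -/

/-- The reference points for the numbers of the parents of a gate. -/
inductive Base : Type
  | zero | acts | center | head | left | block | input

abbrev Opd : Type := Base × ℕ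

def Opd.num (env : Base → ℕ) (o : Opd) : ℕ := env o.1 + o.2

inductive TGate : Type
  | arith (op : ArithOp) (a b : Opd)
  | select (a b c : Opd)

def TGate.inst (env : Base → ℕ) : TGate → Gate
  | arith op a b => .arith op (a.num env) (b.num env)
  | select a b c => .select (a.num env) (b.num env) (c.num env)

/-- The expressions that are computed by pairs of gates. -/
inductive Ex : Type
  | cp (o : Opd)
  | sel (a b c : Opd)
  | sel2 (a b a' b' c' : Opd)
  | ar (op : ArithOp) (a b : Opd)

namespace Ex

/-- The two gates of an expression, the first of which has the number `h` relative to the head. -/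
def gates (h : ℕ) : Ex → List TGate
  -- Every expression takes two gates, although only the nested selection needs both; positions then
  -- do not depend on the kind of the expression.
  | cp o => [.select o o o, .select o o o]
  | sel a b c => [.select a b c, .select a b c]
  | sel2 a b a' b' c' => [.select a' b' c', .select a b (.head, h)]
  -- The two gates are rounded independently. Only the value of the second one is used later.
  | ar op a b => [.arith op a b, .arith op a b]

def opds : Ex → List Opd
  | cp o => [o]
  | sel a b c => [a, b, c]
  | sel2 a b a' b' c' => [a, b, a', b', c']
  | ar _ a b => [a, b]

def Val (R : ℝ → ℝ → Prop) (x : Opd → ℝ) : Ex → ℝ → Prop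
  | cp o, z => z = x o
  | sel a b c, z => z = if x a < 0 then x b else x c
  | sel2 a b a' b' c', z => z = if x a < 0 then x b else if x a' < 0 then x b' else x c'
  | ar op a b, z => R (op.apply (x a) (x b)) z

theorem length_gates (h : ℕ) (e : Ex) : (e.gates h).length = 2 := by cases e <;> rfl

theorem val_of_along {R : ℝ → ℝ → Prop} {v : ℕ → ℝ} {env : Base → ℕ} {h i : ℕ} {e : Ex}
    (hi : i = env .head + h)
    (hA : Along (fun i t => (TGate.inst env t).Holds R v i) i (e.gates h)) :
    e.Val R (fun o => v (o.num env)) (v (i + 1)) := by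
  cases e with
  | cp o => simpa [gates, Along, TGate.inst, Gate.Holds, Val] using hA.2.1
  | sel a b c => simpa [gates, Along, TGate.inst, Gate.Holds, Val] using hA.2.1
  | sel2 a b a' b' c' =>
    obtain ⟨h1, h2, -⟩ := hA
    simp only [TGate.inst, Gate.Holds] at h1 h2
    rw [show Opd.num env (Base.head, h) = i from hi.symm, h1] at h2
    exact h2
  | ar op a b => simpa [gates, Along, TGate.inst, Gate.Holds, Val] using hA.2.1

theorem below_of_opds {env : Base → ℕ} {h i : ℕ} {e : Ex} (hi : i = env .head + h)
    (ho : ∀ o ∈ e.opds, o.num env < i) :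
    Along (fun i t => (TGate.inst env t).Below i) i (e.gates h) := by
  cases e <;> simp only [opds, List.mem_cons, List.not_mem_nil, or_false, forall_eq_or_imp,
    forall_eq] at ho <;>
    simp only [gates, Along, TGate.inst, Gate.Below, Gate.parents, List.mem_cons,
      List.not_mem_nil, or_false, forall_eq_or_imp, forall_eq] <;>
    refine ⟨?_, ?_, trivial⟩ <;> simp only [Opd.num] at * <;> omega

end Ex

/-! ### The circuit that simulates a machine -/

/-- The parts of a configuration that are stored cell by cell: for each discrete tape, whether its
symbol is a given bit, and the real tapes. -/
abbrev Track (d r : ℕ) : Type := (Fin (d + 2) × Bool) ⊕ Fin (r + 1)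

/-- The move of the tape of a track. -/
def Node.dir {L : Type} {d r : ℕ} : Node L d r → Track d r → Option Turing.Dir
  | .moveBit i dir _, .inl (i', _) => if i = i' then some dir else none
  | .moveReal i dir _, .inr i' => if i = i' then some dir else none
  | _, _ => none

-- Truth is represented by a negative value. The nodes `0` and `1` hold the constants `1` and `-1`,
-- whose signs survive rounding.
open Classical in
noncomputable def boolOpd (p : Prop) : Opd := if p then (.zero, 1) else (.zero, 0)

def copyGate (o : Opd) : TGate := .select o o o

namespace Sim

variable (M : Machine)

instance : Finite M.Label := M.finite_label

instance : Nonempty M.Label := ⟨M.start⟩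

abbrev Tr : Type := Track M.bitTapes M.realTapes

/-- What has to be computed about the head positions in one step: which label comes next, whether
a tape is moved to the left (`0`) or to the right (`1`), and what is written on it (`2`). -/
abbrev Target : Type := M.Label ⊕ (Tr M × Fin 3)

noncomputable abbrev nL : ℕ := Nat.card M.Label
noncomputable abbrev nQ : ℕ := Nat.card (Tr M)
noncomputable abbrev nT : ℕ := Nat.card (Target M)

/-- The size of the head of a layer. -/
noncomputable def headSize : ℕ := nT M * (3 * nL M) + 2 * nQ M

variable {M}

/-- Position of the last gate in the chain of the target, which carries the result of the chain. -/
noncomputable def off (τ : Target M) : ℕ := idx τ * (3 * nL M) + (3 * nL M - 1)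

/-- A track has two gates in each cell; the second one holds the final content, hence the odd
offset. -/
noncomputable def ctr (tr : Tr M) : Opd := (.center, 2 * idx tr + 1)

-- Reading a symbol takes a nested selection, as a discrete tape is stored as two sign tracks, one
-- for each bit, and a blank is the absence of both. A halting label is its own successor, so that a
-- halted configuration is repeated until the last layer.
open Classical in
noncomputable def actEx (l l' : M.Label) : Ex :=
  match M.node l with
  | .readBit i next => .sel2 (ctr (.inl (i, true))) (boolOpd (next (some true) = l'))
      (ctr (.inl (i, false))) (boolOpd (next (some false) = l')) (boolOpd (next none = l'))
  | .branch i a b => .sel (ctr (.inr i)) (boolOpd (a = l')) (boolOpd (b = l'))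
  | .halt _ => .cp (boolOpd (l = l'))
  | .writeBit _ _ n => .cp (boolOpd (n = l'))
  | .moveBit _ _ n => .cp (boolOpd (n = l'))
  | .moveReal _ _ n => .cp (boolOpd (n = l'))
  | .copy _ _ n => .cp (boolOpd (n = l'))
  | .const _ _ n => .cp (boolOpd (n = l'))
  | .arith _ _ _ _ n => .cp (boolOpd (n = l'))

/-- The offset `3 + idx l` is the node of the built-in constant of the label `l`, behind the three
constants `1`, `-1`, `0`. -/
noncomputable def writeEx (l : M.Label) (tr : Tr M) : Ex :=
  match M.node l, tr with
  | .writeBit i a _, .inl (i', b) =>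
      if i = i' then .cp (boolOpd (a = some b)) else .cp (ctr (.inl (i', b)))
  | .copy i j _, .inr i' => if i = i' then .cp (ctr (.inr j)) else .cp (ctr (.inr i'))
  | .const i _ _, .inr i' => if i = i' then .cp (.zero, 3 + idx l) else .cp (ctr (.inr i'))
  | .arith op i j k _, .inr i' =>
      if i = i' then .ar op (ctr (.inr j)) (ctr (.inr k)) else .cp (ctr (.inr i'))
  | _, tr => .cp (ctr tr)

noncomputable def ex (τ : Target M) (l : M.Label) : Ex :=
  match τ with
  | .inl l' => actEx l l'
  | .inr (tr, 0) => .cp (boolOpd ((M.node l).dir tr = some .left))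
  | .inr (tr, 1) => .cp (boolOpd ((M.node l).dir tr = some .right))
  | .inr (tr, 2) => writeEx l tr

noncomputable def act (l : M.Label) : Opd := (.acts, off (.inl l))

/-- The expression is computed for every label, active or not. The third gate passes it on if `l` is
active and otherwise hands on the result for the preceding label; the chain starts with an
irrelevant value. -/
noncomputable def chainStep (τ : Target M) (l : M.Label) : List TGate :=
  let s := idx τ * (3 * nL M) + idx l * 3
  (ex τ l).gates s ++
    [.select (act l) (.head, s + 1) (if idx l = 0 then (.zero, 0) else (.head, s - 1))]

-- The idle gates at the end give the cell number `0` of the next layer something to refer to as its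
-- left neighbour.
variable (M) in
noncomputable def headT : List TGate :=
  (enum (Target M)).flatMap (fun τ => (enum M.Label).flatMap (chainStep τ)) ++
    List.replicate (2 * nQ M) (copyGate (.zero, 0))

/-- The gates of a cell; `mid` is the value after the writing. -/
noncomputable def cellT (mid : Tr M → Opd) : List TGate :=
  (enum (Tr M)).flatMap fun tr =>
    -- The reference point `left` is the cell to the left in the preceding layer. One block further
    -- is the cell itself, two blocks further its right neighbour. A move of the head to the right
    -- shifts the content to the left, hence the right neighbour is taken for the flag `1`, and the
    -- left neighbour for the flag `0`.
    [.select (.head, off (.inr (tr, 1))) (.left, 4 * nQ M + (2 * idx tr + 1)) (mid tr),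
      .select (.head, off (.inr (tr, 0))) (.left, 2 * idx tr + 1) (.block, 2 * idx tr)]

variable (M) in
noncomputable def sideT : List TGate :=
  cellT fun tr : Tr M => (.left, 2 * nQ M + (2 * idx tr + 1))

variable (M) in
noncomputable def centerT : List TGate := cellT fun tr : Tr M => (.head, off (.inr (tr, 2)))

theorem length_chainStep (τ : Target M) (l : M.Label) : (chainStep τ l).length = 3 := by
  simp [chainStep, Ex.length_gates]

theorem length_chain (τ : Target M) :
    ((enum M.Label).flatMap (chainStep τ)).length = 3 * nL M := by
  rw [length_enum_flatMap (length_chainStep τ), mul_comm]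

theorem length_headT : (headT M).length = headSize M := by
  rw [headT, List.length_append, length_enum_flatMap length_chain, List.length_replicate, headSize]

theorem length_cellT (mid : Tr M → Opd) : (cellT mid).length = 2 * nQ M := by
  rw [cellT, length_enum_flatMap (c := 2) (fun _ => rfl), mul_comm]

theorem nL_pos : 0 < nL M := Nat.card_pos

theorem off_lt (τ : Target M) : off τ < nT M * (3 * nL M) := by
  have h1 := idx_lt τ
  have h2 := nL_pos (M := M)
  have : (idx τ + 1) * (3 * nL M) ≤ nT M * (3 * nL M) := Nat.mul_le_mul_right _ h1
  rw [add_mul] at this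
  rw [off]
  omega

open Classical in
/-- The result of a chain of selections is the value of the expression of the active label. -/
theorem chain_val {R : ℝ → ℝ → Prop} {v : ℕ → ℝ} {env : Base → ℕ} {τ : Target M} {l₀ : M.Label}
    (hact : ∀ l, v ((act l).num env) < 0 ↔ l₀ = l)
    (h : Along (fun i t => (TGate.inst env t).Holds R v i) (env .head + idx τ * (3 * nL M))
      ((enum M.Label).flatMap (chainStep τ))) :
    (ex τ l₀).Val R (fun o => v (o.num env)) (v (env .head + off τ)) := by
  rw [along_enum (length_chainStep τ)] at h
  set b := env .head + idx τ * (3 * nL M) with hb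
  have hsel : ∀ l : M.Label, v (b + idx l * 3 + 2) =
      if l₀ = l then v (b + idx l * 3 + 1) else
        if idx l = 0 then v (Opd.num env (.zero, 0)) else v (b + idx l * 3 - 1) := by
    intro l
    have := h l
    rw [chainStep, along_append, Ex.length_gates] at this
    have := this.2.1
    simp only [TGate.inst, Gate.Holds, hact] at this
    rw [this, show Opd.num env (Base.head, idx τ * (3 * nL M) + idx l * 3 + 1) =
      b + idx l * 3 + 1 by simp only [Opd.num]; omega]
    by_cases h0 : idx l = 0
    · simp only [if_pos h0]
    · simp only [if_neg h0]
      rw [show Opd.num env (Base.head, idx τ * (3 * nL M) + idx l * 3 - 1) =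
        b + idx l * 3 - 1 by simp only [Opd.num]; omega]
  -- From the active label on, all selections hand on its value, since no later label is active.
  have key : ∀ p, idx l₀ ≤ p → p < nL M → v (b + p * 3 + 2) = v (b + idx l₀ * 3 + 1) := by
    intro p hp
    induction p, hp using Nat.le_induction with
    | base => intro _; rw [hsel l₀, if_pos rfl]
    | succ p hp ih =>
      intro hlt
      have hp' : p + 1 < (enum M.Label).length := by rwa [length_enum]
      have := hsel (enum M.Label)[p + 1]
      rw [idx_enum] at this
      rw [this, if_neg, if_neg (by omega), ← ih (by omega)]
      · congr 1; omega
      · intro h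
        have := idx_enum hp'
        rw [← h] at this
        omega
  have h0 := h l₀
  rw [chainStep, along_append] at h0
  have := Ex.val_of_along (by omega) h0.1
  have hpos := nL_pos (M := M)
  have hlt : idx l₀ < nL M := idx_lt l₀
  rwa [← key (nL M - 1) (by omega) (by omega),
    show b + (nL M - 1) * 3 + 2 = env .head + off τ by rw [off, hb]; omega] at this

/-- The value `z` represents the cell at the relative position `j` of a track. -/
def TrackOK (c : M.Config) (j : ℤ) (z : ℝ) : Tr M → Prop
  | .inl (i, b) => z < 0 ↔ (c.bits i).nth j = some b
  | .inr i => z = (c.reals i).nth j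

/-- What the step from `c` to `c'` does to a track. -/
def Moves (c c' : M.Config) (tr : Tr M) (z : ℝ) : Option Turing.Dir → Prop
  | none => (∀ j z, j ≠ 0 → TrackOK c j z tr → TrackOK c' j z tr) ∧ TrackOK c' 0 z tr
  | some d => ∀ j z, TrackOK c (j + dirStep d) z tr → TrackOK c' j z tr

theorem moves_of_eq {c c' : M.Config} (tr : Tr M) {z : ℝ} (h : TrackOK c 0 z tr)
    (hb : c'.bits = c.bits) (hr : c'.reals = c.reals) : Moves c c' tr z none := by
  have : ∀ j z, TrackOK c j z tr → TrackOK c' j z tr := by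
    intro j z h
    rcases tr with ⟨i, b⟩ | i
    · simpa only [TrackOK, hb] using h
    · simpa only [TrackOK, hr] using h
  exact ⟨fun j z _ => this j z, this 0 z h⟩

/-- The step is read off from the evaluation: the values at the gates for the active label are the
nondeterministic choices of the machine at constants and arithmetic nodes. Tests and moves involve
only selections, so they add no error. -/
theorem step_exists {R : ℝ → ℝ → Prop} {c : M.Config} {x : Opd → ℝ} {va : M.Label → ℝ}
    {vw : Tr M → ℝ} (hb : ∀ p, x (boolOpd p) < 0 ↔ p)
    (hk : ∀ l i a n, M.node l = .const i a n → R a (x (.zero, 3 + idx l)))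
    (hc : ∀ tr, TrackOK c 0 (x (ctr tr)) tr)
    (ha : ∀ l, (actEx c.label l).Val R x (va l))
    (hw : ∀ tr, (writeEx c.label tr).Val R x (vw tr)) :
    ∃ c', (M.Step R c c' ∨ ((∃ b, M.node c.label = .halt b) ∧ c' = c)) ∧
      (∀ l, va l < 0 ↔ c'.label = l) ∧
      ∀ tr, Moves c c' tr (vw tr) ((M.node c.label).dir tr) := by
  cases hn : M.node c.label with
  | readBit i next =>
    simp only [actEx, writeEx, hn, Ex.Val] at ha hw
    refine ⟨{ c with label := next (c.bits i).head }, .inl (by simp only [Machine.Step, hn]), ?_,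
      fun tr => moves_of_eq tr (by rw [hw]; exact hc tr) rfl rfl⟩
    intro l
    have h1 := hc (.inl (i, true))
    have h2 := hc (.inl (i, false))
    simp only [TrackOK, Turing.Tape.nth_zero] at h1 h2
    simp only [ha, h1, h2]
    rcases (c.bits i).head with _ | _ | _ <;> simp [hb]
  | writeBit i a n =>
    simp only [actEx, writeEx, hn, Ex.Val] at ha hw
    refine ⟨{ c with label := n, bits := Function.update c.bits i ((c.bits i).write a) },
      .inl (by simp only [Machine.Step, hn]), by simpa [ha] using fun l => hb _, ?_⟩
    rintro (⟨i', b⟩ | i')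
    · have := hw (.inl (i', b))
      by_cases h : i = i'
      · subst h
        simp only [if_true] at this
        refine ⟨fun j z hj hz => ?_, ?_⟩
        · simpa only [TrackOK, Function.update_self, Turing.Tape.write_nth, if_neg hj] using hz
        · simp only [TrackOK, Function.update_self, Turing.Tape.write_nth, if_true, this, hb]
      · simp only [if_neg h] at this
        refine ⟨fun j z hj hz => ?_, ?_⟩
        · simpa only [TrackOK, Function.update_of_ne (Ne.symm h)] using hz
        · have h0 := hc (.inl (i', b))
          rw [this]
          simpa only [TrackOK, Function.update_of_ne (Ne.symm h)] using h0
    · exact ⟨fun j z hj hz => hz, by rw [hw (.inr i')]; exact hc (.inr i')⟩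
  | moveBit i d n =>
    simp only [actEx, writeEx, hn, Ex.Val] at ha hw
    refine ⟨{ c with label := n, bits := Function.update c.bits i ((c.bits i).move d) },
      .inl (by simp only [Machine.Step, hn]), by simpa [ha] using fun l => hb _, ?_⟩
    rintro (⟨i', b⟩ | i')
    · by_cases h : i = i'
      · subst h
        simp only [Node.dir, if_true]
        intro j z hz
        simpa only [TrackOK, Function.update_self, nth_move] using hz
      · simp only [Node.dir, if_neg h]
        refine ⟨fun j z hj hz => ?_, ?_⟩
        · simpa only [TrackOK, Function.update_of_ne (Ne.symm h)] using hz
        · have h0 := hc (.inl (i', b))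
          rw [hw (.inl (i', b))]
          simpa only [TrackOK, Function.update_of_ne (Ne.symm h)] using h0
    · exact ⟨fun j z hj hz => hz, by rw [hw (.inr i')]; exact hc (.inr i')⟩
  | moveReal i d n =>
    simp only [actEx, writeEx, hn, Ex.Val] at ha hw
    refine ⟨{ c with label := n, reals := Function.update c.reals i ((c.reals i).move d) },
      .inl (by simp only [Machine.Step, hn]), by simpa [ha] using fun l => hb _, ?_⟩
    rintro (⟨i', b⟩ | i')
    · exact ⟨fun j z hj hz => hz, by rw [hw (.inl (i', b))]; exact hc (.inl (i', b))⟩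
    · by_cases h : i = i'
      · subst h
        simp only [Node.dir, if_true]
        intro j z hz
        simpa only [TrackOK, Function.update_self, nth_move] using hz
      · simp only [Node.dir, if_neg h]
        refine ⟨fun j z hj hz => ?_, ?_⟩
        · simpa only [TrackOK, Function.update_of_ne (Ne.symm h)] using hz
        · have h0 := hc (.inr i')
          rw [hw (.inr i')]
          simpa only [TrackOK, Function.update_of_ne (Ne.symm h)] using h0
  | branch i a b =>
    simp only [actEx, writeEx, hn, Ex.Val] at ha hw
    refine ⟨{ c with label := if (c.reals i).head < 0 then a else b },
      .inl (by simp only [Machine.Step, hn]), ?_,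
      fun tr => moves_of_eq tr (by rw [hw]; exact hc tr) rfl rfl⟩
    intro l
    have h1 := hc (.inr i)
    simp only [TrackOK, Turing.Tape.nth_zero] at h1
    simp only [ha, h1]
    split_ifs <;> simp [hb]
  | halt b =>
    simp only [actEx, writeEx, hn, Ex.Val] at ha hw
    exact ⟨c, .inr ⟨⟨b, rfl⟩, rfl⟩, by simpa [ha] using fun l => hb _,
      fun tr => moves_of_eq tr (by rw [hw]; exact hc tr) rfl rfl⟩
  | copy i k n =>
    simp only [actEx, writeEx, hn, Ex.Val] at ha hw
    refine ⟨{ c with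
        label := n, reals := Function.update c.reals i ((c.reals i).write (c.reals k).head) },
      .inl (by simp only [Machine.Step, hn]), by simpa [ha] using fun l => hb _, ?_⟩
    rintro (⟨i', b⟩ | i')
    · exact ⟨fun j z hj hz => hz, by rw [hw (.inl (i', b))]; exact hc (.inl (i', b))⟩
    · have := hw (.inr i')
      by_cases h : i = i'
      · subst h
        simp only [if_true] at this
        refine ⟨fun j z hj hz => ?_, ?_⟩
        · simpa only [TrackOK, Function.update_self, Turing.Tape.write_nth, if_neg hj] using hz
        · have h0 := hc (.inr k)
          simp only [TrackOK, Turing.Tape.nth_zero] at h0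
          simp only [TrackOK, Function.update_self, Turing.Tape.write_nth, if_true, this, h0]
      · simp only [if_neg h] at this
        refine ⟨fun j z hj hz => ?_, ?_⟩
        · simpa only [TrackOK, Function.update_of_ne (Ne.symm h)] using hz
        · have h0 := hc (.inr i')
          rw [this]
          simpa only [TrackOK, Function.update_of_ne (Ne.symm h)] using h0
  | const i a n =>
    have hk' := hk _ _ _ _ hn
    simp only [actEx, writeEx, hn, Ex.Val] at ha hw
    refine ⟨{ c with label := n, reals := Function.update c.reals i ((c.reals i).write _) },
      .inl (by simp only [Machine.Step, hn]; exact ⟨_, hk', rfl⟩),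
      by simpa [ha] using fun l => hb _, ?_⟩
    rintro (⟨i', b⟩ | i')
    · exact ⟨fun j z hj hz => hz, by rw [hw (.inl (i', b))]; exact hc (.inl (i', b))⟩
    · have := hw (.inr i')
      by_cases h : i = i'
      · subst h
        simp only [if_true] at this
        refine ⟨fun j z hj hz => ?_, ?_⟩
        · simpa only [TrackOK, Function.update_self, Turing.Tape.write_nth, if_neg hj] using hz
        · simp only [TrackOK, Function.update_self, Turing.Tape.write_nth, if_true, this]
      · simp only [if_neg h] at this
        refine ⟨fun j z hj hz => ?_, ?_⟩
        · simpa only [TrackOK, Function.update_of_ne (Ne.symm h)] using hz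
        · have h0 := hc (.inr i')
          rw [this]
          simpa only [TrackOK, Function.update_of_ne (Ne.symm h)] using h0
  | arith op i j k n =>
    have h1 := hc (.inr j)
    have h2 := hc (.inr k)
    have hi := hw (.inr i)
    simp only [actEx, writeEx, hn, Ex.Val] at ha hw hi
    simp only [TrackOK, Turing.Tape.nth_zero] at h1 h2
    simp only [if_true, h1, h2] at hi
    refine ⟨{ c with label := n, reals := Function.update c.reals i ((c.reals i).write _) },
      .inl (by simp only [Machine.Step, hn]; exact ⟨_, hi, rfl⟩),
      by simpa [ha] using fun l => hb _, ?_⟩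
    rintro (⟨i', b⟩ | i')
    · exact ⟨fun j z hj hz => hz, by rw [hw (.inl (i', b))]; exact hc (.inl (i', b))⟩
    · by_cases h : i = i'
      · subst h
        refine ⟨fun j z hj hz => ?_, ?_⟩
        · simpa only [TrackOK, Function.update_self, Turing.Tape.write_nth, if_neg hj] using hz
        · simp only [TrackOK, Function.update_self, Turing.Tape.write_nth, if_true]
      · have := hw (.inr i')
        simp only [if_neg h] at this
        refine ⟨fun j z hj hz => ?_, ?_⟩
        · simpa only [TrackOK, Function.update_of_ne (Ne.symm h)] using hz
        · have h0 := hc (.inr i')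
          rw [this]
          simpa only [TrackOK, Function.update_of_ne (Ne.symm h)] using h0

end Sim

end FiniteBSS
namespace FiniteBSS
namespace Sim

variable {M : Machine}

/-! ### Layers of the circuit and the simulation of one step -/

/-- The reference points for the cell number `i` of the layer that starts at the node `b`, the
preceding layer starting at the node `b'`. -/
noncomputable def layerEnv (M : Machine) (K inp b' b i : ℕ) : Base → ℕ
  | .zero => 0
  | .acts => b'
  | .center => b' + headSize M + K * (2 * nQ M)
  | .head => b
  | .left => b' + headSize M + i * (2 * nQ M) - 2 * nQ M
  | .block => b + headSize M + i * (2 * nQ M)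
  | .input => inp

noncomputable def layer (M : Machine) (K inp b' b : ℕ) : List Gate :=
  (headT M).map (TGate.inst (layerEnv M K inp b' b 0)) ++
    (List.range (2 * K + 1)).flatMap fun i =>
      (if i = K then centerT M else sideT M).map (TGate.inst (layerEnv M K inp b' b i))

noncomputable def layerSize (M : Machine) (K : ℕ) : ℕ := headSize M + (2 * K + 1) * (2 * nQ M)

theorem length_cells {K i : ℕ} :
    (if i = K then centerT M else sideT M).length = 2 * nQ M := by
  split_ifs
  · exact length_cellT _
  · exact length_cellT _

theorem length_layer (K inp b' b : ℕ) : (layer M K inp b' b).length = layerSize M K := by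
  rw [layer, List.length_append, List.length_map, length_headT,
    length_flatMap_const (c := 2 * nQ M) (fun i _ => by rw [List.length_map, length_cells]),
    List.length_range, layerSize]

/-- The layer that starts at the node `b` represents the configuration `c`, at a distance of at
most `r` from the heads. -/
structure LayerOK (v : ℕ → ℝ) (K b : ℕ) (c : M.Config) (r : ℕ) : Prop where
  acts : ∀ l : M.Label, v (b + off (.inl l)) < 0 ↔ c.label = l
  cells : ∀ (i : ℕ) (tr : Tr M), i ≤ K + r → K ≤ i + r →
    TrackOK c ((i : ℤ) - K) (v (b + headSize M + i * (2 * nQ M) + (2 * idx tr + 1))) tr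

/-- The values of the constants of the circuit. -/
structure ConstsOK (M : Machine) (R : ℝ → ℝ → Prop) (v : ℕ → ℝ) : Prop where
  zero : 0 ≤ v 0
  one : v 1 < 0
  two : v 2 = 0
  const : ∀ (l : M.Label) i a n, M.node l = .const i a n → R a (v (3 + idx l))

theorem ConstsOK.boolOpd {R : ℝ → ℝ → Prop} {v : ℕ → ℝ} (h : ConstsOK M R v) {env : Base → ℕ}
    (he : env .zero = 0) (p : Prop) : v ((boolOpd p).num env) < 0 ↔ p := by
  by_cases hp : p
  · simp [FiniteBSS.boolOpd, hp, Opd.num, he, h.one]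
  · simp [FiniteBSS.boolOpd, hp, Opd.num, he, h.zero]

theorem two_nQ_le : 2 * nQ M ≤ headSize M := by rw [headSize]; omega

/-- A step shifts the content of a tape by at most one cell. The cells that represent the
configuration faithfully therefore lose one cell at either end in each layer, and whatever stands at
the margins is irrelevant. -/
theorem layer_step {R : ℝ → ℝ → Prop} {v : ℕ → ℝ} {K inp b' b r : ℕ} {c : M.Config}
    (hv : ConstsOK M R v) (hr : r + 1 ≤ K) (hc : LayerOK v K b' c (r + 1))
    (h : Along (Gate.Holds R v) b (layer M K inp b' b)) :
    ∃ c', (M.Step R c c' ∨ ((∃ b, M.node c.label = .halt b) ∧ c' = c)) ∧ LayerOK v K b c' r := by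
  rw [layer, along_append, along_map, headT, along_append,
    along_enum length_chain, List.length_map, ← headT, length_headT,
    along_flatMap (c := 2 * nQ M) (fun i _ => by rw [List.length_map, length_cells])] at h
  obtain ⟨⟨hH, -⟩, hC⟩ := h
  have hex : ∀ τ : Target M, (ex τ c.label).Val R
      (fun o => v (o.num (layerEnv M K inp b' b 0))) (v (b + off τ)) := fun τ =>
    chain_val (env := layerEnv M K inp b' b 0) (fun l => hc.acts l) (hH τ)
  have hmv : ∀ tr (d : Turing.Dir) (k : Fin 3), ex (.inr (tr, k)) c.label =
      .cp (boolOpd ((M.node c.label).dir tr = some d)) →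
      (v (b + off (.inr (tr, k))) < 0 ↔ (M.node c.label).dir tr = some d) := by
    intro tr d k hk
    have := hex (.inr (tr, k))
    rw [hk] at this
    simp only [Ex.Val] at this
    rw [this, hv.boolOpd rfl]
  obtain ⟨c', hs, ha, hm⟩ := step_exists (R := R) (c := c)
    (x := fun o => v (o.num (layerEnv M K inp b' b 0)))
    (va := fun l => v (b + off (.inl l))) (vw := fun tr => v (b + off (.inr (tr, 2))))
    (fun p => hv.boolOpd rfl p)
    (fun l i a n hn => by
      have := hv.const l i a n hn
      simpa only [Opd.num, layerEnv, zero_add] using this)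
    (fun tr => by
      have := hc.cells K tr (by omega) (by omega)
      rw [sub_self] at this
      exact this)
    (fun l => hex (.inl l)) (fun tr => hex (.inr (tr, 2)))
  refine ⟨c', hs, ha, fun i tr hi1 hi2 => ?_⟩
  have hi := hC i (by rw [List.length_range]; omega)
  rw [List.getElem_range, along_map] at hi
  have hmR := hmv tr .right 1 rfl
  have hmL := hmv tr .left 0 rfl
  have hm := hm tr
  have hq := two_nQ_le (M := M)
  -- The central cell and the other cells differ only in the value that is kept when the tape does
  -- not move: what has been written, or the old content.
  have hcells : ∃ mid : Opd, (i = K → mid = (.head, off (.inr (tr, 2)))) ∧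
      (i ≠ K → mid = (.left, 2 * nQ M + (2 * idx tr + 1))) ∧
      Along (fun i t => (TGate.inst (layerEnv M K inp b' b i) t).Holds R v i)
        (b + headSize M + i * (2 * nQ M) + idx tr * 2) [] ∧
      Along (fun j t => (TGate.inst (layerEnv M K inp b' b i) t).Holds R v j)
        (b + headSize M + i * (2 * nQ M) + idx tr * 2)
        [.select (.head, off (.inr (tr, 1))) (.left, 4 * nQ M + (2 * idx tr + 1)) mid,
          .select (.head, off (.inr (tr, 0))) (.left, 2 * idx tr + 1) (.block, 2 * idx tr)] := by
    split_ifs at hi with hK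
    · rw [centerT, cellT, along_enum (c := 2) (fun _ => rfl)] at hi
      exact ⟨_, fun _ => rfl, fun h => absurd hK h, trivial, hi tr⟩
    · rw [sideT, cellT, along_enum (c := 2) (fun _ => rfl)] at hi
      exact ⟨_, fun h => absurd h hK, fun _ => rfl, trivial, hi tr⟩
  obtain ⟨mid, hmid1, hmid2, -, h1, h2, -⟩ := hcells
  simp only [TGate.inst, Gate.Holds, Opd.num, layerEnv] at h1 h2
  set q := 2 * nQ M with hqdef
  have e1 : b' + headSize M + i * q - q + (4 * nQ M + (2 * idx tr + 1)) =
      b' + headSize M + (i + 1) * q + (2 * idx tr + 1) := by rw [add_mul]; omega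
  have e2 : b + headSize M + i * q + 2 * idx tr = b + headSize M + i * q + idx tr * 2 := by omega
  simp only [hmR, e1] at h1
  simp only [hmL, e2, h1] at h2
  rw [show b + headSize M + i * q + (2 * idx tr + 1) =
    b + headSize M + i * q + idx tr * 2 + 1 by omega, h2]
  cases hd : (M.node c.label).dir tr with
  | none =>
    rw [hd] at hm
    simp only [reduceCtorEq, if_false]
    by_cases hK : i = K
    · rw [hmid1 hK, hK, sub_self]
      exact hm.2
    · rw [hmid2 hK]
      refine hm.1 _ _ (by omega) ?_
      have := hc.cells i tr (by omega) (by omega)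
      rwa [← hqdef, show b' + headSize M + i * q + (2 * idx tr + 1) =
        b' + headSize M + i * q - q + (q + (2 * idx tr + 1)) by omega] at this
  | some d =>
    rw [hd] at hm
    cases d with
    | left =>
      simp only [if_true]
      refine hm _ _ ?_
      have := hc.cells (i - 1) tr (by omega) (by omega)
      rw [← hqdef, show b' + headSize M + (i - 1) * q + (2 * idx tr + 1) =
        b' + headSize M + i * q - q + (2 * idx tr + 1) by
          obtain ⟨i, rfl⟩ : ∃ i', i = i' + 1 := ⟨i - 1, by omega⟩
          rw [add_mul]; simp only [Nat.add_sub_cancel]; omega] at this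
      convert this using 1
      simp only [dirStep]
      omega
    | right =>
      simp only [Option.some.injEq, reduceCtorEq, if_false, if_true]
      refine hm _ _ ?_
      have := hc.cells (i + 1) tr (by omega) (by omega)
      convert this using 1
      simp only [dirStep]
      push_cast
      ring

/-! ### The initial layer -/

/-- All other reference points are `0`, as are the registers of the printing program at that time.
The truncated difference is harmless: cells left of the centre never refer to the input. -/
noncomputable def initEnv (M : Machine) (K i : ℕ) : Base → ℕ
  | .input => 3 + nL M + (i - K)
  | _ => 0

/-- The head has the same size as in the other layers, and the last gate of each block carries the
initial indicator, where the next layer looks for it. -/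
noncomputable def initHeadT (M : Machine) : List TGate :=
  (enum (Target M)).flatMap (fun τ =>
    List.replicate (3 * nL M) (copyGate (boolOpd (τ = .inl M.start)))) ++
    List.replicate (2 * nQ M) (copyGate (.zero, 0))

noncomputable def initOpd (s : Option Bool) (inx : Bool) : Tr M → Opd
  | .inl (i, b) => if i = 0 then boolOpd (s = some b) else
      if i = 1 then boolOpd (inx = true ∧ b = true) else boolOpd False
  | .inr i => if i = 0 ∧ inx = true then (.input, 0) else (.zero, 2)

noncomputable def initCellT (M : Machine) (s : Option Bool) (inx : Bool) : List TGate :=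
  (enum (Tr M)).flatMap fun tr => [copyGate (initOpd s inx tr), copyGate (initOpd s inx tr)]

/-- The gates of the cell number `i` of the initial layer, for the bits `u` and `nx` reals. -/
noncomputable def initCell (M : Machine) (K : ℕ) (u : List Bool) (nx i : ℕ) : List Gate :=
  (initCellT M (if i < K then none else u[i - K]?) (decide (K ≤ i ∧ i - K < nx))).map
    (TGate.inst (initEnv M K i))

noncomputable def initLayer (M : Machine) (K : ℕ) (u : List Bool) (nx : ℕ) : List Gate :=
  (initHeadT M).map (TGate.inst (initEnv M K 0)) ++
    (List.range (2 * K + 1)).flatMap (initCell M K u nx)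

theorem length_initHeadT : (initHeadT M).length = headSize M := by
  rw [initHeadT, List.length_append, length_enum_flatMap fun _ => List.length_replicate,
    List.length_replicate, headSize]

theorem length_initCellT (s : Option Bool) (inx : Bool) :
    (initCellT M s inx).length = 2 * nQ M := by
  rw [initCellT, length_enum_flatMap (c := 2) (fun _ => rfl), mul_comm]

theorem length_initCell (K : ℕ) (u : List Bool) (nx i : ℕ) :
    (initCell M K u nx i).length = 2 * nQ M := by
  rw [initCell, List.length_map, length_initCellT]

theorem length_initLayer (K : ℕ) (u : List Bool) (nx : ℕ) :
    (initLayer M K u nx).length = layerSize M K := by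
  rw [initLayer, List.length_append, List.length_map, length_initHeadT,
    length_flatMap_const (c := 2 * nQ M) (fun i _ => length_initCell _ _ _ _),
    List.length_range, layerSize]

/-- The initial configuration on the bits `u` and the (rounded) reals `x`. -/
noncomputable def initConfig (M : Machine) (u : List Bool) (x : List ℝ) : M.Config where
  label := M.start
  bits i := if i = 0 then Turing.Tape.mk₁ (u.map some) else
    if i = 1 then Turing.Tape.mk₁ (List.replicate x.length (some true)) else default
  reals i := if i = 0 then Turing.Tape.mk₁ x else default

theorem isInitial_initConfig {R : ℝ → ℝ → Prop} {w : Instance} {x : List ℝ}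
    (h : List.Forall₂ R w.2 x) : M.IsInitial R w (initConfig M w.1 x) :=
  ⟨rfl, by simp [initConfig], by simp [initConfig, h.length_eq],
    fun i h0 h1 => by simp [initConfig, h0, h1], ⟨x, h, by simp [initConfig]⟩,
    fun i h0 => by simp [initConfig, h0]⟩

/-- Symbols and reals at a distance of more than `K` from the heads are left out. They cannot be
reached within `K` steps, so an input longer than that does no harm. -/
theorem initLayer_ok {R : ℝ → ℝ → Prop} {v : ℕ → ℝ} {K b : ℕ} {u : List Bool} {x : List ℝ}
    (hv : ConstsOK M R v) (hx : ∀ (t : ℕ) (h : t < x.length), x[t] = v (3 + nL M + t))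
    (h : Along (Gate.Holds R v) b (initLayer M K u x.length)) :
    LayerOK v K b (initConfig M u x) K := by
  rw [initLayer, along_append, along_map, initHeadT, along_append,
    along_enum (fun _ => List.length_replicate), List.length_map, ← initHeadT, length_initHeadT,
    along_flatMap (c := 2 * nQ M) (fun i _ => length_initCell _ _ _ _)] at h
  obtain ⟨⟨hH, -⟩, hC⟩ := h
  refine ⟨fun l => ?_, fun i tr hi _ => ?_⟩
  · have h0 := along_iff.1 (hH (.inl l)) (3 * nL M - 1)
      (by rw [List.length_replicate]; have := nL_pos (M := M); omega)
    rw [List.getElem_replicate] at h0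
    simp only [copyGate, TGate.inst, Gate.Holds, ite_self] at h0
    rw [off, ← add_assoc, h0, hv.boolOpd rfl, Sum.inl.injEq]
    exact eq_comm
  · have h0 := hC i (by rw [List.length_range]; omega)
    rw [List.getElem_range, initCell, along_map, initCellT, along_enum (c := 2) (fun _ => rfl)] at h0
    have h0 := (h0 tr).2.1
    simp only [copyGate, TGate.inst, Gate.Holds, ite_self] at h0
    rw [show b + headSize M + i * (2 * nQ M) + (2 * idx tr + 1) =
      b + headSize M + i * (2 * nQ M) + idx tr * 2 + 1 by omega, h0]
    clear h0 hH hC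
    have hcast : ∀ {α : Type} (f : ℕ → α) (d : α), (if (0 : ℤ) ≤ (i : ℤ) - K then
        f ((i : ℤ) - K).toNat else d) = if i < K then d else f (i - K) := by
      intro α f d
      by_cases h : i < K
      · rw [if_neg (by omega), if_pos h]
      · rw [if_pos (by omega), if_neg h]
        congr 1
        omega
    rcases tr with ⟨j, bb⟩ | j
    · simp only [TrackOK, initOpd]
      by_cases j0 : j = 0
      · simp only [if_pos j0, initConfig, hv.boolOpd (M := M) (env := initEnv M K i) rfl,
          mk₁_bits_nth, listArr]
        rw [hcast (fun t => u[t]?)]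
      · by_cases j1 : j = 1
        · have : List.replicate x.length (some true) = (List.replicate x.length true).map some := by
            simp
          simp only [if_neg j0, if_pos j1, initConfig,
            hv.boolOpd (M := M) (env := initEnv M K i) rfl, this, mk₁_bits_nth, listArr]
          rw [hcast (fun t => (List.replicate x.length true)[t]?)]
          by_cases h1 : i < K
          · simp [h1]
          · by_cases h2 : i - K < x.length
            · simp [h1, h2, eq_comm, Nat.le_of_not_lt h1]
            · simp [h1, h2]
        · simp only [if_neg j0, if_neg j1, initConfig,
            hv.boolOpd (M := M) (env := initEnv M K i) rfl, default_nth]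
          simp only [false_iff]
          exact fun h => by cases h
    · simp only [TrackOK, initOpd]
      have two : v 2 = default := hv.two
      by_cases j0 : j = 0
      · simp only [if_pos j0, initConfig, mk₁_nth]
        rw [hcast (fun t => x.getD t default)]
        by_cases h1 : i < K
        · rw [if_neg (by simp; omega), if_pos h1]
          simpa [Opd.num, initEnv] using two
        · by_cases h2 : i - K < x.length
          · rw [if_pos (by simp; omega), if_neg h1, List.getD_eq_getElem _ _ h2, hx _ h2]
            simp [Opd.num, initEnv]
          · rw [if_neg (by simp; omega), if_neg h1, List.getD_eq_default _ _ (by omega)]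
            simpa [Opd.num, initEnv] using two
      · rw [if_neg (by tauto)]
        simp only [initConfig, if_neg j0, default_nth]
        simpa [Opd.num, initEnv] using two

/-! ### The output -/

-- Again a chain over the labels: the active label decides between the nonnegative node `0` and the
-- negative node `1`.
open Classical in
noncomputable def outT (M : Machine) : List TGate :=
  (enum M.Label).flatMap fun l =>
    [.select (act l) (if M.node l = .halt true then (.zero, 0) else (.zero, 1))
      (if idx l = 0 then (.zero, 0) else (.head, idx l - 1))]

theorem length_outT : (outT M).length = nL M := by
  rw [outT, length_enum_flatMap (c := 1) (fun _ => rfl), mul_one]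

theorem out_val {R : ℝ → ℝ → Prop} {v : ℕ → ℝ} {env : Base → ℕ} {l₀ : M.Label}
    (hv : ConstsOK M R v) (he : env .zero = 0)
    (hact : ∀ l, v ((act l).num env) < 0 ↔ l₀ = l)
    (h : Along (Gate.Holds R v) (env .head) ((outT M).map (TGate.inst env))) :
    0 ≤ v (env .head + nL M - 1) ↔ M.node l₀ = .halt true := by
  classical
  rw [along_map, outT, along_enum (c := 1) (fun _ => rfl)] at h
  set b := env .head with hb
  have hsel : ∀ l : M.Label, v (b + idx l) =
      if l₀ = l then (if M.node l = .halt true then v 0 else v 1) else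
        if idx l = 0 then v 0 else v (b + idx l - 1) := by
    intro l
    have := (h l).1
    simp only [TGate.inst, Gate.Holds, hact, mul_one] at this
    rw [this]
    have h1 : v (Opd.num env (if M.node l = .halt true then (.zero, 0) else (.zero, 1))) =
        if M.node l = .halt true then v 0 else v 1 := by
      split_ifs <;> simp [Opd.num, he]
    have h2 : v (Opd.num env (if idx l = 0 then (.zero, 0) else (.head, idx l - 1))) =
        if idx l = 0 then v 0 else v (b + idx l - 1) := by
      split_ifs
      · simp [Opd.num, he]
      · simp only [Opd.num]
        rw [← hb, Nat.add_sub_assoc (by omega)]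
    rw [h1, h2]
  have key : ∀ p, idx l₀ ≤ p → p < nL M →
      v (b + p) = if M.node l₀ = .halt true then v 0 else v 1 := by
    intro p hp
    induction p, hp using Nat.le_induction with
    | base => intro _; rw [hsel l₀, if_pos rfl]
    | succ p hp ih =>
      intro hlt
      have hp' : p + 1 < (enum M.Label).length := by rwa [length_enum]
      have := hsel (enum M.Label)[p + 1]
      rw [idx_enum] at this
      rw [this, if_neg, if_neg (by omega), ← ih (by omega)]
      · rfl
      · intro h
        have := idx_enum hp'
        rw [← h] at this
        omega
  have hlt : idx l₀ < nL M := idx_lt l₀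
  rw [Nat.add_sub_assoc (by omega), key _ (by omega) (by omega)]
  split_ifs with h0
  · simp [h0, hv.zero]
  · simp [h0, hv.one]

end Sim
end FiniteBSS
namespace FiniteBSS
namespace Sim

variable {M : Machine}

/-! ### The circuit is acyclic -/

theorem boolOpd_num_lt {env : Base → ℕ} (he : env .zero = 0) {i : ℕ} (hi : 1 < i) (p : Prop) :
    (boolOpd p).num env < i := by
  by_cases hp : p <;> simp only [boolOpd, hp, if_true, if_false, Opd.num, he] <;> omega

theorem ctr_num_lt {env : Base → ℕ} {i : ℕ} (hc : env .center + 2 * nQ M ≤ i) (tr : Tr M) :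
    (ctr tr).num env < i := by
  have : idx tr < nQ M := idx_lt tr
  simp only [ctr, Opd.num]
  omega

theorem ex_opds_lt {env : Base → ℕ} (he : env .zero = 0) {i : ℕ} (hi : 3 + nL M ≤ i)
    (hc : env .center + 2 * nQ M ≤ i) (τ : Target M) (l : M.Label) :
    ∀ o ∈ (ex τ l).opds, o.num env < i := by
  have hb : ∀ p, (boolOpd p).num env < i := boolOpd_num_lt he (by omega)
  have hctr : ∀ tr : Tr M, (ctr tr).num env < i := ctr_num_lt hc
  have hl : Opd.num env (.zero, 3 + idx l) < i := by
    have : idx l < nL M := idx_lt l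
    simp only [Opd.num, he]
    omega
  rcases τ with l' | ⟨tr, k⟩
  · simp only [ex, actEx]
    split <;> simp [Ex.opds, hb, hctr]
  · match k with
    | 0 => simp [ex, Ex.opds, hb]
    | 1 => simp [ex, Ex.opds, hb]
    | 2 =>
      simp only [ex, writeEx]
      split <;> (try split_ifs) <;> simp [Ex.opds, hb, hctr, hl]

theorem along_copyGate {env : Base → ℕ} {i n : ℕ} {o : Opd} (ho : o.num env < i) :
    Along (fun i t => (TGate.inst env t).Below i) i (List.replicate n (copyGate o)) := by
  rw [along_iff]
  intro t ht
  rw [List.getElem_replicate]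
  simp only [copyGate, TGate.inst, Gate.Below, Gate.parents, List.mem_cons, List.not_mem_nil,
    or_false, forall_eq_or_imp, forall_eq]
  omega

/-- The delicate references are those of the outermost cells. The left neighbour of the first cell
is the idle end of the head of the preceding layer. The right neighbour of the last cell falls
behind the preceding layer, that is, into the head of the present one, which comes before all its
cells since `2 * nQ M ≤ headSize M`. -/
theorem layer_below {K inp b' b : ℕ} (hL : 3 + nL M ≤ b') (hb : b' + layerSize M K = b) :
    Along Gate.Below b (layer M K inp b' b) := by
  have hq := two_nQ_le (M := M)
  have hS : layerSize M K = headSize M + 2 * K * (2 * nQ M) + 2 * nQ M := by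
    rw [layerSize]; ring
  have hK : 2 * K * (2 * nQ M) = K * (2 * nQ M) + K * (2 * nQ M) := by ring
  have hoff : ∀ τ : Target M, off τ < headSize M := fun τ => by
    have := off_lt τ; rw [headSize]; omega
  rw [layer, along_append, along_map, headT, along_append,
    along_enum length_chain, List.length_map, ← headT, length_headT,
    along_flatMap (c := 2 * nQ M) (fun i _ => by rw [List.length_map, length_cells])]
  refine ⟨⟨fun τ => ?_, along_copyGate ?_⟩, fun i hi => ?_⟩
  · rw [along_enum (length_chainStep τ)]
    intro l
    rw [chainStep, along_append, Ex.length_gates]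
    refine ⟨Ex.below_of_opds (by simp only [layerEnv]; omega) fun o ho =>
      (ex_opds_lt (i := b) rfl (by omega) ?_ τ l o ho).trans_le (by omega), ?_, trivial⟩
    · simp only [layerEnv]; omega
    · have := hoff (.inl l)
      simp only [TGate.inst, Gate.Below, Gate.parents, List.mem_cons, List.not_mem_nil,
        or_false, forall_eq_or_imp, forall_eq, act]
      refine ⟨?_, ?_, ?_⟩
      · simp only [Opd.num, layerEnv]; omega
      · simp only [Opd.num, layerEnv]; omega
      · split_ifs with h0
        · simp only [Opd.num, layerEnv]; omega
        · simp only [Opd.num, layerEnv]; omega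
  · simp only [Opd.num, layerEnv]; omega
  · rw [List.length_range] at hi
    rw [List.getElem_range, along_map]
    have hiq : i * (2 * nQ M) ≤ 2 * K * (2 * nQ M) := Nat.mul_le_mul_right _ (by omega)
    have gen : ∀ mid : Tr M → Opd, (∀ tr, (mid tr).num (layerEnv M K inp b' b i) < b + headSize M) →
        Along (fun j t => (TGate.inst (layerEnv M K inp b' b i) t).Below j)
          (b + headSize M + i * (2 * nQ M)) (cellT mid) := by
      intro mid hmid
      rw [cellT, along_enum (c := 2) (fun _ => rfl)]
      intro tr
      have h0 := hmid tr
      have h1 := hoff (.inr (tr, 0))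
      have h2 := hoff (.inr (tr, 1))
      have h3 : idx tr < nQ M := idx_lt tr
      refine ⟨?_, ?_, trivial⟩
      · simp only [TGate.inst, Gate.Below, Gate.parents, List.mem_cons, List.not_mem_nil,
          or_false, forall_eq_or_imp, forall_eq]
        refine ⟨?_, ?_, ?_⟩
        · simp only [Opd.num, layerEnv]; omega
        · simp only [Opd.num, layerEnv]; omega
        · omega
      · simp only [TGate.inst, Gate.Below, Gate.parents, List.mem_cons, List.not_mem_nil,
          or_false, forall_eq_or_imp, forall_eq]
        refine ⟨?_, ?_, ?_⟩ <;> · simp only [Opd.num, layerEnv]; omega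
    split_ifs with h
    · refine gen _ fun tr => ?_
      have := hoff (.inr (tr, 2))
      simp only [Opd.num, layerEnv]; omega
    · refine gen _ fun tr => ?_
      have h3 : idx tr < nQ M := idx_lt tr
      simp only [Opd.num, layerEnv]; omega

theorem initLayer_below {K nx b : ℕ} {u : List Bool} (hL : 3 + nL M + nx ≤ b) :
    Along Gate.Below b (initLayer M K u nx) := by
  rw [initLayer, along_append, along_map, initHeadT, along_append,
    along_enum (fun _ => List.length_replicate), List.length_map, ← initHeadT, length_initHeadT,
    along_flatMap (c := 2 * nQ M) (fun i _ => length_initCell _ _ _ _)]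
  refine ⟨⟨fun τ => along_copyGate (boolOpd_num_lt rfl (by omega) _), along_copyGate ?_⟩,
    fun i hi => ?_⟩
  · simp only [Opd.num, initEnv]; omega
  · rw [List.getElem_range, initCell, along_map, initCellT, along_enum (c := 2) (fun _ => rfl)]
    intro tr
    refine along_copyGate (n := 2) ?_
    rcases tr with ⟨j, bb⟩ | j
    · simp only [initOpd]
      split_ifs <;> exact boolOpd_num_lt rfl (by omega) _
    · simp only [initOpd]
      split_ifs with h
      · have := h.2
        simp only [decide_eq_true_eq] at this
        simp only [Opd.num, initEnv]; omega
      · simp only [Opd.num, initEnv]; omega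

theorem out_below {K inp b' b : ℕ} (hL : 3 + nL M ≤ b') (hb : b' + layerSize M K = b) :
    Along Gate.Below b ((outT M).map (TGate.inst (layerEnv M K inp b' b 0))) := by
  rw [along_map, outT, along_enum (c := 1) (fun _ => rfl)]
  intro l
  have h1 := off_lt (M := M) (.inl l)
  have hS : layerSize M K = headSize M + 2 * K * (2 * nQ M) + 2 * nQ M := by
    rw [layerSize]; ring
  rw [headSize] at hS
  refine ⟨?_, trivial⟩
  simp only [TGate.inst, Gate.Below, Gate.parents, List.mem_cons, List.not_mem_nil,
    or_false, forall_eq_or_imp, forall_eq, act]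
  refine ⟨?_, ?_, ?_⟩
  · simp only [Opd.num, layerEnv]; omega
  · split_ifs <;> (simp only [Opd.num, layerEnv]; omega)
  · split_ifs <;> (simp only [Opd.num, layerEnv]; omega)

/-! ### The whole circuit -/

noncomputable def constOf (l : M.Label) : ℝ :=
  match M.node l with
  | .const _ a _ => a
  | _ => 0

/-- One entry per label, even for labels without a constant, so that the label determines the
position. -/
noncomputable def simConsts (M : Machine) : List ℝ := [1, -1, 0] ++ (enum M.Label).map constOf

theorem length_simConsts : (simConsts M).length = 3 + nL M := by
  simp [simConsts, length_enum, nL]; omega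

noncomputable def simGates (M : Machine) (u : List Bool) (nx T K : ℕ) : List Gate :=
  let b := 3 + nL M + nx
  let S := layerSize M K
  -- No gate of these layers refers to the input. The value is the one that the printing program
  -- leaves in its register after the initial layer.
  let inp := 3 + nL M + (K + 1)
  initLayer M K u nx ++
    ((List.range T).flatMap fun τ => layer M K inp (b + τ * S) (b + τ * S + S)) ++
    (outT M).map (TGate.inst (layerEnv M K inp (b + T * S) (b + T * S + S) 0))

noncomputable def simSize (M : Machine) (nx T K : ℕ) : ℕ :=
  3 + nL M + nx + (T + 1) * layerSize M K + nL M

/-- The circuit that simulates `T` steps of `M` on the bits `u`, the reals `x` and `m` further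
reals. -/
noncomputable def simCircuit (M : Machine) (w : Instance) (m T K : ℕ) : Circuit where
  -- The reals of the instance become constants of the circuit. As the input nodes follow the
  -- constants, the numbers `x` and `y` stand next to each other, as on the tape of the machine.
  consts := simConsts M ++ w.2
  numInputs := m
  gates := simGates M w.1 (w.2.length + m) T K ++ starGates (simSize M (w.2.length + m) T K)

theorem length_simGates (u : List Bool) (nx T K : ℕ) :
    3 + nL M + nx + (simGates M u nx T K).length = simSize M nx T K := by
  simp only [simGates, List.length_append, length_initLayer, List.length_map, length_outT]
  rw [length_flatMap_const (c := layerSize M K) fun τ _ => length_layer _ _ _ _]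
  rw [simSize, List.length_range]
  ring

theorem simGates_below (u : List Bool) (nx T K : ℕ) :
    Along Gate.Below (3 + nL M + nx) (simGates M u nx T K) := by
  rw [simGates]
  rw [along_append, along_append, List.length_append,
    along_flatMap (c := layerSize M K) fun τ _ => length_layer _ _ _ _,
    length_flatMap_const (c := layerSize M K) (fun τ _ => length_layer _ _ _ _),
    length_initLayer]
  refine ⟨⟨initLayer_below le_rfl, fun τ hτ => ?_⟩, ?_⟩
  · rw [List.getElem_range, show 3 + nL M + nx + layerSize M K + τ * layerSize M K =
      3 + nL M + nx + τ * layerSize M K + layerSize M K by ring]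
    exact layer_below (by omega) rfl
  · rw [List.length_range, show 3 + nL M + nx + (layerSize M K + T * layerSize M K) =
      3 + nL M + nx + T * layerSize M K + layerSize M K by ring]
    exact out_below (by omega) rfl

theorem simCircuit_valid (w : Instance) (m T K : ℕ) : (simCircuit M w m T K).Valid := by
  have h := length_simGates (M := M) w.1 (w.2.length + m) T K
  refine valid_of_star ?_ (by rw [simSize]; omega) ?_
  · rw [List.length_append, length_simConsts, ← h]; ring
  · rw [List.length_append, length_simConsts, add_assoc]
    exact simGates_below _ _ _ _

/-- Rounding does not change the signs of the constants `1`, `-1` and `0`. -/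
structure KeepsSigns (R : ℝ → ℝ → Prop) : Prop where
  one : ∀ v, R 1 v → 0 ≤ v
  neg_one : ∀ v, R (-1) v → v < 0
  zero : ∀ v, R 0 v → v = 0

theorem keepsSigns_eq : KeepsSigns Eq :=
  ⟨fun v h => by rw [← h]; exact zero_le_one, fun v h => by rw [← h]; norm_num,
    fun v h => h.symm⟩

/-- The factor `1 + δ` is positive for `|δ| < ε < 1`, and `0` is mapped to `0`. -/
theorem keepsSigns_rounds {ε : ℝ} (h : ε < 1) : KeepsSigns (Rounds ε) := by
  refine ⟨?_, ?_, ?_⟩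
  · rintro v ⟨δ, hδ, rfl⟩
    have := abs_lt.1 hδ
    linarith
  · rintro v ⟨δ, hδ, rfl⟩
    have := abs_lt.1 hδ
    linarith
  · rintro v ⟨δ, hδ, rfl⟩
    simp

theorem steps_snoc {R : ℝ → ℝ → Prop} : ∀ {n : ℕ} {c c' c'' : M.Config}, M.Steps R n c c' →
    M.Step R c' c'' → M.Steps R (n + 1) c c''
  | 0, _, _, c'', h, h' => by cases h; exact ⟨c'', h', rfl⟩
  | _ + 1, _, _, _, ⟨e, he, h⟩, h' => ⟨e, he, steps_snoc h h'⟩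

/-- The evaluations of the circuit follow computations of the machine. -/
theorem sim_run {R : ℝ → ℝ → Prop} (hR : KeepsSigns R) {w : Instance} {m T K : ℕ} (hK : T ≤ K)
    {y : Fin m → ℝ} {z : ℝ} (hz : (simCircuit M w m T K).Yields R y z) :
    ∃ n c, M.Run R (w.append y) n c ∧ (n = T ∨ ∃ b, M.node c.label = .halt b) ∧
      (0 ≤ z ↔ M.node c.label = .halt true) := by
  obtain ⟨v, hv, rfl⟩ := hz
  obtain ⟨hleaf, hg⟩ := Circuit.isEvaluation_iff.1 hv
  have hC : (simCircuit M w m T K).numLeaves = 3 + nL M + (w.2.length + m) := by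
    simp only [Circuit.numLeaves, simCircuit, List.length_append, length_simConsts]; ring
  have hlen := length_simGates (M := M) w.1 (w.2.length + m) T K
  have hleaves : (simCircuit M w m T K).leaves y = simConsts M ++ (w.2 ++ List.ofFn y) := by
    simp [Circuit.leaves, simCircuit]
  rw [hleaves, along_append, length_simConsts, zero_add] at hleaf
  obtain ⟨hl1, hl2⟩ := hleaf
  rw [hC] at hg
  change Along _ _ (simGates M w.1 (w.2.length + m) T K ++ starGates _) at hg
  rw [along_append, hlen] at hg
  obtain ⟨hg, hstar⟩ := hg
  have hcok : ConstsOK M R v := by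
    rw [simConsts, along_append, along_map] at hl1
    obtain ⟨⟨h0, h1, h2, -⟩, h3⟩ := hl1
    refine ⟨hR.one _ h0, hR.neg_one _ h1, hR.zero _ h2, fun l i a n hn => ?_⟩
    have := along_iff.1 h3 (idx l) (length_enum (α := M.Label) ▸ idx_lt l)
    rw [enum_idx] at this
    simpa [constOf, hn] using this
  rw [simGates] at hg
  rw [along_append, along_append, List.length_append,
    along_flatMap (c := layerSize M K) fun τ _ => length_layer _ _ _ _,
    length_flatMap_const (c := layerSize M K) (fun τ _ => length_layer _ _ _ _),
    length_initLayer] at hg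
  obtain ⟨⟨hinit, hlayers⟩, hout⟩ := hg
  rw [List.length_range] at hout
  set b := 3 + nL M + (w.2.length + m) with hb
  set S := layerSize M K with hS
  -- The values of the evaluation at the leaves serve as the rounded input of the machine.
  set x' := List.ofFn fun t : Fin (w.2.length + m) => v (3 + nL M + t) with hx'
  have hx'len : x'.length = w.2.length + m := by simp [hx']
  have hfor : List.Forall₂ R (w.2 ++ List.ofFn y) x' := by
    rw [List.forall₂_iff_get]
    refine ⟨by simp [hx'], fun t h1 h2 => ?_⟩
    have := along_iff.1 hl2 t h1
    simpa [hx'] using this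
  -- Induction over the layers. Starting with the radius `K`, the radius `K - τ` remains after `τ`
  -- layers, which is why `T ≤ K` is needed. Once a halting node is reached, the number `n` of steps
  -- stays fixed while the layers go on.
  have key : ∀ τ ≤ T, ∃ n c, M.Run R (w.append y) n c ∧
      (n = τ ∨ ∃ b, M.node c.label = .halt b) ∧ LayerOK v K (b + τ * S) c (K - τ) := by
    intro τ
    induction τ with
    | zero =>
      intro _
      refine ⟨0, _, ⟨initConfig M w.1 x', isInitial_initConfig (w := w.append y) hfor, rfl⟩,
        .inl rfl, ?_⟩
      rw [zero_mul, add_zero, Nat.sub_zero]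
      refine initLayer_ok hcok (fun t ht => by simp [hx']) ?_
      rwa [hx'len]
    | succ τ ih =>
      intro hτ
      obtain ⟨n, c, ⟨c₀, hi, hs⟩, hn, hl⟩ := ih (by omega)
      have hlay := hlayers τ (by rw [List.length_range]; omega)
      rw [List.getElem_range, show b + S + τ * S = b + τ * S + S by ring] at hlay
      rw [show K - τ = K - (τ + 1) + 1 by omega] at hl
      obtain ⟨c', hstep, hl'⟩ := layer_step hcok (by omega) hl hlay
      rw [add_assoc, ← add_one_mul] at hl'
      rcases hstep with hstep | ⟨hh, rfl⟩
      · refine ⟨n + 1, c', ⟨c₀, hi, steps_snoc hs hstep⟩, .inl ?_, hl'⟩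
        rcases hn with rfl | ⟨b, hb⟩
        · rfl
        · simp [Machine.Step, hb] at hstep
      · exact ⟨n, c', ⟨c₀, hi, hs⟩, .inr hh, hl'⟩
  obtain ⟨n, c, hrun, hn, hl⟩ := key T le_rfl
  refine ⟨n, c, hrun, hn, ?_⟩
  rw [show b + (S + T * S) = b + T * S + S by ring] at hout
  have hval := out_val (env := layerEnv M K (3 + nL M + (K + 1)) (b + T * S) (b + T * S + S) 0)
    hcok rfl hl.acts hout
  rw [← hval]
  have hN : (simCircuit M w m T K).numNodes =
      simSize M (w.2.length + m) T K + simSize M (w.2.length + m) T K := by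
    rw [Circuit.numNodes, hC]
    simp only [simCircuit, List.length_append, starGates, List.length_map,
      List.length_range]
    omega
  rw [hN, star_last (by rw [simSize]; omega) hstar, simSize, ← hb, ← hS]
  rw [show b + (T + 1) * S + nL M = layerEnv M K (3 + nL M + (K + 1)) (b + T * S) (b + T * S + S) 0
    .head + nL M by simp only [layerEnv]; ring]

theorem run_mono {R R' : ℝ → ℝ → Prop} (h : ∀ z v, R z v → R' z v) {w : Instance} {n : ℕ}
    {c : M.Config} (hr : M.Run R w n c) : M.Run R' w n c := by
  have step : ∀ {c c'}, M.Step R c c' → M.Step R' c c' := by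
    intro c c' hs
    unfold Machine.Step at hs ⊢
    split at hs <;> try exact hs
    · exact hs.imp fun v hv => ⟨h _ _ hv.1, hv.2⟩
    · exact hs.imp fun v hv => ⟨h _ _ hv.1, hv.2⟩
  have steps : ∀ {n c c'}, M.Steps R n c c' → M.Steps R' n c c' := by
    intro n
    induction n with
    | zero => exact fun h => h
    | succ n ih => exact fun ⟨e, he, hs⟩ => ⟨e, step he, ih hs⟩
  obtain ⟨c₀, ⟨h1, h2, h3, h4, ⟨x', hx, h5⟩, h6⟩, hs⟩ := hr
  exact ⟨c₀, ⟨h1, h2, h3, h4, ⟨x', hx.imp h, h5⟩, h6⟩, steps hs⟩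

/-- The class `PDir` asserts halting only for positive roundoff; but an exact computation is one of
the rounded ones, with all errors equal to `0`. -/
theorem haltsWithin_eq {w : Instance} {T : ℕ} (h : M.HaltsWithin (Rounds 2⁻¹) w T) :
    M.HaltsWithin Eq w T := fun n c hr =>
  h n c (run_mono (fun z v hz => ⟨0, by norm_num, by rw [← hz]; ring⟩) hr)

/-- If `M` halts and is correct, then the circuit is correct. -/
theorem sim_correct {R : ℝ → ℝ → Prop} (hR : KeepsSigns R) {w : Instance} {m T K : ℕ} (hK : T ≤ K)
    {y : Fin m → ℝ} {S : Set Instance} {T' : ℕ} (hT : T' < T)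
    (hh : M.HaltsWithin R (w.append y) T') (hS : M.AnswersCorrectly R (w.append y) S) {z : ℝ}
    (hz : (simCircuit M w m T K).Yields R y z) : 0 ≤ z ↔ w.append y ∈ S := by
  obtain ⟨n, c, hr, hn, h⟩ := sim_run hR hK hz
  obtain ⟨b, hb⟩ : ∃ b, M.node c.label = .halt b := by
    rcases hn with rfl | hn
    -- A run of `T` steps would exceed the time bound `T'`.
    · have := hh _ _ hr
      omega
    · exact hn
  rw [h, ← hS n c b hr hb, hb]
  simp

end Sim
end FiniteBSS
namespace FiniteBSS
namespace Sim

/-! ### Programs that output circuits -/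

/-- The registers of the program. -/
structure Rg where
  (acts center head left block input cur lk K lt len m rem sa sc : ℕ)

namespace Rg

/-- The counter `0` stays `0` and serves as the reference point `zero`. The counters `7` and `17`
are auxiliary and are `0` between the subprograms. -/
def toF (r : Rg) : Fin 18 → ℕ :=
  ![0, r.acts, r.center, r.head, r.left, r.block, r.input, 0, r.cur, r.lk, r.K, r.lt, r.len, r.m,
    r.rem, r.sa, r.sc, 0]

def env (r : Rg) : Base → ℕ
  | .zero => 0
  | .acts => r.acts
  | .center => r.center
  | .head => r.head
  | .left => r.left
  | .block => r.block
  | .input => r.input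

variable (r : Rg) (n : ℕ)

theorem upd1 : Function.update r.toF 1 n = toF { r with acts := n } := by
  funext i; fin_cases i <;> rfl
theorem upd2 : Function.update r.toF 2 n = toF { r with center := n } := by
  funext i; fin_cases i <;> rfl
theorem upd3 : Function.update r.toF 3 n = toF { r with head := n } := by
  funext i; fin_cases i <;> rfl
theorem upd4 : Function.update r.toF 4 n = toF { r with left := n } := by
  funext i; fin_cases i <;> rfl
theorem upd5 : Function.update r.toF 5 n = toF { r with block := n } := by
  funext i; fin_cases i <;> rfl
theorem upd6 : Function.update r.toF 6 n = toF { r with input := n } := by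
  funext i; fin_cases i <;> rfl
theorem upd8 : Function.update r.toF 8 n = toF { r with cur := n } := by
  funext i; fin_cases i <;> rfl
theorem upd9 : Function.update r.toF 9 n = toF { r with lk := n } := by
  funext i; fin_cases i <;> rfl
theorem upd10 : Function.update r.toF 10 n = toF { r with K := n } := by
  funext i; fin_cases i <;> rfl
theorem upd11 : Function.update r.toF 11 n = toF { r with lt := n } := by
  funext i; fin_cases i <;> rfl
theorem upd12 : Function.update r.toF 12 n = toF { r with len := n } := by
  funext i; fin_cases i <;> rfl
theorem upd13 : Function.update r.toF 13 n = toF { r with m := n } := by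
  funext i; fin_cases i <;> rfl
theorem upd14 : Function.update r.toF 14 n = toF { r with rem := n } := by
  funext i; fin_cases i <;> rfl
theorem upd15 : Function.update r.toF 15 n = toF { r with sa := n } := by
  funext i; fin_cases i <;> rfl
theorem upd16 : Function.update r.toF 16 n = toF { r with sc := n } := by
  funext i; fin_cases i <;> rfl

def Le (D : ℕ) : Prop := ∀ i, r.toF i ≤ D

theorem le_iff {r : Rg} {D : ℕ} : r.Le D ↔ r.acts ≤ D ∧ r.center ≤ D ∧ r.head ≤ D ∧ r.left ≤ D ∧
    r.block ≤ D ∧ r.input ≤ D ∧ r.cur ≤ D ∧ r.lk ≤ D ∧ r.K ≤ D ∧ r.lt ≤ D ∧ r.len ≤ D ∧ r.m ≤ D ∧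
    r.rem ≤ D ∧ r.sa ≤ D ∧ r.sc ≤ D := by
  constructor
  · intro h
    exact ⟨h 1, h 2, h 3, h 4, h 5, h 6, h 8, h 9, h 10, h 11, h 12, h 13, h 14, h 15, h 16⟩
  · rintro ⟨h1, h2, h3, h4, h5, h6, h8, h9, h10, h11, h12, h13, h14, h15, h16⟩ i
    fin_cases i <;> first | assumption | exact Nat.zero_le D

end Rg

def baseReg : Base → Fin 18
  | .zero => 0
  | .acts => 1
  | .center => 2
  | .head => 3
  | .left => 4
  | .block => 5
  | .input => 6

theorem toF_baseReg (r : Rg) (b : Base) : r.toF (baseReg b) = r.env b := by cases b <;> rfl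

/-- The state with the registers `r` in which the gates `gs` have been output. -/
def RG (σ : St 18) (r : Rg) (gs : List Gate) (p : ℤ) : St 18 :=
  St.emit (gs.flatMap Gate.code)
    { σ with cnt := r.toF, pos := Function.update σ.pos 2 p }

variable {σ : St 18} {r : Rg} {gs : List Gate} {p : ℤ}

@[simp] theorem RG_cnt : (RG σ r gs p).cnt = r.toF := by simp [RG]

theorem RG_setc (i : Fin 18) (n : ℕ) {r' : Rg} (h : Function.update r.toF i n = r'.toF) :
    (RG σ r gs p).setc i n = RG σ r' gs p := by
  rw [RG, ← St.emit_setc, RG, ← h]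
  rfl

theorem RG_emit (g : Gate) : St.emit g.code (RG σ r gs p) = RG σ r (gs ++ [g]) p := by
  rw [RG, ← St.emit_append, RG]
  simp

def emitOpd (o : Opd) : Cmd 18 := emitNat (baseReg o.1) 7 o.2

def emitT : TGate → Cmd 18
  | .arith op a b => emitBits op.code ;; emitOpd a ;; emitOpd b
  | .select a b c => emitBits (natCode 4) ;; emitOpd a ;; emitOpd b ;; emitOpd c

def emitTs : List TGate → Cmd 18
  | [] => .act .skip
  | t :: l => emitT t ;; emitTs l

theorem emitOpd_spec (o : Opd) (τ : St 18) {D : ℕ} (hD : 1 ≤ D) (h7 : τ.cnt 7 = 0)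
    (hτ : τ.cnt (baseReg o.1) ≤ D) : Spec Eq (emitOpd o) τ ((4 * o.2 + 22) * D)
      (· = St.emit (natCode (τ.cnt (baseReg o.1) + o.2)) τ) := by
  refine (Spec.emitNat (by cases o.1 <;> decide) o.2 τ h7).mono ?_ fun _ => id
  nlinarith [Nat.zero_le o.2]

theorem time_aux₃ {D : ℕ} (hD : 1 ≤ D) (a b c : ℕ) :
    a + (b * D + c * D) ≤ (a + b + c) * D := by
  have := Nat.le_mul_of_pos_right a hD
  rw [add_mul, add_mul]
  omega

theorem time_aux₄ {D : ℕ} (hD : 1 ≤ D) (a b c d : ℕ) :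
    a + (b * D + (c * D + d * D)) ≤ (a + (b + (c + d))) * D := by
  have := Nat.le_mul_of_pos_right a hD
  rw [add_mul, add_mul, add_mul]
  omega

/-- The constant depends on the template only. The size of the registers, and hence the length of
the unary numbers, enters through the common bound `D`; all time bounds below have the form of a
constant times a power of `D`. -/
theorem emitT_spec (t : TGate) : ∃ c, ∀ σ r gs p D, 1 ≤ D → r.Le D →
    Spec Eq (emitT t) (RG σ r gs p) (c * D)
      (· = RG σ r (gs ++ [t.inst r.env]) p) := by
  have hnum : ∀ (o : Opd) (τ : St 18) (r : Rg), τ.cnt = r.toF →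
      τ.cnt (baseReg o.1) + o.2 = o.num r.env := fun o τ r h => by rw [h, toF_baseReg]; rfl
  cases t with
  | arith op a b =>
    refine ⟨4 * op.code.length + 2 + (4 * a.2 + 22) + (4 * b.2 + 22), fun σ r gs p D hD hr => ?_⟩
    have h1 := Spec.emitBits (R := Eq) op.code (RG σ r gs p)
    have h2 := emitOpd_spec a (St.emit op.code (RG σ r gs p)) hD (by simp; rfl)
      (by simpa using hr _)
    rw [hnum a _ r (by simp)] at h2
    have h3 := emitOpd_spec b (St.emit (natCode (a.num r.env)) (St.emit op.code (RG σ r gs p))) hD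
      (by simp; rfl) (by simpa using hr _)
    rw [hnum b _ r (by simp)] at h3
    refine (Spec.seq_eq h1 (Spec.seq_eq h2 h3)).mono ?_ fun _ h => ?_
    · exact time_aux₃ hD _ _ _
    · rw [h, ← St.emit_append, ← St.emit_append, ← RG_emit]
      simp [TGate.inst, Gate.code]
  | select a b c =>
    refine ⟨4 * (natCode 4).length + 2 + ((4 * a.2 + 22) + ((4 * b.2 + 22) + (4 * c.2 + 22))),
      fun σ r gs p D hD hr => ?_⟩
    have h1 := Spec.emitBits (R := Eq) (natCode 4) (RG σ r gs p)
    have h2 := emitOpd_spec a (St.emit (natCode 4) (RG σ r gs p)) hD (by simp; rfl)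
      (by simpa using hr _)
    rw [hnum a _ r (by simp)] at h2
    have h3 := emitOpd_spec b (St.emit (natCode (a.num r.env)) (St.emit (natCode 4)
      (RG σ r gs p))) hD (by simp; rfl) (by simpa using hr _)
    rw [hnum b _ r (by simp)] at h3
    have h4 := emitOpd_spec c (St.emit (natCode (b.num r.env)) (St.emit (natCode (a.num r.env))
      (St.emit (natCode 4) (RG σ r gs p)))) hD (by simp; rfl) (by simpa using hr _)
    rw [hnum c _ r (by simp)] at h4
    refine (Spec.seq_eq h1 (Spec.seq_eq h2 (Spec.seq_eq h3 h4))).mono ?_ fun _ h => ?_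
    · exact time_aux₄ hD _ _ _ _
    · rw [h, ← St.emit_append, ← St.emit_append, ← St.emit_append, ← RG_emit]
      simp [TGate.inst, Gate.code]

theorem emitTs_spec (l : List TGate) : ∃ c, ∀ σ r gs p D, 1 ≤ D → r.Le D →
    Spec Eq (emitTs l) (RG σ r gs p) (c * D)
      (· = RG σ r (gs ++ l.map (TGate.inst r.env)) p) := by
  induction l with
  | nil =>
    refine ⟨2, fun σ r gs p D hD hr => (Spec.act (R := Eq) (a := .skip) (σ := RG σ r gs p) (Q := (· = RG σ r gs p)) rfl).mono
      (by omega) fun _ h => by simpa using h⟩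
  | cons t l ih =>
    obtain ⟨c₁, h₁⟩ := emitT_spec t
    obtain ⟨c₂, h₂⟩ := ih
    refine ⟨c₁ + c₂, fun σ r gs p D hD hr =>
      (Spec.seq_eq (h₁ σ r gs p D hD hr) (h₂ σ r _ p D hD hr)).mono (by rw [add_mul])
        fun _ h => by rw [h]; simp⟩

/-- Output gates and advance the number of the current gate. -/
def blk (l : List TGate) : Cmd 18 := emitTs l ;; incBy 8 l.length

theorem blk_spec (l : List TGate) : ∃ c, ∀ σ r gs p D, 1 ≤ D → r.Le D →
    Spec Eq (blk l) (RG σ r gs p) (c * D)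
      (· = RG σ { r with cur := r.cur + l.length } (gs ++ l.map (TGate.inst r.env)) p) := by
  obtain ⟨c, h⟩ := emitTs_spec l
  refine ⟨c + (2 * l.length + 2), fun σ r gs p D hD hr =>
    (Spec.seq_eq (h σ r gs p D hD hr) (Spec.incBy 8 _ _)).mono ?_ fun _ h => ?_⟩
  · rw [add_mul]
    gcongr
    exact Nat.le_mul_of_pos_right _ hD
  · rw [h]
    exact RG_setc _ _ (by rw [RG_cnt]; exact Rg.upd8 _ _)

/-- Output `lk` cells. -/
def cellsProg (l : List TGate) : Cmd 18 :=
  loop 9 (blk l ;; incBy 4 l.length ;; incBy 5 l.length)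

theorem cellsProg_spec (l : List TGate) : ∃ c, ∀ σ r gs p D, 1 ≤ D → r.Le D →
    r.cur + r.lk * l.length ≤ D → r.left + r.lk * l.length ≤ D → r.block + r.lk * l.length ≤ D →
    Spec Eq (cellsProg l) (RG σ r gs p) (c * D * D)
      (· = RG σ { r with
          cur := r.cur + r.lk * l.length, left := r.left + r.lk * l.length
          block := r.block + r.lk * l.length, lk := 0 }
        (gs ++ (List.range r.lk).flatMap fun i => l.map (TGate.inst (Rg.env
          { r with left := r.left + i * l.length, block := r.block + i * l.length }))) p) := by
  obtain ⟨c, hc⟩ := blk_spec l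
  set q := l.length with hq
  refine ⟨c + (2 * q + 2) + (2 * q + 2) + 4, fun σ r gs p D hD hr h1 h2 h3 => ?_⟩
  have := Spec.loop_up (R := Eq) (i := 9) (p := blk l ;; incBy 4 q ;; incBy 5 q)
    (t := c * D + ((2 * q + 2) + (2 * q + 2))) (n := r.lk)
    (fun d j => RG σ { r with
        cur := r.cur + d * q, left := r.left + d * q, block := r.block + d * q, lk := j }
      (gs ++ (List.range d).flatMap fun i => l.map (TGate.inst (Rg.env
          { r with left := r.left + i * q, block := r.block + i * q }))) p)
    (fun d j => by rw [RG_cnt]; rfl) (fun d j => RG_setc _ _ (Rg.upd9 _ _))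
    (fun d j hj => by
      have hle : d * q ≤ r.lk * q := Nat.mul_le_mul_right _ (by omega)
      refine (Spec.seq_eq (hc _ _ _ _ D hD ?_) (Spec.seq_eq (Spec.incBy _ _ _)
        (Spec.incBy _ _ _))).mono le_rfl fun _ h => ?_
      · rw [Rg.le_iff] at hr ⊢
        simp only
        omega
      · rw [h, RG_cnt, RG_setc _ _ (Rg.upd4 _ _), RG_cnt, RG_setc _ _ (Rg.upd5 _ _),
          List.range_succ, List.flatMap_append, List.flatMap_singleton, ← List.append_assoc,
          add_mul, one_mul, ← add_assoc, ← add_assoc, ← add_assoc]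
        rfl)
  refine Spec.mono (t := r.lk * (c * D + ((2 * q + 2) + (2 * q + 2)) + 3) + 1) ?_ ?_ fun _ h => h
  · simp only [zero_mul, add_zero, List.range_zero, List.flatMap_nil, List.append_nil] at this
    exact this
  · have hlk : r.lk ≤ D := (Rg.le_iff.1 hr).2.2.2.2.2.2.2.1
    calc _ ≤ D * (c * D + ((2 * q + 2) * D + (2 * q + 2) * D) + 3 * D) + D * D := by
          gcongr
          · exact Nat.le_mul_of_pos_right _ hD
          · exact Nat.le_mul_of_pos_right _ hD
          · omega
          · nlinarith
      _ = _ := by ring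

end Sim
end FiniteBSS
namespace FiniteBSS
namespace Sim

/-! ### Output of one layer -/

theorem _root_.FiniteBSS.Spec.seq_mul {k : ℕ} {R : ℝ → ℝ → Prop} {p q : Cmd k} {σ σ' : St k}
    {c c' E : ℕ} {Q : St k → Prop} (hp : Spec R p σ (c * E) (· = σ'))
    (hq : Spec R q σ' (c' * E) Q) : Spec R (p ;; q) σ ((c + c') * E) Q :=
  add_mul c c' E ▸ Spec.seq_eq hp hq

section
variable {σ : St 18} {r r' : Rg} {gs : List Gate} {p : ℤ} {D : ℕ}

theorem copy_spec {i j : Fin 18} (hij : i ≠ j) (hi : i ≠ 7) (hj : j ≠ 7) (hD : 1 ≤ D) (hr : r.Le D)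
    (h : Function.update r.toF j (r.toF i) = r'.toF) :
    Spec Eq (copyCnt i j 7) (RG σ r gs p) (20 * (D * D)) (· = RG σ r' gs p) := by
  refine (Spec.copyCnt hij hi hj _ (by simp; rfl)).mono ?_ fun _ h' => ?_
  · have h1 := hr i
    have h2 := hr j
    rw [RG_cnt]
    nlinarith
  · rw [h', RG_cnt]
    exact RG_setc _ _ h

theorem incBy_spec {i : Fin 18} {n : ℕ} (hD : 1 ≤ D)
    (h : Function.update r.toF i (r.toF i + n) = r'.toF) :
    Spec Eq (incBy i n) (RG σ r gs p) ((2 * n + 2) * (D * D)) (· = RG σ r' gs p) := by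
  refine (Spec.incBy i n _).mono ?_ fun _ h' => ?_
  · exact Nat.le_mul_of_pos_right _ (by positivity)
  · rw [h', RG_cnt]
    exact RG_setc _ _ h

end

theorem env_eq_layerEnv {M : Machine} {K inp b' b i : ℕ} {r : Rg} (h1 : r.acts = b')
    (h2 : r.center = b' + headSize M + K * (2 * nQ M)) (h3 : r.head = b)
    (h4 : r.left = b' + headSize M + i * (2 * nQ M) - 2 * nQ M)
    (h5 : r.block = b + headSize M + i * (2 * nQ M)) (h6 : r.input = inp) :
    r.env = layerEnv M K inp b' b i := by
  funext x
  cases x <;> simp only [Rg.env, layerEnv] <;> assumption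

/-- The registers before a layer whose predecessor starts with the gate `b`. -/
noncomputable def layerRg (M : Machine) (K b inp lt len m rem sa : ℕ) : Rg where
  acts := b
  center := b + headSize M + K * (2 * nQ M)
  head := b
  left := b + (headSize M - 2 * nQ M)
  block := b + layerSize M K
  input := inp
  cur := b + layerSize M K
  lk := 0
  K := K
  lt := lt
  len := len
  m := m
  rem := rem
  sa := sa
  sc := b + headSize M + K * (2 * nQ M)

/-- The registers `left` and `block` advance with the cells. The start of the central cell is saved
in `sc`, because the old `center` is still in use. After all cells, `left` has advanced by their
total size; adding the size of the head puts it exactly one layer further, so the register invariant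
is restored. -/
noncomputable def layerProg (M : Machine) : Cmd 18 :=
  copyCnt 8 3 7 ;; incBy 5 (headSize M) ;; blk (headT M) ;;
  copyCnt 10 9 7 ;; cellsProg (sideT M) ;;
  copyCnt 8 16 7 ;; blk (centerT M) ;; incBy 4 (2 * nQ M) ;; incBy 5 (2 * nQ M) ;;
  copyCnt 10 9 7 ;; cellsProg (sideT M) ;;
  incBy 4 (headSize M) ;; copyCnt 3 1 7 ;; copyCnt 16 2 7

theorem range_two_mul_add_one (K : ℕ) :
    List.range (2 * K + 1) = List.range K ++ [K] ++ (List.range K).map (K + 1 + ·) := by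
  rw [← List.range_succ, ← List.range_add]
  congr 1
  omega

theorem layer_eq (M : Machine) (K inp b' b : ℕ) : layer M K inp b' b =
    (headT M).map (TGate.inst (layerEnv M K inp b' b 0)) ++
    ((List.range K).flatMap fun i => (sideT M).map (TGate.inst (layerEnv M K inp b' b i))) ++
    (centerT M).map (TGate.inst (layerEnv M K inp b' b K)) ++
    ((List.range K).flatMap fun i =>
      (sideT M).map (TGate.inst (layerEnv M K inp b' b (K + 1 + i)))) := by
  rw [layer, range_two_mul_add_one, List.flatMap_append, List.flatMap_append,
    List.flatMap_singleton, if_pos rfl, List.flatMap_map, List.append_assoc, List.append_assoc,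
    List.append_assoc]
  congr 2
  · exact List.flatMap_congr fun i hi => by rw [if_neg (List.mem_range.1 hi).ne]
  · congr 1
    exact List.flatMap_congr fun i hi => by rw [if_neg (by omega)]

theorem layerProg_spec (M : Machine) : ∃ c, ∀ σ gs p D K b inp lt len m rem sa, 1 ≤ D →
    b + layerSize M K + layerSize M K ≤ D → inp ≤ D → lt ≤ D → len ≤ D → m ≤ D → rem ≤ D →
    sa ≤ D → K ≤ D →
    Spec Eq (layerProg M) (RG σ (layerRg M K b inp lt len m rem sa) gs p) (c * (D * D))
      (· = RG σ (layerRg M K (b + layerSize M K) inp lt len m rem sa)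
        (gs ++ layer M K inp b (b + layerSize M K)) p) := by
  obtain ⟨c₁, h₁⟩ := blk_spec (headT M)
  obtain ⟨c₂, h₂⟩ := cellsProg_spec (sideT M)
  obtain ⟨c₃, h₃⟩ := blk_spec (centerT M)
  -- The constant is left open; unification with the sum of the constants of the fourteen parts
  -- determines it at the end.
  apply Exists.intro
  intro σ gs p D K b inp lt len m rem sa hD hb hi hlt hlen hm hrem hsa hK
  have hq := two_nQ_le (M := M)
  have hl1 : (sideT M).length = 2 * nQ M := length_cellT _
  have hl2 : (centerT M).length = 2 * nQ M := length_cellT _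
  have hl3 := length_headT (M := M)
  rw [hl1] at h₂
  rw [hl2] at h₃
  rw [hl3] at h₁
  rw [layer_eq]
  have hD1 : ∀ c, c * D ≤ c * (D * D) :=
    fun c => Nat.mul_le_mul_left _ (Nat.le_mul_of_pos_left _ hD)
  -- Names for the sizes and for the product `K * q` make the remaining arithmetic linear.
  obtain ⟨q, hq'⟩ : ∃ q, q = 2 * nQ M := ⟨_, rfl⟩
  obtain ⟨H, hH⟩ : ∃ H, H = headSize M := ⟨_, rfl⟩
  obtain ⟨x, hx⟩ : ∃ x, x = K * q := ⟨_, rfl⟩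
  obtain ⟨S, hS⟩ : ∃ S, S = layerSize M K := ⟨_, rfl⟩
  have hS' : S = H + (x + q + x) := by rw [hS, layerSize, ← hq', ← hH, hx]; ring
  obtain ⟨B, hB⟩ : ∃ B, B = b + S := ⟨_, rfl⟩
  have r0 : layerRg M K b inp lt len m rem sa =
      ⟨b, b + H + x, b, b + (H - q), B, inp, B, 0, K, lt, len, m, rem, sa, b + H + x⟩ := by
    rw [layerRg, ← hS, ← hB, ← hq', ← hx, ← hH]
  have r1 : layerRg M K B inp lt len m rem sa =
      ⟨B, B + H + x, B, B + (H - q), B + H + x + q + x, inp, B + H + x + q + x, 0, K, lt, len, m,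
        rem, sa, B + H + x⟩ := by
    rw [layerRg, ← hS, ← hq', ← hx, ← hH, hS']
    simp only [add_assoc]
  rw [← hS, ← hB] at hb ⊢
  rw [r0, r1]
  rw [← hq'] at h₂ h₃ hq
  rw [← hH] at h₁ hq
  let r (a c h l k u lk sc : ℕ) : Rg := ⟨a, c, h, l, k, inp, u, lk, K, lt, len, m, rem, sa, sc⟩
  have e1 : (r b (b + H + x) B (b + (H - q)) (B + H) B 0 (b + H + x)).env = layerEnv M K inp b B 0 := by
    refine env_eq_layerEnv rfl ?_ rfl ?_ ?_ rfl <;> simp only [r, ← hH, ← hq', ← hx] <;> omega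
  have e2 : ∀ i, (r b (b + H + x) B (b + (H - q) + i * q) (B + H + i * q) (B + H) K (b + H + x)).env = layerEnv M K inp b B i := fun i => by
    refine env_eq_layerEnv rfl ?_ rfl ?_ ?_ rfl <;> simp only [r, ← hH, ← hq', ← hx]
    omega
  have e3 : (r b (b + H + x) B (b + (H - q) + x) (B + H + x) (B + H + x) 0 (B + H + x)).env =
      layerEnv M K inp b B K := by
    refine env_eq_layerEnv rfl ?_ rfl ?_ ?_ rfl <;> simp only [r, ← hH, ← hq', ← hx]
    omega
  have e4 : ∀ i, (r b (b + H + x) B (b + (H - q) + x + q + i * q) (B + H + x + q + i * q) (B + H + x + q) K (B + H + x)).env =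
      layerEnv M K inp b B (K + 1 + i) := fun i => by
    refine env_eq_layerEnv rfl ?_ rfl ?_ ?_ rfl <;>
      simp only [r, ← hH, ← hq', ← hx, add_mul, one_mul] <;> omega
  have le : ∀ {a c h l k u lk sc}, a ≤ D → c ≤ D → h ≤ D → l ≤ D → k ≤ D → u ≤ D → lk ≤ D →
      sc ≤ D → (r a c h l k u lk sc).Le D := fun _ _ _ _ _ _ _ _ => by
    rw [Rg.le_iff]; simp only [r]; omega
  let g1 := gs ++ (headT M).map (TGate.inst (layerEnv M K inp b B 0))
  let g2 := g1 ++ (List.range K).flatMap fun i =>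
    (sideT M).map (TGate.inst (layerEnv M K inp b B i))
  let g3 := g2 ++ (centerT M).map (TGate.inst (layerEnv M K inp b B K))
  let g4 := g3 ++ (List.range K).flatMap fun i =>
    (sideT M).map (TGate.inst (layerEnv M K inp b B (K + 1 + i)))
  have s1 : Spec Eq (copyCnt 8 3 7) (RG σ (r b (b + H + x) b (b + (H - q)) B B 0 (b + H + x)) gs p)
      (20 * (D * D)) (· = RG σ (r b (b + H + x) B (b + (H - q)) B B 0 (b + H + x)) gs p) :=
    copy_spec (by decide) (by decide) (by decide) hD
      (le (by omega) (by omega) (by omega) (by omega) (by omega) (by omega) (by omega) (by omega))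
      (Rg.upd3 _ _)
  have s2 : Spec Eq (incBy 5 (headSize M)) (RG σ (r b (b + H + x) B (b + (H - q)) B B 0 (b + H + x)) gs p)
      ((2 * (headSize M) + 2) * (D * D)) (· = RG σ (r b (b + H + x) B (b + (H - q)) (B + H) B 0 (b + H + x)) gs p) := by
    rw [← hH]
    exact incBy_spec hD (Rg.upd5 _ _)
  have s3 : Spec Eq (blk (headT M)) (RG σ (r b (b + H + x) B (b + (H - q)) (B + H) B 0 (b + H + x)) gs p)
      (c₁ * (D * D)) (· = RG σ (r b (b + H + x) B (b + (H - q)) (B + H) (B + H) 0 (b + H + x)) g1 p) := by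
    refine (h₁ σ (r b (b + H + x) B (b + (H - q)) (B + H) B 0 (b + H + x)) gs p D hD
      (le (by omega) (by omega) (by omega) (by omega) (by omega) (by omega) (by omega) (by omega))).mono
      (hD1 _) fun _ h => ?_
    rw [h, e1]
  have s4 : Spec Eq (copyCnt 10 9 7) (RG σ (r b (b + H + x) B (b + (H - q)) (B + H) (B + H) 0 (b + H + x)) g1 p)
      (20 * (D * D)) (· = RG σ (r b (b + H + x) B (b + (H - q)) (B + H) (B + H) K (b + H + x)) g1 p) :=
    copy_spec (by decide) (by decide) (by decide) hD
      (le (by omega) (by omega) (by omega) (by omega) (by omega) (by omega) (by omega) (by omega))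
      (Rg.upd9 _ _)
  have s5 : Spec Eq (cellsProg (sideT M)) (RG σ (r b (b + H + x) B (b + (H - q)) (B + H) (B + H) K (b + H + x)) g1 p)
      (c₂ * (D * D)) (· = RG σ (r b (b + H + x) B (b + (H - q) + x) (B + H + x) (B + H + x) 0 (b + H + x)) g2 p) := by
    refine (h₂ σ (r b (b + H + x) B (b + (H - q)) (B + H) (B + H) K (b + H + x)) g1 p D hD
      (le (by omega) (by omega) (by omega) (by omega) (by omega) (by omega) (by omega) (by omega))
      (by simp only [r, ← hx]; omega) (by simp only [r, ← hx]; omega)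
      (by simp only [r, ← hx]; omega)).mono (mul_assoc _ _ _).le fun _ h => ?_
    rw [h]
    simp only [r, ← hx] at e2 ⊢
    simp only [e2]
    rfl
  have s6 : Spec Eq (copyCnt 8 16 7) (RG σ (r b (b + H + x) B (b + (H - q) + x) (B + H + x) (B + H + x) 0 (b + H + x)) g2 p)
      (20 * (D * D)) (· = RG σ (r b (b + H + x) B (b + (H - q) + x) (B + H + x) (B + H + x) 0 (B + H + x)) g2 p) :=
    copy_spec (by decide) (by decide) (by decide) hD
      (le (by omega) (by omega) (by omega) (by omega) (by omega) (by omega) (by omega) (by omega))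
      (Rg.upd16 _ _)
  have s7 : Spec Eq (blk (centerT M)) (RG σ (r b (b + H + x) B (b + (H - q) + x) (B + H + x) (B + H + x) 0 (B + H + x)) g2 p)
      (c₃ * (D * D)) (· = RG σ (r b (b + H + x) B (b + (H - q) + x) (B + H + x) (B + H + x + q) 0 (B + H + x)) g3 p) := by
    refine (h₃ σ (r b (b + H + x) B (b + (H - q) + x) (B + H + x) (B + H + x) 0 (B + H + x)) g2 p D hD
      (le (by omega) (by omega) (by omega) (by omega) (by omega) (by omega) (by omega) (by omega))).mono
      (hD1 _) fun _ h => ?_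
    rw [h, e3]
  have s8 : Spec Eq (incBy 4 (2 * nQ M)) (RG σ (r b (b + H + x) B (b + (H - q) + x) (B + H + x) (B + H + x + q) 0 (B + H + x)) g3 p)
      ((2 * (2 * nQ M) + 2) * (D * D)) (· = RG σ (r b (b + H + x) B (b + (H - q) + x + q) (B + H + x) (B + H + x + q) 0 (B + H + x)) g3 p) := by
    rw [← hq']
    exact incBy_spec hD (Rg.upd4 _ _)
  have s9 : Spec Eq (incBy 5 (2 * nQ M)) (RG σ (r b (b + H + x) B (b + (H - q) + x + q) (B + H + x) (B + H + x + q) 0 (B + H + x)) g3 p)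
      ((2 * (2 * nQ M) + 2) * (D * D)) (· = RG σ (r b (b + H + x) B (b + (H - q) + x + q) (B + H + x + q) (B + H + x + q) 0 (B + H + x)) g3 p) := by
    rw [← hq']
    exact incBy_spec hD (Rg.upd5 _ _)
  have s10 : Spec Eq (copyCnt 10 9 7) (RG σ (r b (b + H + x) B (b + (H - q) + x + q) (B + H + x + q) (B + H + x + q) 0 (B + H + x)) g3 p)
      (20 * (D * D)) (· = RG σ (r b (b + H + x) B (b + (H - q) + x + q) (B + H + x + q) (B + H + x + q) K (B + H + x)) g3 p) :=
    copy_spec (by decide) (by decide) (by decide) hD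
      (le (by omega) (by omega) (by omega) (by omega) (by omega) (by omega) (by omega) (by omega))
      (Rg.upd9 _ _)
  have s11 : Spec Eq (cellsProg (sideT M)) (RG σ (r b (b + H + x) B (b + (H - q) + x + q) (B + H + x + q) (B + H + x + q) K (B + H + x)) g3 p)
      (c₂ * (D * D)) (· = RG σ (r b (b + H + x) B (b + (H - q) + x + q + x) (B + H + x + q + x) (B + H + x + q + x) 0 (B + H + x)) g4 p) := by
    refine (h₂ σ (r b (b + H + x) B (b + (H - q) + x + q) (B + H + x + q) (B + H + x + q) K (B + H + x)) g3 p D hD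
      (le (by omega) (by omega) (by omega) (by omega) (by omega) (by omega) (by omega) (by omega))
      (by simp only [r, ← hx]; omega) (by simp only [r, ← hx]; omega)
      (by simp only [r, ← hx]; omega)).mono (mul_assoc _ _ _).le fun _ h => ?_
    rw [h]
    simp only [r, ← hx] at e4 ⊢
    simp only [e4]
    rfl
  have s12 : Spec Eq (incBy 4 (headSize M)) (RG σ (r b (b + H + x) B (b + (H - q) + x + q + x) (B + H + x + q + x) (B + H + x + q + x) 0 (B + H + x)) g4 p)
      ((2 * (headSize M) + 2) * (D * D)) (· = RG σ (r b (b + H + x) B (b + (H - q) + x + q + x + H) (B + H + x + q + x) (B + H + x + q + x) 0 (B + H + x)) g4 p) := by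
    rw [← hH]
    exact incBy_spec hD (Rg.upd4 _ _)
  have s13 : Spec Eq (copyCnt 3 1 7) (RG σ (r b (b + H + x) B (b + (H - q) + x + q + x + H) (B + H + x + q + x) (B + H + x + q + x) 0 (B + H + x)) g4 p)
      (20 * (D * D)) (· = RG σ (r B (b + H + x) B (b + (H - q) + x + q + x + H) (B + H + x + q + x) (B + H + x + q + x) 0 (B + H + x)) g4 p) :=
    copy_spec (by decide) (by decide) (by decide) hD
      (le (by omega) (by omega) (by omega) (by omega) (by omega) (by omega) (by omega) (by omega))
      (Rg.upd1 _ _)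
  have s14 : Spec Eq (copyCnt 16 2 7) (RG σ (r B (b + H + x) B (b + (H - q) + x + q + x + H) (B + H + x + q + x) (B + H + x + q + x) 0 (B + H + x)) g4 p)
      (20 * (D * D)) (· = RG σ (r B (B + H + x) B (b + (H - q) + x + q + x + H) (B + H + x + q + x) (B + H + x + q + x) 0 (B + H + x)) g4 p) :=
    copy_spec (by decide) (by decide) (by decide) hD
      (le (by omega) (by omega) (by omega) (by omega) (by omega) (by omega) (by omega) (by omega))
      (Rg.upd2 _ _)
  refine (Spec.seq_mul s1 <| Spec.seq_mul s2 <| Spec.seq_mul s3 <| Spec.seq_mul s4 <|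
    Spec.seq_mul s5 <| Spec.seq_mul s6 <| Spec.seq_mul s7 <| Spec.seq_mul s8 <|
    Spec.seq_mul s9 <| Spec.seq_mul s10 <| Spec.seq_mul s11 <| Spec.seq_mul s12 <|
    Spec.seq_mul s13 s14).mono le_rfl fun _ h => ?_
  rw [h]
  simp only [r, g4, g3, g2, g1, List.append_assoc]
  rw [show b + (H - q) + x + q + x + H = B + (H - q) by omega]

end Sim
end FiniteBSS
namespace FiniteBSS

/-! ### What the output leaves unchanged -/

section
variable {k : ℕ}

@[simp] theorem St.emit_arr (l : List Bool) {a : Fin 3} (ha : a ≠ 0) : ∀ σ : St k,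
    (St.emit l σ).arr a = σ.arr a := by
  induction l with
  | nil => intro σ; rfl
  | cons b l ih => intro σ; rw [St.emit, ih]; simp [ha]

@[simp] theorem St.emit_pos (l : List Bool) {a : Fin 3} (ha : a ≠ 0) : ∀ σ : St k,
    (St.emit l σ).pos a = σ.pos a := by
  induction l with
  | nil => intro σ; rfl
  | cons b l ih => intro σ; rw [St.emit, ih]; simp [ha]

@[simp] theorem St.emit_main (l : List Bool) : ∀ σ : St k, (St.emit l σ).main = σ.main := by
  induction l with
  | nil => intro σ; rfl
  | cons b l ih => intro σ; rw [St.emit, ih]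

@[simp] theorem St.emit_mpos (l : List Bool) : ∀ σ : St k, (St.emit l σ).mpos = σ.mpos := by
  induction l with
  | nil => intro σ; rfl
  | cons b l ih => intro σ; rw [St.emit, ih]

theorem St.emit_setpos (l : List Bool) {a : Fin 3} (ha : a ≠ 0) (v : ℤ) : ∀ σ : St k,
    { St.emit l σ with pos := Function.update (St.emit l σ).pos a v } =
      St.emit l { σ with pos := Function.update σ.pos a v } := by
  induction l with
  | nil => intro σ; rfl
  | cons b l ih =>
    intro σ
    rw [St.emit, ih, St.emit]
    simp only [Function.update_comm ha, Function.update_of_ne ha.symm]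

end

namespace Sim

/-! ### Output of the initial cells, of the star gates and of the answer -/

section
variable {σ : St 18} {r r' : Rg} {gs : List Gate} {p : ℤ} {D : ℕ}

theorem RG_arr : (RG σ r gs p).arr 2 = σ.arr 2 := by simp [RG]

theorem RG_pos : (RG σ r gs p).pos 2 = p := by simp [RG]

theorem RG_move : Spec Eq (.act (.move 2 .right)) (RG σ r gs p) 2 (· = RG σ r gs (p + 1)) := by
  refine Spec.act_eq ?_
  rw [Act.Post, RG_pos, RG, St.emit_setpos _ (by decide), RG]
  simp only [Function.update_idem]
  rfl

theorem loop_time {a n D X : ℕ} (hn : n ≤ D) (hX : X ≤ a * D) (hD : 1 ≤ D) :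
    n * X + 1 ≤ (a + 1) * (D * D) := by
  calc n * X + 1 ≤ D * (a * D) + D * D := by
        gcongr
        exact Nat.mul_pos hD hD
    _ = _ := by ring

/-- Output a cell whose symbol is `s`, and which holds an input number as long as the counter of
these numbers is positive. -/
noncomputable def initCellProg (M : Machine) (s : Option Bool) : Cmd 18 :=
  .ite (.zero 14) (blk (initCellT M s false)) (.act (.dec 14) ;; blk (initCellT M s true))

noncomputable def readCellProg (M : Machine) : Cmd 18 :=
  .ite (.bit 2 (some true)) (initCellProg M (some true))
    (.ite (.bit 2 (some false)) (initCellProg M (some false)) (initCellProg M none))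

theorem Rg.Le.rem (h : r.Le D) {n : ℕ} (hn : n ≤ D) : Rg.Le { r with rem := n } D := by
  rw [Rg.le_iff] at h ⊢
  simp only
  omega

theorem initCellProg_spec (M : Machine) (s : Option Bool) : ∃ c, ∀ σ r gs p D, 1 ≤ D → r.Le D →
    Spec Eq (initCellProg M s) (RG σ r gs p) (c * D)
      (· = RG σ { r with cur := r.cur + 2 * nQ M, rem := r.rem - 1 }
        (gs ++ (initCellT M s (decide (0 < r.rem))).map (TGate.inst r.env)) p) := by
  obtain ⟨c₁, h₁⟩ := blk_spec (initCellT M s false)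
  obtain ⟨c₂, h₂⟩ := blk_spec (initCellT M s true)
  simp only [length_initCellT] at h₁ h₂
  refine ⟨c₁ + c₂ + 2 + 1, fun σ r gs p D hD hr => ?_⟩
  have h0 : (Test.zero 14).Holds (RG σ r gs p) ↔ r.rem = 0 := by
    rw [Test.Holds, RG_cnt]
    rfl
  refine (Spec.ite (t := (c₁ + c₂ + 2) * D) (fun h => ?_) fun h => ?_).mono ?_ fun _ h => h
  · rw [h0] at h
    refine (h₁ σ r gs p D hD hr).mono (by gcongr; omega) fun _ h' => ?_
    rw [h', h]
    simp only [lt_self_iff_false, decide_false, zero_tsub]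
  · rw [h0] at h
    have hle := hr 14
    have hle : r.rem ≤ D := hle
    have hdec : Spec Eq (.act (.dec 14)) (RG σ r gs p) 2
        (· = RG σ { r with rem := r.rem - 1 } gs p) := by
      refine Spec.act_eq ⟨?_, ?_⟩
      · rw [RG_cnt]; exact Nat.pos_of_ne_zero h
      · rw [RG_cnt]; exact RG_setc _ _ (Rg.upd14 _ _)
    refine (Spec.seq_eq hdec (h₂ σ _ gs p D hD (hr.rem (by omega)))).mono ?_ fun _ h' => ?_
    · nlinarith
    · rw [h', decide_eq_true (Nat.pos_of_ne_zero h)]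
      rfl
  · nlinarith

theorem readCellProg_spec (M : Machine) : ∃ c, ∀ σ r gs p D, 1 ≤ D → r.Le D →
    Spec Eq (readCellProg M) (RG σ r gs p) (c * D)
      (· = RG σ { r with cur := r.cur + 2 * nQ M, rem := r.rem - 1 }
        (gs ++ (initCellT M (σ.arr 2 p) (decide (0 < r.rem))).map (TGate.inst r.env)) p) := by
  obtain ⟨c₁, h₁⟩ := initCellProg_spec M (some true)
  obtain ⟨c₂, h₂⟩ := initCellProg_spec M (some false)
  obtain ⟨c₃, h₃⟩ := initCellProg_spec M none
  refine ⟨c₁ + c₂ + c₃ + 2, fun σ r gs p D hD hr => ?_⟩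
  have h0 : ∀ s, (Test.bit 2 s).Holds (RG σ r gs p) ↔ σ.arr 2 p = s := fun s => by
    rw [Test.Holds, RG_arr, RG_pos]
  refine (Spec.ite (t := (c₁ + c₂ + c₃) * D + 1) (fun h => ?_) fun h => Spec.ite (fun h' => ?_)
    fun h' => ?_).mono (by nlinarith) fun _ h => h
  · rw [h0] at h
    rw [h]
    exact (h₁ σ r gs p D hD hr).mono (by nlinarith [Nat.zero_le ((c₂ + c₃) * D)]) fun _ h => h
  · rw [h0] at h'
    rw [h']
    exact (h₂ σ r gs p D hD hr).mono (by gcongr; omega) fun _ h => h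
  · rw [h0] at h h'
    have : σ.arr 2 p = none := by
      rcases h : σ.arr 2 p with _ | _ | _ <;> simp_all
    rw [this]
    exact (h₃ σ r gs p D hD hr).mono (by gcongr; omega) fun _ h => h

/-- Output `lk` cells that lie to the left of the input. -/
noncomputable def leftCellsProg (M : Machine) : Cmd 18 := loop 9 (blk (initCellT M none false))

theorem leftCellsProg_spec (M : Machine) : ∃ c, ∀ σ r gs p D, 1 ≤ D → r.Le D →
    r.cur + r.lk * (2 * nQ M) ≤ D →
    Spec Eq (leftCellsProg M) (RG σ r gs p) (c * (D * D))
      (· = RG σ { r with cur := r.cur + r.lk * (2 * nQ M), lk := 0 }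
        (gs ++ (List.range r.lk).flatMap fun _ =>
          (initCellT M none false).map (TGate.inst r.env)) p) := by
  obtain ⟨c, hc⟩ := blk_spec (initCellT M none false)
  simp only [length_initCellT] at hc
  set q := 2 * nQ M with hq
  refine ⟨c + 4, fun σ r gs p D hD hr h1 => ?_⟩
  have := Spec.loop_up (R := Eq) (i := 9) (p := blk (initCellT M none false)) (t := c * D)
    (n := r.lk)
    (fun d j => RG σ { r with cur := r.cur + d * q, lk := j }
      (gs ++ (List.range d).flatMap fun _ => (initCellT M none false).map (TGate.inst r.env)) p)
    (fun d j => by rw [RG_cnt]; rfl) (fun d j => RG_setc _ _ (Rg.upd9 _ _))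
    (fun d j hj => by
      have hle : d * q ≤ r.lk * q := Nat.mul_le_mul_right _ (by omega)
      refine (hc _ _ _ _ D hD ?_).mono le_rfl fun _ h => ?_
      · rw [Rg.le_iff] at hr ⊢
        simp only
        omega
      · rw [h, List.range_succ, List.flatMap_append, List.flatMap_singleton, ← List.append_assoc,
          add_mul, one_mul, ← add_assoc]
        rfl)
  refine Spec.mono (t := r.lk * (c * D + 3) + 1) ?_ ?_ fun _ h => h
  · simp only [zero_mul, add_zero, List.range_zero, List.flatMap_nil, List.append_nil] at this
    exact this
  · have hlk : r.lk ≤ D := (Rg.le_iff.1 hr).2.2.2.2.2.2.2.1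
    exact loop_time hlk (by nlinarith) hD

/-- Output `lk` cells that hold the input. -/
noncomputable def rightCellsProg (M : Machine) : Cmd 18 :=
  loop 9 (readCellProg M ;; incBy 6 1 ;; .act (.move 2 .right))

theorem rightCellsProg_spec (M : Machine) : ∃ c, ∀ σ r gs p D, 1 ≤ D → r.Le D →
    r.cur + r.lk * (2 * nQ M) ≤ D → r.input + r.lk ≤ D →
    Spec Eq (rightCellsProg M) (RG σ r gs p) (c * (D * D))
      (· = RG σ { r with
          cur := r.cur + r.lk * (2 * nQ M), input := r.input + r.lk, lk := 0
          rem := r.rem - r.lk }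
        (gs ++ (List.range r.lk).flatMap fun i : ℕ =>
          (initCellT M (σ.arr 2 (p + i)) (decide (i < r.rem))).map
            (TGate.inst (Rg.env { r with input := r.input + i }))) (p + r.lk)) := by
  obtain ⟨c, hc⟩ := readCellProg_spec M
  set q := 2 * nQ M with hq
  refine ⟨c + 10, fun σ r gs p D hD hr h1 h2 => ?_⟩
  have := Spec.loop_up (R := Eq) (i := 9)
    (p := readCellProg M ;; incBy 6 1 ;; .act (.move 2 .right)) (t := c * D + 6) (n := r.lk)
    (fun d j => RG σ { r with
          cur := r.cur + d * q, input := r.input + d, lk := j, rem := r.rem - d }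
      (gs ++ (List.range d).flatMap fun i : ℕ =>
          (initCellT M (σ.arr 2 (p + i)) (decide (i < r.rem))).map
            (TGate.inst (Rg.env { r with input := r.input + i }))) (p + d))
    (fun d j => by rw [RG_cnt]; rfl) (fun d j => RG_setc _ _ (Rg.upd9 _ _))
    (fun d j hj => by
      have hle : d * q ≤ r.lk * q := Nat.mul_le_mul_right _ (by omega)
      refine (Spec.seq_eq (hc _ _ _ _ D hD ?_) (Spec.seq_eq (t' := 2) (Spec.incBy 6 1 _)
        ?_)).mono le_rfl fun _ h => h
      · rw [Rg.le_iff] at hr ⊢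
        simp only
        omega
      · rw [RG_cnt, RG_setc _ _ (Rg.upd6 _ _)]
        refine RG_move.mono le_rfl fun _ h => ?_
        have e : ({ r with
            cur := r.cur + (d + 1) * q, input := r.input + (d + 1), lk := j
            rem := r.rem - (d + 1) } : Rg) = { r with
            cur := r.cur + d * q + q, input := r.input + d + 1, lk := j
            rem := r.rem - d - 1 } := by
          rw [add_mul, one_mul, ← add_assoc, ← add_assoc, Nat.sub_add_eq]
        rw [h, e, List.range_succ, List.flatMap_append, List.flatMap_singleton,
          ← List.append_assoc, Nat.cast_add, Nat.cast_one, ← add_assoc p,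
          show (decide (0 < r.rem - d)) = decide (d < r.rem) by
            congr 1; exact propext ⟨fun h => by omega, fun h => by omega⟩]
        rfl)
  refine Spec.mono (t := r.lk * (c * D + 6 + 3) + 1) ?_ ?_ fun _ h => h
  · simp only [zero_mul, add_zero, List.range_zero, List.flatMap_nil, List.append_nil,
      Nat.cast_zero, Nat.sub_zero] at this
    exact this
  · have hlk : r.lk ≤ D := (Rg.le_iff.1 hr).2.2.2.2.2.2.2.1
    exact loop_time hlk (by nlinarith) hD

/-- Output the gates that make the graph of the circuit connected. -/
def starProg : Cmd 18 :=
  copyCnt 8 11 7 ;; clear 3 ;;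
    loop 11 (blk [.select (.zero, 0) (.head, 0) (.head, 0)] ;; incBy 3 1)

theorem starProg_spec : ∃ c, ∀ σ r gs p D, 1 ≤ D → r.Le D → 2 * r.cur ≤ D →
    Spec Eq starProg (RG σ r gs p) (c * (D * D))
      (· = RG σ { r with cur := 2 * r.cur, lt := 0, head := r.cur } (gs ++ starGates r.cur) p) := by
  obtain ⟨c, hc⟩ := blk_spec [.select (.zero, 0) (.head, 0) (.head, 0)]
  refine ⟨20 + (6 + (c + 8)), fun σ r gs p D hD hr h1 => ?_⟩
  have hl := Spec.loop_up (R := Eq) (i := 11)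
    (p := blk [.select (.zero, 0) (.head, 0) (.head, 0)] ;; incBy 3 1) (t := c * D + 4)
    (n := r.cur)
    (fun d j => RG σ { r with cur := r.cur + d, lt := j, head := d } (gs ++ starGates d) p)
    (fun d j => by rw [RG_cnt]; rfl) (fun d j => RG_setc _ _ (Rg.upd11 _ _))
    (fun d j hj => by
      refine (Spec.seq_eq (hc _ _ _ _ D hD ?_) (Spec.incBy _ _ _)).mono le_rfl fun _ h => ?_
      · rw [Rg.le_iff] at hr ⊢
        simp only
        omega
      · have e : gs ++ starGates (d + 1) = gs ++ starGates d ++ [.select 0 d d] := by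
          rw [starGates, starGates, List.range_succ, List.map_append, ← List.append_assoc]
          rfl
        rw [h, RG_cnt, e]
        exact RG_setc (r' := { r with cur := r.cur + (d + 1), lt := j, head := d + 1 }) _ _
          (Rg.upd3 _ _))
  have h1 : Spec Eq (copyCnt 8 11 7) (RG σ r gs p) (20 * (D * D))
      (· = RG σ { r with lt := r.cur } gs p) :=
    copy_spec (by decide) (by decide) (by decide) hD hr (Rg.upd11 _ _)
  have h2 : Spec Eq (clear 3) (RG σ { r with lt := r.cur } gs p) (6 * (D * D))
      (· = RG σ { r with lt := r.cur, head := 0 } gs p) := by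
    refine (Spec.clear 3 _).mono ?_ fun _ h => ?_
    · have h3 : r.head ≤ D := (Rg.le_iff.1 hr).2.2.1
      have : (RG σ { r with lt := r.cur } gs p).cnt 3 = r.head := by
        rw [RG_cnt]
        rfl
      rw [this]
      nlinarith
    · rw [h, RG_setc _ _ (Rg.upd3 _ _)]
  have e : RG σ { r with cur := r.cur + 0, lt := r.cur, head := 0 } (gs ++ starGates 0) p =
      RG σ { r with lt := r.cur, head := 0 } gs p := by
    simp [starGates]
  rw [e] at hl
  have h3 := hl.mono (t' := (c + 8) * (D * D)) (loop_time (by omega) (by nlinarith) hD)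
    fun _ h => h
  exact (Spec.seq_mul h1 (Spec.seq_mul h2 h3)).mono le_rfl fun _ h => by rw [h, two_mul]

/-- Output the gates that compute the answer of the machine. -/
noncomputable def outProg (M : Machine) : Cmd 18 :=
  copyCnt 8 3 7 ;; incBy 5 (headSize M) ;; blk (outT M)

theorem outProg_spec (M : Machine) : ∃ c, ∀ σ gs p D K b inp lt len m rem sa, 1 ≤ D →
    b + layerSize M K + headSize M ≤ D → inp ≤ D → lt ≤ D → len ≤ D → m ≤ D → rem ≤ D →
    sa ≤ D → K ≤ D →
    Spec Eq (outProg M) (RG σ (layerRg M K b inp lt len m rem sa) gs p) (c * (D * D))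
      (· = RG σ { layerRg M K b inp lt len m rem sa with
          head := b + layerSize M K, block := b + layerSize M K + headSize M
          cur := b + layerSize M K + nL M }
        (gs ++ (outT M).map
          (TGate.inst (layerEnv M K inp b (b + layerSize M K) 0))) p) := by
  obtain ⟨c, hc⟩ := blk_spec (outT M)
  rw [length_outT] at hc
  refine ⟨20 + ((2 * headSize M + 2) + c),
    fun σ gs p D K b inp lt len m rem sa hD hb hi hlt hlen hm hrem hsa hK => ?_⟩
  have hD1 : ∀ c, c * D ≤ c * (D * D) :=
    fun c => Nat.mul_le_mul_left _ (Nat.le_mul_of_pos_left _ hD)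
  have hS : layerSize M K = headSize M + (2 * (K * (2 * nQ M)) + 2 * nQ M) := by
    rw [layerSize]; ring
  have hle : (layerRg M K b inp lt len m rem sa).Le D := by
    rw [Rg.le_iff, layerRg]
    simp only
    omega
  have h1 : Spec Eq (copyCnt 8 3 7) (RG σ (layerRg M K b inp lt len m rem sa) gs p)
      (20 * (D * D)) (· = RG σ { layerRg M K b inp lt len m rem sa with
        head := b + layerSize M K } gs p) :=
    copy_spec (by decide) (by decide) (by decide) hD hle (Rg.upd3 _ _)
  have h2 : Spec Eq (incBy 5 (headSize M)) (RG σ { layerRg M K b inp lt len m rem sa with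
        head := b + layerSize M K } gs p)
      ((2 * headSize M + 2) * (D * D)) (· = RG σ { layerRg M K b inp lt len m rem sa with
        head := b + layerSize M K, block := b + layerSize M K + headSize M } gs p) :=
    incBy_spec hD (Rg.upd5 _ _)
  refine Spec.seq_mul h1 (Spec.seq_mul h2 ((hc _ _ _ _ D hD ?_).mono (hD1 _) fun _ h => ?_))
  · rw [Rg.le_iff, layerRg] at hle ⊢
    simp only at hle ⊢
    omega
  · rw [h, env_eq_layerEnv (M := M) (K := K) (inp := inp) (b' := b) (b := b + layerSize M K)
      (i := 0) rfl rfl rfl ?_ ?_ rfl]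
    · rfl
    · have := two_nQ_le (M := M)
      simp only [layerRg]
      omega
    · simp

end

end Sim
end FiniteBSS
namespace FiniteBSS
namespace Sim

/-! ### Output of the initial layer -/

noncomputable def initProg (M : Machine) : Cmd 18 :=
  -- The start of the layer is saved in `sa`, since the reference points have to be `0` while this
  -- layer is printed. Only afterwards are they set to the values that the first ordinary layer
  -- expects.
  copyCnt 8 15 7 ;; incBy 6 (3 + nL M) ;; blk (initHeadT M) ;;
  copyCnt 10 9 7 ;; leftCellsProg M ;; copyCnt 8 16 7 ;;
  copyCnt 10 9 7 ;; incBy 9 1 ;; rightCellsProg M ;;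
  copyCnt 15 1 7 ;; copyCnt 15 3 7 ;; copyCnt 16 2 7 ;; copyCnt 8 5 7 ;; copyCnt 15 4 7 ;;
  incBy 4 (headSize M - 2 * nQ M)

theorem env_eq_initEnv {M : Machine} {K i : ℕ} {r : Rg} (h1 : r.acts = 0) (h2 : r.center = 0)
    (h3 : r.head = 0) (h4 : r.left = 0) (h5 : r.block = 0)
    (h6 : r.input = 3 + nL M + (i - K)) : r.env = initEnv M K i := by
  funext x
  cases x <;> simp only [Rg.env, initEnv] <;> assumption

theorem initLayer_eq (M : Machine) (K : ℕ) (u : List Bool) (nx : ℕ) : initLayer M K u nx =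
    (initHeadT M).map (TGate.inst (initEnv M K 0)) ++
    ((List.range K).flatMap fun _ =>
      (initCellT M none false).map (TGate.inst (initEnv M K 0))) ++
    ((List.range (K + 1)).flatMap fun i : ℕ => (initCellT M (listArr u (0 + i)) (decide (i < nx))).map
        (TGate.inst (initEnv M K (K + i)))) := by
  rw [initLayer, show 2 * K + 1 = K + (K + 1) by omega, List.range_add, List.flatMap_append,
    List.flatMap_map, List.append_assoc]
  congr 2
  · refine List.flatMap_congr fun i hi => ?_
    have hi := List.mem_range.1 hi
    rw [initCell, if_pos hi, decide_eq_false (by omega)]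
    congr 2
    funext x
    cases x <;> simp only [initEnv]
    omega
  · refine List.flatMap_congr fun i hi => ?_
    rw [initCell, if_neg (by omega)]
    simp [listArr]

theorem initProg_spec (M : Machine) : ∃ c, ∀ σ gs D K b lt len m nx (u : List Bool), 1 ≤ D →
    b + layerSize M K ≤ D → 3 + nL M + (K + 1) ≤ D → lt ≤ D → len ≤ D → m ≤ D → nx ≤ D →
    σ.arr 2 = listArr u →
    Spec Eq (initProg M) (RG σ ⟨0, 0, 0, 0, 0, 0, b, 0, K, lt, len, m, nx, 0, 0⟩ gs 0) (c * (D * D))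
      (· = RG σ (layerRg M K b (3 + nL M + (K + 1)) lt len m (nx - (K + 1)) b)
        (gs ++ initLayer M K u nx) (K + 1 : ℕ)) := by
  obtain ⟨c₁, h₁⟩ := blk_spec (initHeadT M)
  obtain ⟨c₂, h₂⟩ := leftCellsProg_spec M
  obtain ⟨c₃, h₃⟩ := rightCellsProg_spec M
  apply Exists.intro
  intro σ gs D K b lt len m nx u hD hb hi hlt hlen hm hnx hu
  have hq := two_nQ_le (M := M)
  rw [length_initHeadT] at h₁
  rw [initLayer_eq]
  have hD1 : ∀ c, c * D ≤ c * (D * D) :=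
    fun c => Nat.mul_le_mul_left _ (Nat.le_mul_of_pos_left _ hD)
  obtain ⟨q, hq'⟩ : ∃ q, q = 2 * nQ M := ⟨_, rfl⟩
  obtain ⟨H, hH⟩ : ∃ H, H = headSize M := ⟨_, rfl⟩
  obtain ⟨N, hN⟩ : ∃ N, N = 3 + nL M := ⟨_, rfl⟩
  obtain ⟨x, hx⟩ : ∃ x, x = K * q := ⟨_, rfl⟩
  obtain ⟨y, hy⟩ : ∃ y, y = (K + 1) * q := ⟨_, rfl⟩
  have hS : layerSize M K = H + (x + y) := by rw [layerSize, ← hq', ← hH, hx, hy]; ring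
  rw [← hN] at hi
  rw [hS] at hb
  rw [← hq'] at h₂ h₃ hq
  rw [← hH] at h₁ hq
  let r (a c h l k i u lk rem sa sc : ℕ) : Rg := ⟨a, c, h, l, k, i, u, lk, K, lt, len, m, rem, sa, sc⟩
  have r1 : layerRg M K b (3 + nL M + (K + 1)) lt len m (nx - (K + 1)) b = (r b (b + H + x) b (b + (H - q)) (b + H + x + y) (N + (K + 1)) (b + H + x + y) 0 (nx - (K + 1)) b (b + H + x)) := by
    rw [layerRg, hS, ← hq', ← hx, ← hH, ← hN]
    simp only [r, add_assoc]
  have e1 : (r 0 0 0 0 0 N b 0 nx b 0).env = initEnv M K 0 :=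
    env_eq_initEnv rfl rfl rfl rfl rfl (by simp only [r]; omega)
  have e2 : (r 0 0 0 0 0 N (b + H) K nx b 0).env = initEnv M K 0 :=
    env_eq_initEnv rfl rfl rfl rfl rfl (by simp only [r]; omega)
  have e3 : ∀ i, (r 0 0 0 0 0 (N + i) (b + H + x) (K + 1) nx b (b + H + x)).env =
      initEnv M K (K + i) := fun i =>
    env_eq_initEnv rfl rfl rfl rfl rfl (by simp only [r]; omega)
  have le : ∀ {a c h l k i u lk rem sa sc}, a ≤ D → c ≤ D → h ≤ D → l ≤ D → k ≤ D → i ≤ D →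
      u ≤ D → lk ≤ D → rem ≤ D → sa ≤ D → sc ≤ D → (r a c h l k i u lk rem sa sc).Le D :=
    fun _ _ _ _ _ _ _ _ _ _ _ => by
      rw [Rg.le_iff]; simp only [r]; omega
  let g1 := gs ++ (initHeadT M).map (TGate.inst (initEnv M K 0))
  let g2 := g1 ++ (List.range K).flatMap fun _ =>
      (initCellT M none false).map (TGate.inst (initEnv M K 0))
  let g3 := g2 ++ (List.range (K + 1)).flatMap fun i : ℕ =>
      (initCellT M (listArr u (0 + i)) (decide (i < nx))).map (TGate.inst (initEnv M K (K + i)))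
  have s1 : Spec Eq (copyCnt 8 15 7) (RG σ (r 0 0 0 0 0 0 b 0 nx 0 0) gs 0)
      (20 * (D * D)) (· = RG σ (r 0 0 0 0 0 0 b 0 nx b 0) gs 0) :=
    copy_spec (by decide) (by decide) (by decide) hD
      (le (by omega) (by omega) (by omega) (by omega) (by omega) (by omega) (by omega) (by omega)
        (by omega) (by omega) (by omega))
      (Rg.upd15 _ _)
  have s2 : Spec Eq (incBy 6 (3 + nL M)) (RG σ (r 0 0 0 0 0 0 b 0 nx b 0) gs 0)
      ((2 * (3 + nL M) + 2) * (D * D)) (· = RG σ (r 0 0 0 0 0 N b 0 nx b 0) gs 0) := by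
    rw [← hN]
    refine incBy_spec hD ?_
    rw [show (r 0 0 0 0 0 0 b 0 nx b 0).toF 6 = 0 from rfl, zero_add]
    exact Rg.upd6 _ _
  have s3 : Spec Eq (blk (initHeadT M)) (RG σ (r 0 0 0 0 0 N b 0 nx b 0) gs 0)
      (c₁ * (D * D)) (· = RG σ (r 0 0 0 0 0 N (b + H) 0 nx b 0) g1 0) := by
    refine (h₁ σ (r 0 0 0 0 0 N b 0 nx b 0) gs 0 D hD
      (le (by omega) (by omega) (by omega) (by omega) (by omega) (by omega) (by omega) (by omega)
        (by omega) (by omega) (by omega))).mono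
      (hD1 _) fun _ h => ?_
    rw [h, e1]
  have s4 : Spec Eq (copyCnt 10 9 7) (RG σ (r 0 0 0 0 0 N (b + H) 0 nx b 0) g1 0)
      (20 * (D * D)) (· = RG σ (r 0 0 0 0 0 N (b + H) K nx b 0) g1 0) :=
    copy_spec (by decide) (by decide) (by decide) hD
      (le (by omega) (by omega) (by omega) (by omega) (by omega) (by omega) (by omega) (by omega)
        (by omega) (by omega) (by omega))
      (Rg.upd9 _ _)
  have s5 : Spec Eq (leftCellsProg M) (RG σ (r 0 0 0 0 0 N (b + H) K nx b 0) g1 0)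
      (c₂ * (D * D)) (· = RG σ (r 0 0 0 0 0 N (b + H + x) 0 nx b 0) g2 0) := by
    refine (h₂ σ (r 0 0 0 0 0 N (b + H) K nx b 0) g1 0 D hD
      (le (by omega) (by omega) (by omega) (by omega) (by omega) (by omega) (by omega) (by omega)
        (by omega) (by omega) (by omega))
      (by simp only [r, ← hx]; omega)).mono le_rfl fun _ h => ?_
    rw [h, e2]
    simp only [r, ← hx]
    rfl
  have s6 : Spec Eq (copyCnt 8 16 7) (RG σ (r 0 0 0 0 0 N (b + H + x) 0 nx b 0) g2 0)
      (20 * (D * D)) (· = RG σ (r 0 0 0 0 0 N (b + H + x) 0 nx b (b + H + x)) g2 0) :=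
    copy_spec (by decide) (by decide) (by decide) hD
      (le (by omega) (by omega) (by omega) (by omega) (by omega) (by omega) (by omega) (by omega)
        (by omega) (by omega) (by omega))
      (Rg.upd16 _ _)
  have s7 : Spec Eq (copyCnt 10 9 7) (RG σ (r 0 0 0 0 0 N (b + H + x) 0 nx b (b + H + x)) g2 0)
      (20 * (D * D)) (· = RG σ (r 0 0 0 0 0 N (b + H + x) K nx b (b + H + x)) g2 0) :=
    copy_spec (by decide) (by decide) (by decide) hD
      (le (by omega) (by omega) (by omega) (by omega) (by omega) (by omega) (by omega) (by omega)
        (by omega) (by omega) (by omega))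
      (Rg.upd9 _ _)
  have s8 : Spec Eq (incBy 9 1) (RG σ (r 0 0 0 0 0 N (b + H + x) K nx b (b + H + x)) g2 0)
      ((2 * 1 + 2) * (D * D)) (· = RG σ (r 0 0 0 0 0 N (b + H + x) (K + 1) nx b (b + H + x)) g2 0) := 
    incBy_spec hD (Rg.upd9 _ _)
  have s9 : Spec Eq (rightCellsProg M) (RG σ (r 0 0 0 0 0 N (b + H + x) (K + 1) nx b (b + H + x)) g2 0)
      (c₃ * (D * D)) (· = RG σ (r 0 0 0 0 0 (N + (K + 1)) (b + H + x + y) 0 (nx - (K + 1)) b (b + H + x)) g3 (K + 1 : ℕ)) := by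
    refine (h₃ σ (r 0 0 0 0 0 N (b + H + x) (K + 1) nx b (b + H + x)) g2 0 D hD
      (le (by omega) (by omega) (by omega) (by omega) (by omega) (by omega) (by omega) (by omega)
        (by omega) (by omega) (by omega))
      (by simp only [r, ← hy]; omega) (by simp only [r]; omega)).mono le_rfl fun _ h => ?_
    rw [h]
    simp only [r] at e3 ⊢
    simp only [e3, ← hy, hu, zero_add]
    simp only [g3, zero_add]
  have s10 : Spec Eq (copyCnt 15 1 7) (RG σ (r 0 0 0 0 0 (N + (K + 1)) (b + H + x + y) 0 (nx - (K + 1)) b (b + H + x)) g3 (K + 1 : ℕ))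
      (20 * (D * D)) (· = RG σ (r b 0 0 0 0 (N + (K + 1)) (b + H + x + y) 0 (nx - (K + 1)) b (b + H + x)) g3 (K + 1 : ℕ)) :=
    copy_spec (by decide) (by decide) (by decide) hD
      (le (by omega) (by omega) (by omega) (by omega) (by omega) (by omega) (by omega) (by omega)
        (by omega) (by omega) (by omega))
      (Rg.upd1 _ _)
  have s11 : Spec Eq (copyCnt 15 3 7) (RG σ (r b 0 0 0 0 (N + (K + 1)) (b + H + x + y) 0 (nx - (K + 1)) b (b + H + x)) g3 (K + 1 : ℕ))
      (20 * (D * D)) (· = RG σ (r b 0 b 0 0 (N + (K + 1)) (b + H + x + y) 0 (nx - (K + 1)) b (b + H + x)) g3 (K + 1 : ℕ)) :=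
    copy_spec (by decide) (by decide) (by decide) hD
      (le (by omega) (by omega) (by omega) (by omega) (by omega) (by omega) (by omega) (by omega)
        (by omega) (by omega) (by omega))
      (Rg.upd3 _ _)
  have s12 : Spec Eq (copyCnt 16 2 7) (RG σ (r b 0 b 0 0 (N + (K + 1)) (b + H + x + y) 0 (nx - (K + 1)) b (b + H + x)) g3 (K + 1 : ℕ))
      (20 * (D * D)) (· = RG σ (r b (b + H + x) b 0 0 (N + (K + 1)) (b + H + x + y) 0 (nx - (K + 1)) b (b + H + x)) g3 (K + 1 : ℕ)) :=
    copy_spec (by decide) (by decide) (by decide) hD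
      (le (by omega) (by omega) (by omega) (by omega) (by omega) (by omega) (by omega) (by omega)
        (by omega) (by omega) (by omega))
      (Rg.upd2 _ _)
  have s13 : Spec Eq (copyCnt 8 5 7) (RG σ (r b (b + H + x) b 0 0 (N + (K + 1)) (b + H + x + y) 0 (nx - (K + 1)) b (b + H + x)) g3 (K + 1 : ℕ))
      (20 * (D * D)) (· = RG σ (r b (b + H + x) b 0 (b + H + x + y) (N + (K + 1)) (b + H + x + y) 0 (nx - (K + 1)) b (b + H + x)) g3 (K + 1 : ℕ)) :=
    copy_spec (by decide) (by decide) (by decide) hD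
      (le (by omega) (by omega) (by omega) (by omega) (by omega) (by omega) (by omega) (by omega)
        (by omega) (by omega) (by omega))
      (Rg.upd5 _ _)
  have s14 : Spec Eq (copyCnt 15 4 7) (RG σ (r b (b + H + x) b 0 (b + H + x + y) (N + (K + 1)) (b + H + x + y) 0 (nx - (K + 1)) b (b + H + x)) g3 (K + 1 : ℕ))
      (20 * (D * D)) (· = RG σ (r b (b + H + x) b b (b + H + x + y) (N + (K + 1)) (b + H + x + y) 0 (nx - (K + 1)) b (b + H + x)) g3 (K + 1 : ℕ)) :=
    copy_spec (by decide) (by decide) (by decide) hD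
      (le (by omega) (by omega) (by omega) (by omega) (by omega) (by omega) (by omega) (by omega)
        (by omega) (by omega) (by omega))
      (Rg.upd4 _ _)
  have s15 : Spec Eq (incBy 4 (headSize M - 2 * nQ M)) (RG σ (r b (b + H + x) b b (b + H + x + y) (N + (K + 1)) (b + H + x + y) 0 (nx - (K + 1)) b (b + H + x)) g3 (K + 1 : ℕ))
      ((2 * (headSize M - 2 * nQ M) + 2) * (D * D)) (· = RG σ (r b (b + H + x) b (b + (H - q)) (b + H + x + y) (N + (K + 1)) (b + H + x + y) 0 (nx - (K + 1)) b (b + H + x)) g3 (K + 1 : ℕ)) := by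
    rw [← hH, ← hq']
    exact incBy_spec hD ((Rg.upd4 _ _).trans (by simp only [r]; rfl))
  rw [r1]
  refine (Spec.seq_mul s1 <| Spec.seq_mul s2 <| Spec.seq_mul s3 <| Spec.seq_mul s4 <|
    Spec.seq_mul s5 <| Spec.seq_mul s6 <| Spec.seq_mul s7 <| Spec.seq_mul s8 <|
    Spec.seq_mul s9 <| Spec.seq_mul s10 <| Spec.seq_mul s11 <| Spec.seq_mul s12 <|
    Spec.seq_mul s13 <| Spec.seq_mul s14 s15).mono le_rfl fun _ h => ?_
  rw [h]
  simp only [g3, g2, g1, List.append_assoc]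

end Sim
end FiniteBSS
namespace FiniteBSS
namespace Sim

/-- Output all gates. -/
noncomputable def gatesProg (M : Machine) : Cmd 18 :=
  initProg M ;; loop 11 (layerProg M) ;; outProg M ;; starProg

/-- One layer costs `O(D ^ 2)` steps, and there are at most `D` of them. The final registers and the
position in the input no longer matter, so they are existentially quantified. -/
theorem gatesProg_spec (M : Machine) : ∃ c, ∀ σ D K T len m nx (u : List Bool),
    2 * simSize M nx T K ≤ D → 3 + nL M + (K + 1) ≤ D → T ≤ D → len ≤ D → m ≤ D → nx ≤ D →
    σ.arr 2 = listArr u →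
    Spec Eq (gatesProg M)
      (RG σ ⟨0, 0, 0, 0, 0, 0, 3 + nL M + nx, 0, K, T, len, m, nx, 0, 0⟩ [] 0) (c * (D * D * D))
      (fun σ' => ∃ r p,
        σ' = RG σ r (simGates M u nx T K ++ starGates (simSize M nx T K)) p) := by
  obtain ⟨c₁, h₁⟩ := initProg_spec M
  obtain ⟨c₂, h₂⟩ := layerProg_spec M
  obtain ⟨c₃, h₃⟩ := outProg_spec M
  obtain ⟨c₄, h₄⟩ := starProg_spec
  refine ⟨c₁ + ((c₂ + 4) + (c₃ + c₄)), fun σ D K T len m nx u hD hi hT hlen hm hnx hu => ?_⟩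
  have hD1 : 1 ≤ D := by rw [simSize] at hD; omega
  have hDD : ∀ c, c * (D * D) ≤ c * (D * D * D) := fun c =>
    Nat.mul_le_mul_left _ (Nat.le_mul_of_pos_right _ hD1)
  obtain ⟨S, hS⟩ : ∃ S, S = layerSize M K := ⟨_, rfl⟩
  obtain ⟨b, hb⟩ : ∃ b, b = 3 + nL M + nx := ⟨_, rfl⟩
  obtain ⟨inp, hinp⟩ : ∃ inp, inp = 3 + nL M + (K + 1) := ⟨_, rfl⟩
  have hHS : headSize M ≤ S := by rw [hS, layerSize]; omega
  have hsz : simSize M nx T K = b + T * S + S + nL M := by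
    rw [simSize, hb, hS]; ring
  rw [← hinp] at hi
  have hgates : simGates M u nx T K = initLayer M K u nx ++
      ((List.range T).flatMap fun τ => layer M K inp (b + τ * S) (b + τ * S + S)) ++
      (outT M).map (TGate.inst (layerEnv M K inp (b + T * S) (b + T * S + S) 0)) := by
    rw [simGates, ← hb, ← hS, ← hinp]
  have s1 := h₁ σ [] D K b T len m nx u hD1 (by rw [← hS]; nlinarith [Nat.zero_le (T * S)])
    (by omega) hT hlen hm hnx hu
  rw [← hinp, List.nil_append] at s1
  have s2 := Spec.loop_up (R := Eq) (i := 11) (p := layerProg M) (t := c₂ * (D * D)) (n := T)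
    (fun d j => RG σ (layerRg M K (b + d * S) inp j len m (nx - (K + 1)) b)
      (initLayer M K u nx ++
        (List.range d).flatMap fun τ => layer M K inp (b + τ * S) (b + τ * S + S)) (K + 1 : ℕ))
    (fun d j => by rw [RG_cnt]; rfl) (fun d j => RG_setc _ _ (Rg.upd11 _ _))
    (fun d j hj => by
      have hle : (d + 1) * S ≤ T * S := Nat.mul_le_mul_right _ (by omega)
      rw [add_mul, one_mul] at hle
      have := h₂ σ (initLayer M K u nx ++
        (List.range d).flatMap fun τ => layer M K inp (b + τ * S) (b + τ * S + S)) (K + 1 : ℕ) D K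
        (b + d * S) inp j len m (nx - (K + 1)) b hD1 (by rw [← hS]; omega) hi (by omega) hlen hm
        (by omega) (by omega) (by omega)
      refine this.mono le_rfl fun _ h => ?_
      rw [h, List.range_succ, List.flatMap_append, List.flatMap_singleton, ← List.append_assoc,
        add_mul, one_mul, ← add_assoc, ← hS])
  have s2' := s2.mono (t' := (c₂ + 4) * (D * D * D))
    (by
      calc T * (c₂ * (D * D) + 3) + 1 ≤ D * (c₂ * (D * D) + 3 * (D * D)) + D * D * D := by
            gcongr
            · nlinarith
            · have : 1 ≤ D * D := Nat.mul_pos hD1 hD1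
              nlinarith
        _ = _ := by ring)
    fun _ h => h
  rw [zero_mul, add_zero, List.range_zero, List.flatMap_nil, List.append_nil] at s2'
  have s3 := h₃ σ (initLayer M K u nx ++
        (List.range T).flatMap fun τ => layer M K inp (b + τ * S) (b + τ * S + S)) (K + 1 : ℕ) D K
        (b + T * S) inp 0 len m (nx - (K + 1)) b hD1 (by rw [← hS]; omega) hi (by omega) hlen hm
        (by omega) (by omega) (by omega)
  rw [← hS, ← hgates] at s3
  have hx : K * (2 * nQ M) ≤ S := by
    rw [hS, layerSize]; nlinarith [Nat.zero_le (headSize M), Nat.zero_le (K * (2 * nQ M))]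
  have s4 := h₄ σ { layerRg M K (b + T * S) inp 0 len m (nx - (K + 1)) b with
          head := b + T * S + S, block := b + T * S + S + headSize M
          cur := b + T * S + S + nL M } (simGates M u nx T K) (K + 1 : ℕ) D hD1
    (by
      have hle : headSize M + K * (2 * nQ M) ≤ S := by
        rw [hS, layerSize]; nlinarith [Nat.zero_le (K * (2 * nQ M))]
      rw [Rg.le_iff, layerRg]
      simp only
      rw [hsz] at hD
      omega)
    (by simp only; omega)
  simp only [← hsz] at s4 s3
  have s1' := s1.mono (hDD _) fun _ h => h
  have s3' := s3.mono (hDD _) fun _ h => h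
  have s4' := s4.mono (hDD _) fun _ h => h
  have s34 := Spec.seq_mul s3' s4'
  have s := Spec.seq_mul s1' (Spec.seq_mul s2' s34)
  rw [← hb]
  refine Spec.mono (p := gatesProg M) s le_rfl ?_
  intro σ' h
  exact ⟨_, _, h⟩

end Sim
end FiniteBSS
namespace FiniteBSS

/-! ### Rewinding of heads, and arrays that hold lists -/

section
variable {k : ℕ} {R : ℝ → ℝ → Prop} [IsSerial R]

def St.setpos (σ : St k) (a : Fin 3) (v : ℤ) : St k :=
  { σ with pos := Function.update σ.pos a v }

/-- Move the head of an array to the left until the symbol to its left is a blank. -/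
def rewind (a : Fin 3) : Cmd k :=
  .act (.move a .left) ;; .whil (.nbit a none) (.act (.move a .left)) ;; .act (.move a .right)

theorem Spec.rewind (a : Fin 3) (σ : St k) (n : ℕ) (hb : σ.arr a (σ.pos a - n - 1) = none)
    (hs : ∀ i < n, σ.arr a (σ.pos a - n + i) ≠ none) :
    Spec R (rewind a) σ (3 * n + 5) (· = σ.setpos a (σ.pos a - n)) := by
  have h1 : Spec R (.act (.move a .left)) σ 2 (· = σ.setpos a (σ.pos a - n - 1 + n)) :=
    Spec.act_eq (by
      show _ = _
      rw [show σ.pos a - n - 1 + n = σ.pos a + dirStep .left by simp only [dirStep]; ring]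
      rfl)
  have h2 := Spec.whil_inv (R := R) (b := .nbit a none) (p := .act (.move a .left)) (t := 2)
    (fun j τ => τ = σ.setpos a (σ.pos a - n - 1 + j) ∧ j ≤ n)
    (fun j τ hj => by
      rw [hj.1, Test.Holds]
      simp only [St.setpos, Function.update_self]
      cases j with
      | zero => simp [hb]
      | succ j =>
        have := hs j (by omega)
        rw [show σ.pos a - n - 1 + ((j + 1 : ℕ) : ℤ) = σ.pos a - n + j by push_cast; ring]
        simpa using this)
    (fun j τ hj => Spec.act ⟨j, le_rfl, by
      rw [hj.1]
      simp only [St.setpos, Function.update_self, Function.update_idem]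
      rw [show σ.pos a - n - 1 + ((j + 1 : ℕ) : ℤ) + dirStep .left = σ.pos a - n - 1 + j by
        simp only [dirStep]; push_cast; ring], by omega⟩)
    n _ ⟨rfl, le_rfl⟩
  refine (Spec.seq_eq h1 (Spec.seq (h2.mono le_rfl fun τ hτ => Spec.act_eq ?_))).mono (by omega)
    fun _ h => h
  rw [hτ.1]
  simp only [Act.Post, St.setpos, Function.update_self, Function.update_idem, dirStep]
  congr 2
  push_cast
  ring

theorem listArr_ne_none {l : List Bool} {i : ℕ} (h : i < l.length) : listArr l i ≠ none := by
  simp [listArr, h]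

theorem listArr_eq_none {l : List Bool} {j : ℤ} (h : j < 0 ∨ l.length ≤ j) : listArr l j = none := by
  rw [listArr]
  split_ifs with h0
  · rw [List.getElem?_eq_none_iff]
    omega
  · rfl

theorem Spec.rewind_list (a : Fin 3) (σ : St k) (l : List Bool) (ha : σ.arr a = listArr l)
    (hp : σ.pos a = l.length) :
    Spec R (FiniteBSS.rewind a) σ (3 * l.length + 5) (· = σ.setpos a 0) := by
  have := Spec.rewind (R := R) a σ l.length
    (by rw [ha, hp]; exact listArr_eq_none (Or.inl (by omega)))
    (fun i hi => by
      rw [ha, hp, show (l.length : ℤ) - l.length + i = i by ring]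
      exact listArr_ne_none hi)
  rwa [hp, sub_self] at this

theorem update_listArr (l : List Bool) (b : Bool) :
    Function.update (listArr l) l.length (some b) = listArr (l ++ [b]) := by
  funext j
  by_cases h : j = l.length
  · subst h
    simp [listArr]
  · rw [Function.update_of_ne h]
    simp only [listArr]
    split_ifs with h0
    · by_cases h1 : j.toNat < l.length
      · rw [List.getElem?_append_left h1]
      · rw [List.getElem?_eq_none (by omega), List.getElem?_eq_none]
        simp
        omega
    · rfl

end

namespace Sim

/-! ### Reading the input -/

/-- Copy the bits of the input to array `2`, and count the bits and the reals. -/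
def countProg : Cmd 18 :=
  .whil (.nbit 0 none)
    (.ite (.bit 0 (some true)) (.act (.write 2 (some true))) (.act (.write 2 (some false))) ;;
      .act (.move 0 .right) ;; .act (.move 2 .right) ;; .act (.inc 12)) ;;
  .whil (.nbit 1 none) (.act (.move 1 .right) ;; .act (.inc 14) ;; .act (.inc 12)) ;;
  -- The output will be printed on array `0` behind the input. One blank is left between them; the
  -- final rewinding stops there.
  rewind 1 ;; rewind 2 ;; .act (.move 0 .right)

/-- The state after the input has been read. -/
def readState (w : Instance) : St 18 where
  cnt _ := 0
  arr a := if a = 0 then listArr w.1 else if a = 1 then listArr (List.replicate w.2.length true)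
    else listArr w.1
  pos := Function.update (fun _ => 0) 0 (w.1.length + 1)
  main := listReal w.2
  mpos := 0
  reg _ := 0

theorem countProg_spec (w : Instance) :
    Spec Eq countProg (St.init 18 w w.2) (25 * w.len + 20)
      (· = RG (readState w) ⟨0, 0, 0, 0, 0, 0, 0, 0, 0, 0, w.len, 0, w.2.length, 0, 0⟩ [] 0) := by
  obtain ⟨u, x⟩ := w
  let F (i : ℕ) : St 18 :=
    { cnt := Function.update (fun _ => 0) 12 i
      arr := Function.update (St.init 18 (u, x) x).arr 2 (listArr (u.take i))
      pos := Function.update (Function.update (fun _ => 0) 0 (i : ℤ)) 2 i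
      main := listReal x, mpos := 0, reg := fun _ => 0 }
  have hF0 : St.init 18 (u, x) x = F 0 := by
    refine St.ext ?_ ?_ ?_ rfl rfl rfl
    · funext i; simp [F, St.init]
    · funext a
      by_cases h : a = 2
      · subst h; funext j; simp [F, St.init, listArr]
      · simp [F, Function.update_of_ne h]
    · funext a; fin_cases a <;> rfl
  have h1 := Spec.whil_inv (R := Eq) (b := .nbit 0 none) (p :=
      .ite (.bit 0 (some true)) (.act (.write 2 (some true))) (.act (.write 2 (some false))) ;;
      .act (.move 0 .right) ;; .act (.move 2 .right) ;; .act (.inc 12)) (t := 9)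
    (fun j τ => ∃ i, i + j = u.length ∧ τ = F i)
    (fun j τ ⟨i, hi, hτ⟩ => by
      rw [hτ]
      have : (F i).arr 0 ((F i).pos 0) = u[i]? := by
        simp [F, St.init, listArr]
      rw [Test.Holds, this]
      simp only [ne_eq, List.getElem?_eq_none_iff]
      omega)
    (fun j τ ⟨i, hi, hτ⟩ => by
      have hiu : i < u.length := by omega
      have e0 : (F i).arr 0 ((F i).pos 0) = some u[i] := by
        simp [F, St.init, listArr, hiu]
      have hw : Spec Eq (.ite (.bit 0 (some true)) (.act (.write 2 (some true)))
          (.act (.write 2 (some false)))) (F i) 3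
          (· = { F i with arr := Function.update (F i).arr 2 (listArr (u.take (i + 1))) }) := by
        have hl : (u.take i).length = i := by simp; omega
        have e2 : Function.update ((F i).arr 2) ((F i).pos 2) (some u[i]) =
            listArr (u.take (i + 1)) := by
          rw [List.take_succ_eq_append_getElem hiu, ← update_listArr, hl]
          simp [F]
        refine Spec.ite (fun h => Spec.act_eq ?_) fun h => Spec.act_eq ?_
        · rw [Test.Holds, e0] at h
          simp only [Act.Post]
          rw [← h, e2]
        · rw [Test.Holds, e0] at h
          have : some false = some u[i] := by cases h : u[i] <;> simp_all
          simp only [Act.Post]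
          rw [this, e2]
      rw [hτ]
      refine Spec.mono (Spec.seq_eq hw (Spec.seq_eq (Spec.act_eq rfl) (Spec.seq_eq
        (Spec.act_eq rfl) (Spec.act (Q := fun τ => τ = F (i + 1)) ?_)))) le_rfl
        fun τ hτ => ⟨j, le_rfl, i + 1, by omega, hτ⟩
      refine St.ext ?_ ?_ ?_ rfl rfl rfl
      · funext c
        simp [F, St.setc]
      · simp [F, St.setc]
      · funext a
        fin_cases a <;> simp [F, St.setc, dirStep])
    u.length (F 0) ⟨0, by omega, rfl⟩
  let G (i : ℕ) : St 18 := { F u.length with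
    cnt := Function.update (Function.update (fun _ => 0) 12 (u.length + i)) 14 i
    pos := Function.update (F u.length).pos 1 (i : ℤ) }
  have hG0 : F u.length = G 0 := by
    refine St.ext ?_ rfl ?_ rfl rfl rfl
    · funext c
      by_cases h : c = 14
      · subst h; rfl
      · simp [G, F, Function.update_of_ne h]
    · funext a; fin_cases a <;> rfl
  have harr1 : ∀ i, (G i).arr 1 = listArr (List.replicate x.length true) := fun i => rfl
  have h2 := Spec.whil_inv (R := Eq) (b := .nbit 1 none) (p :=
      .act (.move 1 .right) ;; .act (.inc 14) ;; .act (.inc 12)) (t := 6)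
    (fun j τ => ∃ i, i + j = x.length ∧ τ = G i)
    (fun j τ ⟨i, hi, hτ⟩ => by
      rw [hτ, Test.Holds, harr1]
      have : (G i).pos 1 = i := rfl
      rw [this]
      rcases Nat.eq_zero_or_pos j with h | h
      · simp only [h, ne_eq, not_true, iff_false, not_not]
        exact listArr_eq_none (Or.inr (by simp; omega))
      · simp only [h.ne', ne_eq, not_false_iff, iff_true]
        exact listArr_ne_none (by simp; omega))
    (fun j τ ⟨i, hi, hτ⟩ => by
      rw [hτ]
      refine Spec.mono (Spec.seq_eq (Spec.act_eq rfl) (Spec.seq_eq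
        (Spec.act_eq rfl) (Spec.act (Q := fun τ => τ = G (i + 1)) ?_))) le_rfl
        fun τ hτ => ⟨j, le_rfl, i + 1, by omega, hτ⟩
      refine St.ext ?_ rfl ?_ rfl rfl rfl
      · funext c
        by_cases h : c = 14
        · subst h; rfl
        · by_cases h' : c = 12
          · subst h'; simp [G, St.setc]; omega
          · simp [G, St.setc, h, h']
      · funext a
        fin_cases a <;> simp [G, F, St.setc, dirStep])
    x.length (G 0) ⟨0, by omega, rfl⟩
  have h3 := Spec.rewind_list (R := Eq) 1 (G x.length) _ (harr1 _) (by simp [G])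
  have h4 := Spec.rewind_list (R := Eq) 2 ((G x.length).setpos 1 0) u
    (by simp [G, F, St.setpos]) (by simp [G, F, St.setpos])
  rw [hF0]
  refine Spec.mono (Spec.seq (t' := 10 * x.length + 3 * u.length + 13)
    (h1.mono le_rfl fun τ hτ => ?_)) ?_ fun _ h => h
  · obtain ⟨i, hi, rfl⟩ := hτ
    rw [show i = u.length by omega, hG0]
    refine Spec.mono (Spec.seq (t' := 3 * x.length + 3 * u.length + 12)
      (h2.mono le_rfl fun τ hτ => ?_)) (by omega) fun _ h => h
    obtain ⟨i, hi, rfl⟩ := hτ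
    rw [show i = x.length by omega]
    refine (Spec.seq_eq h3 (Spec.seq_eq h4 (Spec.act_eq ?_))).mono (by simp; omega) fun _ h => h
    refine St.ext ?_ ?_ ?_ rfl rfl rfl
    · funext c
      fin_cases c <;> rfl
    · funext a
      fin_cases a <;> simp [G, F, RG, readState, St.setpos, St.init, St.emit]
    · funext a
      fin_cases a <;> simp [G, F, RG, readState, St.setpos, St.init, St.emit, dirStep]
  · simp [Instance.len]
    omega

end Sim
end FiniteBSS
namespace FiniteBSS

/-! ### Displaying the result -/

section
variable {k : ℕ}

theorem St.emit_pos_zero (l : List Bool) : ∀ σ : St k,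
    (St.emit l σ).pos 0 = σ.pos 0 + l.length := by
  induction l with
  | nil => intro σ; simp [St.emit]
  | cons b l ih =>
    intro σ
    rw [St.emit, ih]
    simp
    ring

theorem St.emit_arr_zero_lt (l : List Bool) : ∀ (σ : St k) {j : ℤ}, j < σ.pos 0 →
    (St.emit l σ).arr 0 j = σ.arr 0 j := by
  induction l with
  | nil => intro σ j _; rfl
  | cons b l ih =>
    intro σ j hj
    rw [St.emit, ih]
    · simp [hj.ne]
    · simp
      omega

theorem St.emit_arr_zero_ge (l : List Bool) : ∀ (σ : St k), (∀ j, σ.pos 0 ≤ j → σ.arr 0 j = none) →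
    ∀ i : ℕ, (St.emit l σ).arr 0 (σ.pos 0 + i) = l[i]? := by
  induction l with
  | nil => intro σ h i; exact h _ (by omega)
  | cons b l ih =>
    intro σ h i
    cases i with
    | zero =>
      rw [St.emit, St.emit_arr_zero_lt]
      · simp
      · simp
    | succ i =>
      rw [St.emit]
      have := ih { σ with
        arr := Function.update σ.arr 0 (Function.update (σ.arr 0) (σ.pos 0) (some b))
        pos := Function.update σ.pos 0 (σ.pos 0 + 1) } (fun j hj => by
          simp only [Function.update_self] at hj ⊢
          rw [Function.update_of_ne (by omega)]
          exact h j (by omega)) i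
      simp only [Function.update_self] at this
      rw [show σ.pos 0 + ((i + 1 : ℕ) : ℤ) = σ.pos 0 + 1 + i by push_cast; ring, this]
      simp

/-- The reals `z` are displayed by the state. -/
structure St.ShowsReals (σ : St k) (z : List ℝ) : Prop where
  ones : ∀ i : ℕ, i < z.length → σ.arr 1 (σ.pos 1 + i) = some true
  blank : σ.arr 1 (σ.pos 1 + z.length) = none
  reals : ∀ (i : ℕ) (h : i < z.length), σ.main (σ.mpos + i) = z[i]

/-- Put reals in front of the reals that are displayed. -/
def pushReals : List ℝ → Cmd k
  | [] => .act .skip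
  | a :: l => pushReals l ;; .act (.moveMain .left) ;; .act (.const a) ;; .act (.move 1 .left) ;;
      .act (.write 1 (some true))

theorem pushReals_isDiscrete : ∀ l : List ℝ, (pushReals l : Cmd k).IsDiscrete
  | [] => trivial
  | _ :: l => ⟨pushReals_isDiscrete l, trivial, trivial, trivial, trivial⟩

theorem St.ShowsReals.push {σ : St k} {z : List ℝ} (h : σ.ShowsReals z) (a : ℝ) :
    St.ShowsReals { σ with
      main := Function.update σ.main (σ.mpos + dirStep .left) a
      mpos := σ.mpos + dirStep .left
      pos := Function.update σ.pos 1 (σ.pos 1 + dirStep .left)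
      arr := Function.update σ.arr 1 (Function.update (σ.arr 1) (σ.pos 1 + dirStep .left)
        (some true)) } (a :: z) := by
  refine ⟨fun i hi => ?_, ?_, fun i hi => ?_⟩
  · simp only [Function.update_self]
    cases i with
    | zero => simp
    | succ i =>
      rw [Function.update_of_ne (by push_cast; omega), show
        σ.pos 1 + dirStep .left + ((i + 1 : ℕ) : ℤ) = σ.pos 1 + i by simp [dirStep]; ring]
      exact h.ones i (by simpa using hi)
  · simp only [Function.update_self, List.length_cons]
    rw [Function.update_of_ne (by push_cast; omega), show
        σ.pos 1 + dirStep .left + ((z.length + 1 : ℕ) : ℤ) = σ.pos 1 + z.length by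
      simp [dirStep]; ring]
    exact h.blank
  · simp only
    cases i with
    | zero => simp
    | succ i =>
      rw [Function.update_of_ne (by push_cast; omega), show
        σ.mpos + dirStep .left + ((i + 1 : ℕ) : ℤ) = σ.mpos + i by simp [dirStep]; ring]
      simpa using h.reals i (by simpa using hi)

theorem pushReals_spec (l : List ℝ) (σ : St k) (z : List ℝ) (h : σ.ShowsReals z) :
    Spec Eq (pushReals l) σ (8 * l.length + 2) (fun σ' =>
      σ'.ShowsReals (l ++ z) ∧ σ'.arr 0 = σ.arr 0 ∧ σ'.pos 0 = σ.pos 0) := by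
  induction l with
  | nil => exact Spec.act ⟨h, rfl, rfl⟩
  | cons a l ih =>
    refine Spec.mono (t := 8 * l.length + 2 + (2 + (2 + (2 + 2)))) (Spec.seq (ih.mono le_rfl fun τ hτ => ?_))
      (by simp; omega) fun _ h => h
    refine Spec.seq_eq (Spec.act_eq rfl) (Spec.seq (Spec.act fun v hv => ?_))
    subst hv
    refine Spec.seq_eq (Spec.act_eq rfl) (Spec.act ⟨?_, ?_, ?_⟩)
    · have := hτ.1.push a
      convert this using 2 <;> simp
    · rw [← hτ.2.1]; simp
    · rw [← hτ.2.2]; simp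

end

theorem Gate.length_code_le {g : Gate} {N : ℕ} (h : ∀ a ∈ g.parents, a < N) :
    g.code.length ≤ 5 + 3 * N := by
  have hc : ∀ n, (natCode n).length = n + 1 := fun n => by simp [natCode]
  cases g with
  | arith op a b =>
    have ha := h a (by simp [Gate.parents])
    have hb := h b (by simp [Gate.parents])
    have ho : op.code.length ≤ 4 := by cases op <;> simp [ArithOp.code, hc]
    simp only [Gate.code, List.length_append, hc]
    omega
  | select a b c =>
    have ha := h a (by simp [Gate.parents])
    have hb := h b (by simp [Gate.parents])
    have hb := h c (by simp [Gate.parents])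
    simp only [Gate.code, List.length_append, hc]
    omega

/-- The numbers of the parents are less than the number of nodes, so even the unary code is only
quadratically long. -/
theorem Circuit.Valid.length_code_le {C : Circuit} (h : C.Valid) :
    C.code.1.length ≤ C.numInputs + 1 + C.gates.length * (5 + 3 * C.numNodes) := by
  have : ∀ g ∈ C.gates, g.code.length ≤ 5 + 3 * C.numNodes := by
    intro g hg
    refine Gate.length_code_le fun a ha => ?_
    obtain ⟨t, ht, rfl⟩ := List.getElem_of_mem hg
    have h1 := h.1 a (C.numLeaves + t) ⟨⟨t, ht⟩, rfl, ha⟩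
    rw [Circuit.numNodes]
    omega
  simp only [Circuit.code, List.length_append, List.length_flatMap, natCode, List.length_replicate,
    List.length_singleton]
  have h2 := List.sum_le_card_nsmul (C.gates.map fun g => g.code.length) (5 + 3 * C.numNodes)
    (by simpa using this)
  simpa using h2

end FiniteBSS
namespace FiniteBSS

/-! ### The complete reduction, and its discreteness -/

section
variable {k : ℕ}

theorem incBy_isDiscrete (i : Fin k) : ∀ n, (incBy i n).IsDiscrete
  | 0 => trivial
  | n + 1 => ⟨trivial, incBy_isDiscrete i n⟩

theorem emitBits_isDiscrete : ∀ l : List Bool, (emitBits l : Cmd k).IsDiscrete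
  | [] => trivial
  | _ :: l => ⟨⟨trivial, trivial⟩, emitBits_isDiscrete l⟩

theorem clear_isDiscrete (i : Fin k) : (clear i).IsDiscrete := ⟨trivial, trivial, trivial⟩

theorem addCnt_isDiscrete (i j s : Fin k) : (addCnt i j s).IsDiscrete :=
  ⟨⟨trivial, trivial, trivial, trivial⟩, trivial, trivial, trivial⟩

theorem copyCnt_isDiscrete (i j s : Fin k) : (copyCnt i j s).IsDiscrete :=
  ⟨clear_isDiscrete _, addCnt_isDiscrete _ _ _⟩

theorem emitNat_isDiscrete (i s : Fin k) (n : ℕ) : (emitNat i s n).IsDiscrete :=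
  ⟨⟨trivial, trivial, trivial, trivial, trivial⟩, ⟨trivial, trivial, trivial⟩,
    emitBits_isDiscrete _⟩

theorem rewind_isDiscrete (a : Fin 3) : (rewind a : Cmd k).IsDiscrete :=
  ⟨trivial, ⟨trivial, trivial⟩, trivial⟩

end

namespace Sim

theorem emitTs_isDiscrete : ∀ l, (emitTs l).IsDiscrete
  | [] => trivial
  | .arith _ _ _ :: l => ⟨⟨emitBits_isDiscrete _, emitNat_isDiscrete _ _ _,
      emitNat_isDiscrete _ _ _⟩, emitTs_isDiscrete l⟩
  | .select _ _ _ :: l => ⟨⟨emitBits_isDiscrete _, emitNat_isDiscrete _ _ _,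
      emitNat_isDiscrete _ _ _, emitNat_isDiscrete _ _ _⟩, emitTs_isDiscrete l⟩

theorem blk_isDiscrete (l : List TGate) : (blk l).IsDiscrete :=
  ⟨emitTs_isDiscrete l, incBy_isDiscrete _ _⟩

theorem initCellProg_isDiscrete (M : Machine) (s : Option Bool) : (initCellProg M s).IsDiscrete :=
  ⟨trivial, blk_isDiscrete _, trivial, blk_isDiscrete _⟩

theorem gatesProg_isDiscrete (M : Machine) : (gatesProg M).IsDiscrete := by
  simp only [gatesProg, initProg, layerProg, outProg, starProg, cellsProg, leftCellsProg,
    rightCellsProg, readCellProg, loop, Cmd.IsDiscrete, incBy_isDiscrete, blk_isDiscrete,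
    copyCnt_isDiscrete, clear_isDiscrete, initCellProg_isDiscrete, Act.IsDiscrete,
    Test.IsDiscrete, and_self]

theorem countProg_isDiscrete : countProg.IsDiscrete := by
  simp only [countProg, Cmd.IsDiscrete, rewind_isDiscrete, Act.IsDiscrete, Test.IsDiscrete,
    and_self]

/-- Compute the parameters of the circuit, where `P` and `Q` evaluate polynomials. -/
noncomputable def paramProg (M : Machine) (P Q : Cmd 18) : Cmd 18 :=
  -- Counter `13` gets the number `m` of certificate components, which is added to the number of
  -- reals (`14`) and to the length (`12`). Then `11` becomes the time bound of the verifier on the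
  -- extended input plus one, and `10` the radius, chosen equal to it.
  P ;; addCnt 13 14 7 ;; addCnt 13 12 7 ;; Q ;; incBy 11 1 ;; copyCnt 11 10 7 ;;
  copyCnt 14 8 7 ;; incBy 8 (3 + nL M)

theorem paramProg_spec (M : Machine) {P Q : Cmd 18} {p t tP tQ : Polynomial ℕ}
    (hP : ∀ (R : ℝ → ℝ → Prop) [IsSerial R] (σ : St 18), σ.cnt 13 = 0 → σ.cnt 17 = 0 →
      σ.cnt 7 = 0 → Spec R P σ (tP.eval (σ.cnt 12)) (· = σ.setc 13 (p.eval (σ.cnt 12))))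
    (hQ : ∀ (R : ℝ → ℝ → Prop) [IsSerial R] (σ : St 18), σ.cnt 11 = 0 → σ.cnt 17 = 0 →
      σ.cnt 7 = 0 → Spec R Q σ (tQ.eval (σ.cnt 12)) (· = σ.setc 11 (t.eval (σ.cnt 12))))
    (σ : St 18) (L n m T D : ℕ) (hm : m = p.eval L) (hT : T = t.eval (L + m) + 1) (hLD : L + m ≤ D)
    (hnD : n + m ≤ D) (hTD : T ≤ D) :
    Spec Eq (paramProg M P Q) (RG σ ⟨0, 0, 0, 0, 0, 0, 0, 0, 0, 0, L, 0, n, 0, 0⟩ [] 0)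
      (tP.eval L + tQ.eval (L + m) + (80 + 2 * nL M) * (D * D))
      (· = RG σ ⟨0, 0, 0, 0, 0, 0, 3 + nL M + (n + m), 0, T, T, L + m, m, n + m, 0, 0⟩ [] 0) := by
  have hD : 1 ≤ D := by omega
  have hDD : 1 ≤ D * D := Nat.mul_pos hD hD
  have hmD : m ≤ D * D := (show m ≤ D by omega).trans (Nat.le_mul_of_pos_right _ hD)
  let r (u K lt len m rem : ℕ) : Rg := ⟨0, 0, 0, 0, 0, 0, u, 0, K, lt, len, m, rem, 0, 0⟩
  have s1 : Spec Eq P (RG σ (r 0 0 0 L 0 n) [] 0) (tP.eval L)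
      (· = RG σ (r 0 0 0 L m n) [] 0) := by
    have := hP Eq (RG σ (r 0 0 0 L 0 n) [] 0) (by rw [RG_cnt]; rfl) (by rw [RG_cnt]; rfl)
      (by rw [RG_cnt]; rfl)
    rw [show (RG σ (r 0 0 0 L 0 n) [] 0).cnt 12 = L by rw [RG_cnt]; rfl, ← hm,
      RG_setc _ _ (Rg.upd13 _ _)] at this
    exact this
  have s2 : Spec Eq (addCnt 13 14 7) (RG σ (r 0 0 0 L m n) [] 0) (14 * (D * D))
      (· = RG σ (r 0 0 0 L m (n + m)) [] 0) := by
    have := Spec.addCnt (R := Eq) (i := 13) (j := 14) (s := 7) (by decide) (by decide) (by decide)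
      (RG σ (r 0 0 0 L m n) [] 0) (by rw [RG_cnt]; rfl)
    rw [show (RG σ (r 0 0 0 L m n) [] 0).cnt 13 = m by rw [RG_cnt]; rfl,
      show (RG σ (r 0 0 0 L m n) [] 0).cnt 14 = n by rw [RG_cnt]; rfl,
      RG_setc _ _ (Rg.upd14 _ _)] at this
    exact this.mono (by omega) fun _ h => h
  have s3 : Spec Eq (addCnt 13 12 7) (RG σ (r 0 0 0 L m (n + m)) [] 0) (14 * (D * D))
      (· = RG σ (r 0 0 0 (L + m) m (n + m)) [] 0) := by
    have := Spec.addCnt (R := Eq) (i := 13) (j := 12) (s := 7) (by decide) (by decide) (by decide)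
      (RG σ (r 0 0 0 L m (n + m)) [] 0) (by rw [RG_cnt]; rfl)
    rw [show (RG σ (r 0 0 0 L m (n + m)) [] 0).cnt 13 = m by rw [RG_cnt]; rfl,
      show (RG σ (r 0 0 0 L m (n + m)) [] 0).cnt 12 = L by rw [RG_cnt]; rfl,
      RG_setc _ _ (Rg.upd12 _ _)] at this
    exact this.mono (by omega) fun _ h => h
  have s4 : Spec Eq Q (RG σ (r 0 0 0 (L + m) m (n + m)) [] 0) (tQ.eval (L + m))
      (· = RG σ (r 0 0 (t.eval (L + m)) (L + m) m (n + m)) [] 0) := by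
    have := hQ Eq (RG σ (r 0 0 0 (L + m) m (n + m)) [] 0) (by rw [RG_cnt]; rfl)
      (by rw [RG_cnt]; rfl) (by rw [RG_cnt]; rfl)
    rw [show (RG σ (r 0 0 0 (L + m) m (n + m)) [] 0).cnt 12 = L + m by rw [RG_cnt]; rfl,
      RG_setc _ _ (Rg.upd11 _ _)] at this
    exact this
  have s5 : Spec Eq (incBy 11 1) (RG σ (r 0 0 (t.eval (L + m)) (L + m) m (n + m)) [] 0)
      ((2 * 1 + 2) * (D * D)) (· = RG σ (r 0 0 T (L + m) m (n + m)) [] 0) :=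
    incBy_spec hD (by rw [hT]; exact Rg.upd11 _ _)
  have le : ∀ {u K lt len m rem}, u ≤ D → K ≤ D → lt ≤ D → len ≤ D → m ≤ D → rem ≤ D →
      (r u K lt len m rem).Le D := fun _ _ _ _ _ _ => by
    rw [Rg.le_iff]; simp only [r]; omega
  have s6 : Spec Eq (copyCnt 11 10 7) (RG σ (r 0 0 T (L + m) m (n + m)) [] 0)
      (20 * (D * D)) (· = RG σ (r 0 T T (L + m) m (n + m)) [] 0) :=
    copy_spec (by decide) (by decide) (by decide) hD
      (le (by omega) (by omega) (by omega) (by omega) (by omega) (by omega)) (Rg.upd10 _ _)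
  have s7 : Spec Eq (copyCnt 14 8 7) (RG σ (r 0 T T (L + m) m (n + m)) [] 0)
      (20 * (D * D)) (· = RG σ (r (n + m) T T (L + m) m (n + m)) [] 0) :=
    copy_spec (by decide) (by decide) (by decide) hD
      (le (by omega) (by omega) (by omega) (by omega) (by omega) (by omega)) (Rg.upd8 _ _)
  have s8 : Spec Eq (incBy 8 (3 + nL M)) (RG σ (r (n + m) T T (L + m) m (n + m)) [] 0)
      ((2 * (3 + nL M) + 2) * (D * D))
      (· = RG σ (r (3 + nL M + (n + m)) T T (L + m) m (n + m)) [] 0) :=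
    incBy_spec hD (by rw [add_comm (3 + nL M)]; exact Rg.upd8 _ _)
  refine (Spec.seq_eq s1 <| Spec.seq_eq s2 <| Spec.seq_eq s3 <| Spec.seq_eq s4 <|
    Spec.seq_eq s5 <| Spec.seq_eq s6 <| Spec.seq_eq s7 s8).mono ?_ fun _ h => h
  ring_nf
  omega

/-- The program that outputs the circuit. -/
noncomputable def redProg (M : Machine) (P Q : Cmd 18) : Cmd 18 :=
  -- The code starts with the number of inputs. The real tape is touched only at the end, when the
  -- constants of the machine are placed to the left of the given reals.
  countProg ;; paramProg M P Q ;; emitNat 13 7 0 ;; gatesProg M ;; rewind 0 ;;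
    pushReals (simConsts M)

/-- Absorbs the code of the number of inputs, printed first, into the background state, so that the
specification for the gates applies with an empty list. -/
theorem RG_emit_eq (l : List Bool) (σ : St 18) (r : Rg) (p : ℤ) :
    St.emit l (RG σ r [] p) = RG (St.emit l σ) r [] p := by
  have : ∀ (l : List Bool) (σ : St 18) (c : Fin 18 → ℕ), { St.emit l σ with cnt := c } =
      St.emit l { σ with cnt := c } := by
    intro l
    induction l with
    | nil => intro σ c; rfl
    | cons b l ih => intro σ c; rw [St.emit, ih]; rfl
  simp only [RG, List.flatMap_nil]
  rw [show ∀ τ : St 18, St.emit [] τ = τ from fun τ => rfl,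
    show ∀ τ : St 18, St.emit [] τ = τ from fun τ => rfl]
  have h1 := St.emit_setpos l (a := 2) (by decide) p { σ with cnt := r.toF }
  rw [← h1, ← this]

/-- With `T` one more than the time bound, a run of `T` steps is impossible, so the simulation
reaches a halting node. The radius `T` suffices for `T` steps. -/
theorem exists_reduction (M : Machine) (p t : Polynomial ℕ) :
    ∃ (N : Machine) (s : Polynomial ℕ), N.IsDiscrete ∧ ∀ (w : Instance) (m T : ℕ),
      m = p.eval w.len → T = t.eval (w.len + m) + 1 →
        N.Returns w (simCircuit M w m T T).code (s.eval w.len) := by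
  obtain ⟨P, tP, hPd, hP⟩ := exists_evalPoly (k := 18) (i := 12) (j := 13) (s := 17) (s' := 7)
    (by decide) (by decide) (by decide) (by decide) (by decide) (by decide) p
  obtain ⟨Q, tQ, hQd, hQ⟩ := exists_evalPoly (k := 18) (i := 12) (j := 11) (s := 17) (s' := 7)
    (by decide) (by decide) (by decide) (by decide) (by decide) (by decide) t
  obtain ⟨c, hc⟩ := gatesProg_spec M
  let tt : Polynomial ℕ := t.comp (.X + p) + 1
  -- An upper bound for twice the number of gates and leaves, and for all counters. It is written as
  -- a polynomial in the length alone, with `m` and `T` substituted; the running time is then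
  -- controlled by `dp ^ 3`.
  let dp : Polynomial ℕ := 2 * (3 + .C (nL M) + (.X + p) +
    (tt + 1) * (.C (headSize M) + (2 * tt + 1) * (2 * .C (nQ M))) + .C (nL M)) +
    (3 + .C (nL M) + (tt + 1)) + tt + (.X + p) + .X + p + 1
  refine ⟨(redProg M P Q).machine (.zero 0), tP + tQ.comp (.X + p) +
      .C (25 + 20 + (80 + 2 * nL M) + 22 + c + 35 + (8 * (3 + nL M) + 3)) * dp ^ 3,
    Cmd.machine_isDiscrete ⟨countProg_isDiscrete, ⟨hPd, addCnt_isDiscrete _ _ _,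
      addCnt_isDiscrete _ _ _, hQd, incBy_isDiscrete _ _, copyCnt_isDiscrete _ _ _,
      copyCnt_isDiscrete _ _ _, incBy_isDiscrete _ _⟩, emitNat_isDiscrete _ _ _,
      gatesProg_isDiscrete M, rewind_isDiscrete _, pushReals_isDiscrete _⟩ trivial,
    fun w m T hm hT => ?_⟩
  obtain ⟨D, hD⟩ : ∃ D, D = dp.eval w.len := ⟨_, rfl⟩
  have hD' : D = 2 * (3 + nL M + (w.len + m) +
      (T + 1) * (headSize M + (2 * T + 1) * (2 * nQ M)) + nL M) +
      (3 + nL M + (T + 1)) + T + (w.len + m) + w.len + m + 1 := by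
    rw [hD, hT, hm]
    simp [dp, tt]
  have hn : w.2.length ≤ w.len := by simp [Instance.len]
  have hsz : 2 * simSize M (w.2.length + m) T T ≤ D := by
    rw [hD', simSize, layerSize]
    omega
  have hS : simSize M (w.2.length + m) T T + simSize M (w.2.length + m) T T ≤ D := by omega
  obtain ⟨X, hX⟩ : ∃ X, X = (T + 1) * (headSize M + (2 * T + 1) * (2 * nQ M)) := ⟨_, rfl⟩
  rw [← hX] at hD'
  have hD1 : 1 ≤ D := by omega
  have hDD : D * D ≤ D * D * D := Nat.le_mul_of_pos_right _ hD1
  have hDD1 : D ≤ D * D := Nat.le_mul_of_pos_right _ hD1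
  have h1 := countProg_spec w
  have h2 := paramProg_spec M hP hQ (readState w) w.len w.2.length m T D hm hT (by omega)
    (by omega) (by omega)
  obtain ⟨r, hr⟩ : ∃ r : Rg, r = ⟨0, 0, 0, 0, 0, 0, 3 + nL M + (w.2.length + m), 0, T, T,
    w.len + m, m, w.2.length + m, 0, 0⟩ := ⟨_, rfl⟩
  have h3 := Spec.emitNat (R := Eq) (i := 13) (s := 7) (by decide) 0 (RG (readState w) r [] 0)
    (by rw [RG_cnt]; rfl)
  rw [show (RG (readState w) r [] 0).cnt 13 = m by rw [RG_cnt, hr]; rfl, RG_emit_eq,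
    add_zero] at h3
  have h4 := hc (St.emit (natCode m) (readState w)) D T T (w.len + m) m (w.2.length + m) w.1
    hsz (by omega) (by omega) (by omega) (by omega) (by omega) (by simp [readState])
  rw [← hr] at h2 h4
  set C := simCircuit M w m T T with hC
  have hlen : C.code.1.length ≤ 3 * D * D + 9 * D := by
    have h5 : C.gates.length ≤ D := by
      have := length_simGates (M := M) w.1 (w.2.length + m) T T
      simp only [hC, simCircuit, List.length_append, starGates, List.length_map, List.length_range]
      omega
    have h6 : C.numNodes ≤ D := by
      have := length_simGates (M := M) w.1 (w.2.length + m) T T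
      simp only [Circuit.numNodes, Circuit.numLeaves, hC, simCircuit, List.length_append, starGates,
        List.length_map, List.length_range, length_simConsts]
      omega
    have h7 : C.numInputs ≤ D := by
      show m ≤ D
      omega
    calc _ ≤ C.numInputs + 1 + C.gates.length * (5 + 3 * C.numNodes) :=
          (simCircuit_valid w m T T).length_code_le
      _ ≤ D + D + D * (5 + 3 * D) := by gcongr
      _ ≤ _ := by nlinarith
  have h5 := h4.mono (Q' := fun τ => Spec Eq (rewind 0 ;; pushReals (simConsts M)) τ
      (3 * (3 * D * D + 9 * D) + 5 + (8 * (3 + nL M) + 2)) fun σ => σ.Displays C.code) le_rfl ?_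
  · have key := Spec.seq_eq h1 (Spec.seq_eq h2 (Spec.seq_eq h3 (Spec.seq h5)))
    obtain ⟨n, c', b, hn, hrun⟩ := Cmd.machine_returns (p := redProg M P Q) (b := .zero 0) key
    refine ⟨n, c', b, hn.trans ?_, hrun⟩
    simp only [Polynomial.eval_add, Polynomial.eval_mul, Polynomial.eval_comp, Polynomial.eval_C,
      Polynomial.eval_pow, Polynomial.eval_X, ← hm, ← hD]
    rw [show D ^ 3 = D * D * D by ring]
    generalize hU : D * D * D = U at *
    have hL : w.len ≤ U := by omega
    have hmU : m ≤ U := by omega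
    have h1U : 1 ≤ U := by omega
    have h8 : (80 + 2 * nL M) * (D * D) ≤ (80 + 2 * nL M) * U := Nat.mul_le_mul_left _ hDD
    have h9 : nL M ≤ nL M * U := Nat.le_mul_of_pos_right _ h1U
    have h10 : 3 * D * D = 3 * (D * D) := by ring
    rw [h10]
    simp only [add_mul] at h8 ⊢
    simp only [mul_add, add_mul, mul_assoc] at *
    omega
  · rintro τ ⟨r', p', hτ⟩
    have hτ' : τ = St.emit C.code.1 (RG (readState w) r' [] p') := by
      rw [hτ, show ∀ (σ : St 18) r gs p, RG σ r gs p = St.emit (gs.flatMap Gate.code) (RG σ r [] p)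
        from fun σ r gs p => rfl, ← RG_emit_eq, ← St.emit_append]
      rfl
    have hpos : (RG (readState w) r' [] p').pos 0 = w.1.length + 1 := by
      simp [RG, St.emit, readState]
    have harr : (RG (readState w) r' [] p').arr = (readState w).arr := rfl
    have hnone : ∀ j : ℤ, (w.1.length : ℤ) ≤ j → (readState w).arr 0 j = none := fun j hj => by
      rw [readState]
      simp only [if_true]
      exact listArr_eq_none (Or.inr hj)
    have hge := St.emit_arr_zero_ge C.code.1 (RG (readState w) r' [] p') (fun j hj => by
      rw [harr]
      exact hnone j (by omega))
    have hp := St.emit_pos_zero C.code.1 (RG (readState w) r' [] p')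
    rw [← hτ'] at hge hp
    have h6 := Spec.rewind (R := Eq) 0 τ C.code.1.length
      (by
        rw [hp, add_sub_cancel_right, hτ', St.emit_arr_zero_lt _ _ (by omega), hpos, harr]
        exact hnone _ (by omega))
      (fun i hi => by
        rw [hp, add_sub_cancel_right, hge]
        simp [hi])
    rw [hp, add_sub_cancel_right] at h6
    have hshow : (τ.setpos 0 ((RG (readState w) r' [] p').pos 0)).ShowsReals w.2 := by
      have e1 : (τ.setpos 0 ((RG (readState w) r' [] p').pos 0)).arr 1 =
          listArr (List.replicate w.2.length true) := by
        rw [hτ']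
        exact St.emit_arr _ (by decide) _
      have e2 : (τ.setpos 0 ((RG (readState w) r' [] p').pos 0)).pos 1 = 0 := by
        rw [hτ', St.setpos]
        simp [RG, St.emit, readState]
      have e3 : (τ.setpos 0 ((RG (readState w) r' [] p').pos 0)).main = listReal w.2 := by
        rw [hτ']
        exact St.emit_main _ _
      have e4 : (τ.setpos 0 ((RG (readState w) r' [] p').pos 0)).mpos = 0 := by
        rw [hτ']
        exact St.emit_mpos _ _
      refine ⟨fun i hi => ?_, ?_, fun i hi => ?_⟩
      · rw [e1, e2]
        simp [listArr, hi]
      · rw [e1, e2]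
        simp [listArr]
      · rw [e3, e4]
        simp [listReal, hi]
    refine (Spec.seq_eq h6 (pushReals_spec (simConsts M) _ _ hshow)).mono ?_ fun σ hσ => ?_
    · rw [length_simConsts]
      omega
    · obtain ⟨hs, ha, hp'⟩ := hσ
      refine ⟨fun i hi => ?_, hs.ones, hs.blank, hs.reals⟩
      rw [ha, hp']
      have : (τ.setpos 0 ((RG (readState w) r' [] p').pos 0)).pos 0 =
          (RG (readState w) r' [] p').pos 0 := by simp [St.setpos]
      rw [this]
      exact hge i

end Sim
end FiniteBSS
namespace FiniteBSS
namespace Ev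

/-! ### A machine that evaluates circuits -/

/-- The state in which the bits `l` remain to be read, all heads but that of array `0` stand at `p`,
the first `cur` nodes have been treated, and the flag is `b`. -/
def EV (u l : List Bool) (b : Bool) (n k : ℕ) (p : ℤ) (cur : ℕ) (M : ℤ → Option Bool) (v : ℤ → ℝ)
    (ρ : Fin 3 → ℝ) : St 7 where
  -- The counters are: rejection, the flag for spreading marks, the number of rounds, the number of
  -- constants, two auxiliary ones, and the answer.
  cnt := ![0, b.toNat, n, k, 0, 0, 0]
  arr := ![listArr u, listArr (List.replicate cur true), M]
  pos := ![u.length - l.length, p, p]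
  main := v
  mpos := p
  reg := ρ

theorem listArr_suffix {u l : List Bool} (h : l <:+ u) :
    listArr u (u.length - l.length) = l.head? := by
  obtain ⟨t, rfl⟩ := h
  have : ((t ++ l).length : ℤ) - l.length = t.length := by simp
  rw [this, listArr, if_pos (by omega), Int.toNat_natCast,
    List.getElem?_append_right le_rfl, Nat.sub_self, List.head?_eq_getElem?]

theorem listArr_replicate (cur n : ℕ) :
    listArr (List.replicate cur true) n = if n < cur then some true else none := by
  simp only [listArr]
  rw [if_pos (by omega), Int.toNat_natCast, List.getElem?_replicate]

theorem listArr_neg_one (l : List Bool) : listArr l (-1) = none := listArr_eq_none (Or.inl (by omega))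

section
variable {R : ℝ → ℝ → Prop} [IsSerial R] {u l l' : List Bool} {b a : Bool} {n k : ℕ} {p : ℤ}
  {cur D : ℕ} {M : ℤ → Option Bool} {v : ℤ → ℝ} {ρ : Fin 3 → ℝ} {Q : St 7 → Prop} {t : ℕ}

local notation "ev" => EV u l b n k p cur M v ρ

/-- A node number is a head position. The list of treated nodes, the marks and the values are
scanned in step, so going to a node reaches all its data at once. -/
def right3 : Cmd 7 := .act (.move 1 .right) ;; .act (.move 2 .right) ;; .act (.moveMain .right)

def left3 : Cmd 7 := .act (.move 1 .left) ;; .act (.move 2 .left) ;; .act (.moveMain .left)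

theorem right3_spec : Spec R right3 ev 6 (· = EV u l b n k (p + 1) cur M v ρ) := by
  refine Spec.seq_eq (Spec.act_eq (by exact rfl)) (Spec.seq_eq (Spec.act_eq (by exact rfl))
    (Spec.act_eq ?_))
  refine St.ext rfl rfl ?_ rfl rfl rfl
  funext i
  fin_cases i <;> rfl

theorem left3_spec : Spec R left3 ev 6 (· = EV u l b n k (p - 1) cur M v ρ) := by
  refine Spec.seq_eq (Spec.act_eq (by exact rfl)) (Spec.seq_eq (Spec.act_eq (by exact rfl))
    (Spec.act_eq ?_))
  refine St.ext rfl rfl ?_ rfl rfl rfl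
  funext i
  fin_cases i <;> rfl

theorem move0_spec : Spec R (.act (.move 0 .right)) (EV u (a :: l) b n k p cur M v ρ) 2
    (· = ev) := by
  refine Spec.act_eq ?_
  refine St.ext rfl rfl ?_ rfl rfl rfl
  funext i
  fin_cases i
  · simp [EV, dirStep]
    ring
  · rfl
  · rfl

theorem bit0_holds {s : Option Bool} (h : l <:+ u) :
    (Test.bit 0 s).Holds ev ↔ l.head? = s := by
  rw [← listArr_suffix h]
  rfl

theorem nbit0_holds {s : Option Bool} (h : l <:+ u) :
    (Test.nbit 0 s).Holds ev ↔ l.head? ≠ s := by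
  rw [← listArr_suffix h]
  rfl

theorem bit1_holds {m : ℕ} : (Test.bit 1 none).Holds (EV u l b n k m cur M v ρ) ↔ cur ≤ m := by
  have : (Test.bit 1 none).Holds (EV u l b n k m cur M v ρ) ↔
      listArr (List.replicate cur true) m = none := Iff.rfl
  rw [this, listArr_replicate]
  by_cases h : m < cur
  · simp [h]
  · simp [not_lt.1 h, h]

theorem nbit1_holds {m : ℕ} : (Test.nbit 1 none).Holds (EV u l b n k m cur M v ρ) ↔ m < cur := by
  rw [← not_le, ← bit1_holds (u := u) (l := l) (b := b) (n := n) (k := k) (M := M) (v := v)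
    (ρ := ρ)]
  exact Iff.rfl

/-- Go to the first node that has not been treated. -/
def goEnd : Cmd 7 := .whil (.nbit 1 none) right3

theorem goEnd_spec : Spec R goEnd (EV u l b n k 0 cur M v ρ) (7 * cur + 1)
    (· = EV u l b n k cur cur M v ρ) := by
  have := Spec.whil_inv (R := R) (b := .nbit 1 none) (p := right3) (t := 6)
    (fun j τ => ∃ i : ℕ, i + j = cur ∧ τ = EV u l b n k i cur M v ρ)
    (fun j τ ⟨i, hi, hτ⟩ => by rw [hτ, nbit1_holds]; omega)
    (fun j τ ⟨i, hi, hτ⟩ => by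
      rw [hτ]
      exact right3_spec.mono le_rfl fun τ h =>
        ⟨j, le_rfl, i + 1, by omega, by rw [h]; push_cast; rfl⟩)
    cur _ ⟨0, by omega, rfl⟩
  refine this.mono (by omega) fun τ ⟨i, hi, hτ⟩ => ?_
  rw [hτ, show i = cur by omega]

/-- Return to the node `0`. -/
def home : Cmd 7 := left3 ;; .whil (.nbit 1 none) left3 ;; right3

theorem home_spec {m : ℕ} (hm : m ≤ cur) : Spec R home (EV u l b n k m cur M v ρ) (7 * cur + 13)
    (· = EV u l b n k 0 cur M v ρ) := by
  have := Spec.whil_inv (R := R) (b := .nbit 1 none) (p := left3) (t := 6)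
    (fun j τ => j ≤ m ∧ τ = EV u l b n k (j - 1) cur M v ρ)
    (fun j τ ⟨hj, hτ⟩ => by
      rw [hτ]
      cases j with
      | zero =>
        refine iff_of_false (fun h => h ?_) (by simp)
        simpa [EV] using listArr_neg_one (List.replicate cur true)
      | succ j =>
        rw [show ((j + 1 : ℕ) : ℤ) - 1 = (j : ℕ) by push_cast; ring, nbit1_holds]
        omega)
    (fun j τ ⟨hj, hτ⟩ => by
      rw [hτ]
      exact left3_spec.mono le_rfl fun τ h =>
        ⟨j, le_rfl, by omega, by rw [h]; push_cast; ring_nf⟩)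
    m _ ⟨le_rfl, rfl⟩
  refine (Spec.seq_eq left3_spec (Spec.seq (t' := 6) (this.mono le_rfl ?_))).mono (by omega)
    fun _ h => h
  rintro τ ⟨-, hτ⟩
  rw [hτ]
  exact right3_spec.mono le_rfl fun τ h => by rw [h]; simp

/-- If the flag is set, mark the current node; otherwise, set the flag if the node is marked. -/
def touch : Cmd 7 :=
  .ite (.pos 1) (.act (.write 2 (some true)))
    (.ite (.bit 2 (some true)) (.act (.inc 1)) (.act .skip))

/-- The flag records that some marked node has been met; from then on, every node that is met gets
marked. -/
def stepMark (s : (ℤ → Option Bool) × Bool) (a : ℕ) : (ℤ → Option Bool) × Bool :=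
  if s.2 then (Function.update s.1 a (some true), true) else (s.1, decide (s.1 a = some true))

theorem touch_spec {m : ℕ} : Spec R touch (EV u l b n k m cur M v ρ) 4
    (· = EV u l (stepMark (M, b) m).2 n k m cur (stepMark (M, b) m).1 v ρ) := by
  cases b with
  | true =>
    refine Spec.mono (t := 2 + 1) (Spec.ite (fun _ => Spec.act_eq ?_) fun h => absurd ?_ h)
      (by omega) fun _ h => h
    · refine St.ext rfl ?_ rfl rfl rfl rfl
      funext i
      fin_cases i <;> rfl
    · simp [Test.Holds, EV]
  | false =>
    refine Spec.ite (t := 3) (fun h => absurd h (by simp [Test.Holds, EV])) fun _ =>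
      Spec.ite (fun h => Spec.act_eq ?_) fun h => Spec.act_eq ?_
    · have h : M m = some true := h
      refine St.ext ?_ ?_ rfl rfl rfl rfl
      · funext i
        fin_cases i <;> simp [EV, stepMark, St.setc, h]
      · simp [EV, stepMark, St.setc]
    · have h : ¬ M m = some true := h
      refine St.ext ?_ ?_ rfl rfl rfl rfl
      · funext i
        fin_cases i <;> simp [EV, stepMark, h]
      · simp [EV, stepMark]

/-- The input has been rejected. -/
structure Bad (n : ℕ) (σ : St 7) : Prop where
  flag : σ.cnt 0 ≠ 0
  rounds : σ.cnt 2 = n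
  answer : σ.cnt 6 = 0
  blank : σ.arr 0 (σ.pos 0) = none

/-- The reading head is moved behind the bits, because the loops that read the bits stop at a blank;
rejection thus needs no jump out of a loop. -/
def abort : Cmd 7 := .act (.inc 0) ;; .whil (.nbit 0 none) (.act (.move 0 .right))

theorem abort_spec (hl : l <:+ u) : Spec R abort ev (3 * u.length + 3) (Bad n) := by
  have h1 : Spec R (.act (.inc 0)) ev 2 (· = (ev).setc 0 1) := Spec.act_eq rfl
  have := Spec.whil_inv (R := R) (b := .nbit 0 none) (p := .act (.move 0 .right)) (t := 2)
    (fun j τ => ∃ l : List Bool, l <:+ u ∧ l.length = j ∧ τ = (EV u l b n k p cur M v ρ).setc 0 1)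
    (fun j τ ⟨l, hl, hj, hτ⟩ => by
      rw [hτ, ← hj]
      refine (nbit0_holds (b := b) (n := n) (k := k) (p := p) (cur := cur) (M := M) (v := v)
        (ρ := ρ) hl).trans ?_
      simp)
    (fun j τ ⟨l, hl, hj, hτ⟩ => by
      rw [hτ]
      cases l with
      | nil => simp at hj
      | cons a l =>
        refine Spec.act ⟨j, le_rfl, l, (List.suffix_cons a l).trans hl, by simpa using hj, ?_⟩
        refine St.ext rfl rfl ?_ rfl rfl rfl
        funext i
        fin_cases i
        · simp [EV, dirStep, St.setc]
          ring
        · rfl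
        · rfl)
    l.length _ ⟨l, hl, rfl, rfl⟩
  refine (Spec.seq_eq h1 this).mono ?_ fun τ ⟨l, hl, hj, hτ⟩ => ?_
  · have := hl.length_le
    omega
  · rw [List.length_eq_zero_iff] at hj
    rw [hτ, hj]
    refine ⟨by simp, by simp; rfl, by simp; rfl, ?_⟩
    have := listArr_suffix (u := u) (l := []) (List.nil_suffix)
    exact this

/-- Run `q` after `p` unless the input has been rejected. -/
def andThen (p q : Cmd 7) : Cmd 7 := p ;; .ite (.zero 0) q (.act .skip)

theorem spec_andThen {pr q : Cmd 7} {σ : St 7} {t t' : ℕ} {B G : St 7 → Prop}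
    (hp : Spec R pr σ t fun σ' => B σ' ∨ G σ') (ht : 2 ≤ t')
    (hq : ∀ σ', G σ' → σ'.cnt 0 = 0 ∧ Spec R q σ' t' Q) (hB : ∀ σ', B σ' → σ'.cnt 0 ≠ 0 ∧ Q σ') :
    Spec R (andThen pr q) σ (t + (t' + 1)) Q := by
  refine Spec.seq (hp.mono le_rfl fun σ' h => ?_)
  rcases h with h | h
  · exact Spec.ite (fun h0 => absurd h0 (hB σ' h).1) fun _ =>
      (Spec.act (by exact (hB σ' h).2)).mono ht fun _ h => h
  · exact Spec.ite (fun _ => (hq σ' h).2) fun h0 => absurd (hq σ' h).1 h0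

theorem Bad.spec_andThen {pr q : Cmd 7} {σ : St 7} {t t' : ℕ} {A : Prop} {G : St 7 → Prop}
    (hp : Spec R pr σ t fun σ' => (Bad n σ' ∧ A) ∨ G σ') (ht : 2 ≤ t')
    (hq : ∀ σ', G σ' → σ'.cnt 0 = 0 ∧ Spec R q σ' t' Q) (hQ : A → ∀ σ', Bad n σ' → Q σ') :
    Spec R (andThen pr q) σ (t + (t' + 1)) Q :=
  Ev.spec_andThen hp ht hq fun σ' h => ⟨h.1.flag, hQ h.2 σ' h.1⟩

/-- Read the number of a node, go there, and load its value into the register `j`. -/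
def visit (j : Fin 3) : Cmd 7 :=
  .whil (.bit 0 (some true)) (.act (.move 0 .right) ;; right3) ;;
    .ite (.bit 0 none) abort (.ite (.bit 1 none) abort
      (.act (.move 0 .right) ;; touch ;; .act (.load j) ;; home))

/-- Rejection comes with a proof that no admissible node number can be read here. As the code is
uniquely decodable, these negative statements combine along the program into a correct decision
about the syntax. They involve no real numbers, so rounding cannot spoil them. -/
theorem visit_spec (j : Fin 3) (hl : l <:+ u) (hu : u.length ≤ D) (hc : cur ≤ D) :
    Spec R (visit j) (EV u l b n k 0 cur M v ρ) (16 * D + 30) fun σ' =>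
      (Bad n σ' ∧ ¬ ∃ a l', a < cur ∧ l = natCode a ++ l') ∨
      ∃ a l', a < cur ∧ l = natCode a ++ l' ∧
        σ' = EV u l' (stepMark (M, b) a).2 n k 0 cur (stepMark (M, b) a).1 v
          (Function.update ρ j (v a)) := by
  have hw : Spec R (.whil (.bit 0 (some true)) (.act (.move 0 .right) ;; right3))
      (EV u l b n k 0 cur M v ρ) (9 * D + 1) (fun σ' => ∃ (a : ℕ) (l' : List Bool),
        l = List.replicate a true ++ l' ∧ l'.head? ≠ some true ∧
        σ' = EV u l' b n k a cur M v ρ) := by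
    have key : ∀ (l : List Bool) (i : ℕ), l <:+ u →
        Spec R (.whil (.bit 0 (some true)) (.act (.move 0 .right) ;; right3))
        (EV u l b n k i cur M v ρ) (9 * l.length + 1) (fun σ' => ∃ (a : ℕ) (l' : List Bool),
          l = List.replicate a true ++ l' ∧ l'.head? ≠ some true ∧
          σ' = EV u l' b n k (i + a : ℕ) cur M v ρ) := by
      intro l
      induction l with
      | nil =>
        intro i hl
        refine Spec.whil_false ?_ ⟨0, [], rfl, by simp, rfl⟩
        rw [bit0_holds hl]
        simp
      | cons x l ih =>
        intro i hl
        cases x with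
        | false =>
          refine (Spec.whil_false ?_ ⟨0, false :: l, rfl, by simp, rfl⟩).mono (by omega)
            fun _ h => h
          rw [bit0_holds hl]
          simp
        | true =>
          refine (Spec.whil_true (t := 8) (t' := 9 * l.length + 1) ?_ ?_).mono ?_ fun _ h => h
          · rw [bit0_holds hl]
            simp
          · refine Spec.seq_eq move0_spec (right3_spec.mono le_rfl fun τ hτ => ?_)
            rw [hτ]
            refine (ih (i + 1) ((List.suffix_cons _ l).trans hl)).mono le_rfl ?_
            rintro τ ⟨a, l', h1, h2, h3⟩
            exact ⟨a + 1, l', by rw [h1]; rfl, h2, by rw [h3]; congr 1; push_cast; ring⟩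
          · simp
            omega
    refine (key l 0 hl).mono ?_ fun τ ⟨a, l', h1, h2, h3⟩ => ⟨a, l', h1, h2, by simpa using h3⟩
    have := hl.length_le
    omega
  refine Spec.mono (Spec.seq (t' := 7 * D + 28) (hw.mono le_rfl ?_)) (by omega) fun _ h => h
  rintro τ ⟨a, l', h1, h2, rfl⟩
  have hl' : l' <:+ u := by
    rw [h1] at hl
    exact (List.suffix_append _ _).trans hl
  have hinj : ∀ {a' l''}, l = natCode a' ++ l'' → a' = a ∧ l' = false :: l'' := by
    intro a' l'' h
    cases l' with
    | nil =>
      rw [h1, List.append_nil] at h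
      have : false ∈ List.replicate a true := by rw [h]; simp [natCode]
      simp at this
    | cons x l' =>
      cases x with
      | true => simp at h2
      | false =>
        have e : natCode a ++ l' = natCode a' ++ l'' := by
          rw [← h, h1]
          simp [natCode]
        have := natCode_append_inj e
        exact ⟨this.1.symm, by rw [this.2]⟩
  refine Spec.mono (Spec.ite (t := 7 * D + 27) (fun h => ?_) fun h => Spec.mono (t := 7 * D + 22 + 1)
    (Spec.ite (fun h' => ?_) fun h' => ?_) (by omega) fun _ h => h) (by omega) fun _ h => h
  · rw [bit0_holds hl'] at h
    refine (abort_spec hl').mono (by omega) fun τ hτ => Or.inl ⟨hτ, ?_⟩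
    rintro ⟨a', l'', -, h3⟩
    rw [(hinj h3).2] at h
    simp at h
  · rw [bit1_holds] at h'
    refine (abort_spec hl').mono (by omega) fun τ hτ => Or.inl ⟨hτ, ?_⟩
    rintro ⟨a', l'', h4, h3⟩
    rw [(hinj h3).1] at h4
    omega
  · rw [bit1_holds] at h'
    rw [bit0_holds hl'] at h
    obtain ⟨l'', rfl⟩ : ∃ l'', l' = false :: l'' := by
      cases l' with
      | nil => simp at h
      | cons x l' =>
        cases x with
        | true => simp at h2
        | false => exact ⟨l', rfl⟩
    have h3 : Spec R (.act (.load j)) (EV u l'' (stepMark (M, b) a).2 n k a cur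
        (stepMark (M, b) a).1 v ρ) 2 (· = EV u l'' (stepMark (M, b) a).2 n k a cur
        (stepMark (M, b) a).1 v (Function.update ρ j (v a))) := Spec.act_eq (by exact rfl)
    refine (Spec.seq_eq move0_spec (Spec.seq_eq touch_spec (Spec.seq_eq h3
      ((home_spec (m := a) (by omega)).mono (t' := 7 * D + 13) (by omega) ?_)))).mono (by omega)
      fun _ h => h
    intro τ hτ
    refine Or.inr ⟨a, l'', by omega, ?_, hτ⟩
    rw [h1]
    simp [natCode]

end

end Ev
end FiniteBSS
namespace FiniteBSS
namespace Ev

section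
variable {R : ℝ → ℝ → Prop} [IsSerial R] {u l l' : List Bool} {b a : Bool} {n k : ℕ} {p : ℤ}
  {cur D : ℕ} {M : ℤ → Option Bool} {v : ℤ → ℝ} {ρ : Fin 3 → ℝ} {Q : St 7 → Prop} {t : ℕ}

/-- Set the flag if the first node that has not been treated is marked. -/
def peek : Cmd 7 := goEnd ;; touch ;; home

theorem peek_spec : Spec R peek (EV u l b n k 0 cur M v ρ) (14 * cur + 18)
    (· = EV u l (stepMark (M, b) cur).2 n k 0 cur (stepMark (M, b) cur).1 v ρ) :=
  (Spec.seq_eq goEnd_spec (Spec.seq_eq touch_spec (home_spec le_rfl))).mono (by omega) fun _ h => h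

/-- Store the register `j` as the value of the next node. -/
def finish (j : Fin 3) : Cmd 7 :=
  goEnd ;; .act (.store j) ;; touch ;; .act (.write 1 (some true)) ;; home ;; clear 1

theorem finish_spec (j : Fin 3) : Spec R (finish j) (EV u l b n k 0 cur M v ρ) (14 * cur + 40)
    (· = EV u l false n k 0 (cur + 1) (stepMark (M, b) cur).1 (Function.update v cur (ρ j)) ρ) := by
  set s := stepMark (M, b) cur
  have h2 : Spec R (.act (.store j)) (EV u l b n k cur cur M v ρ) 2
      (· = EV u l b n k cur cur M (Function.update v cur (ρ j)) ρ) := Spec.act_eq (by exact rfl)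
  have h4 : Spec R (.act (.write 1 (some true)))
      (EV u l s.2 n k cur cur s.1 (Function.update v cur (ρ j)) ρ) 2
      (· = EV u l s.2 n k cur (cur + 1) s.1 (Function.update v cur (ρ j)) ρ) := by
    refine Spec.act_eq (St.ext rfl ?_ rfl rfl rfl rfl)
    have := update_listArr (List.replicate cur true) true
    rw [List.length_replicate, ← List.replicate_succ'] at this
    funext i
    fin_cases i
    · rfl
    · simpa [EV] using this
    · rfl
  have h6 := Spec.clear (R := R) 1 (EV u l s.2 n k 0 (cur + 1) s.1 (Function.update v cur (ρ j)) ρ)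
  refine (Spec.seq_eq goEnd_spec (Spec.seq_eq h2 (Spec.seq_eq touch_spec (Spec.seq_eq h4
    (Spec.seq_eq (home_spec (by omega)) (h6.mono (t' := 6) ?_ fun τ hτ => ?_)))))).mono (by omega)
    fun _ h => h
  · have : (EV u l s.2 n k 0 (cur + 1) s.1 (Function.update v cur (ρ j)) ρ).cnt 1 = s.2.toNat := rfl
    rw [this]
    have := Bool.toNat_le s.2
    omega
  · rw [hτ]
    refine St.ext ?_ rfl rfl rfl rfl rfl
    funext i
    fin_cases i <;> rfl

/-- The marks after the treatment of the node `cur` with the parents `ps`. -/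
def gateMark (M : ℤ → Option Bool) (cur : ℕ) (ps : List ℕ) : ℤ → Option Bool :=
  ((cur :: ps ++ [cur]).foldl stepMark (M, false)).1

def arithProg (op : ArithOp) : Cmd 7 :=
  andThen (peek ;; visit 0) (andThen (visit 1) (.act (.arith op) ;; finish 2))

theorem arithProg_spec (op : ArithOp) (hl : l <:+ u) (hu : u.length ≤ D) (hc : cur ≤ D) :
    Spec R (arithProg op) (EV u l false n k 0 cur M v ρ) (60 * D + 140) fun σ' =>
      (Bad n σ' ∧ ¬ ∃ a b l', a < cur ∧ b < cur ∧ l = natCode a ++ (natCode b ++ l')) ∨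
      ∃ a b l' x ρ', a < cur ∧ b < cur ∧ l = natCode a ++ (natCode b ++ l') ∧
        R (op.apply (v a) (v b)) x ∧
        σ' = EV u l' false n k 0 (cur + 1) (gateMark M cur [a, b]) (Function.update v cur x) ρ' := by
  refine Spec.mono (Bad.spec_andThen (n := n) (t' := 30 * D + 76)
    (Spec.seq_eq peek_spec (visit_spec 0 hl hu hc)) (by omega)
    ?_ fun h σ' hb => Or.inl ⟨hb, ?_⟩) (by omega) fun _ h => h
  · rintro σ' ⟨a, l1, ha, h1, rfl⟩
    have hl1 : l1 <:+ u := (h1 ▸ List.suffix_append _ _ : l1 <:+ l).trans hl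
    refine ⟨rfl, ?_⟩
    refine Spec.mono (Bad.spec_andThen (n := n) (t' := 14 * D + 42) (visit_spec 1 hl1 hu hc)
      (by omega) ?_ fun h σ' hb => Or.inl ⟨hb, ?_⟩) (by omega) fun _ h => h
    · rintro σ' ⟨b, l2, hb, h2, rfl⟩
      refine ⟨rfl, Spec.mono (Spec.seq (t := 2) (t' := 14 * D + 40)
        (Spec.act fun x hx => ?_)) (by omega) fun _ h => h⟩
      refine Spec.mono (finish_spec (n := n) (k := k) 2) (by omega) fun σ' hσ => Or.inr ⟨a, b, l2, x,
        Function.update (Function.update (Function.update ρ 0 (v a)) 1 (v b)) 2 x, ha, hb,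
        by rw [h1, h2], ?_, hσ.trans ?_⟩
      · exact hx
      · congr 1
    · rintro ⟨a', b', l', ha', hb', h'⟩
      have := (natCode_append_inj (h1.symm.trans h')).2
      exact h ⟨b', l', hb', this⟩
  · rintro ⟨a', b', l', ha', hb', h'⟩
    exact h ⟨a', _, ha', h'⟩

def selectProg : Cmd 7 :=
  andThen (peek ;; visit 0) (andThen (visit 1) (andThen (visit 2)
    (.ite (.neg 0) (finish 1) (finish 2))))

theorem selectProg_spec (hl : l <:+ u) (hu : u.length ≤ D) (hc : cur ≤ D) :
    Spec R selectProg (EV u l false n k 0 cur M v ρ) (76 * D + 180) fun σ' =>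
      (Bad n σ' ∧ ¬ ∃ a b c l', a < cur ∧ b < cur ∧ c < cur ∧
        l = natCode a ++ (natCode b ++ (natCode c ++ l'))) ∨
      ∃ a b c l' ρ', a < cur ∧ b < cur ∧ c < cur ∧
        l = natCode a ++ (natCode b ++ (natCode c ++ l')) ∧
        σ' = EV u l' false n k 0 (cur + 1) (gateMark M cur [a, b, c])
          (Function.update v cur (if v a < 0 then v b else v c)) ρ' := by
  refine Spec.mono (Bad.spec_andThen (n := n) (t' := 46 * D + 110)
    (Spec.seq_eq peek_spec (visit_spec 0 hl hu hc)) (by omega)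
    ?_ fun h σ' hb => Or.inl ⟨hb, ?_⟩) (by omega) fun _ h => h
  · rintro σ' ⟨a, l1, ha, h1, rfl⟩
    have hl1 : l1 <:+ u := (h1 ▸ List.suffix_append _ _ : l1 <:+ l).trans hl
    refine ⟨rfl, ?_⟩
    refine Spec.mono (Bad.spec_andThen (n := n) (t' := 30 * D + 76) (visit_spec 1 hl1 hu hc)
      (by omega) ?_ fun h σ' hb => Or.inl ⟨hb, ?_⟩) (by omega) fun _ h => h
    · rintro σ' ⟨b, l2, hb, h2, rfl⟩
      have hl2 : l2 <:+ u := (h2 ▸ List.suffix_append _ _ : l2 <:+ l1).trans hl1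
      refine ⟨rfl, ?_⟩
      refine Spec.mono (Bad.spec_andThen (n := n) (t' := 14 * D + 42) (visit_spec 2 hl2 hu hc)
        (by omega) ?_ fun h σ' hb => Or.inl ⟨hb, ?_⟩) (by omega) fun _ h => h
      · rintro σ' ⟨c, l3, hc, h3, rfl⟩
        refine ⟨rfl, Spec.mono (Spec.ite (t := 14 * D + 40) (fun h => ?_) fun h => ?_) (by omega)
          fun _ h => h⟩
        · refine Spec.mono (finish_spec (n := n) (k := k) 1) (by omega) fun σ' hσ => Or.inr ⟨a, b, c, l3,
            Function.update (Function.update (Function.update ρ 0 (v a)) 1 (v b)) 2 (v c), ha, hb,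
            hc, by rw [h1, h2, h3], hσ.trans ?_⟩
          have h : v a < 0 := h
          rw [if_pos h]
          congr 1
        · refine Spec.mono (finish_spec (n := n) (k := k) 2) (by omega) fun σ' hσ => Or.inr ⟨a, b, c, l3,
            Function.update (Function.update (Function.update ρ 0 (v a)) 1 (v b)) 2 (v c), ha, hb,
            hc, by rw [h1, h2, h3], hσ.trans ?_⟩
          have h : ¬ v a < 0 := h
          rw [if_neg h]
          congr 1
      · rintro ⟨a', b', c', l', ha', hb', hc', h'⟩
        have := (natCode_append_inj (h1.symm.trans h')).2
        have := (natCode_append_inj (h2.symm.trans this)).2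
        exact h ⟨c', l', hc', this⟩
    · rintro ⟨a', b', c', l', ha', hb', hc', h'⟩
      have := (natCode_append_inj (h1.symm.trans h')).2
      exact h ⟨b', _, hb', this⟩
  · rintro ⟨a', b', c', l', ha', hb', hc', h'⟩
    exact h ⟨a', _, ha', h'⟩

/-- Read a number and run the program with this number. -/
def dispatch : List (Cmd 7) → Cmd 7
  | [] => abort
  | p :: ps => .ite (.bit 0 none) abort (.ite (.bit 0 (some false)) (.act (.move 0 .right) ;; p)
      (.act (.move 0 .right) ;; dispatch ps))

theorem dispatch_spec : ∀ (ps : List (Cmd 7)) {l : List Bool}, l <:+ u →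
    (∀ (i : ℕ) (hi : i < ps.length) (l' : List Bool), l = natCode i ++ l' →
      Spec R ps[i] (EV u l' b n k p cur M v ρ) t Q) →
    ((¬ ∃ i l', i < ps.length ∧ l = natCode i ++ l') → ∀ σ', Bad n σ' → Q σ') →
    Spec R (dispatch ps) (EV u l b n k p cur M v ρ) (4 * ps.length + 3 * u.length + 3 + t) Q
  | [], l, hl, _, hb => (abort_spec hl).mono (by omega) (hb (by simp))
  | pr :: ps, l, hl, hps, hb => by
    refine Spec.mono (t := (2 + (4 * ps.length + 3 * u.length + 3 + t)) + 1 + 1)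
      (Spec.ite (fun h => ?_) fun h => Spec.ite (fun h' => ?_) fun h' => ?_)
      (by rw [List.length_cons]; omega) fun _ h => h
    · rw [bit0_holds hl] at h
      refine (abort_spec hl).mono (by omega) (hb ?_)
      rintro ⟨i, l', -, hi⟩
      rw [hi] at h
      cases i <;> simp [natCode, List.replicate_succ] at h
    · rw [bit0_holds hl] at h'
      obtain ⟨l', rfl⟩ : ∃ l', l = false :: l' := by
        cases l with
        | nil => simp at h'
        | cons x l => exact ⟨l, by simpa using h'⟩
      refine (Spec.seq_eq move0_spec (hps 0 (by simp) l' rfl)).mono (by omega) fun _ h => h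
    · rw [bit0_holds hl] at h' h
      obtain ⟨l', rfl⟩ : ∃ l', l = true :: l' := by
        cases l with
        | nil => simp at h
        | cons x l => exact ⟨l, by simpa using h'⟩
      refine Spec.seq_eq move0_spec (dispatch_spec ps ((List.suffix_cons _ _).trans hl) ?_ ?_)
      · intro i hi l'' h''
        exact hps (i + 1) (by simpa using hi) l'' (by rw [h'']; rfl)
      · refine fun hi => hb ?_
        rintro ⟨i, l'', h1, h2⟩
        cases i with
        | zero => simp [natCode] at h2
        | succ i =>
          exact hi ⟨i, l'', by simpa using h1, by simpa [natCode, List.replicate_succ] using h2⟩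

/-- Read and evaluate a gate. -/
def gateProg : Cmd 7 :=
  dispatch [arithProg .add, arithProg .sub, arithProg .mul, arithProg .div, selectProg]

theorem code_arith (op : ArithOp) : ∃ i < 4, op.code = natCode i := by
  cases op
  exacts [⟨0, by omega, rfl⟩, ⟨1, by omega, rfl⟩, ⟨2, by omega, rfl⟩, ⟨3, by omega, rfl⟩]

theorem gateProg_spec (hl : l <:+ u) (hu : u.length ≤ D) (hc : cur ≤ D) :
    Spec R gateProg (EV u l false n k 0 cur M v ρ) (79 * D + 203) fun σ' =>
      (Bad n σ' ∧ ¬ ∃ (g : Gate) (l' : List Bool), g.Below cur ∧ l = g.code ++ l') ∨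
      ∃ (g : Gate) (l' : List Bool) (x : ℝ) (ρ' : Fin 3 → ℝ), g.Below cur ∧ l = g.code ++ l' ∧
        g.Holds R (fun i : ℕ => Function.update v cur x i) cur ∧
        σ' = EV u l' false n k 0 (cur + 1) (gateMark M cur g.parents)
          (Function.update v cur x) ρ' := by
  have hne : ∀ {a : ℕ} (x : ℝ), a < cur → Function.update v (cur : ℤ) x (a : ℤ) = v a := by
    intro a x h
    exact Function.update_of_ne (by omega) _ _
  have harith : ∀ (op : ArithOp) (l' : List Bool), l = op.code ++ l' →
      Spec R (arithProg op) (EV u l' false n k 0 cur M v ρ) (76 * D + 180) fun σ' =>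
      (Bad n σ' ∧ ¬ ∃ (g : Gate) (l' : List Bool), g.Below cur ∧ l = g.code ++ l') ∨
      ∃ (g : Gate) (l' : List Bool) (x : ℝ) (ρ' : Fin 3 → ℝ), g.Below cur ∧ l = g.code ++ l' ∧
        g.Holds R (fun i : ℕ => Function.update v cur x i) cur ∧
        σ' = EV u l' false n k 0 (cur + 1) (gateMark M cur g.parents)
          (Function.update v cur x) ρ' := by
    intro op l1 h1
    have hl1 : l1 <:+ u := (h1 ▸ List.suffix_append _ _ : l1 <:+ l).trans hl
    refine (arithProg_spec op hl1 hu hc).mono (by omega) fun σ' h => ?_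
    rcases h with ⟨hb, h⟩ | ⟨a, b, l', x, ρ', ha, hb, h2, hx, hσ⟩
    · refine Or.inl ⟨hb, ?_⟩
      rintro ⟨g, l', hg, h3⟩
      apply h
      rw [h1] at h3
      cases g with
      | arith op' a b =>
        simp only [Gate.code, List.append_assoc] at h3
        obtain ⟨i, -, hi⟩ := code_arith op
        obtain ⟨j, -, hj⟩ := code_arith op'
        rw [hi, hj] at h3
        exact ⟨a, b, l', hg a (by simp [Gate.parents]), hg b (by simp [Gate.parents]),
          (natCode_append_inj h3).2⟩
      | select a b c =>
        obtain ⟨i, hi4, hi⟩ := code_arith op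
        simp only [Gate.code, List.append_assoc] at h3
        rw [hi] at h3
        have := (natCode_append_inj h3).1
        omega
    · refine Or.inr ⟨.arith op a b, l', x, ρ', ?_, ?_, ?_, hσ⟩
      · intro c hc
        simp only [Gate.parents, List.mem_cons, List.not_mem_nil, or_false] at hc
        rcases hc with rfl | rfl <;> assumption
      · rw [h1, h2]
        simp [Gate.code]
      · simpa [Gate.Holds, hne x ha, hne x hb] using hx
  refine (dispatch_spec (t := 76 * D + 180) _ hl ?_ ?_).mono ?_ fun _ h => h
  · intro i hi l1 h1
    simp only [List.length_cons, List.length_nil] at hi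
    interval_cases i
    · exact harith .add l1 h1
    · exact harith .sub l1 h1
    · exact harith .mul l1 h1
    · exact harith .div l1 h1
    · have hl1 : l1 <:+ u := (h1 ▸ List.suffix_append _ _ : l1 <:+ l).trans hl
      refine (selectProg_spec hl1 hu hc).mono le_rfl fun σ' h => ?_
      rcases h with ⟨hb, h⟩ | ⟨a, b, c, l', ρ', ha, hb, hc, h2, hσ⟩
      · refine Or.inl ⟨hb, ?_⟩
        rintro ⟨g, l', hg, h3⟩
        apply h
        rw [h1] at h3
        cases g with
        | arith op' a b =>
          obtain ⟨i, hi4, hi⟩ := code_arith op'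
          simp only [Gate.code, List.append_assoc] at h3
          rw [hi] at h3
          have := (natCode_append_inj h3).1
          omega
        | select a b c =>
          simp only [Gate.code, List.append_assoc] at h3
          exact ⟨a, b, c, l', hg a (by simp [Gate.parents]), hg b (by simp [Gate.parents]),
            hg c (by simp [Gate.parents]), (natCode_append_inj h3).2⟩
      · refine Or.inr ⟨.select a b c, l', _, ρ', ?_, ?_, ?_, hσ⟩
        · intro d hd
          simp only [Gate.parents, List.mem_cons, List.not_mem_nil, or_false] at hd
          rcases hd with rfl | rfl | rfl <;> assumption
        · rw [h1, h2]
          simp [Gate.code]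
        · simp [Gate.Holds, hne _ ha, hne _ hb, hne _ hc]
  · intro h σ' hb
    refine Or.inl ⟨hb, ?_⟩
    rintro ⟨g, l', hg, rfl⟩
    apply h
    cases g with
    | arith op a b =>
      obtain ⟨i, hi4, hi⟩ := code_arith op
      exact ⟨i, natCode a ++ (natCode b ++ l'), by simp; omega,
        by simp only [Gate.code, hi, List.append_assoc]⟩
    | select a b c => exact ⟨4, natCode a ++ (natCode b ++ (natCode c ++ l')), by simp,
        by simp only [Gate.code, List.append_assoc]⟩
  · simp only [List.length_cons, List.length_nil]
    omega

end

end Ev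
end FiniteBSS
namespace FiniteBSS
namespace Ev

/-! ### Marks -/

section
variable {M : ℤ → Option Bool} {s : (ℤ → Option Bool) × Bool} {ps : List ℕ} {a c : ℕ} {j : ℤ}

theorem foldl_stepMark_mono (h : s.1 j = some true) : (ps.foldl stepMark s).1 j = some true := by
  induction ps generalizing s with
  | nil => exact h
  | cons a ps ih =>
    refine ih ?_
    unfold stepMark
    split
    · by_cases hj : j = a
      · simp [hj]
      · simpa [hj] using h
    · exact h

theorem foldl_stepMark_flag (h : s.2 = true) (ha : a ∈ ps) :
    (ps.foldl stepMark s).1 a = some true := by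
  induction ps generalizing s with
  | nil => simp at ha
  | cons b ps ih =>
    have hs : stepMark s b = (Function.update s.1 b (some true), true) := by simp [stepMark, h]
    rw [List.foldl_cons, hs]
    rcases List.mem_cons.1 ha with rfl | ha
    · exact foldl_stepMark_mono (by simp)
    · exact ih rfl ha

theorem stepMark_snd (h : s.1 c = some true) : (stepMark s c).2 = true := by
  unfold stepMark
  split
  · rfl
  · simpa using h

/-- Meeting the marked node `c` sets the flag, and the flag is never cleared afterwards. -/
theorem foldl_stepMark_mem {ps' : List ℕ} (h : s.1 c = some true) (ha : a ∈ ps') :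
    ((ps ++ c :: ps').foldl stepMark s).1 a = some true := by
  rw [List.foldl_append, List.foldl_cons]
  exact foldl_stepMark_flag (stepMark_snd (foldl_stepMark_mono h)) ha

/-- For `S` that holds for all or for none of the nodes in the list: the flag is set only by a node
in `S`, and then the nodes still to be marked are in `S` too. -/
theorem foldl_stepMark_sound {S : ℕ → Prop} (hps : ∀ a ∈ ps, ∀ b ∈ ps, S a → S b)
    (hM : ∀ a : ℕ, s.1 a = some true → S a) (hs : s.2 = true → ∀ a ∈ ps, S a) {a : ℕ}
    (h : (ps.foldl stepMark s).1 a = some true) : S a := by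
  induction ps generalizing s with
  | nil => exact hM a h
  | cons c ps ih =>
    refine ih (fun x hx y hy => hps x (by simp [hx]) y (by simp [hy])) ?_ ?_ h
    · intro x hx
      unfold stepMark at hx
      split at hx
      · rename_i hs2
        by_cases hxc : x = c
        · exact hs hs2 x (by simp [hxc])
        · exact hM x (by simpa [hxc] using hx)
      · exact hM x hx
    · intro h2 x hx
      unfold stepMark at h2
      split at h2
      · rename_i hs2
        exact hs hs2 x (by simp [hx])
      · exact hps c (by simp) x (by simp [hx]) (hM c (by simpa using h2))

theorem gateMark_mono (h : M j = some true) : gateMark M c ps j = some true :=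
  foldl_stepMark_mono h

/-- This is why the gate itself is visited before its parents. -/
theorem gateMark_parent (h : M c = some true) (ha : a ∈ ps) : gateMark M c ps a = some true :=
  foldl_stepMark_mem (s := (M, false)) (ps := []) (ps' := ps ++ [c]) h (by simp [ha])

/-- This is why the gate itself is visited once more after its parents. -/
theorem gateMark_child (h : M a = some true) (ha : a ∈ ps) : gateMark M c ps c = some true := by
  obtain ⟨l1, l2, rfl⟩ := List.append_of_mem ha
  have := foldl_stepMark_mem (s := (M, false)) (ps := c :: l1) (ps' := l2 ++ [c]) (c := a) (a := c) h
    (by simp)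
  unfold gateMark
  simpa using this

theorem gateMark_sound {S : ℕ → Prop} (hps : ∀ a ∈ ps, (S a ↔ S c))
    (hM : ∀ a : ℕ, M a = some true → S a) {a : ℕ} (h : gateMark M c ps a = some true) : S a := by
  have hall : ∀ a ∈ c :: ps ++ [c], (S a ↔ S c) := by
    intro a ha
    simp only [List.cons_append, List.mem_cons, List.mem_append, List.not_mem_nil, or_false] at ha
    rcases ha with rfl | ha | rfl
    exacts [Iff.rfl, hps a ha, Iff.rfl]
  exact foldl_stepMark_sound (s := (M, false)) (fun a ha b hb => by rw [hall a ha, hall b hb]; exact id)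
    hM (by simp) h

/-- The marks after the treatment of the gates `gs`, the first of which has the number `c`. -/
def passMark : (ℤ → Option Bool) → ℕ → List Gate → ℤ → Option Bool
  | M, _, [] => M
  | M, c, g :: gs => passMark (gateMark M c g.parents) (c + 1) gs

variable {gs : List Gate}

theorem passMark_mono (h : M j = some true) : passMark M c gs j = some true := by
  induction gs generalizing M c with
  | nil => exact h
  | cons g gs ih => exact ih (gateMark_mono h)

/-- One pass carries marks across every edge in both directions; as marks are never removed, the
other gates of the pass do not interfere. -/
theorem passMark_edge {t : ℕ} (ht : t < gs.length) (ha : a ∈ gs[t].parents) :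
    (M a = some true → passMark M c gs (c + t : ℕ) = some true) ∧
      (M (c + t : ℕ) = some true → passMark M c gs a = some true) := by
  induction gs generalizing M c t with
  | nil => simp at ht
  | cons g gs ih =>
    cases t with
    | zero =>
      exact ⟨fun h => passMark_mono (M := gateMark M c g.parents) (c := c + 1) (gs := gs)
          (gateMark_child h ha),
        fun h => passMark_mono (M := gateMark M c g.parents) (c := c + 1) (gs := gs)
          (gateMark_parent h ha)⟩
    | succ t =>
      have := ih (M := gateMark M c g.parents) (c := c + 1) (t := t) (by simpa using ht) ha
      rw [show c + 1 + t = c + (t + 1) by omega] at this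
      exact ⟨fun h => this.1 (gateMark_mono h), fun h => this.2 (gateMark_mono h)⟩

theorem passMark_sound {S : ℕ → Prop}
    (hS : ∀ t (ht : t < gs.length), ∀ a ∈ gs[t].parents, (S a ↔ S (c + t)))
    (hM : ∀ a : ℕ, M a = some true → S a) {a : ℕ} (h : passMark M c gs a = some true) : S a := by
  induction gs generalizing M c with
  | nil => exact hM a h
  | cons g gs ih =>
    refine ih (c := c + 1) (fun t ht a ha => ?_)
      (fun a => gateMark_sound (hS 0 (by simp)) hM) h
    rw [show c + 1 + t = c + (t + 1) by omega]
    exact hS (t + 1) (by simpa using ht) a (by simpa using ha)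

end

/-! ### One pass over the circuit -/

section
variable {R : ℝ → ℝ → Prop} [IsSerial R] {u l l' : List Bool} {b a : Bool} {n k : ℕ} {p : ℤ}
  {cur D : ℕ} {M : ℤ → Option Bool} {v : ℤ → ℝ} {ρ : Fin 3 → ℝ} {Q : St 7 → Prop} {t : ℕ}

/-- The number `j` bounds the number of remaining bits, and thereby the number of remaining gates,
since every gate consumes at least one bit. -/
theorem gates_spec : ∀ (j : ℕ) {l : List Bool} {cur : ℕ} {M : ℤ → Option Bool} {v : ℤ → ℝ}
    {ρ : Fin 3 → ℝ}, l.length ≤ j → l <:+ u → u.length ≤ D → cur + l.length ≤ D →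
    Spec R (.whil (.nbit 0 none) gateProg) (EV u l false n k 0 cur M v ρ)
      (j * (79 * D + 204) + 1) fun σ' =>
      (Bad n σ' ∧ ¬ ∃ gs : List Gate, l = gs.flatMap Gate.code ∧ Along Gate.Below cur gs) ∨
      ∃ (gs : List Gate) (v' : ℤ → ℝ) (ρ' : Fin 3 → ℝ), l = gs.flatMap Gate.code ∧
        Along Gate.Below cur gs ∧ Along (Gate.Holds R fun i : ℕ => v' i) cur gs ∧
        (∀ i < cur, v' (i : ℕ) = v (i : ℕ)) ∧
        σ' = EV u [] false n k 0 (cur + gs.length) (passMark M cur gs) v' ρ' := by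
  intro j
  induction j with
  | zero =>
    intro l cur M v ρ hj hl hu hc
    obtain rfl : l = [] := List.length_eq_zero_iff.1 (by omega)
    refine (Spec.whil_false ?_ (Or.inr ⟨[], v, ρ, rfl, trivial, trivial, fun _ _ => rfl, rfl⟩)).mono
      (by omega) fun _ h => h
    rw [nbit0_holds hl]
    simp
  | succ j ih =>
    intro l cur M v ρ hj hl hu hc
    by_cases hn : l = []
    · subst hn
      refine (Spec.whil_false ?_
        (Or.inr ⟨[], v, ρ, rfl, trivial, trivial, fun _ _ => rfl, rfl⟩)).mono (by omega) fun _ h => h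
      rw [nbit0_holds hl]
      simp
    refine Spec.mono (Spec.whil_true (t := 79 * D + 203) (t' := j * (79 * D + 204) + 1) ?_ ?_)
      (by rw [add_mul, one_mul]; omega) fun _ h => h
    · rw [nbit0_holds hl]
      simpa using hn
    · refine (gateProg_spec hl hu (by omega)).mono le_rfl ?_
      rintro σ' (⟨hb, h⟩ | ⟨g, l', x, ρ', hg, rfl, hx, rfl⟩)
      · refine (Spec.whil_false ?_ (Or.inl ⟨hb, ?_⟩)).mono (by omega) fun _ h => h
        · exact fun h => h hb.blank
        · rintro ⟨gs, h1, h2⟩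
          cases gs with
          | nil => exact hn h1
          | cons g gs => exact h ⟨g, _, h2.1, h1⟩
      · have hpos := List.length_pos_iff.2 (Gate.code_ne_nil g)
        rw [List.length_append] at hj hc
        refine (ih (by omega) ((List.suffix_append _ _).trans hl) hu (by omega)).mono le_rfl ?_
        rintro σ' (⟨hb, h⟩ | ⟨gs, v', ρ'', rfl, h2, h3, h4, rfl⟩)
        · refine Or.inl ⟨hb, ?_⟩
          rintro ⟨gs, h1, h2⟩
          cases gs with
          | nil => simp [Gate.code_ne_nil] at h1
          | cons g' gs =>
            have := Gate.code_append_inj h1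
            exact h ⟨gs, this.2, h2.2⟩
        · refine Or.inr ⟨g :: gs, v', ρ'', rfl, ⟨hg, h2⟩, ⟨?_, h3⟩, fun i hi => ?_, ?_⟩
          · exact hx.congr hg fun i hi => (h4 i (by omega)).symm
          · rw [h4 i (by omega)]
            exact Function.update_of_ne (by omega) _ _
          · rw [List.length_cons, add_assoc cur 1, add_comm 1]
            rfl

/-- Go back to the beginning of the input and forget all nodes. -/
def reset : Cmd 7 :=
  rewind 0 ;; goEnd ;; left3 ;; .whil (.nbit 1 none) (.act (.write 1 none) ;; left3) ;; right3

theorem update_replicate (i : ℕ) :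
    Function.update (listArr (List.replicate (i + 1) true)) (i : ℤ) none =
      listArr (List.replicate i true) := by
  funext j
  by_cases h : j = i
  · subst h
    rw [Function.update_self, listArr_replicate, if_neg (lt_irrefl _)]
  · rw [Function.update_of_ne h]
    by_cases hj : 0 ≤ j
    · lift j to ℕ using hj
      rw [listArr_replicate, listArr_replicate]
      have : j < i + 1 ↔ j < i := by omega
      simp only [this]
    · rw [listArr_eq_none (Or.inl (by omega)), listArr_eq_none (Or.inl (by omega))]

theorem reset_spec (hl : l <:+ u) : Spec R reset (EV u l false n k 0 cur M v ρ)
    (3 * u.length + 16 * cur + 20) (· = EV u u false n k 0 0 M v ρ) := by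
  have hle := hl.length_le
  have h1 : Spec R (rewind 0) (EV u l false n k 0 cur M v ρ) (3 * u.length + 5)
      (· = EV u u false n k 0 cur M v ρ) := by
    refine (Spec.rewind (R := R) 0 (EV u l false n k 0 cur M v ρ) (u.length - l.length)
      ?_ ?_).mono (by omega) fun τ hτ => ?_
    · exact listArr_eq_none (Or.inl (by simp [EV]; omega))
    · intro i hi
      have : (EV u l false n k 0 cur M v ρ).pos 0 - (u.length - l.length : ℕ) + i = (i : ℤ) := by
        simp [EV]; omega
      rw [this]
      exact listArr_ne_none (by omega)
    · rw [hτ]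
      refine St.ext rfl rfl ?_ rfl rfl rfl
      funext i
      fin_cases i
      · simp [EV, St.setpos]; omega
      · rfl
      · rfl
  have h2 := Spec.whil_inv (R := R) (b := .nbit 1 none) (p := .act (.write 1 none) ;; left3) (t := 8)
    (fun j τ => τ = EV u u false n k (j - 1) j M v ρ)
    (fun j τ hτ => by
      rw [hτ]
      cases j with
      | zero =>
        refine iff_of_false (fun h => h ?_) (by simp)
        simpa [EV] using listArr_neg_one (List.replicate 0 true)
      | succ j =>
        rw [show ((j + 1 : ℕ) : ℤ) - 1 = (j : ℕ) by push_cast; ring, nbit1_holds]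
        omega)
    (fun j τ hτ => by
      rw [hτ, show ((j + 1 : ℕ) : ℤ) - 1 = (j : ℕ) by push_cast; ring]
      have hw : Spec R (.act (.write 1 none)) (EV u u false n k j (j + 1) M v ρ) 2
          (· = EV u u false n k j j M v ρ) := by
        refine Spec.act_eq (St.ext rfl ?_ rfl rfl rfl rfl)
        funext i
        fin_cases i
        · rfl
        · exact update_replicate j
        · rfl
      exact Spec.seq_eq hw (left3_spec.mono le_rfl fun τ h => ⟨j, le_rfl, h⟩))
    cur _ rfl
  refine (Spec.seq_eq h1 (Spec.seq_eq goEnd_spec (Spec.seq_eq left3_spec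
    (Spec.seq (t' := 6) (h2.mono le_rfl ?_))))).mono (by omega) fun _ h => h
  rintro τ hτ
  rw [hτ]
  exact right3_spec.mono le_rfl fun τ h => by rw [h]; simp

/-- Add a node at the present place. -/
def newNode : Cmd 7 := .act (.write 1 (some true)) ;; right3

theorem newNode_spec (j : ℕ) : Spec R newNode ((EV u l b n k cur cur M v ρ).setc 4 j) 8
    (· = (EV u l b n k (cur + 1 : ℕ) (cur + 1) M v ρ).setc 4 j) := by
  refine Spec.seq_eq (Spec.act_eq (by exact rfl)) (Spec.seq_eq (Spec.act_eq (by exact rfl))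
    (Spec.seq_eq (Spec.act_eq (by exact rfl)) (Spec.act_eq ?_)))
  have := update_listArr (List.replicate cur true) true
  rw [List.length_replicate, ← List.replicate_succ'] at this
  refine St.ext rfl ?_ ?_ rfl ?_ rfl
  · funext i
    fin_cases i
    · rfl
    · simpa [EV, St.setc] using this
    · rfl
  · funext i
    fin_cases i <;> simp [EV, St.setc, dirStep]
  · simp [EV, St.setc, dirStep]

theorem setc_four : (EV u l b n k p cur M v ρ).setc 4 0 = EV u l b n k p cur M v ρ :=
  St.setc_self' rfl

/-- Evaluate all gates and propagate the marks. -/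
def pass : Cmd 7 :=
  -- Constants and inputs only have to be declared as treated nodes: `k` of them by the counter, and
  -- `m` of them by the unary number at the head of the code. Their values already stand in the real
  -- array.
  reset ;; copyCnt 3 4 5 ;; loop 4 newNode ;;
    .whil (.bit 0 (some true)) (.act (.move 0 .right) ;; newNode) ;;
      .ite (.bit 0 none) abort
        (.act (.move 0 .right) ;; home ;; .whil (.nbit 0 none) gateProg)

def passTime (D : ℕ) : ℕ := D * (79 * D + 204) + 80 * D + 80

/-- The leaves are not overwritten. Every pass therefore evaluates the gates on the same, once
rounded, leaves, and the values after it form an evaluation, whatever the earlier passes computed.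
-/
theorem pass_spec (hl : l <:+ u) (hc : cur ≤ D) (hD : k + u.length ≤ D) :
    Spec R pass (EV u l false n k 0 cur M v ρ) (passTime D) fun σ' =>
      (Bad n σ' ∧ ¬ ∃ (m : ℕ) (gs : List Gate), u = natCode m ++ gs.flatMap Gate.code ∧
        Along Gate.Below (k + m) gs) ∨
      ∃ (m : ℕ) (gs : List Gate) (v' : ℤ → ℝ) (ρ' : Fin 3 → ℝ),
        u = natCode m ++ gs.flatMap Gate.code ∧ Along Gate.Below (k + m) gs ∧
        Along (Gate.Holds R fun i : ℕ => v' i) (k + m) gs ∧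
        (∀ i < k + m, v' (i : ℕ) = v (i : ℕ)) ∧
        σ' = EV u [] false n k 0 (k + m + gs.length) (passMark M (k + m) gs) v' ρ' := by
  have h2 := Spec.copyCnt (R := R) (i := 3) (j := 4) (s := 5) (by decide) (by decide) (by decide)
    (EV u u false n k 0 0 M v ρ) rfl
  have h3 := Spec.loop_up (R := R) (i := 4) (p := newNode) (t := 8) (n := k)
    (fun d j => (EV u u false n k d d M v ρ).setc 4 j) (by simp) (by simp [St.setc_setc])
    (fun d j hd => newNode_spec j)
  rw [setc_four] at h3
  have h4 : ∀ (l : List Bool) (i : ℕ), l <:+ u →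
      Spec R (.whil (.bit 0 (some true)) (.act (.move 0 .right) ;; newNode))
      (EV u l false n k i i M v ρ) (11 * l.length + 1) (fun σ' => ∃ (m : ℕ) (l' : List Bool),
        l = List.replicate m true ++ l' ∧ l'.head? ≠ some true ∧
        σ' = EV u l' false n k (i + m : ℕ) (i + m) M v ρ) := by
    intro l
    induction l with
    | nil =>
      intro i hl
      refine Spec.whil_false ?_ ⟨0, [], rfl, by simp, rfl⟩
      rw [bit0_holds hl]
      simp
    | cons x l ih =>
      intro i hl
      cases x with
      | false =>
        refine (Spec.whil_false ?_ ⟨0, false :: l, rfl, by simp, rfl⟩).mono (by omega)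
          fun _ h => h
        rw [bit0_holds hl]
        simp
      | true =>
        refine (Spec.whil_true (t := 10) (t' := 11 * l.length + 1) ?_ ?_).mono ?_ fun _ h => h
        · rw [bit0_holds hl]
          simp
        · have := newNode_spec (R := R) (u := u) (l := l) (b := false) (n := n) (k := k) (cur := i)
            (M := M) (v := v) (ρ := ρ) 0
          rw [setc_four, setc_four] at this
          refine Spec.seq_eq move0_spec (this.mono le_rfl fun τ hτ => ?_)
          rw [hτ]
          refine (ih (i + 1) ((List.suffix_cons _ l).trans hl)).mono le_rfl ?_
          rintro τ ⟨a, l', h1, h2, h3⟩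
          exact ⟨a + 1, l', by rw [h1]; rfl, h2, by rw [h3, add_assoc i 1, add_comm 1 a]⟩
        · simp
          omega
  refine Spec.mono (Spec.seq_eq (reset_spec hl) (Spec.seq_eq h2 (Spec.seq_eq h3
    (Spec.seq (t' := 7 * D + 17 + (D * (79 * D + 204) + 1)) ((h4 u k List.suffix_rfl).mono le_rfl
      ?_))))) ?_ fun _ h => h
  swap
  · have e3 : (EV u u false n k 0 0 M v ρ).cnt 3 = k := rfl
    have e4 : (EV u u false n k 0 0 M v ρ).cnt 4 = 0 := rfl
    rw [e3, e4, passTime]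
    omega
  rintro τ ⟨m, l', h1, h2, rfl⟩
  have hl' : l' <:+ u := h1 ▸ List.suffix_append _ _
  have hlen : u.length = m + l'.length := by rw [h1]; simp
  refine Spec.mono (Spec.ite (t := 7 * D + 16 + (D * (79 * D + 204) + 1)) (fun h => ?_) fun h => ?_)
    (by omega) fun _ h => h
  · rw [bit0_holds hl'] at h
    refine (abort_spec hl').mono (by omega) fun τ hτ => Or.inl ⟨hτ, ?_⟩
    rintro ⟨m', gs, h3, -⟩
    obtain rfl : l' = [] := by simpa using h
    have : false ∈ u := by rw [h3]; simp [natCode]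
    rw [h1] at this
    simp at this
  · rw [bit0_holds hl'] at h
    obtain ⟨l'', rfl⟩ : ∃ l'', l' = false :: l'' := by
      cases l' with
      | nil => simp at h
      | cons x l' =>
        cases x with
        | true => simp at h2
        | false => exact ⟨l', rfl⟩
    have hu : u = natCode m ++ l'' := by
      conv_lhs => rw [h1]
      simp [natCode]
    rw [List.length_cons] at hlen
    refine (Spec.seq_eq move0_spec (Spec.seq_eq (home_spec le_rfl)
      ((gates_spec (D := D) D (by omega) ((List.suffix_cons _ _).trans hl') (by omega)
        (by omega)).mono le_rfl ?_))).mono (by omega) fun _ h => h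
    rintro σ' (⟨hb, h⟩ | ⟨gs, v', ρ', rfl, h6⟩)
    · refine Or.inl ⟨hb, ?_⟩
      rintro ⟨m', gs, h3, h4⟩
      obtain ⟨rfl, rfl⟩ := natCode_append_inj (hu.symm.trans h3)
      exact h ⟨gs, rfl, h4⟩
    · exact Or.inr ⟨m, gs, v', ρ', hu, h6⟩

end

end Ev
end FiniteBSS
namespace FiniteBSS
namespace Ev

section
variable {R : ℝ → ℝ → Prop} [IsSerial R] {u l l' : List Bool} {b a : Bool} {n k : ℕ} {p : ℤ}
  {cur D : ℕ} {M : ℤ → Option Bool} {v : ℤ → ℝ} {ρ : Fin 3 → ℝ} {Q : St 7 → Prop} {t : ℕ}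

local notation "ev" => EV u l b n k p cur M v ρ

/-! ### The whole program -/

/-- Reject if there are fewer reals than bits. -/
def skipPad : Cmd 7 :=
  -- Bits and reals are walked through in parallel. The counter `2` ends with the number of bits,
  -- the first part of the number of rounds.
  .whil (.nbit 0 none) (.act (.move 0 .right) ;; .act (.inc 2) ;; .ite (.bit 1 none) abort right3)

theorem skipPad_spec (hu : u.length ≤ D) : Spec R skipPad (EV u u false 0 0 0 cur M v ρ)
    (D * (3 * D + 15) + 1) fun σ' =>
      ((∃ n, Bad n σ') ∧ cur < u.length) ∨
      (u.length ≤ cur ∧ σ' = EV u [] false u.length 0 u.length cur M v ρ) := by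
  have key : ∀ (l : List Bool) (i : ℕ), l <:+ u → i + l.length = u.length → i ≤ cur →
      Spec R skipPad (EV u l false i 0 i cur M v ρ) (l.length * (3 * D + 15) + 1) fun σ' =>
      ((∃ n, Bad n σ') ∧ cur < u.length) ∨
      (u.length ≤ cur ∧ σ' = EV u [] false u.length 0 u.length cur M v ρ) := by
    intro l
    induction l with
    | nil =>
      intro i hl hi hc
      simp only [List.length_nil, add_zero] at hi
      subst hi
      refine (Spec.whil_false ?_ (Or.inr ⟨hc, rfl⟩)).mono (by omega) fun _ h => h
      rw [nbit0_holds hl]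
      simp
    | cons x l ih =>
      intro i hl hi hc
      have hl' : l <:+ u := (List.suffix_cons _ l).trans hl
      have h2 : Spec R (.act (.inc 2)) (EV u l false i 0 i cur M v ρ) 2
          (· = EV u l false (i + 1) 0 i cur M v ρ) := by
        refine Spec.act_eq (St.ext ?_ rfl rfl rfl rfl rfl)
        funext i
        fin_cases i <;> rfl
      rw [List.length_cons] at hi
      refine (Spec.whil_true (t := 2 + (2 + (3 * D + 9 + 1)))
        (t' := l.length * (3 * D + 15) + 1 - 0) ?_ (Spec.seq_eq move0_spec (Spec.seq_eq h2
          (Spec.ite (fun h => ?_) fun h => ?_)))).mono ?_ fun _ h => h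
      · rw [nbit0_holds hl]
        simp
      · rw [bit1_holds] at h
        refine (abort_spec hl').mono (by omega) fun τ hτ => ?_
        refine (Spec.whil_false ?_ (Or.inl ⟨⟨_, hτ⟩, by omega⟩)).mono (by omega) fun _ h => h
        exact fun h => h hτ.blank
      · rw [bit1_holds] at h
        refine right3_spec.mono (by omega) fun τ hτ => ?_
        rw [hτ]
        exact ih (i + 1) hl' (by omega) (by omega)
      · rw [List.length_cons, add_mul, one_mul]
        omega
  refine (key u 0 List.suffix_rfl (by omega) (by omega)).mono ?_ fun _ h => h
  have := Nat.mul_le_mul_right (3 * D + 15) hu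
  omega

/-- Count the pairs among the remaining reals, and reject if one real is left over. -/
def pairs : Cmd 7 :=
  .whil (.nbit 1 none)
    (.act (.inc 3) ;; .act (.inc 2) ;; right3 ;; .ite (.bit 1 none) (.act (.inc 0)) right3)

theorem bad_setc : Bad n ((EV u [] b n k p cur M v ρ).setc 0 1) where
  flag := by simp
  rounds := by simp; rfl
  answer := by simp; rfl
  blank := listArr_suffix (l := []) List.nil_suffix

theorem pairs_spec {s : ℕ} (hs : s ≤ cur) : Spec R pairs (EV u [] false s 0 s cur M v ρ)
    (18 * cur + 1) fun σ' =>
      ((∃ n, Bad n σ') ∧ ¬ ∃ k, cur = s + 2 * k) ∨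
      ∃ k, cur = s + 2 * k ∧ σ' = EV u [] false (s + k) k cur cur M v ρ := by
  have key : ∀ (j i : ℕ), s + 2 * i + j = cur →
      Spec R pairs (EV u [] false (s + i) i (s + 2 * i : ℕ) cur M v ρ) (18 * j + 1) fun σ' =>
      ((∃ n, Bad n σ') ∧ ¬ ∃ k, cur = s + 2 * k) ∨
      ∃ k, cur = s + 2 * k ∧ σ' = EV u [] false (s + k) k cur cur M v ρ := by
    intro j
    induction j using Nat.strong_induction_on with
    | _ j ih =>
      intro i hi
      by_cases hj : j = 0
      · refine (Spec.whil_false ?_ (Or.inr ⟨i, by omega, ?_⟩)).mono (by omega) fun _ h => h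
        · rw [nbit1_holds]
          omega
        · rw [show s + 2 * i = cur by omega]
      · have h1 : Spec R (.act (.inc 3)) (EV u [] false (s + i) i (s + 2 * i : ℕ) cur M v ρ) 2
            (· = EV u [] false (s + i) (i + 1) (s + 2 * i : ℕ) cur M v ρ) := by
          refine Spec.act_eq (St.ext ?_ rfl rfl rfl rfl rfl)
          funext i
          fin_cases i <;> rfl
        have h2 : Spec R (.act (.inc 2)) (EV u [] false (s + i) (i + 1) (s + 2 * i : ℕ) cur M v ρ) 2
            (· = EV u [] false (s + (i + 1)) (i + 1) (s + 2 * i : ℕ) cur M v ρ) := by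
          refine Spec.act_eq (St.ext ?_ rfl rfl rfl rfl rfl)
          funext i
          fin_cases i <;> rfl
        have h3 : Spec R right3 (EV u [] false (s + (i + 1)) (i + 1) (s + 2 * i : ℕ) cur M v ρ) 6
            (· = EV u [] false (s + (i + 1)) (i + 1) (s + 2 * i + 1 : ℕ) cur M v ρ) :=
          right3_spec.mono le_rfl fun _ h => by rw [h]; push_cast; rfl
        refine (Spec.whil_true (t := 2 + (2 + (6 + (6 + 1)))) (t' := 18 * (j - 1) + 1) ?_
          (Spec.seq_eq h1 (Spec.seq_eq h2 (Spec.seq_eq h3 (Spec.ite (fun h => ?_) fun h => ?_))))).mono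
          (by omega) fun _ h => h
        · rw [nbit1_holds]
          omega
        · rw [bit1_holds] at h
          obtain rfl : cur = s + 2 * i + 1 := by omega
          refine (Spec.inc 0 _).mono (by omega) fun τ hτ => ?_
          rw [hτ]
          refine (Spec.whil_false ?_ (Or.inl ⟨⟨_, bad_setc⟩, ?_⟩)).mono (by omega) fun _ h => h
          · refine fun h' => h' ?_
            have := listArr_replicate (s + 2 * i + 1) (s + 2 * i + 1)
            rwa [if_neg (lt_irrefl _)] at this
          · rintro ⟨k, hk⟩
            omega
        · rw [bit1_holds] at h
          refine right3_spec.mono le_rfl fun τ hτ => ?_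
          rw [hτ]
          refine ((ih (j - 2) (by omega) (i + 1) (by omega)).mono (by omega) fun _ h => h)
  exact (key (cur - s) 0 (by omega)).mono (by omega) fun _ h => h

theorem right3_setc {c : ℕ} : Spec R right3 ((ev).setc 0 c) 6
    (· = (EV u l b n k (p + 1) cur M v ρ).setc 0 c) := by
  refine Spec.seq_eq (Spec.act_eq (by exact rfl)) (Spec.seq_eq (Spec.act_eq (by exact rfl))
    (Spec.act_eq ?_))
  refine St.ext rfl rfl ?_ rfl rfl rfl
  funext i
  fin_cases i <;> rfl

theorem left3_setc {c : ℕ} : Spec R left3 ((ev).setc 0 c) 6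
    (· = (EV u l b n k (p - 1) cur M v ρ).setc 0 c) := by
  refine Spec.seq_eq (Spec.act_eq (by exact rfl)) (Spec.seq_eq (Spec.act_eq (by exact rfl))
    (Spec.act_eq ?_))
  refine St.ext rfl rfl ?_ rfl rfl rfl
  funext i
  fin_cases i <;> rfl

theorem setc_zero : (ev).setc 0 0 = ev := St.setc_self' rfl

/-- Count the nodes without a mark. -/
def checkMarks : Cmd 7 :=
  .whil (.nbit 1 none) (.ite (.bit 2 (some true)) (.act .skip) (.act (.inc 0)) ;; right3)

theorem checkMarks_spec : Spec R checkMarks (EV u l b n k 0 cur M v ρ) (10 * cur + 1) fun σ' =>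
    ∃ c, (c = 0 ↔ ∀ j < cur, M (j : ℕ) = some true) ∧
      σ' = (EV u l b n k cur cur M v ρ).setc 0 c := by
  have := Spec.whil_inv (R := R) (b := .nbit 1 none)
    (p := .ite (.bit 2 (some true)) (.act .skip) (.act (.inc 0)) ;; right3) (t := 9)
    (fun j τ => ∃ i c : ℕ, i + j = cur ∧ (c = 0 ↔ ∀ j < i, M (j : ℕ) = some true) ∧
      τ = (EV u l b n k i cur M v ρ).setc 0 c)
    (fun j τ ⟨i, c, hi, hc, hτ⟩ => by
      rw [hτ]
      refine (nbit1_holds (u := u) (l := l) (b := b) (n := n) (k := k) (M := M) (v := v)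
        (ρ := ρ)).trans ?_
      omega)
    (fun j τ ⟨i, c, hi, hc, hτ⟩ => by
      rw [hτ]
      refine Spec.mono (Spec.seq (t := 2 + 1) (t' := 6) (Spec.ite (fun h => Spec.act ?_)
        fun h => Spec.act ?_)) le_rfl fun _ h => h
      · have h : M i = some true := h
        refine right3_setc.mono le_rfl fun τ hτ => ⟨j, le_rfl, i + 1, c, by omega, ?_, hτ⟩
        rw [hc]
        refine ⟨fun h' x hx => ?_, fun h' x hx => h' x (by omega)⟩
        rcases Nat.lt_succ_iff_lt_or_eq.1 hx with hx | rfl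
        exacts [h' x hx, h]
      · have h : ¬ M i = some true := h
        have e : ((EV u l b n k i cur M v ρ).setc 0 c).setc 0
            (((EV u l b n k i cur M v ρ).setc 0 c).cnt 0 + 1) =
            (EV u l b n k i cur M v ρ).setc 0 (c + 1) := by simp [St.setc_setc]
        show Spec _ _ _ _ _
        rw [e]
        refine right3_setc.mono le_rfl fun τ hτ => ⟨j, le_rfl, i + 1, c + 1, by omega, ?_, hτ⟩
        exact iff_of_false (by omega) fun h' => h (h' i (by omega)))
    cur _ ⟨0, 0, by omega, by simp, setc_zero.symm⟩
  refine this.mono (by omega) fun τ ⟨i, c, hi, hc, hτ⟩ => ?_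
  obtain rfl : i = cur := by omega
  exact ⟨c, hc, hτ⟩

/-- Accept if all nodes are marked and the value of the last one is not negative. -/
def check : Cmd 7 :=
  -- The counter `0` now counts objections: nodes without a mark and, as there would be none of
  -- these, the absence of nodes. After `left3` the head stands on the last node, or on a blank if
  -- there is none.
  checkMarks ;; left3 ;; .ite (.bit 1 none) (.act (.inc 0)) (.act .skip) ;; .act (.load 0) ;;
    .ite (.zero 0) (.ite (.neg 0) (.act .skip) (.act (.inc 6))) (.act .skip)

theorem check_spec : Spec R check (EV u l b n k 0 cur M v ρ) (10 * cur + 16) fun σ' =>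
    (σ'.cnt 6 ≠ 0 ↔ (0 < cur ∧ ∀ j < cur, M (j : ℕ) = some true) ∧ 0 ≤ v (cur - 1 : ℕ)) := by
  refine Spec.mono (Spec.seq (t' := 6 + ((2 + 1) + (2 + (2 + 1 + 1))) - 0)
    (checkMarks_spec.mono le_rfl ?_)) (by omega) fun _ h => h
  rintro τ ⟨c, hc, rfl⟩
  have h3 : ∀ d, Spec R (.act (.load 0)) ((EV u l b n k (cur - 1) cur M v ρ).setc 0 d) 2
      (· = (EV u l b n k (cur - 1) cur M v (Function.update ρ 0 (v (cur - 1)))).setc 0 d) :=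
    fun d => Spec.act_eq (by exact rfl)
  refine Spec.seq_eq left3_setc (Spec.seq (Spec.ite (fun h => ?_) fun h => ?_))
  · obtain rfl : cur = 0 := by
      by_contra h0
      have h : listArr (List.replicate cur true) (cur - 1) = none := h
      rw [show (cur : ℤ) - 1 = (cur - 1 : ℕ) by omega, listArr_replicate, if_pos (by omega)] at h
      simp at h
    refine Spec.act ?_
    have e : ((EV u l b n k ((0 : ℕ) - 1) 0 M v ρ).setc 0 c).setc 0
        (((EV u l b n k ((0 : ℕ) - 1) 0 M v ρ).setc 0 c).cnt 0 + 1) =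
        (EV u l b n k ((0 : ℕ) - 1) 0 M v ρ).setc 0 (c + 1) := by simp [St.setc_setc]
    show Spec _ _ _ _ _
    rw [e]
    refine Spec.seq_eq (h3 _) (Spec.ite (fun h => ?_) fun h => (Spec.act ?_).mono (by omega) fun _ h => h)
    · simp [Test.Holds] at h
    · show _ ↔ _
      simp [EV]
  · refine Spec.act ?_
    have h0 : 0 < cur := by
      rcases Nat.eq_zero_or_pos cur with rfl | h0
      · exact absurd (by simpa [EV, Test.Holds] using listArr_neg_one (List.replicate 0 true)) h
      · exact h0
    have e : (cur : ℤ) - 1 = (cur - 1 : ℕ) := by omega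
    refine Spec.seq_eq (h3 _) (Spec.ite (fun h => Spec.ite (fun h' => Spec.act ?_)
      fun h' => Spec.act ?_) fun h => (Spec.act ?_).mono (by omega) fun _ h => h)
    · have h' : v (cur - 1) < 0 := h'
      rw [e] at h'
      show _ ↔ _
      refine iff_of_false (by simp [EV]) fun h => absurd h.2 (by linarith)
    · have h' : ¬ v (cur - 1) < 0 := h'
      rw [e] at h'
      have hc0 : c = 0 := by simpa [Test.Holds] using h
      show _ ↔ _
      refine iff_of_true (by simp) ⟨⟨h0, hc.1 hc0⟩, not_lt.1 h'⟩
    · have hc0 : ¬ c = 0 := by simpa [Test.Holds] using h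
      show _ ↔ _
      exact iff_of_false (by simp [EV]) fun h => hc0 (hc.2 h.1.2)

end

end Ev
end FiniteBSS
namespace FiniteBSS
namespace Ev

section
variable {R : ℝ → ℝ → Prop} [IsSerial R] {u : List Bool} {n k : ℕ} {p : ℤ}
  {cur D : ℕ} {M : ℤ → Option Bool} {v : ℤ → ℝ} {ρ : Fin 3 → ℝ}

/-- The bits `u` and `k` constants describe a circuit with `m` inputs and the gates `gs`, which is
acyclic. -/
def Parses (u : List Bool) (k m : ℕ) (gs : List Gate) : Prop :=
  u = natCode m ++ gs.flatMap Gate.code ∧ Along Gate.Below (k + m) gs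

theorem Parses.unique {m m' : ℕ} {gs gs' : List Gate} (h : Parses u k m gs)
    (h' : Parses u k m' gs') : m = m' ∧ gs = gs' := by
  have := Circuit.code_injective (a₁ := ⟨[], m, gs⟩) (a₂ := ⟨[], m', gs'⟩)
    (by simp only [Circuit.code, ← h.1, ← h'.1])
  simpa using this

theorem length_le_length_flatMap (gs : List Gate) : gs.length ≤ (gs.flatMap Gate.code).length := by
  induction gs with
  | nil => simp
  | cons g gs ih =>
    have := List.length_pos_iff.2 (Gate.code_ne_nil g)
    simp only [List.length_cons, List.flatMap_cons, List.length_append]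
    omega

/-- Every input and every gate costs at least one bit, and the first number ends with a `false`. So
`|u| + k` exceeds the number of nodes, and `|u| + k + 1` rounds are enough. -/
theorem Parses.lt_length {m : ℕ} {gs : List Gate} (h : Parses u k m gs) :
    m + gs.length < u.length := by
  have := length_le_length_flatMap gs
  rw [h.1]
  simp [natCode] at this ⊢
  omega

/-- The passes serve two purposes: together they spread the marks, and the last one provides the
values. After a rejection the remaining rounds are idle. -/
def rounds : Cmd 7 := loop 2 (.ite (.zero 0) pass (.act .skip))

theorem setc_two {l : List Bool} {b : Bool} {j : ℕ} :
    (EV u l b n k p cur M v ρ).setc 2 j = EV u l b j k p cur M v ρ := by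
  refine St.ext ?_ rfl rfl rfl rfl rfl
  funext i
  fin_cases i <;> rfl

theorem Bad.setc {σ : St 7} (h : Bad n σ) (j : ℕ) : Bad j (σ.setc 2 j) where
  flag := by simpa using h.flag
  rounds := by simp
  answer := by simpa using h.answer
  blank := h.blank

theorem rounds_spec (hc : cur ≤ D) (hD : k + u.length ≤ D) (hn : 0 < n) :
    Spec R rounds (EV u [] false n k 0 cur M v ρ) (n * (passTime D + 4) + 1) fun σ' =>
      (Bad 0 σ' ∧ ¬ ∃ m gs, Parses u k m gs) ∨
      ∃ (m : ℕ) (gs : List Gate) (v' : ℤ → ℝ) (ρ' : Fin 3 → ℝ), Parses u k m gs ∧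
        Along (Gate.Holds R fun i : ℕ => v' i) (k + m) gs ∧
        (∀ i < k + m, v' (i : ℕ) = v (i : ℕ)) ∧
        σ' = EV u [] false 0 k 0 (k + m + gs.length) ((passMark · (k + m) gs)^[n] M) v' ρ' := by
  -- Three situations: rejected, not yet started, or `i` passes completed successfully. Since `0 <
  -- n`, the second one is excluded at the end.
  let I : ℕ → St 7 → Prop := fun j σ =>
    (Bad j σ ∧ ¬ ∃ m gs, Parses u k m gs) ∨ (j = n ∧ σ = EV u [] false n k 0 cur M v ρ) ∨
      ∃ (m : ℕ) (gs : List Gate) (v' : ℤ → ℝ) (ρ' : Fin 3 → ℝ) (i : ℕ), Parses u k m gs ∧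
        Along (Gate.Holds R fun i : ℕ => v' i) (k + m) gs ∧
        (∀ i < k + m, v' (i : ℕ) = v (i : ℕ)) ∧ i + j = n ∧
        σ = EV u [] false j k 0 (k + m + gs.length) ((passMark · (k + m) gs)^[i] M) v' ρ'
  refine (Spec.loop (i := 2) (t := passTime D + 1) I ?_ ?_ (n := n) (Or.inr (Or.inl ⟨rfl, rfl⟩))).mono
    le_rfl ?_
  · rintro j σ (⟨h, -⟩ | ⟨rfl, rfl⟩ | ⟨m, gs, v', ρ', i, -, -, -, -, rfl⟩)
    exacts [h.rounds, rfl, rfl]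
  · rintro j σ (⟨h, h'⟩ | ⟨hj, rfl⟩ | ⟨m, gs, v', ρ', i, h1, h2, h3, h4, rfl⟩)
    · refine Spec.mono (Spec.ite (t := 2) (fun h0 => absurd h0 (h.setc j).flag) fun _ =>
        Spec.act ?_) ?_ fun _ h => h
      · exact Or.inl ⟨h.setc j, h'⟩
      · unfold passTime
        omega
    · rw [setc_two]
      refine Spec.ite (fun _ => ?_) fun h0 => absurd rfl h0
      refine (pass_spec List.nil_suffix hc hD).mono le_rfl ?_
      rintro σ' (⟨hb, h⟩ | ⟨m, gs, v', ρ', h1, h2, h3, h4, rfl⟩)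
      · exact Or.inl ⟨hb, h⟩
      · exact Or.inr (Or.inr ⟨m, gs, v', ρ', 1, ⟨h1, h2⟩, h3, h4, by omega, rfl⟩)
    · rw [setc_two]
      have := h1.lt_length
      refine Spec.ite (fun _ => ?_) fun h0 => absurd rfl h0
      refine (pass_spec List.nil_suffix (by omega) hD).mono le_rfl ?_
      rintro σ' (⟨hb, h⟩ | ⟨m', gs', v'', ρ'', h5, h6, h7, h8, rfl⟩)
      · exact absurd ⟨m, gs, h1⟩ h
      · obtain ⟨rfl, rfl⟩ := h1.unique ⟨h5, h6⟩
        refine Or.inr (Or.inr ⟨m, gs, v'', ρ'', i + 1, h1, h7, fun i hi => (h8 i hi).trans (h3 i hi),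
          by omega, ?_⟩)
        rw [Function.iterate_succ_apply']
  · rintro σ (⟨h, h'⟩ | ⟨hj, -⟩ | ⟨m, gs, v', ρ', i, h1, h2, h3, h4, rfl⟩)
    · exact Or.inl ⟨h, h'⟩
    · omega
    · obtain rfl : i = n := by omega
      exact Or.inr ⟨m, gs, v', ρ', h1, h2, h3, rfl⟩

/-- Initially, only the node `0` is marked. -/
def startMark : ℤ → Option Bool := Function.update (fun _ => none) 0 (some true)

/-- The surplus of reals over bits must be even, namely twice the number `k` of constants. The
counter `2` has collected `|u| + k` at that time and is increased by one, so that at least one pass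
takes place; the spreading starts at the node `0`. -/
def evalProg : Cmd 7 :=
  andThen skipPad (andThen pairs (.act (.inc 2) ;; home ;; .act (.write 2 (some true)) ;;
    rounds ;; .ite (.zero 0) check (.act .skip)))

noncomputable def evalTime : Polynomial ℕ :=
  .X * (3 * .X + 15) + (.X + 1) * (.X * (79 * .X + 204) + 80 * .X + 84) + 60 * .X + 101

theorem init_eq (w : Instance) (x : List ℝ) : St.init 7 w x =
    EV w.1 w.1 false 0 0 0 w.2.length (fun _ => none) (listReal x) (fun _ => 0) := by
  refine St.ext ?_ ?_ ?_ rfl rfl rfl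
  · funext i
    fin_cases i <;> rfl
  · funext i
    fin_cases i <;> simp [EV, St.init]
  · funext i
    fin_cases i <;> simp [EV, St.init]

theorem evalProg_spec (w : Instance) (x : List ℝ) :
    Spec R evalProg (St.init 7 w x) (evalTime.eval w.len) fun σ' =>
      (σ'.cnt 6 = 0 ∧ ¬ ∃ k m gs, w.2.length = w.1.length + 2 * k ∧ Parses w.1 k m gs) ∨
      ∃ (k m : ℕ) (gs : List Gate) (v : ℤ → ℝ), w.2.length = w.1.length + 2 * k ∧
        Parses w.1 k m gs ∧ Along (Gate.Holds R fun i : ℕ => v i) (k + m) gs ∧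
        (∀ i < k + m, v (i : ℕ) = listReal x (i : ℕ)) ∧
        (σ'.cnt 6 ≠ 0 ↔ (0 < k + m + gs.length ∧ ∀ j < k + m + gs.length,
          (passMark · (k + m) gs)^[w.1.length + k + 1] startMark (j : ℕ) = some true) ∧
          0 ≤ v (k + m + gs.length - 1 : ℕ)) := by
  rw [init_eq]
  obtain ⟨u, x₀⟩ := w
  simp only
  set s := u.length with hs
  set c := x₀.length with hc
  have hlen : Instance.len (u, x₀) = s + c := rfl
  rw [hlen]
  obtain ⟨D, hD⟩ : ∃ D, D = s + c := ⟨_, rfl⟩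
  rw [← hD]
  have htime : evalTime.eval D = (D * (3 * D + 15) + 1) + ((18 * D + 1) +
      (2 + (7 * D + 13 + (2 + ((D + 1) * (passTime D + 4) + 1 + (10 * D + 17)))) + 1) + 1)
      + (25 * D + 62) := by
    simp only [evalTime, passTime, Polynomial.eval_add, Polynomial.eval_mul, Polynomial.eval_X,
      Polynomial.eval_ofNat, Polynomial.eval_one]
    ring
  rw [htime]
  refine Spec.mono (spec_andThen (skipPad_spec (D := D) (by omega)) (by omega) ?_ ?_)
    (Nat.le_add_right _ _) fun _ h => h
  swap
  · rintro σ ⟨⟨n, hb⟩, h⟩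
    refine ⟨hb.flag, Or.inl ⟨hb.answer, ?_⟩⟩
    rintro ⟨k, m, gs, h1, -⟩
    omega
  rintro σ ⟨h1, rfl⟩
  refine ⟨rfl, spec_andThen ((pairs_spec h1).mono (by omega) fun _ h => h) (by omega) ?_ ?_⟩
  swap
  · rintro σ ⟨⟨n, hb⟩, h⟩
    refine ⟨hb.flag, Or.inl ⟨hb.answer, ?_⟩⟩
    rintro ⟨k, m, gs, h1, -⟩
    exact h ⟨k, h1⟩
  rintro σ ⟨k, hk, rfl⟩
  refine ⟨rfl, ?_⟩
  have h2 : Spec R (.act (.inc 2))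
      (EV u [] false (s + k) k c c (fun _ => none) (listReal x) fun _ => 0) 2
      (· = EV u [] false (s + k + 1) k c c (fun _ => none) (listReal x) fun _ => 0) := by
    refine Spec.act_eq (St.ext ?_ rfl rfl rfl rfl rfl)
    funext i
    fin_cases i <;> rfl
  have h3 : Spec R (.act (.write 2 (some true)))
      (EV u [] false (s + k + 1) k 0 c (fun _ => none) (listReal x) fun _ => 0) 2
      (· = EV u [] false (s + k + 1) k 0 c startMark (listReal x) fun _ => 0) := by
    refine Spec.act_eq (St.ext rfl ?_ rfl rfl rfl rfl)
    funext i
    fin_cases i <;> rfl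
  refine Spec.seq_eq h2 (Spec.seq_eq ((home_spec le_rfl).mono (by omega) fun _ h => h)
    (Spec.seq_eq h3 (Spec.seq ((rounds_spec (D := D) (by omega) (by omega) (by omega)).mono
      (by gcongr; omega) ?_))))
  rintro σ (⟨hb, h⟩ | ⟨m, gs, v, ρ, h4, h5, h6, rfl⟩)
  · refine Spec.mono (Spec.ite (t := 2) (fun h0 => absurd h0 hb.flag) fun _ => Spec.act ?_)
      (by omega) fun _ h => h
    refine Or.inl ⟨hb.answer, ?_⟩
    rintro ⟨k', m, gs, h1, h7⟩
    obtain rfl : k' = k := by omega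
    exact h ⟨m, gs, h7⟩
  · have := h4.lt_length
    refine Spec.ite (t := 10 * D + 16) (fun _ => ?_) fun h0 => absurd rfl h0
    exact check_spec.mono (by omega) fun σ hσ => Or.inr ⟨k, m, gs, v, hk, h4, h5, h6, hσ⟩

end

/-! ### Connectedness -/

/-- A path has fewer edges than the graph has nodes, and each pass carries a mark at least one edge
further. Conversely, marks never leave the component of the node `0`. -/
theorem connected_iff_marked {C : Circuit} {n : ℕ} (hn : C.numNodes ≤ n)
    (hC : Along Gate.Below C.numLeaves C.gates) :
    (SimpleGraph.fromRel fun i j : Fin C.numNodes => C.Edge i j).Connected ↔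
      0 < C.numNodes ∧ ∀ j < C.numNodes,
        (passMark · C.numLeaves C.gates)^[n] startMark (j : ℕ) = some true := by
  set G := SimpleGraph.fromRel fun i j : Fin C.numNodes => C.Edge i j with hG
  set F : (ℤ → Option Bool) → ℤ → Option Bool := (passMark · C.numLeaves C.gates) with hF
  have hmono : ∀ {i j : ℕ} {a : ℤ}, i ≤ j → F^[i] startMark a = some true →
      F^[j] startMark a = some true := by
    intro i j a hij h
    induction j, hij using Nat.le_induction with
    | base => exact h
    | succ j _ ih =>
      rw [Function.iterate_succ_apply']
      exact passMark_mono ih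
  have hstart : startMark 0 = some true := Function.update_self ..
  constructor
  · intro h
    have h0 : 0 < C.numNodes := by
      obtain ⟨i⟩ := h.nonempty
      exact Fin.pos i
    refine ⟨h0, fun j hj => ?_⟩
    -- Induction on a walk that ends in the node `0`; the edge at its beginning is the one that the
    -- last pass crosses.
    have walk : ∀ (i j : Fin C.numNodes) (q : G.Walk i j), (j : ℕ) = 0 →
        F^[q.length] startMark (i : ℕ) = some true := by
      intro i j q hj
      induction q with
      | nil => simpa [hj] using hstart
      | @cons i j' j hij q ih =>
        rw [SimpleGraph.Walk.length_cons, Function.iterate_succ_apply']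
        have := ih hj
        rw [hG, SimpleGraph.fromRel_adj] at hij
        rcases hij.2 with ⟨t, ht, he⟩ | ⟨t, ht, he⟩
        · rw [ht] at this
          exact (passMark_edge t.2 he).2 this
        · rw [ht]
          exact (passMark_edge t.2 he).1 this
    obtain ⟨q, hq⟩ := (h.preconnected ⟨j, hj⟩ ⟨0, h0⟩).exists_isPath
    have hl := hq.length_lt
    rw [Fintype.card_fin] at hl
    exact hmono (by omega) (walk _ _ q rfl)
  · rintro ⟨h0, h⟩
    have : ∀ n (a : ℕ), F^[n] startMark a = some true →
        ∃ ha : a < C.numNodes, G.Reachable ⟨0, h0⟩ ⟨a, ha⟩ := by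
      intro n
      induction n with
      | zero =>
        intro a ha
        obtain rfl : a = 0 := by
          by_contra hne
          rw [Function.iterate_zero_apply, startMark, Function.update_of_ne (by omega)] at ha
          simp at ha
        exact ⟨h0, SimpleGraph.Reachable.refl _⟩
      | succ n ih =>
        intro a ha
        rw [Function.iterate_succ_apply'] at ha
        refine passMark_sound (S := fun a => ∃ ha : a < C.numNodes, G.Reachable ⟨0, h0⟩ ⟨a, ha⟩)
          (fun t ht b hb => ?_) ih ha
        have hbt : b < C.numLeaves + t := along_iff.1 hC t ht b hb
        have hN : C.numLeaves + t < C.numNodes := by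
          rw [Circuit.numNodes]
          omega
        have hadj : G.Adj ⟨b, by omega⟩ ⟨C.numLeaves + t, hN⟩ := by
          rw [hG, SimpleGraph.fromRel_adj]
          exact ⟨fun h => by simp at h; omega, Or.inl ⟨⟨t, ht⟩, rfl, hb⟩⟩
        exact ⟨fun ⟨_, h⟩ => ⟨hN, h.trans hadj.reachable⟩,
          fun ⟨_, h⟩ => ⟨by omega, h.trans hadj.symm.reachable⟩⟩
    refine SimpleGraph.connected_iff_exists_forall_reachable _ |>.2 ⟨⟨0, h0⟩, fun j => ?_⟩
    exact (this n j (h j j.2)).2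

end Ev
end FiniteBSS
namespace FiniteBSS

/-! ### Condition numbers and sizes -/

theorem Rounds.mono {ε ε' z v : ℝ} (h : Rounds ε z v) (hε : ε ≤ ε') : Rounds ε' z v :=
  ⟨h.choose, h.choose_spec.1.trans_le hε, h.choose_spec.2⟩

namespace Circuit
variable {C : Circuit} {y : Fin C.numInputs → ℝ} {ε : ℝ}

theorem IsEvaluation.mono {R R' : ℝ → ℝ → Prop} (hR : ∀ z v, R z v → R' z v) {v : ℕ → ℝ}
    (h : C.IsEvaluation R y v) : C.IsEvaluation R' y v := by
  rw [isEvaluation_iff] at h ⊢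
  refine ⟨h.1.imp fun _ _ _ _ _ => hR _ _, h.2.imp fun _ g _ _ _ hg => ?_⟩
  cases g with
  | arith op a b => exact hR _ _ hg
  | select a b c => exact hg

/-- The supremum need not be attained. But below it there is an admissible larger error bound, and
evaluations with smaller errors are among those with larger ones. -/
theorem correct_of_lt_rhoEval (h : ENNReal.ofReal ε < C.rhoEval y) {z : ℝ}
    (hz : C.Yields (Rounds ε) y z) : 0 ≤ z ↔ y ∈ C.solutions := by
  rw [rhoEval, lt_iSup_iff] at h
  obtain ⟨ε', h⟩ := h
  rw [lt_iSup_iff] at h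
  obtain ⟨⟨h0, -, hc⟩, h⟩ := h
  have hle : ε ≤ ε' := ((ENNReal.ofReal_lt_ofReal_iff h0).1 h).le
  obtain ⟨v, hv, hz⟩ := hz
  exact hc z ⟨v, hv.mono fun _ _ h => h.mono hle, hz⟩

theorem le_rhoEval (h0 : 0 < ε) (h1 : ε < 1)
    (h : ∀ z, C.Yields (Rounds ε) y z → (0 ≤ z ↔ y ∈ C.solutions)) :
    ENNReal.ofReal ε ≤ C.rhoEval y :=
  le_iSup₂_of_le (f := fun (ε : ℝ) (_ : ε ∈ {ε : ℝ | 0 < ε ∧ ε < 1 ∧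
    ∀ z, C.Yields (Rounds ε) y z → (0 ≤ z ↔ y ∈ C.solutions)}) => ENNReal.ofReal ε)
    ε ⟨h0, h1, h⟩ le_rfl

theorem rhoEval_le_one : C.rhoEval y ≤ 1 :=
  iSup₂_le fun _ h => ENNReal.ofReal_le_one.2 h.2.1.le

end Circuit

namespace DecisionProblem
variable {P : DecisionProblem} {w : Instance} {j s : ℕ}

theorem logCond_le (h : P.cond w ≤ 2 ^ j) : P.logCond w ≤ j := by
  have h2 : (P.cond w).toReal ≤ 2 ^ j := by
    have := ENNReal.toReal_mono (by finiteness) h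
    simpa using this
  have h1 : 1 ≤ (P.cond w).toReal := by
    have := ENNReal.toReal_mono (ne_top_of_le_ne_top (by finiteness) h) (P.one_le_cond w)
    simpa using this
  rw [logCond, Real.logb_le_iff_le_rpow one_lt_two (by linarith), Real.rpow_natCast]
  exact h2

theorem logCond_nonneg (P : DecisionProblem) (w : Instance) : 0 ≤ P.logCond w := by
  by_cases h : P.cond w = ⊤
  · simp [logCond, h]
  · have h1 : 1 ≤ (P.cond w).toReal := by
      have := ENNReal.toReal_mono h (P.one_le_cond w)
      simpa using this
    exact Real.logb_nonneg one_lt_two h1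

theorem cond_le_of_logCond_le (h : P.cond w ≠ ⊤) (hj : P.logCond w ≤ j) : P.cond w ≤ 2 ^ j := by
  have h1 : 1 ≤ (P.cond w).toReal := by
    have := ENNReal.toReal_mono h (P.one_le_cond w)
    simpa using this
  rw [logCond, Real.logb_le_iff_le_rpow one_lt_two (by linarith), Real.rpow_natCast] at hj
  rw [← ENNReal.ofReal_toReal h]
  refine (ENNReal.ofReal_le_ofReal hj).trans ?_
  rw [ENNReal.ofReal_pow (by norm_num)]
  simp

theorem size_eq_iff : P.size w = s ↔ P.cond w ≠ ⊤ ∧ w.len + ⌈P.logCond w⌉₊ = s := by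
  unfold size
  split_ifs with h
  · simp [h]
  · simp only [h, ne_eq, not_false_eq_true, true_and, Nat.cast_inj]

theorem cond_le_of_size (h : P.size w = s) : P.cond w ≤ 2 ^ (s - w.len) := by
  rw [size_eq_iff] at h
  refine cond_le_of_logCond_le h.1 ((Nat.le_ceil _).trans ?_)
  exact_mod_cast (by omega)

theorem len_le_of_size (h : P.size w = s) : w.len ≤ s := by
  rw [size_eq_iff] at h
  omega

theorem size_le (h : P.cond w ≤ 2 ^ j) : P.size w ≤ (w.len + j : ℕ) := by
  rw [size, if_neg (ne_top_of_le_ne_top (by finiteness) h)]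
  have : ⌈P.logCond w⌉₊ ≤ j := Nat.ceil_le.2 (logCond_le h)
  exact_mod_cast Nat.add_le_add_left this _

end DecisionProblem

/-- The extra `1` compensates for the ceiling in the precision and yields a strict inequality, as
needed for a supremum that may not be attained. -/
theorem lt_of_lt_precision {ε : ℝ} (h0 : 0 < ε) {s : ℕ} (h : s + 1 ≤ precision ε) :
    ε < (2 ^ s)⁻¹ := by
  have h1 : (s : ℝ) < Real.logb 2 (1 / ε) := Nat.lt_ceil.1 h
  rw [Real.lt_logb_iff_rpow_lt one_lt_two (by positivity), Real.rpow_natCast, one_div] at h1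
  exact lt_inv_of_lt_inv₀ (by positivity) h1

theorem le_precision {s : ℕ} : s ≤ precision ((2 ^ s)⁻¹ : ℝ) := by
  have : Real.logb 2 (1 / (2 ^ s)⁻¹) = s := by
    rw [one_div, inv_inv, Real.logb_pow, Real.logb_self_eq_one one_lt_two, mul_one]
  rw [precision, this, Nat.ceil_natCast]

/-! ### The problem of evaluating a circuit -/

/-- The instance `w` consists of the code of the circuit `C`, the point `y`, and a padding. -/
structure EvalOK (w : Instance) (C : Circuit) (y : Fin C.numInputs → ℝ) : Prop where
  valid : C.Valid
  bits : w.1 = C.code.1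
  reals : C.leaves y <+: w.2
  -- A certificate as long as the code `(u, c)` with `k` constants has `|u| + k` components, so
  -- there are `|u| + 2 * k` reals in all. This equation lets `k` be recovered from the instance.
  length : w.2.length = w.1.length + 2 * C.consts.length

theorem EvalOK.parses {w : Instance} {C : Circuit} {y : Fin C.numInputs → ℝ} (h : EvalOK w C y) :
    Ev.Parses w.1 C.consts.length C.numInputs C.gates :=
  ⟨h.bits, Circuit.edge_lt_iff.1 h.valid.1⟩

/-- The two lengths give the number of constants, the bits give the number of inputs and the gates,
and then the reals of the leaves are a prefix of known length. -/
theorem EvalOK.unique {w : Instance} {C C' : Circuit} {y : Fin C.numInputs → ℝ}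
    {y' : Fin C'.numInputs → ℝ} (h : EvalOK w C y) (h' : EvalOK w C' y') :
    (⟨C, y⟩ : Σ C : Circuit, (Fin C.numInputs → ℝ)) = ⟨C', y'⟩ := by
  have hk : C.consts.length = C'.consts.length := by
    have := h.length
    have := h'.length
    omega
  have hp := h.parses
  rw [hk] at hp
  have hu := hp.unique h'.parses
  have hr : C.leaves y = C'.leaves y' := by
    refine (List.prefix_of_prefix_length_le h.reals h'.reals ?_).eq_of_length ?_ <;>
      simp [Circuit.leaves, hk, hu.1]
  obtain ⟨c, m, gs⟩ := C
  obtain ⟨c', m', gs'⟩ := C'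
  obtain ⟨rfl, rfl⟩ := hu
  have := List.append_inj hr hk
  obtain ⟨rfl, h2⟩ := this
  rw [List.ofFn_injective h2]

/-- Decide whether a point is a solution of a circuit. -/
noncomputable def evalProblem : DecisionProblem where
  carrier := {w | ∃ C y, EvalOK w C y ∧ y ∈ C.solutions}
  -- By uniqueness at most one pair contributes. Without any, the supremum is `0` and the condition
  -- number is `1`.
  cond w := max 1 (⨆ (C : Circuit) (y : Fin C.numInputs → ℝ) (_ : EvalOK w C y), (C.rhoEval y)⁻¹)
  one_le_cond _ := le_max_left _ _

theorem EvalOK.cond_eq {w : Instance} {C : Circuit} {y : Fin C.numInputs → ℝ} (h : EvalOK w C y) :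
    evalProblem.cond w = max 1 (C.rhoEval y)⁻¹ := by
  show max _ _ = _
  congr 1
  refine le_antisymm (iSup_le fun C' => iSup₂_le fun y' h' => ?_) ?_
  · cases h.unique h'
    exact le_rfl
  · exact le_iSup_of_le C (le_iSup₂_of_le (f := fun y (_ : EvalOK w C y) => (C.rhoEval y)⁻¹)
      y h le_rfl)

theorem EvalOK.mem_carrier {w : Instance} {C : Circuit} {y : Fin C.numInputs → ℝ}
    (h : EvalOK w C y) : w ∈ evalProblem.carrier ↔ y ∈ C.solutions := by
  constructor
  · rintro ⟨C', y', h', hs⟩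
    cases h.unique h'
    exact hs
  · exact fun hs => ⟨C, y, h, hs⟩

theorem listReal_natCast {l : List ℝ} {i : ℕ} (h : i < l.length) : listReal l (i : ℕ) = l[i] := by
  simp [listReal, h]

/-- Rounding enters only through the sign of the output. Syntax and connectedness are decided
exactly, so the hypothesis is needed for proper circuits only. -/
theorem evalProgram_correct {R : ℝ → ℝ → Prop} [IsSerial R] {w : Instance}
    (h : ∀ (C : Circuit) (y : Fin C.numInputs → ℝ) (z : ℝ), EvalOK w C y → C.Yields R y z →
      (0 ≤ z ↔ y ∈ C.solutions)) :
    (Ev.evalProg.machine (.pos 6)).AnswersCorrectly R w evalProblem.carrier := by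
  refine (Cmd.machine_decides fun x _ => Ev.evalProg_spec w x).2 _ ?_
  rintro x hx σ (⟨h0, h1⟩ | ⟨k, m, gs, v, h1, h2, h3, h4, h5⟩)
  · refine iff_of_false (fun h => h h0) ?_
    rintro ⟨C, y, hC, -⟩
    exact h1 ⟨_, _, _, hC.length, hC.parses⟩
  · have hlt := h2.lt_length
    set C : Circuit := ⟨w.2.take k, m, gs⟩ with hC
    have hk : C.consts.length = k := by simp [hC]; omega
    have hL : C.numLeaves = k + m := by rw [Circuit.numLeaves, hk]
    have hN : C.numNodes = k + m + gs.length := by rw [Circuit.numNodes, hL]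
    have hb : Along Gate.Below C.numLeaves C.gates := by rw [hL]; exact h2.2
    have hcon : (SimpleGraph.fromRel fun i j : Fin C.numNodes => C.Edge i j).Connected ↔
        0 < k + m + gs.length ∧ ∀ j < k + m + gs.length,
          (Ev.passMark · (k + m) gs)^[w.1.length + k + 1] Ev.startMark (j : ℕ) = some true := by
      rw [Ev.connected_iff_marked (n := w.1.length + k + 1) (by omega) hb, hN, hL]
    refine Iff.trans (h5 : Test.Holds σ (.pos 6) ↔ _) ?_
    rw [← hcon]
    by_cases hv : C.Valid
    · set y : Fin C.numInputs → ℝ := fun i => w.2[k + i]'(by have := i.2; simp [hC] at this; omega)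
        with hy
      have hl : C.leaves y = w.2.take (k + m) := by
        refine List.ext_getElem ?_ fun i hi hi' => ?_
        · rw [Circuit.length_leaves, hL, List.length_take]
          omega
        · simp only [Circuit.leaves, List.getElem_append, hk, List.getElem_ofFn, List.getElem_take]
          split_ifs with hik
          · simp [hC]
          · simp only [hy]
            congr 1
            omega
      have hok : EvalOK w C y := ⟨hv, h2.1, by rw [hl]; exact List.take_prefix _ _, by rw [hk, h1]⟩
      have hz : C.Yields R y (v (C.numNodes - 1 : ℕ)) := by
        refine ⟨fun i => v i, Circuit.isEvaluation_iff.2 ⟨along_iff.2 fun t ht => ?_, ?_⟩, rfl⟩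
        · have ht' := ht
          rw [Circuit.length_leaves, hL] at ht'
          rw [zero_add, h4 t ht']
          have hlen := hx.length_eq
          rw [listReal_natCast (by omega)]
          have := (List.forall₂_iff_get.1 hx).2 t (by omega) (by omega)
          simpa [hl] using this
        · rw [hL]
          exact h3
      have hz0 := h C y _ hok hz
      rw [hN] at hz0
      rw [hok.mem_carrier, ← hz0]
      exact ⟨fun h => h.2, fun h => ⟨hv.2, h⟩⟩
    -- The gates can be parsed but the graph is disconnected. Any circuit that fits the instance
    -- would have the same leaves in number and the same gates, hence the same graph.
    · refine iff_of_false (fun h => hv ⟨Circuit.edge_lt_iff.2 hb, h.1⟩) ?_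
      rintro ⟨C', y', h', -⟩
      have hk' : C'.consts.length = k := by
        have := h'.length
        omega
      have hp := h'.parses
      rw [hk'] at hp
      have hu := hp.unique h2
      apply hv
      refine ⟨Circuit.edge_lt_iff.2 hb, ?_⟩
      have := (Ev.connected_iff_marked (C := C') (n := w.1.length + k + 1) ?_
        (Circuit.edge_lt_iff.1 h'.valid.1)).1 h'.valid.2
      · rw [Circuit.numNodes, Circuit.numLeaves, hk', hu.1, hu.2] at this
        rwa [hcon]
      · rw [Circuit.numNodes, Circuit.numLeaves, hk', hu.1, hu.2]
        omega

theorem pDir_evalProblem : PDir evalProblem := by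
  -- The final test takes one more step. The precision `s + 1` forces `ε < 2 ^ (-s)`, and `2 ^ (-s)`
  -- is at most `rhoEval` for an instance of size `s`.
  refine ⟨Ev.evalProg.machine (.pos 6), Ev.evalTime + 1, .X + 1, fun w => ⟨?_, ?_, ?_⟩⟩
  · intro ε h0 _
    have := isSerial_rounds h0
    simpa using (Cmd.machine_decides (b := .pos 6) (R := Rounds ε) (w := w)
      fun x _ => Ev.evalProg_spec w x).1
  · intro ε h0 _ s hs hq
    have := isSerial_rounds h0
    refine evalProgram_correct fun C y z hok hz => Circuit.correct_of_lt_rhoEval ?_ hz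
    have hlt := lt_of_lt_precision h0 (s := s) (by simpa using hq)
    have hc := DecisionProblem.cond_le_of_size hs
    rw [hok.cond_eq] at hc
    have h2 : (C.rhoEval y)⁻¹ ≤ 2 ^ s :=
      (le_max_right _ _).trans (hc.trans (pow_le_pow_right₀ (by norm_num) (by omega)))
    rw [ENNReal.inv_le_iff_inv_le] at h2
    refine lt_of_lt_of_le ?_ h2
    have e : ((2 : ℝ≥0∞) ^ s)⁻¹ = ENNReal.ofReal ((2 ^ s)⁻¹) := by
      rw [ENNReal.ofReal_inv_of_pos (by positivity), ENNReal.ofReal_pow (by norm_num)]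
      simp
    rw [e]
    exact (ENNReal.ofReal_lt_ofReal_iff (by positivity)).2 hlt
  · refine evalProgram_correct fun C y z hok hz => (Circuit.mem_solutions_iff
      (Circuit.edge_lt_iff.1 hok.valid.1) ?_ hz).symm
    obtain ⟨i⟩ := hok.valid.2.nonempty
    exact Fin.pos i

end FiniteBSS
namespace FiniteBSS

/-! ### A common form of the two classes -/

open Classical in
/-- The common generalization of `rhoFeas` and `rhoBFeas`, with the weight `2 ^ e y`. -/
noncomputable def Circuit.rhoWeighted (e : ∀ m : ℕ, (Fin m → ℝ) → ℕ) (C : Circuit) : ℝ≥0∞ :=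
  if C.Feasible then ⨆ y ∈ C.solutions, C.rhoEval y * (2 ^ e _ y)⁻¹ else ⨅ y, C.rhoEval y

/-- Nondeterministic direct polynomial cost, with certificates `y` of bounded `e y`. -/
def NPWeighted (e : ∀ m : ℕ, (Fin m → ℝ) → ℕ) (W : DecisionProblem) : Prop :=
  ∃ B : DecisionProblem, PDir B ∧ ∃ (p q : Polynomial ℕ) (Q : Polynomial ℝ), ∀ w : Instance,
    (w ∈ W.carrier → ∃ y : Fin (p.eval w.len) → ℝ,
      w.append y ∈ B.carrier ∧ CondBounded Q W B w (w.append y) ∧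
      ∀ s : ℕ, W.size w = s → e _ y ≤ q.eval s) ∧
    (w ∉ W.carrier → ∀ y : Fin (p.eval w.len) → ℝ,
      w.append y ∉ B.carrier ∧ CondBounded Q W B w (w.append y))

theorem npUDir_iff {W : DecisionProblem} : NPUDir W ↔ NPWeighted (fun _ _ => 0) W := by
  refine exists_congr fun B => and_congr_right fun _ => exists_congr fun p =>
    ⟨fun ⟨Q, h⟩ => ⟨0, Q, ?_⟩, fun ⟨_, Q, h⟩ => ⟨Q, ?_⟩⟩
  · exact fun w => ⟨fun hw => ((h w).1 hw).imp fun y hy => ⟨hy.1, hy.2, by simp⟩, (h w).2⟩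
  · exact fun w => ⟨fun hw => ((h w).1 hw).imp fun y hy => ⟨hy.1, hy.2.1⟩, (h w).2⟩

theorem circFeas_eq : circFeas = circuitProblem (Circuit.rhoWeighted fun _ _ => 0) := by
  have : Circuit.rhoFeas = Circuit.rhoWeighted fun _ _ => 0 := by
    funext C
    simp [Circuit.rhoFeas, Circuit.rhoWeighted]
  rw [circFeas, this]

section
variable {rho : Circuit → ℝ≥0∞} {C : Circuit} {e : ∀ m : ℕ, (Fin m → ℝ) → ℕ}

theorem cond_circuitProblem (hC : C.Valid) :
    (circuitProblem rho).cond C.code = max 1 (rho C)⁻¹ := by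
  have h : ∃ C' : Circuit, C'.Valid ∧ C'.code = C.code := ⟨C, hC, rfl⟩
  have h2 : h.choose = C := Circuit.code_injective h.choose_spec.2
  simp only [circuitProblem]
  rw [dif_pos h, h2]

theorem mem_circuitProblem (hC : C.Valid) :
    C.code ∈ (circuitProblem rho).carrier ↔ C.Feasible := by
  constructor
  · rintro ⟨C', -, h, hf⟩
    rwa [← Circuit.code_injective h]
  · exact fun h => ⟨C, hC, rfl, h⟩

/-! ### Membership -/

theorem condBounded_of_le {W B : DecisionProblem} {w w' : Instance}
    (h : W.cond w ≠ ⊤ → B.cond w' ≤ 2 * W.cond w) : CondBounded (.X + 1) W B w w' := by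
  intro hw
  have h := h hw
  have hB : B.cond w' ≠ ⊤ := ne_top_of_le_ne_top (by finiteness) h
  refine ⟨hB, ?_⟩
  have h1 : ∀ {P : DecisionProblem} {w : Instance}, P.cond w ≠ ⊤ → 1 ≤ (P.cond w).toReal := by
    intro P w h
    have := ENNReal.toReal_mono h (P.one_le_cond w)
    simpa using this
  have h2 : (B.cond w').toReal ≤ 2 * (W.cond w).toReal := by
    have := ENNReal.toReal_mono (by finiteness) h
    simpa using this
  have hW1 := h1 hw
  have hB1 := h1 hB
  rw [Polynomial.eval_add, Polynomial.eval_X, Polynomial.eval_one, DecisionProblem.logCond,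
    DecisionProblem.logCond]
  calc Real.logb 2 (B.cond w').toReal ≤ Real.logb 2 (2 * (W.cond w).toReal) :=
        Real.logb_le_logb_of_le one_lt_two (by linarith) h2
    _ = Real.logb 2 (W.cond w).toReal + 1 := by
        rw [Real.logb_mul (by norm_num) (by linarith), Real.logb_self_eq_one one_lt_two, add_comm]

/-- Fill up a vector with zeros. -/
def padZero {m : ℕ} (n : ℕ) (y : Fin m → ℝ) : Fin n → ℝ :=
  fun i => if h : (i : ℕ) < m then y ⟨i, h⟩ else 0

theorem numInputs_le_len (C : Circuit) : C.numInputs ≤ C.code.len := by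
  simp only [Circuit.code, Instance.len, natCode, List.length_append, List.length_replicate]
  omega

theorem evalOK_append (hC : C.Valid) {n : ℕ} (hn : n = C.code.len) (y : Fin n → ℝ) :
    EvalOK (C.code.append y) C
      fun i => y (Fin.castLE (hn ▸ numInputs_le_len C) i) where
  valid := hC
  bits := rfl
  reals := by
    have hm : C.numInputs ≤ n := hn ▸ numInputs_le_len C
    refine List.prefix_append_right_inj C.consts |>.2 ?_
    refine List.prefix_iff_eq_take.2 (List.ext_getElem (by simp [hm]) fun i hi hi' => ?_)
    simp
  length := by
    simp only [Instance.append, Circuit.code, List.length_append, List.length_ofFn, hn, Instance.len]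
    ring

/-- The padding has a length fixed by `w`, so a circuit that fits has exactly as many constants as
`w` has reals, and its code is `w`. -/
theorem not_evalOK_append {w : Instance} {n : ℕ} (hn : n = w.len) (y : Fin n → ℝ)
    {y' : Fin C.numInputs → ℝ} (hw : C.code ≠ w) : ¬ EvalOK (w.append y) C y' := by
  intro h
  apply hw
  have h1 := h.length
  simp only [Instance.append, List.length_append, List.length_ofFn, hn, Instance.len] at h1
  have h2 : C.consts <+: w.2 := by
    have : C.consts <+: w.2 ++ List.ofFn y := (List.prefix_append _ _).trans h.reals
    exact List.prefix_of_prefix_length_le this (List.prefix_append _ _) (by omega)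
  exact Prod.ext h.bits.symm (h2.eq_of_length (by omega))

/-- The supremum over the solutions may not be attained, but if it is positive, some solution
exceeds half of it. If it is `0`, the condition number is infinite and any solution will do. -/
theorem exists_half_lt {y₀ : Fin C.numInputs → ℝ} (h : y₀ ∈ C.solutions) :
    ∃ y ∈ C.solutions, max 1 (C.rhoWeighted e)⁻¹ ≠ ⊤ →
      (C.rhoEval y * (2 ^ e _ y)⁻¹)⁻¹ ≤ 2 * max 1 (C.rhoWeighted e)⁻¹ := by
  have hf : C.Feasible := ⟨y₀, h⟩
  have hr : C.rhoWeighted e = ⨆ y ∈ C.solutions, C.rhoEval y * (2 ^ e _ y)⁻¹ := if_pos hf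
  have hle : C.rhoWeighted e ≤ 1 := by
    rw [hr]
    refine iSup₂_le fun y _ => mul_le_one' Circuit.rhoEval_le_one ?_
    rw [ENNReal.inv_le_one]
    exact one_le_pow₀ (by norm_num)
  by_cases h0 : C.rhoWeighted e = 0
  · exact ⟨y₀, h, fun h => absurd (by simp [h0]) h⟩
  · have hlt : C.rhoWeighted e / 2 < C.rhoWeighted e :=
      ENNReal.half_lt_self h0 (ne_top_of_le_ne_top (by finiteness) hle)
    conv_rhs at hlt => rw [hr]
    rw [lt_iSup_iff] at hlt
    obtain ⟨y, hlt⟩ := hlt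
    rw [lt_iSup_iff] at hlt
    obtain ⟨hy, hlt⟩ := hlt
    refine ⟨y, hy, fun _ => (ENNReal.inv_le_inv.2 hlt.le).trans ?_⟩
    rw [ENNReal.inv_div (by simp) (by simp), ENNReal.div_eq_inv_mul, mul_comm]
    gcongr
    exact le_max_right _ _

/-- A nearly optimal solution controls both quantities at once: since `rhoEval` and `2 ^ (-e y)` are
at most `1`, a lower bound for their product bounds each of them. Padding may raise the weight by
one. -/
theorem npWeighted_circuitProblem
    (he : ∀ {m n : ℕ} (_ : m ≤ n) (y : Fin m → ℝ), e n (padZero n y) ≤ e m y + 1) :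
    NPWeighted e (circuitProblem (Circuit.rhoWeighted e)) := by
  -- Certificates are as long as the instance. The factor `2` lost in the choice of the solution
  -- gives `X + 1` for the condition and one unit for the weight; the padding costs the other unit
  -- in `X + 2`.
  refine ⟨evalProblem, pDir_evalProblem, .X, .X + 2, .X + 1, fun w => ⟨fun hw => ?_, fun hw y => ?_⟩⟩
  · obtain ⟨C, hC, rfl, y₀, hy₀⟩ := hw
    have hn : (Polynomial.X : Polynomial ℕ).eval C.code.len = C.code.len := Polynomial.eval_X
    obtain ⟨y, hy, h⟩ := exists_half_lt (e := e) hy₀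
    have hm : C.numInputs ≤ (Polynomial.X : Polynomial ℕ).eval C.code.len :=
      (numInputs_le_len C).trans hn.ge
    have hok := evalOK_append hC hn (padZero _ y)
    have hpad : (fun i => padZero (Polynomial.X.eval C.code.len) y (Fin.castLE hm i)) = y := by
      funext i
      simp [padZero]
    rw [hpad] at hok
    have hone : ((2 : ℝ≥0∞) ^ e _ y)⁻¹ ≤ 1 := by
      rw [ENNReal.inv_le_one]
      exact one_le_pow₀ (by norm_num)
    refine ⟨_, hok.mem_carrier.2 hy, condBounded_of_le fun htop => ?_, fun s hs => ?_⟩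
    · rw [cond_circuitProblem hC] at htop ⊢
      rw [hok.cond_eq]
      refine max_le ?_ (le_trans ?_ (h htop))
      · calc (1 : ℝ≥0∞) ≤ 2 * 1 := by norm_num
          _ ≤ _ := by gcongr; exact le_max_left _ _
      · exact ENNReal.inv_le_inv.2 (mul_le_of_le_one_right' hone)
    · refine (he hm y).trans ?_
      rw [Polynomial.eval_add, Polynomial.eval_X, Polynomial.eval_ofNat]
      have hc := DecisionProblem.cond_le_of_size hs
      have htop := (DecisionProblem.size_eq_iff.1 hs).1
      rw [cond_circuitProblem hC] at hc htop
      -- `2 ^ e y` is at most the reciprocal of the product, which is at most twice the condition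
      -- number.
      have h2 : (2 : ℝ≥0∞) ^ e _ y ≤ 2 ^ (s + 1) := by
        calc (2 : ℝ≥0∞) ^ e _ y = (1 * (2 ^ e _ y)⁻¹)⁻¹ := by rw [one_mul, inv_inv]
          _ ≤ (C.rhoEval y * (2 ^ e _ y)⁻¹)⁻¹ := by
            refine ENNReal.inv_le_inv.2 ?_
            gcongr
            exact Circuit.rhoEval_le_one
          _ ≤ 2 * 2 ^ (s - C.code.len) := (h htop).trans (by gcongr)
          _ ≤ 2 * 2 ^ s := by
            gcongr
            · norm_num
            · omega
          _ = 2 ^ (s + 1) := by rw [pow_succ, mul_comm]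
      have := (Nat.pow_le_pow_iff_right (a := 2) (by norm_num)).1 (by exact_mod_cast h2)
      omega
  · have hn : (Polynomial.X : Polynomial ℕ).eval w.len = w.len := Polynomial.eval_X
    by_cases hC : ∃ C : Circuit, C.Valid ∧ C.code = w
    · obtain ⟨C, hC, rfl⟩ := hC
      have hok := evalOK_append hC hn y
      have hf : ¬ C.Feasible := fun h => hw ((mem_circuitProblem hC).2 h)
      refine ⟨fun h => hf ⟨_, hok.mem_carrier.1 h⟩, condBounded_of_le fun htop => ?_⟩
      rw [cond_circuitProblem hC, hok.cond_eq, Circuit.rhoWeighted, if_neg hf]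
      refine le_trans ?_ (le_mul_of_one_le_left' (by norm_num))
      refine max_le_max le_rfl (ENNReal.inv_le_inv.2 (iInf_le _ _))
    · have hno : ∀ (C : Circuit) (y' : Fin C.numInputs → ℝ), ¬ EvalOK (w.append y) C y' :=
        fun C y' h => not_evalOK_append hn y (fun h' => hC ⟨C, h.valid, h'⟩) h
      refine ⟨fun ⟨C, y', h, _⟩ => hno C y' h, condBounded_of_le fun _ => ?_⟩
      have : evalProblem.cond (w.append y) = 1 := by
        show max _ _ = _
        simp [hno]
      rw [this]
      calc (1 : ℝ≥0∞) ≤ 2 * 1 := by norm_num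
        _ ≤ _ := by gcongr; exact DecisionProblem.one_le_cond _ _

theorem mgt_zero : mgt 0 = 1 :=
  IsLeast.csInf_eq ⟨⟨le_rfl, Or.inl rfl⟩, fun _ h => h.1⟩

/-- The summand `1` is needed when the given vector has no components: its magnitude is `0`, but
that of the number `0` is `1`. -/
theorem mgtVec_padZero {m n : ℕ} (y : Fin m → ℝ) : mgtVec (padZero n y) ≤ mgtVec y + 1 := by
  refine Finset.sup_le fun i _ => ?_
  unfold padZero
  split_ifs with h
  · exact (Finset.le_sup (f := fun i => mgt (y i)) (Finset.mem_univ _)).trans (Nat.le_succ _)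
  · rw [mgt_zero]
    omega

end

end FiniteBSS
namespace FiniteBSS

/-! ### Hardness -/

theorem eval_mono_nat (p : Polynomial ℕ) {a b : ℕ} (h : a ≤ b) : p.eval a ≤ p.eval b := by
  rw [Polynomial.eval_eq_sum_range, Polynomial.eval_eq_sum_range]
  gcongr

/-- Negative or fractional coefficients are replaced by their absolute values, rounded up, which
gives a monotone upper bound on nonnegative arguments. -/
theorem exists_nat_polynomial_ge (Q : Polynomial ℝ) :
    ∃ b : Polynomial ℕ, ∀ (x : ℝ) (s : ℕ), 0 ≤ x → x ≤ s → Q.eval x ≤ b.eval s := by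
  induction Q using Polynomial.induction_on' with
  | add P Q hP hQ =>
    obtain ⟨b, hb⟩ := hP
    obtain ⟨c, hc⟩ := hQ
    refine ⟨b + c, fun x s h0 hs => ?_⟩
    rw [Polynomial.eval_add, Polynomial.eval_add, Nat.cast_add]
    exact add_le_add (hb x s h0 hs) (hc x s h0 hs)
  | monomial n a =>
    refine ⟨.monomial n ⌈|a|⌉₊, fun x s h0 hs => ?_⟩
    rw [Polynomial.eval_monomial, Polynomial.eval_monomial, Nat.cast_mul, Nat.cast_pow]
    calc a * x ^ n ≤ ⌈|a|⌉₊ * x ^ n := by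
          gcongr
          exact (le_abs_self a).trans (Nat.le_ceil _)
      _ ≤ _ := by gcongr

namespace Sim
variable (M : Machine)

theorem numNodes_simCircuit (w : Instance) (m T K : ℕ) :
    (simCircuit M w m T K).numNodes = 2 * simSize M (w.2.length + m) T K := by
  have h := length_simGates (M := M) w.1 (w.2.length + m) T K
  simp only [Circuit.numNodes, Circuit.numLeaves, simCircuit, List.length_append, length_simConsts,
    starGates, List.length_map, List.length_range]
  omega

theorem len_code_le {C : Circuit} (hC : C.Valid) :
    C.code.len ≤ C.numNodes * (5 + 3 * C.numNodes) + 2 * C.numNodes + 1 := by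
  have h := hC.length_code_le
  have h1 : C.gates.length ≤ C.numNodes := by rw [Circuit.numNodes]; omega
  have h2 : C.numInputs + C.consts.length ≤ C.numNodes := by
    rw [Circuit.numNodes, Circuit.numLeaves]
    omega
  have h3 := Nat.mul_le_mul_right (5 + 3 * C.numNodes) h1
  have h4 : C.code.len = C.code.1.length + C.consts.length := rfl
  omega

theorem exists_len_simCircuit_le (p t : Polynomial ℕ) : ∃ r : Polynomial ℕ,
    ∀ (w : Instance) (s : ℕ), w.len ≤ s → ∀ m T, m = p.eval w.len →
      T = t.eval (w.len + m) + 1 → (simCircuit M w m T T).code.len ≤ r.eval s := by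
  let tt : Polynomial ℕ := t.comp (.X + p) + 1
  let N : Polynomial ℕ := 2 * (3 + .C (nL M) + (.X + p) +
    (tt + 1) * (.C (headSize M) + (2 * tt + 1) * (2 * .C (nQ M))) + .C (nL M))
  refine ⟨N * (5 + 3 * N) + 2 * N + 1, fun w s hs m T hm hT => ?_⟩
  have hm' : m ≤ p.eval s := hm ▸ eval_mono_nat p hs
  have hT' : T ≤ tt.eval s := by
    simp only [hT, tt, Polynomial.eval_add, Polynomial.eval_comp, Polynomial.eval_X,
      Polynomial.eval_one]
    have := eval_mono_nat t (add_le_add hs hm')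
    omega
  have hx : w.2.length ≤ s := by
    rw [Instance.len] at hs
    omega
  have hN : (simCircuit M w m T T).numNodes ≤ N.eval s := by
    rw [numNodes_simCircuit, simSize, layerSize]
    simp only [N, Polynomial.eval_add, Polynomial.eval_mul, Polynomial.eval_C, Polynomial.eval_X,
      Polynomial.eval_one, Polynomial.eval_ofNat]
    gcongr
  refine (len_code_le (simCircuit_valid w m T T)).trans ?_
  simp only [Polynomial.eval_add, Polynomial.eval_mul, Polynomial.eval_one, Polynomial.eval_ofNat]
  gcongr

end Sim

theorem ofReal_inv_two_pow (j : ℕ) : ENNReal.ofReal ((2 ^ j)⁻¹) = (2 ^ j)⁻¹ := by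
  rw [ENNReal.ofReal_inv_of_pos (by positivity), ENNReal.ofReal_pow (by norm_num)]
  simp

/-- The instance is mapped to the circuit that simulates its verifier, with the certificate as the
input of the circuit. Nothing is assumed about the weight, because it enters the class and the
condition number in the same way. -/
theorem hard_circuitProblem (e : ∀ m : ℕ, (Fin m → ℝ) → ℕ) :
    Hard (NPWeighted e) (circuitProblem (Circuit.rhoWeighted e)) := by
  rintro W ⟨B, ⟨M, t, q, hM⟩, p, q', Q, h⟩
  obtain ⟨N, sN, hNd, hN⟩ := Sim.exists_reduction M p t
  obtain ⟨b, hb⟩ := exists_nat_polynomial_ge Q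
  obtain ⟨r, hr⟩ := Sim.exists_len_simCircuit_le M p t
  -- The size of `(w, y)` for the verifier is at most the length of `w`, plus the number of
  -- components of `y`, plus the bound `b` for the logarithm of the condition number. The summand
  -- `1` keeps `2 ^ (-J)` below `1`.
  let J : Polynomial ℕ := q.comp (.X + p + b) + 1
  refine ⟨N, fun w => (Sim.simCircuit M w (p.eval w.len) (t.eval (w.len + p.eval w.len) + 1)
    (t.eval (w.len + p.eval w.len) + 1)).code, sN, r + (J + q'), hNd, fun w => ?_⟩
  set m := p.eval w.len with hm
  set T := t.eval (w.len + m) + 1 with hT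
  set C := Sim.simCircuit M w m T T with hC
  have hv : C.Valid := Sim.simCircuit_valid w m T T
  have hlen : ∀ y : Fin m → ℝ, (w.append y).len = w.len + m := fun y => by
    simp [Instance.append, Instance.len, add_assoc]
  have hhalt : ∀ (y : Fin m → ℝ) (ε : ℝ), 0 < ε → ε < 1 →
      M.HaltsWithin (Rounds ε) (w.append y) (t.eval (w.len + m)) := fun y ε h0 h1 => by
    rw [← hlen y]
    exact (hM _).1 ε h0 h1
  have hsol : ∀ y : Fin m → ℝ, y ∈ C.solutions ↔ w.append y ∈ B.carrier := by
    intro y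
    have hpos : 0 < C.numNodes := by
      obtain ⟨i⟩ := hv.2.nonempty
      exact Fin.pos i
    obtain ⟨v, hve⟩ := Circuit.exists_isEvaluation (Circuit.edge_lt_iff.1 hv.1) y
    have hz : C.Yields Eq y (v (C.numNodes - 1)) := ⟨v, hve, rfl⟩
    refine (Circuit.mem_solutions_iff (Circuit.edge_lt_iff.1 hv.1) hpos hz).trans ?_
    exact Sim.sim_correct Sim.keepsSigns_eq le_rfl (Nat.lt_succ_self _)
      (Sim.haltsWithin_eq (hhalt y 2⁻¹ (by norm_num) (by norm_num))) (hM _).2.2 hz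
  -- At the roundoff `2 ^ (-J)` the verifier answers correctly, hence so do all evaluations of the
  -- circuit, which makes this roundoff admissible in the supremum.
  have hrho : ∀ s : ℕ, W.size w = s → ∀ y : Fin m → ℝ, CondBounded Q W B w (w.append y) →
      ((2 : ℝ≥0∞) ^ J.eval s)⁻¹ ≤ C.rhoEval y := by
    intro s hs y hcb
    obtain ⟨htop, hsz⟩ := DecisionProblem.size_eq_iff.1 hs
    obtain ⟨hBtop, hBlog⟩ := hcb htop
    have hlog : W.logCond w ≤ s := (Nat.le_ceil _).trans (by exact_mod_cast (by omega))
    have hB := DecisionProblem.cond_le_of_logCond_le hBtop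
      (hBlog.trans (hb _ s (DecisionProblem.logCond_nonneg _ _) hlog))
    have hBs := DecisionProblem.size_le hB
    obtain ⟨s', hs'⟩ := ENat.ne_top_iff_exists.1 (ne_top_of_le_ne_top (by simp) hBs)
    rw [← hs', hlen y] at hBs
    have hs'le : s' ≤ (.X + p + b : Polynomial ℕ).eval s := by
      have h1 : s' ≤ w.len + m + b.eval s := by exact_mod_cast hBs
      have h2 : m ≤ p.eval s := eval_mono_nat p (by omega)
      simp only [Polynomial.eval_add, Polynomial.eval_X]
      omega
    have hJ : J.eval s = q.eval ((.X + p + b : Polynomial ℕ).eval s) + 1 := by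
      simp [J]
    have hε : ((2 : ℝ) ^ J.eval s)⁻¹ < 1 := by
      refine inv_lt_one_of_one_lt₀ (one_lt_pow₀ one_lt_two ?_)
      omega
    rw [← ofReal_inv_two_pow]
    refine Circuit.le_rhoEval (by positivity) hε fun z hz => ?_
    refine (Sim.sim_correct (Sim.keepsSigns_rounds hε) le_rfl (Nat.lt_succ_self _)
      (hhalt y _ (by positivity) hε) ((hM _).2.1 _ (by positivity) hε s' hs'.symm ?_) hz).trans
      (hsol y).symm
    have := eval_mono_nat q hs'le
    exact le_trans (by omega) le_precision
  refine ⟨hN w m T rfl rfl, ?_, fun s hs => ?_⟩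
  · rw [mem_circuitProblem hv]
    constructor
    · intro hw
      obtain ⟨y, hy, -⟩ := (h w).1 hw
      exact ⟨y, (hsol y).2 hy⟩
    · rintro ⟨y, hy⟩
      by_contra hw
      exact ((h w).2 hw y).1 ((hsol y).1 hy)
  · have hc : (circuitProblem (Circuit.rhoWeighted e)).cond C.code ≤ 2 ^ (J + q').eval s := by
      rw [cond_circuitProblem hv]
      refine max_le (one_le_pow₀ (by norm_num)) ?_
      -- The factor `2 ^ q'` pays for the weight of the certificate of a Yes-instance; for a
      -- No-instance it is not needed.
      rw [ENNReal.inv_le_iff_inv_le, Polynomial.eval_add, pow_add]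
      by_cases hw : w ∈ W.carrier
      · obtain ⟨y, hy, hcb, he⟩ := (h w).1 hw
        have hys := (hsol y).2 hy
        have hf : C.Feasible := ⟨y, hys⟩
        rw [Circuit.rhoWeighted, if_pos hf]
        refine le_trans ?_ (le_iSup₂ (f := fun (y : Fin C.numInputs → ℝ) (_ : y ∈ C.solutions) =>
          C.rhoEval y * (2 ^ e _ y)⁻¹) y hys)
        rw [ENNReal.mul_inv (by simp) (by simp)]
        refine mul_le_mul' (hrho s hs y hcb) (ENNReal.inv_le_inv.2 ?_)
        exact pow_le_pow_right₀ (by norm_num) (he s hs)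
      · have hf : ¬ C.Feasible := by
          rintro ⟨y, hy⟩
          exact ((h w).2 hw y).1 ((hsol y).1 hy)
        rw [Circuit.rhoWeighted, if_neg hf]
        refine le_iInf fun y => le_trans ?_ (hrho s hs y ((h w).2 hw y).2)
        refine ENNReal.inv_le_inv.2 ?_
        exact le_mul_of_one_le_right' (one_le_pow₀ (by norm_num))
    refine (DecisionProblem.size_le hc).trans ?_
    rw [Polynomial.eval_add (p := r)]
    have := hr w s (DecisionProblem.len_le_of_size hs) m T rfl rfl
    exact_mod_cast Nat.add_le_add_right this _

end FiniteBSS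

theorem mainTheorem6 :
    FiniteBSS.Complete FiniteBSS.NPUDir FiniteBSS.circFeas ∧
      FiniteBSS.Complete FiniteBSS.NPBDir FiniteBSS.circBFeas := by
  refine ⟨⟨?_, ?_⟩, ?_, ?_⟩
  · rw [FiniteBSS.npUDir_iff, FiniteBSS.circFeas_eq]
    exact FiniteBSS.npWeighted_circuitProblem fun _ _ => Nat.zero_le _
  · intro W hW
    rw [FiniteBSS.circFeas_eq]
    exact FiniteBSS.hard_circuitProblem _ W (FiniteBSS.npUDir_iff.1 hW)
  · exact FiniteBSS.npWeighted_circuitProblem (e := fun _ y => FiniteBSS.mgtVec y)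
      fun _ y => FiniteBSS.mgtVec_padZero y
  · exact FiniteBSS.hard_circuitProblem fun _ y => FiniteBSS.mgtVec y
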